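/- Let $L$ be an imaginary quadratic field with conjugation $x\mapsto\bar x$, let $q$ be any prime, and put $L_q=L\otimes_{\mathbb Q}\mathbb Q_q$, with norm $N:L_q\to\mathbb Q_q$ and ring of integers $\mathbb Z_{L,q}$ (the closure of $\mathbb Z_L$ in $L_q$). With $J_n=\begin{pmatrix}0&I_n\\-I_n&0\end{pmatrix}$ let $GU(n,n)$ be the group of all $g\in GL_{2n}(L_q)$ with $\bar g^tJ_ng=\mu(g)J_n$ for some $\mu(g)\in\mathbb Q_q^\times$, and $U(n,n)$ its subgroup $\mu(g)=1$. Let $\iota$ be the embedding $$\left(\begin{pmatrix}A&B\\C&D\end{pmatrix},\begin{pmatrix}a&b\\c&d\end{pmatrix}\right)\mapsto\begin{pmatrix}A&&B&\\&a&&-b\\C&&D&\\&-c&&d\end{pmatrix}$$ of $\{(g_1,g_2)\in GU(2,2)\times GU(1,1):\mu(g_1)=\mu(g_2)\}$ into $GU(3,3)$, and let $$Q=\begin{pmatrix}0&1&0&0&0&0\\1&0&0&0&0&0\\0&0&0&0&0&-1\\0&0&0&0&1&-1\\0&0&0&1&0&0\\0&1&1&0&0&0\end{pmatrix}.$$ Let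 $\Lambda_q$ be a unitary character of $L_q^\times$, trivial on $\mathbb Q_q^\times$ and on $\mathbb Z_{L,q}^\times$. For $s\in\mathbb C$ let $\Upsilon_q(\cdot,s)$ be the unique function on $GU(3,3)$ that is right invariant under $GU(3,3)\cap GL_6(\mathbb Z_{L,q})$, satisfies $\Upsilon_q(1,s)=1$ and $$\Upsilon_q\left(\begin{pmatrix}1&b\\0&1\end{pmatrix}\begin{pmatrix}A&0\\0&v(\bar A^{-1})^t\end{pmatrix}g,s\right)=|v|^{-9(s+\frac12)}\,|N(\det A)|^{3(s+\frac12)}\,\Lambda_q(\det A)\,\Upsilon_q(g,s)$$ for $A\in GL_3(L_q)$, $v\in\mathbb Q_q^\times$, $b=\bar b^t\in M_3(L_q)$. Let $\sigma_q$ be the principal series representation of $GL_2(\mathbb Q_q)$ induced from unramified characters $\alpha,\beta$ of $\mathbb Q_q^\times$ with $\alpha\beta=1$, let $\psi_q$ be an additive character of $\mathbb Q_q$ with conductor $\mathbb Z_q$, and let $W_q$ be the image of a $GL_2(\mathbb Z_q)$-fixed vector of $\sigma_q$ under a $GL_2(\mathbb Q_q)$-equivariant linear map into the space of functions $w$ on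 $GL_2(\mathbb Q_q)$ with $w\left(\begin{pmatrix}1&x\\0&1\end{pmatrix}g\right)=\psi_q(x)w(g)$, extended to $GU(1,1)=L_q^\times GL_2(\mathbb Q_q)$ by $W_q(ag)=W_q(g)$ for $a\in L_q^\times$. (When $\Psi$ is the adelization of a newform of level prime to $q$ and trivial character, the $q$-component $W_{\Psi,q}$ of its Whittaker function is such a $W_q$.) Let $\int dh$ be the Haar measure on $U(1,1)$ for which $U(1,1)\cap GL_2(\mathbb Z_{L,q})$ has measure $1$, and for $g_q\in GU(1,1)$ put $$Z_q(g_q,1,s)=\int_{U(1,1)}\Upsilon_q(Q\cdot\iota(1,h),s)\,W_q(g_qh)\,\Lambda_q^{-1}(\det h)\,dh.$$ Define $L(s,\sigma_q\times\rho(\Lambda_q))$ to be - $(1-\alpha(q)^2q^{-2s})^{-1}(1-\beta(q)^2q^{-2s})^{-1}$ if $q$ is inert in $L$, - $(1-\alpha(q)\Lambda_q(q_1)q^{-s})^{-1}(1-\beta(q)\Lambda_q(q_1)q^{-s})^{-1}$ if $q$ is ramified in $L$, - $\prod_{\epsilon=\pm1}(1-\alpha(q)\Lambda_q(q_1)^{\epsilon}q^{-s})^{-1}(1-\beta(q)\Lambda_q(q_1)^{\epsilon}q^{-s})^{-1}$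 if $q$ splits in $L$, where $q_1\in\mathbb Z_{L,q}$ is any element with $N(q_1)\in q\mathbb Z_q^\times$. For a character $\chi$ of $\mathbb Q_q^\times$ let $L(s,\chi)=(1-\chi(q)q^{-s})^{-1}$ if $\chi$ is unramified and $L(s,\chi)=1$ otherwise; let $(\chi_{-D})_q$ be the character of $\mathbb Q_q^\times$ of order at most $2$ with kernel $N(L_q^\times)$ (the component at $q$ of the Hecke character of $L/\mathbb Q$), and $\mathbf 1$ the trivial character. Then for every $s$ with $|\alpha(q)|,|\beta(q)|<q^{3\operatorname{Re}(s)+1}$ (for $W_q=W_{\Psi,q}$ as above, where $|\alpha(q)|=|\beta(q)|=1$, this means $\operatorname{Re}(s)>-\tfrac13$) the integral $Z_q(g_q,1,s)$ converges absolutely, and $$Z_q(g_q,1,s)=W_q(g_q)\cdot\frac{L(3s+1,\sigma_q\times\rho(\Lambda_q))}{L(6s+2,(\chi_{-D})_q)\,L(6s+3,\mathbf 1)}.$$ -/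

import Mathlib

open scoped TensorProduct Matrix

namespace PullbackFormula

noncomputable section

/-! ### The quadratic algebra `L_q` and its ring of integers -/

section LocalAlgebra

variable (q : ℕ) [Fact q.Prime] (L : Type*) [Field L] [NumberField L]

/-- `L_q = L ⊗_ℚ ℚ_q`, regarded as a `ℚ_q`-algebra. -/
abbrev LocalAlg : Type _ := ℚ_[q] ⊗[ℚ] L

/-- `L_q` carries its canonical topology of a finite-dimensional `ℚ_q`-vector space. -/
instance : TopologicalSpace (LocalAlg q L) := moduleTopology ℚ_[q] (LocalAlg q L)

/-- `ℤ_{L,q}`, the closure of the ring of integers of `L` in `L_q`: the `ℤ_q`-subalgebra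
generated by the ring of integers of `L`. -/
def localIntegers : Subalgebra ℤ_[q] (LocalAlg q L) :=
  Algebra.adjoin ℤ_[q]
    (Set.range fun x : NumberField.RingOfIntegers L => (1 : ℚ_[q]) ⊗ₜ[ℚ] (x : L))

/-- `GL_ι(ℤ_{L,q})` as a subgroup of `GL_ι(L_q)`. -/
def integralGL (ι : Type*) [Fintype ι] [DecidableEq ι] : Subgroup (GL ι (LocalAlg q L)) :=
  (Matrix.GeneralLinearGroup.map (n := ι)
    (algebraMap (localIntegers q L) (LocalAlg q L))).range

variable {L}

/-- The conjugation of `L_q` over `ℚ_q` induced by the conjugation `c` of `L`. -/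
def localConj (c : L ≃ₐ[ℚ] L) : LocalAlg q L ≃ₐ[ℚ_[q]] LocalAlg q L :=
  Algebra.TensorProduct.congr AlgEquiv.refl c

/-- The conjugate transpose `\bar{A}^t`. -/
def conjT {m n : Type*} (c : L ≃ₐ[ℚ] L) (A : Matrix m n (LocalAlg q L)) :
    Matrix n m (LocalAlg q L) :=
  (A.map (localConj q c))ᵀ

end LocalAlgebra

/-! ### Unitary similitude groups -/

section Groups

variable (q : ℕ) [Fact q.Prime] {L : Type*} [Field L] [NumberField L] (c : L ≃ₐ[ℚ] L)

/-- `g` is a similitude, with multiplier `v ∈ ℚ_q^×`, of the skew-hermitian form `S`. -/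
def IsSimilitude {ι : Type*} [Fintype ι] (S g : Matrix ι ι (LocalAlg q L)) (v : ℚ_[q]ˣ) : Prop :=
  conjT q c g * S * g = (v : ℚ_[q]) • S

variable {q c} in
theorem IsSimilitude.one {ι : Type*} [Fintype ι] [DecidableEq ι]
    (S : Matrix ι ι (LocalAlg q L)) : IsSimilitude q c S 1 1 := by
  simp [IsSimilitude, conjT, Matrix.map_one]

variable {q c} in
theorem conjT_mul {l m n : Type*} [Fintype m] (A : Matrix l m (LocalAlg q L))
    (B : Matrix m n (LocalAlg q L)) : conjT q c (A * B) = conjT q c B * conjT q c A := by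
  simp [conjT, Matrix.map_mul, Matrix.transpose_mul]

variable {q c} in
theorem IsSimilitude.mul {ι : Type*} [Fintype ι] {S g h : Matrix ι ι (LocalAlg q L)}
    {v w : ℚ_[q]ˣ} (hg : IsSimilitude q c S g v) (hh : IsSimilitude q c S h w) :
    IsSimilitude q c S (g * h) (v * w) := by
  unfold IsSimilitude at *
  rw [conjT_mul]
  calc conjT q c h * conjT q c g * S * (g * h)
      = conjT q c h * (conjT q c g * S * g) * h := by simp only [Matrix.mul_assoc]
    _ = _ := by
      rw [hg, Matrix.mul_smul, Matrix.smul_mul, hh, smul_smul]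
      simp

variable {q c} in
theorem IsSimilitude.inv {ι : Type*} [Fintype ι] [DecidableEq ι] {S : Matrix ι ι (LocalAlg q L)}
    {g : GL ι (LocalAlg q L)} {v : ℚ_[q]ˣ} (hg : IsSimilitude q c S g.1 v) :
    IsSimilitude q c S (g⁻¹).1 v⁻¹ := by
  unfold IsSimilitude at *
  have h1 : conjT q c (g⁻¹).1 * conjT q c g.1 = 1 := by
    rw [← conjT_mul, ← Units.val_mul, mul_inv_cancel]
    simp [conjT, Matrix.map_one]
  have h2 : g.1 * (g⁻¹).1 = 1 := by rw [← Units.val_mul, mul_inv_cancel]; rfl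
  have h3 : S = (v : ℚ_[q]) • (conjT q c (g⁻¹).1 * S * (g⁻¹).1) := by
    calc S = (conjT q c (g⁻¹).1 * conjT q c g.1) * S * (g.1 * (g⁻¹).1) := by
          rw [h1, h2, Matrix.one_mul, Matrix.mul_one]
      _ = conjT q c (g⁻¹).1 * (conjT q c g.1 * S * g.1) * (g⁻¹).1 := by
          simp only [Matrix.mul_assoc]
      _ = _ := by rw [hg, Matrix.mul_smul, Matrix.smul_mul]
  conv_rhs => rw [h3]
  rw [smul_smul]
  simp

/-- The group of unitary similitudes of `S`, with multiplier in `ℚ_q^×`. -/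
def similitudeGroup {ι : Type*} [Fintype ι] [DecidableEq ι] (S : Matrix ι ι (LocalAlg q L)) :
    Subgroup (GL ι (LocalAlg q L)) where
  carrier := {g | ∃ v : ℚ_[q]ˣ, IsSimilitude q c S g.1 v}
  one_mem' := ⟨1, IsSimilitude.one S⟩
  mul_mem' := fun ⟨v, hv⟩ ⟨w, hw⟩ => ⟨v * w, hv.mul hw⟩
  inv_mem' := fun ⟨v, hv⟩ => ⟨v⁻¹, hv.inv⟩

/-- The subgroup of similitudes with multiplier `1`. -/
def isometryGroup {ι : Type*} [Fintype ι] [DecidableEq ι] (S : Matrix ι ι (LocalAlg q L)) :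
    Subgroup (similitudeGroup q c S) where
  carrier := {g | IsSimilitude q c S g.1.1 1}
  one_mem' := IsSimilitude.one S
  mul_mem' := fun {g h} hg hh => by
    have := IsSimilitude.mul (q := q) (c := c) hg hh
    rwa [mul_one] at this
  inv_mem' := fun {g} hg => by
    have := IsSimilitude.inv (q := q) (c := c) (g := g.1) hg
    rwa [inv_one] at this

variable (L) in
/-- The matrix `J_n = (0, I_n; -I_n, 0)`, in blocks of size `n`. -/
def formJ (n : ℕ) : Matrix (Fin n ⊕ Fin n) (Fin n ⊕ Fin n) (LocalAlg q L) :=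
  Matrix.fromBlocks 0 1 (-1) 0

variable (L) in
/-- The matrix `J_1 = (0, 1; -1, 0)`, as an ordinary `2 × 2` matrix. -/
def formJOne : Matrix (Fin 2) (Fin 2) (LocalAlg q L) := !![0, 1; -1, 0]

/-- `GU(3,3)(ℚ_q)`. -/
abbrev GUThree : Subgroup (GL (Fin 3 ⊕ Fin 3) (LocalAlg q L)) :=
  similitudeGroup q c (formJ q L 3)

/-- `GU(2,2)(ℚ_q)`. -/
abbrev GUTwo : Subgroup (GL (Fin 2 ⊕ Fin 2) (LocalAlg q L)) :=
  similitudeGroup q c (formJ q L 2)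

/-- `GU(1,1)(ℚ_q)`. -/
abbrev GUOne : Subgroup (GL (Fin 2) (LocalAlg q L)) :=
  similitudeGroup q c (formJOne q L)

/-- `U(2,2)(ℚ_q)`, as a subgroup of `GU(2,2)(ℚ_q)`. -/
abbrev UTwo : Subgroup (GUTwo q c) := isometryGroup q c (formJ q L 2)

/-- `U(1,1)(ℚ_q)`, as a subgroup of `GU(1,1)(ℚ_q)`. -/
abbrev UOne : Subgroup (GUOne q c) := isometryGroup q c (formJOne q L)

/-- The maximal compact subgroup `U(1,1)(ℚ_q) ∩ GL_2(ℤ_{L,q})` of `U(1,1)(ℚ_q)`. -/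
def compactUOne : Subgroup (UOne q c) :=
  (integralGL q L (Fin 2)).comap ((GUOne q c).subtype.comp (UOne q c).subtype)

/-- The maximal compact subgroup `GU(3,3)(ℚ_q) ∩ GL_6(ℤ_{L,q})` of `GU(3,3)(ℚ_q)`. -/
def compactGUThree : Subgroup (GUThree q c) :=
  (integralGL q L (Fin 3 ⊕ Fin 3)).comap (GUThree q c).subtype

/-- The group of pairs in `GU(2,2) × GU(1,1)` with equal multipliers. -/
def pairGroup : Subgroup (GUTwo q c × GUOne q c) where
  carrier := {x | ∃ v : ℚ_[q]ˣ, IsSimilitude q c (formJ q L 2) x.1.1.1 v ∧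
    IsSimilitude q c (formJOne q L) x.2.1.1 v}
  one_mem' := ⟨1, IsSimilitude.one _, IsSimilitude.one _⟩
  mul_mem' := fun ⟨v, h1, h2⟩ ⟨w, h3, h4⟩ => ⟨v * w, h1.mul h3, h2.mul h4⟩
  inv_mem' := fun {x} ⟨v, h1, h2⟩ =>
    ⟨v⁻¹, IsSimilitude.inv (g := x.1.1) h1, IsSimilitude.inv (g := x.2.1) h2⟩

end Groups

/-! ### The embedding `ι` and the matrix `Q` -/

section Embedding

variable (q : ℕ) [Fact q.Prime] {L : Type*} [Field L] [NumberField L] (c : L ≃ₐ[ℚ] L)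

/-- The `3 × 3` matrix with diagonal blocks `X` and `x`. -/
def blockThree {R : Type*} [Zero R] (X : Matrix (Fin 2) (Fin 2) R) (x : R) :
    Matrix (Fin 3) (Fin 3) R :=
  !![X 0 0, X 0 1, 0; X 1 0, X 1 1, 0; 0, 0, x]

/-- The matrix `(A, 0, B, 0; 0, a, 0, -b; C, 0, D, 0; 0, -c, 0, d)` attached to
`(A, B; C, D)` and `(a, b; c, d)`. -/
def iotaMat {R : Type*} [Ring R] (g : Matrix (Fin 2 ⊕ Fin 2) (Fin 2 ⊕ Fin 2) R)
    (h : Matrix (Fin 2) (Fin 2) R) : Matrix (Fin 3 ⊕ Fin 3) (Fin 3 ⊕ Fin 3) R :=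
  Matrix.fromBlocks (blockThree g.toBlocks₁₁ (h 0 0)) (blockThree g.toBlocks₁₂ (-h 0 1))
    (blockThree g.toBlocks₂₁ (-h 1 0)) (blockThree g.toBlocks₂₂ (h 1 1))

/-- The matrix `Q`. -/
def matQ (R : Type*) [Ring R] : Matrix (Fin 3 ⊕ Fin 3) (Fin 3 ⊕ Fin 3) R :=
  Matrix.fromBlocks
    !![0, 1, 0; 1, 0, 0; 0, 0, 0] !![0, 0, 0; 0, 0, 0; 0, 0, -1]
    !![0, 0, 0; 0, 0, 0; 0, 1, 1] !![0, 1, -1; 1, 0, 0; 0, 0, 0]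

theorem blockThree_mul_add {R : Type*} [Ring R] (X Y Z W : Matrix (Fin 2) (Fin 2) R)
    (x y z w : R) : blockThree (X * Y + Z * W) (x * y + z * w) =
      blockThree X x * blockThree Y y + blockThree Z z * blockThree W w := by
  ext i j
  fin_cases i <;> fin_cases j <;> simp [blockThree, Matrix.mul_apply, Fin.sum_univ_succ]

theorem iotaMat_mul {R : Type*} [Ring R] (g g' : Matrix (Fin 2 ⊕ Fin 2) (Fin 2 ⊕ Fin 2) R)
    (h h' : Matrix (Fin 2) (Fin 2) R) :
    iotaMat (g * g') (h * h') = iotaMat g h * iotaMat g' h' := by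
  rw [← Matrix.fromBlocks_toBlocks g, ← Matrix.fromBlocks_toBlocks g',
    Matrix.fromBlocks_multiply]
  unfold iotaMat
  simp only [Matrix.toBlocks_fromBlocks₁₁, Matrix.toBlocks_fromBlocks₁₂,
    Matrix.toBlocks_fromBlocks₂₁, Matrix.toBlocks_fromBlocks₂₂]
  rw [Matrix.fromBlocks_multiply]
  simp only [← blockThree_mul_add]
  simp [Matrix.mul_apply, Fin.sum_univ_two, add_comm]

theorem iotaMat_one {R : Type*} [Ring R] : iotaMat (1 : Matrix (Fin 2 ⊕ Fin 2) _ R) 1 = 1 := by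
  rw [← Matrix.fromBlocks_one (l := Fin 3)]
  unfold iotaMat
  congr 1 <;> ext i j <;> fin_cases i <;> fin_cases j <;>
    simp [blockThree, Matrix.toBlocks₁₁, Matrix.toBlocks₁₂,
      Matrix.toBlocks₂₁, Matrix.toBlocks₂₂, Matrix.one_apply]

variable {q c} in
theorem conjT_iotaMat (g : Matrix (Fin 2 ⊕ Fin 2) (Fin 2 ⊕ Fin 2) (LocalAlg q L))
    (h : Matrix (Fin 2) (Fin 2) (LocalAlg q L)) :
    conjT q c (iotaMat g h) = iotaMat (conjT q c g) (conjT q c h) := by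
  unfold iotaMat conjT
  rw [Matrix.fromBlocks_map, Matrix.fromBlocks_transpose]
  congr 1 <;> ext i j <;> fin_cases i <;> fin_cases j <;>
    simp [blockThree, Matrix.toBlocks₁₁, Matrix.toBlocks₁₂,
      Matrix.toBlocks₂₁, Matrix.toBlocks₂₂]

theorem formJ_three_eq : formJ q L 3 = iotaMat (formJ q L 2) (-formJOne q L) := by
  unfold iotaMat formJ formJOne
  congr 1 <;> ext i j <;> fin_cases i <;> fin_cases j <;>
    simp [blockThree]

variable {q c} in
theorem IsSimilitude.iotaMat {g : Matrix (Fin 2 ⊕ Fin 2) (Fin 2 ⊕ Fin 2) (LocalAlg q L)}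
    {h : Matrix (Fin 2) (Fin 2) (LocalAlg q L)} {v : ℚ_[q]ˣ}
    (hg : IsSimilitude q c (formJ q L 2) g v) (hh : IsSimilitude q c (formJOne q L) h v) :
    IsSimilitude q c (formJ q L 3) (iotaMat g h) v := by
  unfold IsSimilitude at *
  rw [formJ_three_eq, conjT_iotaMat, ← iotaMat_mul, ← iotaMat_mul, hg, Matrix.mul_neg,
    Matrix.neg_mul, hh]
  unfold PullbackFormula.iotaMat
  rw [Matrix.fromBlocks_smul]
  congr 1 <;> ext i j <;> fin_cases i <;> fin_cases j <;>
    simp [blockThree, Matrix.toBlocks₁₁, Matrix.toBlocks₁₂,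
      Matrix.toBlocks₂₁, Matrix.toBlocks₂₂]

/-- The embedding `ι` of the group of pairs in `GU(2,2) × GU(1,1)` with equal multipliers into
`GU(3,3)`. -/
def iota : pairGroup q c →* GUThree q c where
  toFun x := ⟨⟨iotaMat x.1.1.1.1 x.1.2.1.1, iotaMat (x⁻¹).1.1.1.1 (x⁻¹).1.2.1.1,
      by
        rw [← iotaMat_mul, ← iotaMat_one]
        congr 1
        · exact congrArg (fun y : pairGroup q c => y.1.1.1.1) (mul_inv_cancel x)
        · exact congrArg (fun y : pairGroup q c => y.1.2.1.1) (mul_inv_cancel x),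
      by
        rw [← iotaMat_mul, ← iotaMat_one]
        congr 1
        · exact congrArg (fun y : pairGroup q c => y.1.1.1.1) (inv_mul_cancel x)
        · exact congrArg (fun y : pairGroup q c => y.1.2.1.1) (inv_mul_cancel x)⟩,
    by
      obtain ⟨v, h1, h2⟩ := x.2
      exact ⟨v, h1.iotaMat h2⟩⟩
  map_one' := Subtype.ext (Units.ext iotaMat_one)
  map_mul' x y := Subtype.ext (Units.ext (iotaMat_mul _ _ _ _))

theorem matQ_symplectic (R : Type*) [Ring R] :
    (matQ R)ᵀ * Matrix.fromBlocks 0 1 (-1) 0 * matQ R = Matrix.fromBlocks 0 1 (-1) 0 := by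
  unfold matQ
  rw [Matrix.fromBlocks_transpose, Matrix.fromBlocks_multiply, Matrix.fromBlocks_multiply]
  congr 1 <;> ext i j <;> fin_cases i <;> fin_cases j <;>
    simp [Matrix.mul_apply, Fin.sum_univ_succ]

theorem matQ_similitude : IsSimilitude q c (formJ q L 3) (matQ (LocalAlg q L)) 1 := by
  have h : conjT q c (matQ (LocalAlg q L)) = (matQ (LocalAlg q L))ᵀ := by
    unfold conjT matQ
    rw [Matrix.fromBlocks_map]
    congr 2 <;> ext i j <;> fin_cases i <;> fin_cases j <;> simp
  unfold IsSimilitude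
  rw [h]
  unfold formJ
  rw [matQ_symplectic, Units.val_one, one_smul]

theorem matQ_left_inv : -(formJ q L 3 * ((matQ (LocalAlg q L))ᵀ * formJ q L 3)) *
    matQ (LocalAlg q L) = 1 := by
  have h := matQ_symplectic (LocalAlg q L)
  rw [Matrix.neg_mul, Matrix.mul_assoc]
  unfold formJ
  rw [h, Matrix.fromBlocks_multiply]
  simp [Matrix.fromBlocks_neg]

/-- The element `Q` of `GU(3,3)(ℚ_q)`. -/
def elemQ : GUThree q c :=
  ⟨⟨matQ (LocalAlg q L),
      -(formJ q L 3 * ((matQ (LocalAlg q L))ᵀ * formJ q L 3)),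
      mul_eq_one_comm.mp (matQ_left_inv q),
      matQ_left_inv q⟩,
    ⟨1, matQ_similitude q c⟩⟩

end Embedding

/-! ### The unramified section -/

section UnramifiedSection

variable (q : ℕ) [Fact q.Prime] {L : Type*} [Field L] [NumberField L] (c : L ≃ₐ[ℚ] L)

/-- The element `n(b)` of the unipotent radical of the Siegel parabolic subgroup. -/
def siegelN (b : Matrix (Fin 3) (Fin 3) (LocalAlg q L)) :
    Matrix (Fin 3 ⊕ Fin 3) (Fin 3 ⊕ Fin 3) (LocalAlg q L) :=
  Matrix.fromBlocks 1 b 0 1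

/-- The element `m(A, v)` of the Levi subgroup of the Siegel parabolic subgroup. -/
def siegelM (A : GL (Fin 3) (LocalAlg q L)) (v : ℚ_[q]ˣ) :
    Matrix (Fin 3 ⊕ Fin 3) (Fin 3 ⊕ Fin 3) (LocalAlg q L) :=
  Matrix.fromBlocks A.1 0 0 ((v : ℚ_[q]) • conjT q c (A⁻¹).1)

variable {q} in
/-- The character
`n(b) m(A, v) ↦ |v|^{-9(s + 1/2)} |N(det A)|^{3(s + 1/2)} Λ(det A)` of the Siegel parabolic. -/
def siegelChar (Λ : (LocalAlg q L)ˣ →* Circle) (s : ℂ) (A : GL (Fin 3) (LocalAlg q L))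
    (v : ℚ_[q]ˣ) : ℂ :=
  (‖(v : ℚ_[q])‖ : ℂ) ^ (-9 * (s + 1 / 2)) *
    (‖Algebra.norm ℚ_[q] A.1.det‖ : ℂ) ^ (3 * (s + 1 / 2)) *
    (Λ (Matrix.GeneralLinearGroup.det A) : ℂ)

variable {q} in
/-- `g = n(b) m(A, v) k` for some hermitian `b` and some `k` in the maximal compact subgroup. -/
def HasSiegelPart (g : GUThree q c) (A : GL (Fin 3) (LocalAlg q L)) (v : ℚ_[q]ˣ) : Prop :=
  ∃ b : Matrix (Fin 3) (Fin 3) (LocalAlg q L), conjT q c b = b ∧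
    ∃ k ∈ compactGUThree q c, g.1.1 = siegelN q b * siegelM q c A v * k.1.1

open Classical in
variable {q} in
/-- The unramified section `Υ_q(·, s)`, the vector of the induced representation `I_q(Λ, s)` of
`GU(3,3)(ℚ_q)` that is fixed by the maximal compact subgroup and takes the value `1` at `1`:
it sends `n(b) m(A, v) k` to `|v|^{-9(s + 1/2)} |N(det A)|^{3(s + 1/2)} Λ(det A)`. -/
def unramifiedSection (Λ : (LocalAlg q L)ˣ →* Circle) (s : ℂ) (g : GUThree q c) : ℂ :=
  if h : ∃ p : GL (Fin 3) (LocalAlg q L) × ℚ_[q]ˣ, HasSiegelPart c g p.1 p.2 then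
    siegelChar Λ s h.choose.1 h.choose.2
  else 0

theorem localConj_mem {x : LocalAlg q L} (hx : x ∈ localIntegers q L) :
    localConj q c x ∈ localIntegers q L := by
  unfold localIntegers at *
  induction hx using Algebra.adjoin_induction with
  | mem x hx =>
    obtain ⟨y, rfl⟩ := hx
    refine Algebra.subset_adjoin ⟨NumberField.RingOfIntegers.mapAlgEquiv c y, ?_⟩
    simp only [localConj, Algebra.TensorProduct.congr_apply, Algebra.TensorProduct.map_tmul]
    rfl
  | algebraMap r =>
    have : localConj q c (algebraMap ℤ_[q] (LocalAlg q L) r) = algebraMap ℤ_[q] _ r := by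
      rw [IsScalarTower.algebraMap_apply ℤ_[q] ℚ_[q] (LocalAlg q L), AlgEquiv.commutes]
    rw [this]
    exact Subalgebra.algebraMap_mem _ r
  | add x y _ _ hx hy => rw [map_add]; exact add_mem hx hy
  | mul x y _ _ hx hy => rw [map_mul]; exact mul_mem hx hy

theorem norm_le_one {x : LocalAlg q L} (hx : x ∈ localIntegers q L) :
    ‖Algebra.norm ℚ_[q] x‖ ≤ 1 := by
  classical
  let B := Algebra.TensorProduct.basis ℚ_[q] (NumberField.integralBasis L)
  have key : ∃ M : Matrix _ _ ℤ_[q],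
      Algebra.leftMulMatrix B x = M.map (algebraMap ℤ_[q] ℚ_[q]) := by
    unfold localIntegers at hx
    induction hx using Algebra.adjoin_induction with
    | mem x hx =>
      obtain ⟨y, rfl⟩ := hx
      refine ⟨(Algebra.leftMulMatrix (NumberField.RingOfIntegers.basis L) y).map
        (algebraMap ℤ ℤ_[q]), ?_⟩
      ext i j
      rw [Algebra.leftMulMatrix_eq_repr_mul, Matrix.map_apply, Matrix.map_apply,
        Algebra.leftMulMatrix_eq_repr_mul]
      have h1 : ((1 : ℚ_[q]) ⊗ₜ[ℚ] (y : L)) * B j =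
          1 ⊗ₜ[ℚ] (algebraMap _ L (y * NumberField.RingOfIntegers.basis L j)) := by
        simp [B, Algebra.TensorProduct.basis_apply, NumberField.integralBasis_apply]
      simp only [h1]
      rw [Algebra.TensorProduct.basis_repr_tmul, one_smul, Finsupp.mapRange_apply,
        NumberField.integralBasis_repr_apply]
      simp
    | algebraMap r =>
      refine ⟨algebraMap ℤ_[q] _ r, ?_⟩
      rw [IsScalarTower.algebraMap_apply ℤ_[q] ℚ_[q] (LocalAlg q L), AlgHom.commutes]
      ext i j
      simp [Matrix.algebraMap_matrix_apply]
      split_ifs <;> simp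
    | add x y _ _ hx hy =>
      obtain ⟨M, hM⟩ := hx
      obtain ⟨N, hN⟩ := hy
      exact ⟨M + N, by rw [map_add, hM, hN, Matrix.map_add _ (map_add _)]⟩
    | mul x y _ _ hx hy =>
      obtain ⟨M, hM⟩ := hx
      obtain ⟨N, hN⟩ := hy
      exact ⟨M * N, by rw [map_mul, hM, hN, Matrix.map_mul]⟩
  obtain ⟨M, hM⟩ := key
  rw [Algebra.norm_eq_matrix_det B, hM, ← RingHom.mapMatrix_apply, ← RingHom.map_det]
  exact M.det.norm_le_one

variable {q c}

theorem integralGL_apply_mem {ι : Type*} [Fintype ι] [DecidableEq ι] {k : GL ι (LocalAlg q L)}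
    (hk : k ∈ integralGL q L ι) (i j : ι) : k.1 i j ∈ localIntegers q L := by
  obtain ⟨k₀, rfl⟩ := hk
  exact (k₀.1 i j).2

theorem conjT_mul_siegel (A : GL (Fin 3) (LocalAlg q L)) (v : ℚ_[q]ˣ) :
    conjT q c A.1 * ((v : ℚ_[q]) • conjT q c (A⁻¹).1) = (v : ℚ_[q]) • 1 := by
  rw [Matrix.mul_smul, ← conjT_mul, ← Units.val_mul, inv_mul_cancel]
  simp [conjT, Matrix.map_one]

theorem det_mem {ι : Type*} [Fintype ι] [DecidableEq ι] {X : Matrix ι ι (LocalAlg q L)}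
    (hX : ∀ i j, X i j ∈ localIntegers q L) : X.det ∈ localIntegers q L := by
  rw [Matrix.det_apply]
  refine sum_mem fun σ _ => ?_
  rw [Units.smul_def]
  exact zsmul_mem (prod_mem fun i _ => hX _ _) _

theorem HasSiegelPart.eq_aux {g : GUThree q c} {A A' : GL (Fin 3) (LocalAlg q L)}
    {v v' : ℚ_[q]ˣ} (h : HasSiegelPart c g A v) (h' : HasSiegelPart c g A' v') :
    (∃ x ∈ localIntegers q L, A.1.det = A'.1.det * x) ∧ ‖(v : ℚ_[q])‖ ≤ ‖(v' : ℚ_[q])‖ := by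
  obtain ⟨b, -, k, hk, hg⟩ := h
  obtain ⟨b', -, k', hk', hg'⟩ := h'
  have hκ : k'.1 * k.1⁻¹ ∈ integralGL q L (Fin 3 ⊕ Fin 3) := mul_mem hk' (inv_mem hk)
  set X := (k'.1 * k.1⁻¹).1 with hX
  have hmem : ∀ i j, X i j ∈ localIntegers q L := integralGL_apply_mem hκ
  have h1 : siegelN q b * siegelM q c A v = siegelN q b' * siegelM q c A' v' * X := by
    have h2 : k.1.1 * (k.1⁻¹).1 = 1 := by rw [← Units.val_mul, mul_inv_cancel]; rfl
    rw [hX, Units.val_mul, ← Matrix.mul_assoc, ← hg', hg, Matrix.mul_assoc _ k.1.1, h2,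
      Matrix.mul_one]
  rw [← Matrix.fromBlocks_toBlocks X] at h1
  simp only [siegelN, siegelM, Matrix.fromBlocks_multiply, Matrix.one_mul, Matrix.zero_mul,
    Matrix.mul_zero, add_zero, zero_add, Matrix.fromBlocks_inj] at h1
  obtain ⟨e1, -, e3, e4⟩ := h1
  have hv' : (v' : ℚ_[q]) ≠ 0 := v'.ne_zero
  have e3' : X.toBlocks₂₁ = 0 := by
    have : conjT q c A'.1 * 0 = _ := congrArg (conjT q c A'.1 * ·) e3
    rw [Matrix.mul_zero, ← Matrix.mul_assoc, conjT_mul_siegel, Matrix.smul_mul,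
      Matrix.one_mul] at this
    exact (smul_eq_zero.mp this.symm).resolve_left hv'
  rw [e3', Matrix.mul_zero, add_zero] at e1
  refine ⟨⟨X.toBlocks₁₁.det, det_mem fun i j => hmem _ _, by rw [e1, Matrix.det_mul]⟩, ?_⟩
  have e5 : (v : ℚ_[q]) • (1 : Matrix (Fin 3) (Fin 3) (LocalAlg q L)) =
      (v' : ℚ_[q]) • (conjT q c X.toBlocks₁₁ * X.toBlocks₂₂) := by
    rw [← conjT_mul_siegel (c := c) A v, e4, e1, conjT_mul, Matrix.mul_assoc,
      ← Matrix.mul_assoc (conjT q c A'.1), conjT_mul_siegel, Matrix.smul_mul, Matrix.one_mul,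
      Matrix.mul_smul]
  have e6 := congrFun (congrFun e5 0) 0
  simp only [Matrix.smul_apply, Matrix.one_apply_eq] at e6
  have hy : (conjT q c X.toBlocks₁₁ * X.toBlocks₂₂) 0 0 ∈ localIntegers q L := by
    rw [Matrix.mul_apply]
    exact sum_mem fun i _ => mul_mem (localConj_mem q c (hmem _ _)) (hmem _ _)
  have e7 : algebraMap ℚ_[q] (LocalAlg q L) ((v' : ℚ_[q])⁻¹ * v) =
      (conjT q c X.toBlocks₁₁ * X.toBlocks₂₂) 0 0 := by
    rw [Algebra.algebraMap_eq_smul_one, mul_smul, e6, smul_smul, inv_mul_cancel₀ hv', one_smul]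
  have e8 := norm_le_one q hy
  rw [← e7, Algebra.norm_algebraMap_of_basis
    (Algebra.TensorProduct.basis ℚ_[q] (NumberField.integralBasis L)), norm_pow] at e8
  have e9 : ‖(v' : ℚ_[q])⁻¹ * v‖ ≤ 1 :=
    (pow_le_one_iff_of_nonneg (norm_nonneg _) Fintype.card_ne_zero).mp e8
  rw [norm_mul, norm_inv, inv_mul_le_iff₀ (norm_pos_iff.mpr hv'), mul_one] at e9
  exact e9

/-- `unramifiedSection` is well defined: its value can be computed from any decomposition. -/
theorem unramifiedSection_eq {Λ : (LocalAlg q L)ˣ →* Circle}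
    (hΛ : ∀ u : (LocalAlg q L)ˣ, (u : LocalAlg q L) ∈ localIntegers q L →
      ((u⁻¹ : (LocalAlg q L)ˣ) : LocalAlg q L) ∈ localIntegers q L → Λ u = 1) (s : ℂ)
    {g : GUThree q c} {A : GL (Fin 3) (LocalAlg q L)} {v : ℚ_[q]ˣ} (h : HasSiegelPart c g A v) :
    unramifiedSection c Λ s g = siegelChar Λ s A v := by
  have hex : ∃ p : GL (Fin 3) (LocalAlg q L) × ℚ_[q]ˣ, HasSiegelPart c g p.1 p.2 := ⟨(A, v), h⟩
  unfold unramifiedSection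
  rw [dif_pos hex]
  have h' := hex.choose_spec
  set A' := hex.choose.1
  set v' := hex.choose.2
  obtain ⟨⟨x, hx, hxA⟩, hv⟩ := h.eq_aux h'
  obtain ⟨⟨y, hy, hyA⟩, hv'⟩ := h'.eq_aux h
  set d := Matrix.GeneralLinearGroup.det A
  set d' := Matrix.GeneralLinearGroup.det A'
  have hd : (d : LocalAlg q L) = A.1.det := rfl
  have hd' : (d' : LocalAlg q L) = A'.1.det := rfl
  rw [← hd, ← hd'] at hxA hyA
  have hx' : ((d'⁻¹ * d : (LocalAlg q L)ˣ) : LocalAlg q L) = x := by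
    rw [Units.val_mul, hxA, Units.inv_mul_cancel_left]
  have hy' : (((d'⁻¹ * d)⁻¹ : (LocalAlg q L)ˣ) : LocalAlg q L) = y := by
    rw [mul_inv_rev, inv_inv, Units.val_mul, hyA, Units.inv_mul_cancel_left]
  have hΛd : Λ d' = Λ d := by
    have := hΛ (d'⁻¹ * d) (hx' ▸ hx) (hy' ▸ hy)
    rw [map_mul, map_inv] at this
    exact inv_mul_eq_one.mp this
  have hN : ‖Algebra.norm ℚ_[q] A'.1.det‖ = ‖Algebra.norm ℚ_[q] A.1.det‖ := by
    rw [← hd, ← hd']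
    apply le_antisymm
    · rw [hyA, map_mul, norm_mul]
      exact mul_le_of_le_one_right (norm_nonneg _) (norm_le_one q hy)
    · rw [hxA, map_mul, norm_mul]
      exact mul_le_of_le_one_right (norm_nonneg _) (norm_le_one q hx)
  unfold siegelChar
  rw [hN, le_antisymm hv' hv]
  change _ * (Λ d' : ℂ) = _ * (Λ d : ℂ)
  rw [hΛd]

theorem siegelChar_mul (Λ : (LocalAlg q L)ˣ →* Circle) (s : ℂ) (A B : GL (Fin 3) (LocalAlg q L))
    (v w : ℚ_[q]ˣ) : siegelChar Λ s (A * B) (v * w) = siegelChar Λ s A v * siegelChar Λ s B w := by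
  unfold siegelChar
  rw [Units.val_mul, Units.val_mul, Matrix.det_mul, map_mul, map_mul, map_mul, norm_mul, norm_mul,
    Complex.ofReal_mul, Complex.ofReal_mul,
    Complex.mul_cpow_ofReal_nonneg (norm_nonneg _) (norm_nonneg _),
    Complex.mul_cpow_ofReal_nonneg (norm_nonneg _) (norm_nonneg _), Circle.coe_mul]
  ring

theorem siegelM_mul_siegelN (A : GL (Fin 3) (LocalAlg q L)) (v : ℚ_[q]ˣ)
    (b : Matrix (Fin 3) (Fin 3) (LocalAlg q L)) :
    siegelM q c A v * siegelN q b =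
      siegelN q ((v : ℚ_[q])⁻¹ • (A.1 * b * conjT q c A.1)) * siegelM q c A v := by
  have h : (v : ℚ_[q])⁻¹ • (A.1 * b * conjT q c A.1) * ((v : ℚ_[q]) • conjT q c (A⁻¹).1) =
      A.1 * b := by
    rw [Matrix.smul_mul, Matrix.mul_assoc, conjT_mul_siegel, Matrix.mul_smul, Matrix.mul_one,
      smul_smul, inv_mul_cancel₀ v.ne_zero, one_smul]
  unfold siegelM siegelN
  simp only [Matrix.fromBlocks_multiply, h, Matrix.mul_one, Matrix.one_mul, Matrix.mul_zero,
    Matrix.zero_mul, add_zero, zero_add]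

theorem siegelM_mul (A B : GL (Fin 3) (LocalAlg q L)) (v w : ℚ_[q]ˣ) :
    siegelM q c A v * siegelM q c B w = siegelM q c (A * B) (v * w) := by
  simp [siegelM, Matrix.fromBlocks_multiply, conjT_mul, smul_smul, mul_comm]

theorem siegelN_mul (b b' : Matrix (Fin 3) (Fin 3) (LocalAlg q L)) :
    siegelN q b * siegelN q b' = siegelN q (b + b') := by
  simp [siegelN, Matrix.fromBlocks_multiply, add_comm]

theorem conjT_conj (hc : ∀ x, c (c x) = x) (v : ℚ_[q]) (A b : Matrix (Fin 3) (Fin 3) (LocalAlg q L))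
    (hb : conjT q c b = b) :
    conjT q c (v • (A * b * conjT q c A)) = v • (A * b * conjT q c A) := by
  have h1 : ∀ B : Matrix (Fin 3) (Fin 3) (LocalAlg q L), conjT q c (conjT q c B) = B := by
    intro B
    ext i j
    have h2 : (localConj q c : LocalAlg q L →ₐ[ℚ_[q]] LocalAlg q L).comp
        (localConj q c : LocalAlg q L →ₐ[ℚ_[q]] LocalAlg q L) = AlgHom.id _ _ := by
      ext x
      simp [localConj, hc]
    exact DFunLike.congr_fun h2 (B i j)
  have h3 : ∀ B : Matrix (Fin 3) (Fin 3) (LocalAlg q L), conjT q c (v • B) = v • conjT q c B := by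
    intro B
    ext i j
    simp [conjT]
  rw [h3, conjT_mul, conjT_mul, h1, hb, Matrix.mul_assoc]

theorem HasSiegelPart.mul (hc : ∀ x, c (c x) = x) {g g' : GUThree q c}
    {A B : GL (Fin 3) (LocalAlg q L)} {v w : ℚ_[q]ˣ} {b : Matrix (Fin 3) (Fin 3) (LocalAlg q L)}
    (hb : conjT q c b = b) (hg : g'.1.1 = siegelN q b * siegelM q c A v * g.1.1)
    (h : HasSiegelPart c g B w) : HasSiegelPart c g' (A * B) (v * w) := by
  obtain ⟨b', hb', k, hk, hgk⟩ := h
  refine ⟨b + (v : ℚ_[q])⁻¹ • (A.1 * b' * conjT q c A.1), ?_, k, hk, ?_⟩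
  · have h3 : ∀ B C : Matrix (Fin 3) (Fin 3) (LocalAlg q L),
        conjT q c (B + C) = conjT q c B + conjT q c C := by
      intro B C
      ext i j
      simp [conjT]
    rw [h3, conjT_conj hc _ _ _ hb', hb]
  · rw [hg, hgk, ← siegelM_mul, ← siegelN_mul]
    calc siegelN q b * siegelM q c A v * (siegelN q b' * siegelM q c B w * k.1.1)
        = siegelN q b * (siegelM q c A v * siegelN q b') * siegelM q c B w * k.1.1 := by
          simp only [Matrix.mul_assoc]
      _ = _ := by rw [siegelM_mul_siegelN]; simp only [Matrix.mul_assoc]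

/-- The transformation law of the induced representation `I_q(Λ, s)`. -/
theorem unramifiedSection_mul (hc : ∀ x, c (c x) = x) {Λ : (LocalAlg q L)ˣ →* Circle}
    (hΛ : ∀ u : (LocalAlg q L)ˣ, (u : LocalAlg q L) ∈ localIntegers q L →
      ((u⁻¹ : (LocalAlg q L)ˣ) : LocalAlg q L) ∈ localIntegers q L → Λ u = 1) (s : ℂ)
    {g g' : GUThree q c} {A : GL (Fin 3) (LocalAlg q L)} {v : ℚ_[q]ˣ}
    {b : Matrix (Fin 3) (Fin 3) (LocalAlg q L)} (hb : conjT q c b = b)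
    (hg : g'.1.1 = siegelN q b * siegelM q c A v * g.1.1) :
    unramifiedSection c Λ s g' = siegelChar Λ s A v * unramifiedSection c Λ s g := by
  by_cases h : ∃ p : GL (Fin 3) (LocalAlg q L) × ℚ_[q]ˣ, HasSiegelPart c g p.1 p.2
  · obtain ⟨⟨B, w⟩, h⟩ := h
    rw [unramifiedSection_eq hΛ s h, unramifiedSection_eq hΛ s (h.mul hc hb hg), siegelChar_mul]
  · have h' : ¬ ∃ p : GL (Fin 3) (LocalAlg q L) × ℚ_[q]ˣ, HasSiegelPart c g' p.1 p.2 := by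
      rintro ⟨⟨B, w⟩, h'⟩
      refine h ⟨(A⁻¹ * B, v⁻¹ * w), h'.mul hc
        (b := ((v⁻¹ : ℚ_[q]ˣ) : ℚ_[q])⁻¹ • ((A⁻¹).1 * (-b) * conjT q c (A⁻¹).1)) ?_ ?_⟩
      · refine conjT_conj hc _ _ _ ?_
        conv_rhs => rw [← hb]
        ext i j
        simp [conjT]
      · rw [← siegelM_mul_siegelN, hg]
        calc g.1.1 = siegelM q c 1 1 * siegelN q 0 * g.1.1 := by
              simp [siegelM, siegelN, conjT, Matrix.map_one, Matrix.fromBlocks_one]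
          _ = siegelM q c A⁻¹ v⁻¹ * siegelM q c A v * siegelN q 0 * g.1.1 := by
              rw [siegelM_mul, inv_mul_cancel, inv_mul_cancel]
          _ = siegelM q c A⁻¹ v⁻¹ * (siegelN q (-b) * siegelN q b) * siegelM q c A v * g.1.1 := by
              rw [siegelN_mul, neg_add_cancel]
              have : siegelN q (0 : Matrix (Fin 3) (Fin 3) (LocalAlg q L)) = 1 :=
                Matrix.fromBlocks_one
              rw [this, Matrix.mul_one, Matrix.mul_one]
          _ = _ := by simp only [Matrix.mul_assoc]
    unfold unramifiedSection
    rw [dif_neg h, dif_neg h', mul_zero]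

/-- `unramifiedSection` is fixed by the maximal compact subgroup. -/
theorem unramifiedSection_mul_compact {Λ : (LocalAlg q L)ˣ →* Circle} (s : ℂ)
    (g k : GUThree q c) (hk : k ∈ compactGUThree q c) :
    unramifiedSection c Λ s (g * k) = unramifiedSection c Λ s g := by
  have h : HasSiegelPart c (g * k) = HasSiegelPart c g := by
    refine funext fun A => funext fun v => propext ⟨?_, ?_⟩
    · rintro ⟨b, hb, k', hk', h⟩
      refine ⟨b, hb, k' * k⁻¹, mul_mem hk' (inv_mem hk), ?_⟩
      have : g = (g * k) * k⁻¹ := by group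
      rw [this]
      change (g * k).1.1 * (k⁻¹).1.1 = _ * (k'.1.1 * (k⁻¹).1.1)
      rw [h, Matrix.mul_assoc]
    · rintro ⟨b, hb, k', hk', h⟩
      refine ⟨b, hb, k' * k, mul_mem hk' hk, ?_⟩
      change g.1.1 * k.1.1 = _ * (k'.1.1 * k.1.1)
      rw [h, Matrix.mul_assoc]
  have gen : ∀ (P P' : GL (Fin 3) (LocalAlg q L) × ℚ_[q]ˣ → Prop), P = P' →
      (open Classical in
        (if h : ∃ p, P p then siegelChar Λ s h.choose.1 h.choose.2 else 0) =
          if h : ∃ p, P' p then siegelChar Λ s h.choose.1 h.choose.2 else 0) := by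
    rintro P _ rfl
    rfl
  exact gen (fun p => HasSiegelPart c (g * k) p.1 p.2) (fun p => HasSiegelPart c g p.1 p.2)
    (by rw [h])

theorem unramifiedSection_one {Λ : (LocalAlg q L)ˣ →* Circle}
    (hΛ : ∀ u : (LocalAlg q L)ˣ, (u : LocalAlg q L) ∈ localIntegers q L →
      ((u⁻¹ : (LocalAlg q L)ˣ) : LocalAlg q L) ∈ localIntegers q L → Λ u = 1) (s : ℂ) :
    unramifiedSection c Λ s 1 = 1 := by
  have h : HasSiegelPart c (1 : GUThree q c) 1 1 := by
    refine ⟨0, by ext i j; simp [conjT], 1, one_mem _, ?_⟩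
    simp [siegelM, siegelN, conjT, Matrix.map_one, Matrix.fromBlocks_one]
  rw [unramifiedSection_eq hΛ s h]
  simp [siegelChar]

end UnramifiedSection

/-! ### Spherical Whittaker functions of unramified principal series -/

section Whittaker

variable {q : ℕ} [Fact q.Prime]

/-- `f` is right invariant under an open subgroup. -/
def IsSmooth {G : Type*} [Group G] [TopologicalSpace G] (f : G → ℂ) : Prop :=
  ∃ U : Subgroup G, IsOpen (U : Set G) ∧ ∀ g, ∀ u ∈ U, f (g * u) = f g

/-- The matrix `(a, b; 0, d)`. -/
def upperTri (a d : ℚ_[q]ˣ) (b : ℚ_[q]) : GL (Fin 2) ℚ_[q] :=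
  Matrix.GeneralLinearGroup.mkOfDetNeZero !![(a : ℚ_[q]), b; 0, (d : ℚ_[q])]
    (by simp [Matrix.det_fin_two])

/-- The space of the (normalized) principal series representation of `GL_2(ℚ_q)` induced from the
characters `α, β`. -/
def principalSeries (α β : ℚ_[q]ˣ →* ℂˣ) : Submodule ℂ (GL (Fin 2) ℚ_[q] → ℂ) where
  carrier := {f | IsSmooth f ∧ ∀ (a d : ℚ_[q]ˣ) (b : ℚ_[q]) (g : GL (Fin 2) ℚ_[q]),
    f (upperTri a d b * g) =
      (α a : ℂ) * (β d : ℂ) * ((√(‖(a : ℚ_[q])‖ / ‖(d : ℚ_[q])‖) : ℝ) : ℂ) * f g}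
  zero_mem' := ⟨⟨⊤, isOpen_univ, by simp⟩, by simp⟩
  add_mem' := by
    rintro f f' ⟨⟨U, hU, hf⟩, h⟩ ⟨⟨U', hU', hf'⟩, h'⟩
    refine ⟨⟨U ⊓ U', hU.inter hU', fun g u hu => ?_⟩, fun a d b g => ?_⟩
    · simp only [Pi.add_apply, hf g u hu.1, hf' g u hu.2]
    · simp only [Pi.add_apply, h, h', mul_add]
  smul_mem' := by
    rintro z f ⟨⟨U, hU, hf⟩, h⟩
    refine ⟨⟨U, hU, fun g u hu => ?_⟩, fun a d b g => ?_⟩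
    · simp only [Pi.smul_apply, hf g u hu]
    · simp only [Pi.smul_apply, h, smul_eq_mul]
      ring

/-- The action of `GL_2(ℚ_q)` on the principal series by right translation. -/
def rightTranslate (α β : ℚ_[q]ˣ →* ℂˣ) (h : GL (Fin 2) ℚ_[q]) (f : principalSeries α β) :
    principalSeries α β :=
  ⟨fun g => f.1 (g * h), by
    obtain ⟨⟨U, hU, hf⟩, hf'⟩ := f.2
    refine ⟨⟨U.comap (MulAut.conj h⁻¹).toMonoidHom, ?_, fun g u hu => ?_⟩, fun a d b g => ?_⟩
    · refine hU.preimage ?_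
      change Continuous fun x => h⁻¹ * x * h⁻¹⁻¹
      fun_prop
    · have h1 := hf (g * h) _ hu
      have h2 : g * h * (MulAut.conj h⁻¹).toMonoidHom u = g * u * h := by
        simp [mul_assoc]
      rw [h2] at h1
      exact h1
    · simpa only [mul_assoc] using hf' a d b (g * h)⟩

/-- `T` is a `GL_2(ℚ_q)`-equivariant linear map from the principal series to the space of functions
`w` on `GL_2(ℚ_q)` with `w((1, x; 0, 1) g) = ψ(x) w(g)`. Its image (when `T` is nonzero and the
principal series is irreducible) is the `ψ`-Whittaker model. -/
def IsWhittakerMap (ψ : AddChar ℚ_[q] Circle) (α β : ℚ_[q]ˣ →* ℂˣ)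
    (T : principalSeries α β →ₗ[ℂ] (GL (Fin 2) ℚ_[q] → ℂ)) : Prop :=
  (∀ f x g, T f (upperTri 1 1 x * g) = (ψ x : ℂ) * T f g) ∧
    ∀ f h g, T (rightTranslate α β h f) g = T f (g * h)

/-- `GL_2(ℤ_q)` as a subgroup of `GL_2(ℚ_q)`. -/
def maxCompact (q : ℕ) [Fact q.Prime] : Subgroup (GL (Fin 2) ℚ_[q]) :=
  (Matrix.GeneralLinearGroup.map (n := Fin 2) (algebraMap ℤ_[q] ℚ_[q])).range

/-- `W` is the function on `GU(1,1)(ℚ_q) = L_q^× GL_2(ℚ_q)` given by `W(a x) = w(x)` for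
`a ∈ L_q^×` and `x ∈ GL_2(ℚ_q)`, where `w` is the image of a `GL_2(ℤ_q)`-fixed vector of the
principal series induced from `α, β` in its `ψ`-Whittaker model. -/
def IsSphericalWhittaker {L : Type*} [Field L] [NumberField L] (c : L ≃ₐ[ℚ] L)
    (ψ : AddChar ℚ_[q] Circle) (α β : ℚ_[q]ˣ →* ℂˣ) (W : GUOne q c → ℂ) : Prop :=
  ∃ (T : principalSeries α β →ₗ[ℂ] (GL (Fin 2) ℚ_[q] → ℂ)) (f : principalSeries α β),
    IsWhittakerMap ψ α β T ∧ (∀ g, ∀ k ∈ maxCompact q, f.1 (g * k) = f.1 g) ∧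
    ∀ (a : (LocalAlg q L)ˣ) (x : GL (Fin 2) ℚ_[q]) (g : GUOne q c),
      g.1.1 = (a : LocalAlg q L) • x.1.map (algebraMap ℚ_[q] (LocalAlg q L)) → W g = T f x

/-- The conductor of `ψ` is `ℤ_q`: it is trivial on `ℤ_q` but not on `q⁻¹ ℤ_q`. -/
def HasConductorIntegers (ψ : AddChar ℚ_[q] Circle) : Prop :=
  (∀ x : ℚ_[q], ‖x‖ ≤ 1 → ψ x = 1) ∧ ∃ x : ℚ_[q], ‖x‖ ≤ q ∧ ψ x ≠ 1

end Whittaker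

/-! ### The local zeta integral -/

section Zeta

variable {q : ℕ} [Fact q.Prime] {L : Type*} [Field L] [NumberField L] (c : L ≃ₐ[ℚ] L)

/-- A pair in `U(2,2) × U(1,1)`, regarded as a pair of similitudes with equal multipliers. -/
def isometryPair (k : UTwo q c) (h : UOne q c) : pairGroup q c :=
  ⟨(k.1, h.1), ⟨1, k.2, h.2⟩⟩

/-- The integrand `Υ_q(Q · ι(k, h), s) W(g h) Λ⁻¹(det h)` of the local zeta integral. -/
def zetaIntegrand (Λ : (LocalAlg q L)ˣ →* Circle) (W : GUOne q c → ℂ) (g : GUOne q c)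
    (k : UTwo q c) (s : ℂ) (h : UOne q c) : ℂ :=
  unramifiedSection c Λ s (elemQ q c * iota q c (isometryPair c k h)) * W (g * h.1) *
    ((Λ (Matrix.GeneralLinearGroup.det h.1.1) : ℂ))⁻¹

/-- The local zeta integral `Z_q(g, k, s)`, with respect to the measure `μ` on `U(1,1)(ℚ_q)`. -/
def localZeta [MeasurableSpace (UOne q c)] (μ : MeasureTheory.Measure (UOne q c))
    (Λ : (LocalAlg q L)ˣ →* Circle) (W : GUOne q c → ℂ) (g : GUOne q c) (k : UTwo q c) (s : ℂ) :
    ℂ :=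
  ∫ h, zetaIntegrand c Λ W g k s h ∂μ

end Zeta

/-! ### Local `L`-factors -/

section LFactors

variable (q : ℕ) [Fact q.Prime] (L : Type*) [Field L] [NumberField L]

/-- `q` as an element of `ℚ_q^×`. -/
def primeUnit : ℚ_[q]ˣ :=
  Units.mk0 (q : ℚ_[q]) (Nat.cast_ne_zero.mpr (Fact.out : q.Prime).ne_zero)

/-- `q` is inert in `L`. -/
def IsInert : Prop := (Ideal.span {(q : NumberField.RingOfIntegers L)}).IsPrime

/-- `q` is ramified in the quadratic field `L`. -/
def IsRamified : Prop :=
  ∃ P : Ideal (NumberField.RingOfIntegers L), P.IsPrime ∧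
    Ideal.span {(q : NumberField.RingOfIntegers L)} = P ^ 2

/-- `q₁` is an element of `ℤ_{L,q}` whose norm lies in `q ℤ_q^×`. -/
def IsNormUniformizer (q₁ : (LocalAlg q L)ˣ) : Prop :=
  (q₁ : LocalAlg q L) ∈ localIntegers q L ∧
    ‖Algebra.norm ℚ_[q] (q₁ : LocalAlg q L)‖ = ‖(q : ℚ_[q])‖

variable {q L}

/-- A character (or function) on `ℚ_q^×` is unramified if it is trivial on `ℤ_q^×`. -/
def IsUnram {M : Type*} [One M] (χ : ℚ_[q]ˣ → M) : Prop :=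
  ∀ u : ℚ_[q]ˣ, ‖(u : ℚ_[q])‖ = 1 → χ u = 1

open Classical in
/-- The local factor `L(s, χ)`: `(1 - χ(q) q^{-s})⁻¹` if `χ` is unramified, `1` otherwise. -/
def charLFactor (χ : ℚ_[q]ˣ → ℂ) (s : ℂ) : ℂ :=
  if IsUnram χ then (1 - χ (primeUnit q) * (q : ℂ) ^ (-s))⁻¹ else 1

open Classical in
variable (q L) in
/-- The local component at `q` of the Hecke character attached by class field theory to the
quadratic extension `L / ℚ`: the character of `ℚ_q^×` that is `1` exactly on the norms from
`L_q^×`, and `-1` elsewhere. -/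
def normResidueChar (x : ℚ_[q]ˣ) : ℂ :=
  if ∃ y : (LocalAlg q L)ˣ, Algebra.norm ℚ_[q] (y : LocalAlg q L) = (x : ℚ_[q]) then 1 else -1

open Classical in
/-- The local factor `L(s, σ_q × ρ(Λ_q))`, where `σ_q` is the principal series induced from `α, β`
and `ρ(Λ_q)` is the automorphic induction of `Λ_q`; the three cases are `q` inert, ramified, and
split in `L`. In the last two cases `q₁` is an element of `ℤ_{L,q}` with norm in `q ℤ_q^×`. -/
def rankinLFactor (α β : ℚ_[q]ˣ →* ℂˣ) (Λ : (LocalAlg q L)ˣ →* Circle) (q₁ : (LocalAlg q L)ˣ)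
    (s : ℂ) : ℂ :=
  let a : ℂ := α (primeUnit q)
  let b : ℂ := β (primeUnit q)
  let t : ℂ := Λ q₁
  if IsInert q L then
    (1 - a ^ 2 * (q : ℂ) ^ (-2 * s))⁻¹ * (1 - b ^ 2 * (q : ℂ) ^ (-2 * s))⁻¹
  else if IsRamified q L then
    (1 - a * t * (q : ℂ) ^ (-s))⁻¹ * (1 - b * t * (q : ℂ) ^ (-s))⁻¹
  else
    (1 - a * t * (q : ℂ) ^ (-s))⁻¹ * (1 - b * t * (q : ℂ) ^ (-s))⁻¹ *
      (1 - a * t⁻¹ * (q : ℂ) ^ (-s))⁻¹ * (1 - b * t⁻¹ * (q : ℂ) ^ (-s))⁻¹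

end LFactors

end

end PullbackFormula

open PullbackFormula

/-! The integral is a sum over cosets, and the sum is an instance of Cauchy's identity for complete
homogeneous polynomials.

By Hilbert 90, every h in U(1,1) is l·M with l in L_q^× and M in GL_2(ℚ_q)
(`IsQuadGen.exists_smul_map`). If M is taken primitive, the pair is unique up to ℤ_q^×. So the
cosets of K = U(1,1) ∩ GL_2(ℤ_{L,q}) are indexed by d ≥ 0 with |det M| = q^(-d), a point of the
sphere of radius d in the tree of PGL_2(ℚ_q), and a class of l modulo units with |N l| = q^d
(`IsUnitReps.exists_coset`). The integrand is right K-invariant and K is open of measure 1.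

Q carries the diagonally embedded SL_2 into the Siegel parabolic. Hence h ↦ Υ(Q ι(1, h)) is left
invariant under SL_2(ℤ_q), and the Cartan decomposition reduces its computation to diagonal h with
entries x/y and conj(y/x), x and y coprime. A Bezout relation for x, y gives an explicit Iwasawa
decomposition (`sectionValue_diagonal`). Together with Λ⁻¹(det h) the value is u^e Λ(l)⁻¹, where u =
q^(-(3s+3/2)), x/y is l det M up to a unit, and |N(xy)| = q^(-e) (`sectionValue_eq`). It does not
depend on the point of the sphere.

For fixed d the sum therefore factors into c_d, the sum of u^e Λ(l)⁻¹ over the classes of l, and the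
sum of W over a sphere. The latter is a Hecke operator: with A = √q α(q), B = √q β(q) and h_d the
complete homogeneous polynomial, it acts on W by h_d(A,B) − h_{d−2}(A,B)
(`IsUnramWhittaker.sum_sphere`). Summation by parts gives Z = W(g) Σ (c_d − c_{d+2}) h_d(A,B).

In each case c_d − c_{d+2} = (1 − u²) h_d(X,Y), where (X,Y) is (u, −u), (Λ(q₁)u, 0) or (Λ(q₁)u,
Λ(q₁)⁻¹u) for q inert, ramified or split. Cauchy's identity (`hasSum_completeHom_mul`) then gives (1
− u²)(1 − XYAB) over the product of the four factors 1 − XA, 1 − XB, 1 − YA, 1 − YB. Here 1 − u² is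
the inverse of L(6s+3, 1). Since u²AB = q^(-(6s+2)), the numerator 1 − XYAB is the inverse of
L(6s+2, χ_{-D}), once χ_{-D} is known to be unramified nontrivial, ramified or trivial respectively.
The four factors give the Rankin factor because uA = α(q) q^(-(3s+1)).

For absolute convergence, the sums of |W| grow at most like (d+1)² R^d with R = √q max(|α(q)|,
|β(q)|), and the hypothesis on s says |u| R < 1. -/

namespace PullbackFormula

open NumberField

set_option linter.unusedSectionVars false

/-! ### Monogenicity of the ring of integers of a quadratic field -/

section QuadraticGenerator

variable {L : Type*} [Field L] [NumberField L]

/-- `θ` generates the ring of integers of the quadratic field `L`, with trace `t` and norm `n`. -/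
structure IsQuadGen (c : L ≃ₐ[ℚ] L) (θ : 𝓞 L) (t n : ℤ) : Prop where
  finrank : Module.finrank ℚ L = 2
  span : ∀ x : 𝓞 L, ∃ a b : ℤ, x = a + b * θ
  sq : θ ^ 2 = t * θ - n
  conj : c (θ : L) = t - θ
  ne : c (θ : L) ≠ θ

/-- The coordinates of 1 in a ℤ-basis are coprime, so 1 can be completed to a basis 1, θ. -/
theorem exists_isQuadGen (hL : Module.finrank ℚ L = 2) (c : L ≃ₐ[ℚ] L) (hc : c ≠ 1) :
    ∃ (θ : 𝓞 L) (t n : ℤ), IsQuadGen c θ t n := by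
  have hr : Module.finrank ℤ (𝓞 L) = 2 := by rw [RingOfIntegers.rank, hL]
  let e := Module.finBasisOfFinrankEq ℤ (𝓞 L) hr
  have he : ∀ x : 𝓞 L, x = (e.repr x 0 : 𝓞 L) * e 0 + (e.repr x 1 : 𝓞 L) * e 1 := by
    intro x
    conv_lhs => rw [← e.sum_repr x]
    simp [Fin.sum_univ_two, zsmul_eq_mul]
  set a := e.repr 1 0 with ha
  set b := e.repr 1 1 with hb
  have hcop : IsCoprime a b := by
    rw [Int.isCoprime_iff_gcd_eq_one]
    obtain ⟨a', ha'⟩ := Int.gcd_dvd_left a b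
    obtain ⟨b', hb'⟩ := Int.gcd_dvd_right a b
    set d : ℤ := (Int.gcd a b : ℤ)
    -- A common divisor d of the coordinates of 1 divides 1, hence divides e 0, whose own coordinate
    -- is 1.
    have h1 : e 0 = d • ((a' * e 0 + b' * e 1) * e 0) := by
      have : (1 : 𝓞 L) = (d : 𝓞 L) * (a' * e 0 + b' * e 1) := by
        conv_lhs => rw [he 1, ← ha, ← hb, ha', hb']
        push_cast
        ring
      rw [zsmul_eq_mul, ← mul_assoc, ← this, one_mul]
    have h2 := congrArg (fun x => e.repr x 0) h1
    simp only [Module.Basis.repr_self, map_zsmul, Finsupp.smul_apply, Finsupp.single_eq_same] at h2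
    have h3 : d ∣ 1 := ⟨_, h2⟩
    have h4 := Int.eq_one_of_dvd_one (by positivity) h3
    have h5 : (Int.gcd a b : ℤ) = 1 := h4
    exact_mod_cast h5
  obtain ⟨x, y, hxy⟩ := hcop
  -- The change of basis from e to 1, θ has rows (a, b) and (−y, x), of determinant xa + yb = 1.
  have hspan : ∀ z : 𝓞 L, ∃ k l : ℤ, z = k + l * (-(y : 𝓞 L) * e 0 + x * e 1) := by
    intro z
    have h1 := he z
    have h2 : (1 : 𝓞 L) = a * e 0 + b * e 1 := he 1
    have h3 : (x : 𝓞 L) * a + y * b = 1 := by exact_mod_cast congrArg (Int.cast : ℤ → 𝓞 L) hxy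
    set r := e.repr z 0
    set s := e.repr z 1
    refine ⟨x * r + y * s, -b * r + a * s, ?_⟩
    push_cast
    rw [h1]
    linear_combination (-(r * e 0) - s * e 1 : 𝓞 L) * h3 - (x * r + y * s : 𝓞 L) * h2
  set θ : 𝓞 L := -(y : 𝓞 L) * e 0 + x * e 1
  obtain ⟨n', t, hsq⟩ := hspan (θ ^ 2)
  have hne : c (θ : L) ≠ θ := by
    intro h
    apply hc
    ext z
    obtain ⟨w, m, -, hw⟩ := IsFractionRing.div_surjective (A := 𝓞 L) z
    have hfix : ∀ w : 𝓞 L, c (w : L) = w := by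
      intro w
      obtain ⟨k, l, rfl⟩ := hspan w
      simp [h]
    have h1 := hfix w
    have h2 := hfix m
    rw [← hw, map_div₀]
    simp only [AlgEquiv.one_apply, map_div₀]
    congr 1
  have hsqL : (θ : L) ^ 2 = n' + t * θ := by
    have := congrArg (algebraMap (𝓞 L) L) hsq
    simpa using this
  have hconj : c (θ : L) = t - θ := by
    have h1 : c (θ : L) ^ 2 = n' + t * c θ := by
      have := congrArg c hsqL
      simpa using this
    -- The conjugate of θ is a root of the same quadratic polynomial, so it is θ or t − θ.
    have h2 : (c (θ : L) - θ) * (c θ - (t - θ)) = 0 := by linear_combination h1 - hsqL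
    rcases mul_eq_zero.mp h2 with h | h
    · exact absurd (sub_eq_zero.mp h) hne
    · exact sub_eq_zero.mp h
  exact ⟨θ, t, -n', hL, hspan, by rw [hsq]; push_cast; ring, hconj, hne⟩

end QuadraticGenerator

/-! ### Coordinates on the local algebra: norm, conjugation, integers -/

section LocalCoordinates

variable (q : ℕ) [Fact q.Prime] {L : Type*} [Field L] [NumberField L]

/-- The element `a + b θ` of `L_q`. -/
noncomputable def locMk (θ : 𝓞 L) (a b : ℚ_[q]) : LocalAlg q L :=
  algebraMap ℚ_[q] (LocalAlg q L) a + algebraMap ℚ_[q] (LocalAlg q L) b * (1 ⊗ₜ[ℚ] (θ : L))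

variable {q} {c : L ≃ₐ[ℚ] L} {θ : 𝓞 L} {t n : ℤ}

/-- The basis `1, θ` of `L`. -/
noncomputable def IsQuadGen.basis (h : IsQuadGen c θ t n) : Module.Basis (Fin 2) ℚ L :=
  basisOfLinearIndependentOfCardEqFinrank (b := ![1, (θ : L)])
    (by
      rw [LinearIndependent.pair_iff]
      intro a b hab
      have h1 : b = 0 := by
        by_contra hb
        apply h.ne
        have : (θ : L) = algebraMap ℚ L (-a / b) := by
          rw [Algebra.smul_def, Algebra.smul_def, mul_one] at hab
          have : algebraMap ℚ L b ≠ 0 := by simpa using hb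
          rw [map_div₀, map_neg]
          field_simp
          linear_combination hab
        rw [this, AlgEquiv.commutes]
      subst h1
      simpa using hab)
    (by simp [h.finrank])

theorem IsQuadGen.basis_zero (h : IsQuadGen c θ t n) : h.basis 0 = 1 := by
  simp [IsQuadGen.basis]

theorem IsQuadGen.basis_one (h : IsQuadGen c θ t n) : h.basis 1 = (θ : L) := by
  simp [IsQuadGen.basis]

/-- The basis `1, θ` of `L_q`. -/
noncomputable def IsQuadGen.locBasis (h : IsQuadGen c θ t n) (q : ℕ) [Fact q.Prime] :
    Module.Basis (Fin 2) ℚ_[q] (LocalAlg q L) :=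
  Algebra.TensorProduct.basis ℚ_[q] h.basis

theorem IsQuadGen.locMk_eq (h : IsQuadGen c θ t n) (a b : ℚ_[q]) :
    locMk q θ a b = a • h.locBasis q 0 + b • h.locBasis q 1 := by
  rw [IsQuadGen.locBasis, Algebra.TensorProduct.basis_apply, Algebra.TensorProduct.basis_apply,
    h.basis_zero, h.basis_one, locMk, Algebra.smul_def, Algebra.smul_def,
    ← Algebra.TensorProduct.one_def, mul_one]

theorem IsQuadGen.exists_locMk (h : IsQuadGen c θ t n) (x : LocalAlg q L) :
    ∃ a b, x = locMk q θ a b :=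
  ⟨(h.locBasis q).repr x 0, (h.locBasis q).repr x 1, by
    rw [h.locMk_eq, ← Fin.sum_univ_two (fun i => (h.locBasis q).repr x i • h.locBasis q i),
      Module.Basis.sum_repr]⟩

theorem IsQuadGen.repr_locMk (h : IsQuadGen c θ t n) (a b : ℚ_[q]) :
    (h.locBasis q).repr (locMk q θ a b) 0 = a ∧ (h.locBasis q).repr (locMk q θ a b) 1 = b := by
  rw [h.locMk_eq]
  simp

theorem IsQuadGen.locMk_inj (h : IsQuadGen c θ t n) {a b a' b' : ℚ_[q]}
    (heq : locMk q θ a b = locMk q θ a' b') : a = a' ∧ b = b' := by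
  have h1 := h.repr_locMk a b
  rw [heq] at h1
  exact ⟨h1.1.symm.trans (h.repr_locMk a' b').1, h1.2.symm.trans (h.repr_locMk a' b').2⟩

theorem IsQuadGen.algebraMap_inj (h : IsQuadGen c θ t n) {a b : ℚ_[q]}
    (hab : algebraMap ℚ_[q] (LocalAlg q L) a = algebraMap ℚ_[q] (LocalAlg q L) b) : a = b :=
  (h.locMk_inj (a := a) (b := 0) (a' := b) (b' := 0) (by simp [locMk, hab])).1

theorem IsQuadGen.tmul_sq (h : IsQuadGen c θ t n) :
    ((1 : ℚ_[q]) ⊗ₜ[ℚ] (θ : L)) ^ 2 = (t : LocalAlg q L) * (1 ⊗ₜ[ℚ] (θ : L)) - (n : LocalAlg q L) := by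
  have h1 : (θ : L) ^ 2 = t * θ - n := by
    have := congrArg (algebraMap (𝓞 L) L) h.sq
    simpa using this
  have h2 := congrArg (Algebra.TensorProduct.includeRight : L →ₐ[ℚ] ℚ_[q] ⊗[ℚ] L) h1
  simp only [map_sub, map_mul, map_pow, map_intCast] at h2
  exact h2

theorem IsQuadGen.localConj_tmul (h : IsQuadGen c θ t n) :
    localConj q c ((1 : ℚ_[q]) ⊗ₜ[ℚ] (θ : L)) = (t : LocalAlg q L) - 1 ⊗ₜ[ℚ] (θ : L) := by
  have h2 := congrArg (Algebra.TensorProduct.includeRight : L →ₐ[ℚ] ℚ_[q] ⊗[ℚ] L) h.conj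
  simp only [localConj, Algebra.TensorProduct.congr_apply, Algebra.TensorProduct.map_tmul]
  simp only [map_sub, map_intCast] at h2
  exact h2

theorem IsQuadGen.localConj_locMk (h : IsQuadGen c θ t n) (a b : ℚ_[q]) :
    localConj q c (locMk q θ a b) = locMk q θ (a + t * b) (-b) := by
  simp only [locMk, map_add, map_mul, AlgEquiv.commutes, h.localConj_tmul, map_neg, map_intCast]
  ring

theorem locMk_add (a b a' b' : ℚ_[q]) :
    locMk q θ a b + locMk q θ a' b' = locMk q θ (a + a') (b + b') := by
  simp only [locMk, map_add]
  ring

theorem IsQuadGen.locMk_mul (h : IsQuadGen c θ t n) (a b a' b' : ℚ_[q]) :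
    locMk q θ a b * locMk q θ a' b' =
      locMk q θ (a * a' - n * (b * b')) (a * b' + b * a' + t * (b * b')) := by
  have := h.tmul_sq (q := q)
  simp only [locMk, map_add, map_mul, map_sub, map_intCast]
  linear_combination (algebraMap ℚ_[q] (LocalAlg q L) b * algebraMap ℚ_[q] (LocalAlg q L) b') * this

theorem IsQuadGen.norm_locMk (h : IsQuadGen c θ t n) (a b : ℚ_[q]) :
    Algebra.norm ℚ_[q] (locMk q θ a b) = a ^ 2 + t * a * b + n * b ^ 2 := by
  have e0 : h.locBasis q 0 = locMk q θ 1 0 := by rw [h.locMk_eq]; simp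
  have e1 : h.locBasis q 1 = locMk q θ 0 1 := by rw [h.locMk_eq]; simp
  rw [Algebra.norm_eq_matrix_det (h.locBasis q), Matrix.det_fin_two]
  simp only [Algebra.leftMulMatrix_eq_repr_mul]
  rw [e0, e1, h.locMk_mul, h.locMk_mul, (h.repr_locMk _ _).1, (h.repr_locMk _ _).1,
    (h.repr_locMk _ _).2, (h.repr_locMk _ _).2]
  ring

theorem IsQuadGen.mul_localConj (h : IsQuadGen c θ t n) (x : LocalAlg q L) :
    x * localConj q c x = algebraMap ℚ_[q] _ (Algebra.norm ℚ_[q] x) := by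
  obtain ⟨a, b, rfl⟩ := h.exists_locMk x
  rw [h.localConj_locMk, h.locMk_mul, h.norm_locMk]
  simp only [locMk, map_add, map_mul, map_sub, map_neg, map_pow]
  ring

theorem IsQuadGen.norm_algebraMap (h : IsQuadGen c θ t n) (a : ℚ_[q]) :
    Algebra.norm ℚ_[q] (algebraMap ℚ_[q] (LocalAlg q L) a) = a ^ 2 := by
  have := h.norm_locMk a 0
  simpa [locMk] using this

theorem IsQuadGen.localConj_localConj (h : IsQuadGen c θ t n) (x : LocalAlg q L) :
    localConj q c (localConj q c x) = x := by
  obtain ⟨a, b, rfl⟩ := h.exists_locMk x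
  rw [h.localConj_locMk, h.localConj_locMk]
  congr 1 <;> ring

theorem IsQuadGen.conj_conj (h : IsQuadGen c θ t n) (x : L) : c (c x) = x := by
  have h1 := h.basis.sum_repr x
  rw [Fin.sum_univ_two, h.basis_zero, h.basis_one, Algebra.smul_def, Algebra.smul_def] at h1
  rw [← h1]
  simp only [map_add, map_mul, map_one, AlgEquiv.commutes, h.conj, map_sub, map_intCast]
  ring

theorem IsQuadGen.norm_localConj (h : IsQuadGen c θ t n) (x : LocalAlg q L) :
    Algebra.norm ℚ_[q] (localConj q c x) = Algebra.norm ℚ_[q] x := by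
  apply h.algebraMap_inj
  rw [← h.mul_localConj, ← h.mul_localConj, h.localConj_localConj, mul_comm]

theorem IsQuadGen.isUnit_of_norm_ne_zero (h : IsQuadGen c θ t n) {x : LocalAlg q L}
    (hx : Algebra.norm ℚ_[q] x ≠ 0) : IsUnit x := by
  refine IsUnit.of_mul_eq_one
    (localConj q c x * algebraMap ℚ_[q] _ (Algebra.norm ℚ_[q] x)⁻¹) ?_
  rw [← mul_assoc, h.mul_localConj, ← map_mul, mul_inv_cancel₀ hx, map_one]

theorem norm_ne_zero_of_unit (x : (LocalAlg q L)ˣ) :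
    Algebra.norm ℚ_[q] (x : LocalAlg q L) ≠ 0 :=
  (x.isUnit.map (Algebra.norm ℚ_[q])).ne_zero

theorem IsQuadGen.localConj_eq_self (h : IsQuadGen c θ t n) {x : LocalAlg q L}
    (hx : localConj q c x = x) : ∃ a, x = algebraMap ℚ_[q] _ a := by
  obtain ⟨a, b, rfl⟩ := h.exists_locMk x
  rw [h.localConj_locMk] at hx
  have h1 := (h.locMk_inj hx).2
  have h2 : b = 0 := by linear_combination (-1 / 2 : ℚ_[q]) * h1
  exact ⟨a, by simp [locMk, h2]⟩

/-- The lattice ℤ_q + ℤ_q θ is a ring because θ² = tθ − n with integers t, n, and it contains all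
generators of ℤ_{L,q}. -/
theorem IsQuadGen.locMk_mem (h : IsQuadGen c θ t n) {a b : ℚ_[q]} :
    locMk q θ a b ∈ localIntegers q L ↔ ‖a‖ ≤ 1 ∧ ‖b‖ ≤ 1 := by
  constructor
  · have ht : ‖(t : ℚ_[q])‖ ≤ 1 := Padic.norm_int_le_one t
    have hn : ‖(n : ℚ_[q])‖ ≤ 1 := Padic.norm_int_le_one n
    have key : ∀ x ∈ localIntegers q L, ∃ a b : ℤ_[q], x = locMk q θ a b := by
      intro x hx
      unfold localIntegers at hx
      induction hx using Algebra.adjoin_induction with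
      | mem x hx =>
        obtain ⟨y, rfl⟩ := hx
        obtain ⟨a, b, rfl⟩ := h.span y
        refine ⟨a, b, ?_⟩
        have h0 : ((a + b * θ : 𝓞 L) : L) = a + b * (θ : L) := by simp
        have := congrArg (Algebra.TensorProduct.includeRight : L →ₐ[ℚ] ℚ_[q] ⊗[ℚ] L) h0
        rw [map_add, map_mul, map_intCast, map_intCast] at this
        simp only [locMk, PadicInt.coe_intCast, map_intCast]
        exact this
      | algebraMap r => exact ⟨r, 0, by simp [locMk]⟩
      | add x y _ _ hx hy =>
        obtain ⟨a, b, rfl⟩ := hx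
        obtain ⟨a', b', rfl⟩ := hy
        exact ⟨a + a', b + b', by rw [locMk_add]; simp⟩
      | mul x y _ _ hx hy =>
        obtain ⟨a, b, rfl⟩ := hx
        obtain ⟨a', b', rfl⟩ := hy
        exact ⟨a * a' - n * (b * b'), a * b' + b * a' + t * (b * b'), by
          rw [h.locMk_mul]; push_cast; rfl⟩
    intro hx
    obtain ⟨a', b', h1⟩ := key _ hx
    obtain ⟨rfl, rfl⟩ := h.locMk_inj h1
    exact ⟨a'.2, b'.2⟩
  · rintro ⟨ha, hb⟩
    have h1 : ∀ a : ℚ_[q], ‖a‖ ≤ 1 → algebraMap ℚ_[q] (LocalAlg q L) a ∈ localIntegers q L :=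
      fun a ha => (localIntegers q L).algebraMap_mem ⟨a, ha⟩
    exact add_mem (h1 a ha) (mul_mem (h1 b hb) (Algebra.subset_adjoin ⟨θ, rfl⟩))

theorem IsQuadGen.algebraMap_mem (h : IsQuadGen c θ t n) {a : ℚ_[q]} :
    algebraMap ℚ_[q] _ a ∈ localIntegers q L ↔ ‖a‖ ≤ 1 := by
  have := h.locMk_mem (a := a) (b := 0)
  simpa [locMk] using this

end LocalCoordinates

/-! ### Local units and Hilbert 90 -/

section LocalUnits

variable (q : ℕ) [Fact q.Prime] (L : Type*) [Field L] [NumberField L]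

/-- The units of `ℤ_{L,q}`, as a subgroup of the units of `L_q`. -/
def localUnits : Subgroup (LocalAlg q L)ˣ where
  carrier := {x | (x : LocalAlg q L) ∈ localIntegers q L ∧
    ((x⁻¹ : (LocalAlg q L)ˣ) : LocalAlg q L) ∈ localIntegers q L}
  one_mem' := by simp [one_mem]
  mul_mem' := by
    rintro a b ⟨h1, h2⟩ ⟨h3, h4⟩
    refine ⟨by rw [Units.val_mul]; exact mul_mem h1 h3, ?_⟩
    rw [mul_inv, Units.val_mul]
    exact mul_mem h2 h4
  inv_mem' := by
    rintro a ⟨h1, h2⟩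
    exact ⟨h2, by rwa [inv_inv]⟩

variable {q L} {c : L ≃ₐ[ℚ] L} {θ : 𝓞 L} {t n : ℤ}

theorem IsQuadGen.inv_eq (h : IsQuadGen c θ t n) (x : (LocalAlg q L)ˣ) :
    ((x⁻¹ : (LocalAlg q L)ˣ) : LocalAlg q L) = localConj q c x *
      algebraMap ℚ_[q] _ (Algebra.norm ℚ_[q] (x : LocalAlg q L))⁻¹ := by
  rw [Units.inv_eq_of_mul_eq_one_right]
  rw [← mul_assoc, h.mul_localConj, ← map_mul, mul_inv_cancel₀ (norm_ne_zero_of_unit x), map_one]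

/-- The inverse of x is conj(x)/N(x), so an integral x is a unit exactly when its norm is one. -/
theorem IsQuadGen.mem_localUnits_iff (h : IsQuadGen c θ t n) {x : (LocalAlg q L)ˣ} :
    x ∈ localUnits q L ↔ (x : LocalAlg q L) ∈ localIntegers q L ∧
      ‖Algebra.norm ℚ_[q] (x : LocalAlg q L)‖ = 1 := by
  constructor
  · rintro ⟨h1, h2⟩
    refine ⟨h1, le_antisymm (norm_le_one q h1) ?_⟩
    have h3 := norm_le_one q h2
    have h4 : Algebra.norm ℚ_[q] (x : LocalAlg q L) *
        Algebra.norm ℚ_[q] ((x⁻¹ : (LocalAlg q L)ˣ) : LocalAlg q L) = 1 := by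
      rw [← map_mul, Units.mul_inv, map_one]
    have h5 := congrArg norm h4
    rw [norm_mul, norm_one] at h5
    nlinarith [norm_nonneg (Algebra.norm ℚ_[q] (x : LocalAlg q L))]
  · rintro ⟨h1, h2⟩
    refine ⟨h1, ?_⟩
    rw [h.inv_eq]
    exact mul_mem (localConj_mem q c h1) (h.algebraMap_mem.mpr (by rw [norm_inv, h2, inv_one]))

theorem IsQuadGen.map_mem_localUnits (h : IsQuadGen c θ t n) {x : ℚ_[q]ˣ}
    (hx : ‖(x : ℚ_[q])‖ = 1) :
    Units.map (algebraMap ℚ_[q] (LocalAlg q L)).toMonoidHom x ∈ localUnits q L :=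
  ⟨h.algebraMap_mem.mpr hx.le, (h.algebraMap_mem (a := ((x⁻¹ : ℚ_[q]ˣ) : ℚ_[q]))).mpr
    (by rw [Units.val_inv_eq_inv_val, norm_inv, hx, inv_one])⟩

/-- Hilbert's theorem 90 for `L_q`. -/
theorem IsQuadGen.hilbert90 (h : IsQuadGen c θ t n) {ε : LocalAlg q L}
    (hε : ε * localConj q c ε = 1) : ∃ a : (LocalAlg q L)ˣ, localConj q c a = ε * a := by
  -- For every x, a = x + conj(ε) conj(x) satisfies conj(a) = εa. The point is to make a invertible:
  -- L_q may have zero divisors, so a ≠ 0 is not enough.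
  have key : ∀ x : LocalAlg q L, IsUnit (x + localConj q c ε * localConj q c x) →
      ∃ a : (LocalAlg q L)ˣ, localConj q c a = ε * a := by
    rintro x ⟨a, ha⟩
    refine ⟨a, ?_⟩
    rw [ha, map_add, map_mul, h.localConj_localConj, h.localConj_localConj]
    linear_combination (-localConj q c x) * hε
  have hnorm : ∀ x : LocalAlg q L, x * localConj q c x = 0 → Algebra.norm ℚ_[q] x = 0 := by
    intro x hx
    rw [h.mul_localConj] at hx
    exact h.algebraMap_inj (by rw [hx, map_zero])
  have htr : ∃ r : ℚ_[q], ε + localConj q c ε = algebraMap ℚ_[q] _ r := by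
    refine h.localConj_eq_self ?_
    rw [map_add, h.localConj_localConj, add_comm]
  obtain ⟨r, hr⟩ := htr
  -- Let r be the trace of ε. The choice x = 1 gives a = 1 + conj(ε) of norm 2 + r. If r = −2, the
  -- choice x = δ = θ − conj(θ) gives a = δ(1 − conj(ε)), whose second factor has norm 2 − r = 4.
  by_cases hr2 : r = -2
  · apply key (locMk q θ 0 1 - localConj q c (locMk q θ 0 1))
    apply h.isUnit_of_norm_ne_zero
    set δ := locMk q θ 0 1 - localConj q c (locMk q θ 0 1) with hδ
    have hδc : localConj q c δ = -δ := by
      rw [hδ, map_sub, h.localConj_localConj]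
      ring
    -- The norm of δ is 4n − t²; if it vanished, θ would equal its conjugate.
    have hδ0 : Algebra.norm ℚ_[q] δ ≠ 0 := by
      intro h0
      have h1 := h.mul_localConj δ
      rw [h0, map_zero, hδc] at h1
      have h2 : δ = locMk q θ (-t) 2 := by
        rw [hδ, h.localConj_locMk, sub_eq_iff_eq_add, locMk_add]
        congr 1 <;> ring
      have h3 : localConj q c (locMk q θ 0 1) ≠ locMk q θ 0 1 := by
        intro h4
        rw [h.localConj_locMk] at h4
        have h5 := (h.locMk_inj h4).2
        have : (2 : ℚ_[q]) = 0 := by linear_combination -h5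
        exact two_ne_zero this
      have h6 : (t : ℚ_[q]) ^ 2 - 4 * n = 0 := by
        have h7 := h0
        rw [h2, h.norm_locMk] at h7
        linear_combination -h7
      have h8 : ((t ^ 2 - 4 * n : ℤ) : ℚ_[q]) = 0 := by push_cast; exact h6
      have h9 : (t ^ 2 - 4 * n : ℤ) = 0 := by exact_mod_cast h8
      apply h.ne
      rw [h.conj]
      have h10 : ((t : L) - 2 * (θ : L)) ^ 2 = 0 := by
        have h11 : (θ : L) ^ 2 = t * θ - n := by
          have := congrArg (algebraMap (𝓞 L) L) h.sq
          simpa using this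
        have h12 : (t : L) ^ 2 - 4 * n = 0 := by exact_mod_cast congrArg (Int.cast : ℤ → L) h9
        linear_combination 4 * h11 + h12
      have h13 := pow_eq_zero_iff (two_ne_zero) |>.mp h10
      linear_combination h13
    have e1 : δ + localConj q c ε * localConj q c δ = δ * (1 - localConj q c ε) := by
      rw [hδc]; ring
    rw [e1, map_mul]
    refine mul_ne_zero hδ0 ?_
    intro h0
    have h1 := h.mul_localConj (1 - localConj q c ε)
    rw [h0, map_zero, map_sub, h.localConj_localConj, map_one] at h1
    have h2 : algebraMap ℚ_[q] (LocalAlg q L) (2 - r) = 0 := by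
      rw [map_sub, ← hr, map_ofNat]
      linear_combination h1 - hε
    have h3 := h.algebraMap_inj (h2.trans (map_zero _).symm)
    rw [hr2] at h3
    norm_num at h3
  · apply key 1
    apply h.isUnit_of_norm_ne_zero
    rw [map_one, mul_one]
    intro h0
    have h1 := h.mul_localConj (1 + localConj q c ε)
    rw [h0, map_zero, map_add, h.localConj_localConj, map_one] at h1
    have h2 : algebraMap ℚ_[q] (LocalAlg q L) (2 + r) = 0 := by
      rw [map_add, ← hr, map_ofNat]
      linear_combination h1 - hε
    have h3 := h.algebraMap_inj (h2.trans (map_zero _).symm)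
    exact hr2 (by linear_combination h3)

end LocalUnits

/-! ### The decomposition GU(1,1) = L_q^× GL_2(ℚ_q) -/

section Similitudes

variable {q : ℕ} [Fact q.Prime] {L : Type*} [Field L] [NumberField L]
variable {c : L ≃ₐ[ℚ] L} {θ : 𝓞 L} {t n : ℤ}

theorem isSimilitude_formJOne_iff {g : Matrix (Fin 2) (Fin 2) (LocalAlg q L)} {v : ℚ_[q]ˣ} :
    IsSimilitude q c (formJOne q L) g v ↔
      (localConj q c (g 0 0) * g 1 0 - localConj q c (g 1 0) * g 0 0 = 0 ∧
       localConj q c (g 0 0) * g 1 1 - localConj q c (g 1 0) * g 0 1 = algebraMap ℚ_[q] _ v ∧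
       localConj q c (g 0 1) * g 1 0 - localConj q c (g 1 1) * g 0 0 = -algebraMap ℚ_[q] _ v ∧
       localConj q c (g 0 1) * g 1 1 - localConj q c (g 1 1) * g 0 1 = 0) := by
  unfold IsSimilitude
  rw [← Matrix.ext_iff]
  simp only [Fin.forall_fin_two, Matrix.mul_apply, Fin.sum_univ_two, conjT, formJOne,
    Matrix.transpose_apply, Matrix.map_apply, Matrix.smul_apply, Algebra.smul_def]
  simp [sub_eq_add_neg, add_comm, and_assoc]

theorem isSimilitude_smul_map (h : IsQuadGen c θ t n) (a : LocalAlg q L)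
    (y : Matrix (Fin 2) (Fin 2) ℚ_[q]) (v : ℚ_[q]ˣ)
    (hv : Algebra.norm ℚ_[q] a * y.det = v) :
    IsSimilitude q c (formJOne q L) (a • y.map (algebraMap ℚ_[q] (LocalAlg q L))) v := by
  rw [isSimilitude_formJOne_iff]
  simp only [Matrix.smul_apply, Matrix.map_apply, smul_eq_mul, map_mul, AlgEquiv.commutes]
  have h1 := h.mul_localConj a
  have h2 : algebraMap ℚ_[q] (LocalAlg q L) (v : ℚ_[q]) = algebraMap ℚ_[q] _
      (Algebra.norm ℚ_[q] a) * (algebraMap ℚ_[q] _ (y 0 0) * algebraMap ℚ_[q] _ (y 1 1) -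
        algebraMap ℚ_[q] _ (y 0 1) * algebraMap ℚ_[q] _ (y 1 0)) := by
    rw [← hv, Matrix.det_fin_two, map_mul, map_sub, map_mul, map_mul]
  rw [h2, ← h1]
  refine ⟨by ring, by ring, by ring, by ring⟩

/-- The similitude relation says that conj(g) = εg entrywise with ε = v / det g, and ε has norm one.
Hilbert 90 gives a with conj(a) = εa, and then a⁻¹g is fixed by conjugation, hence rational. -/
theorem IsQuadGen.exists_smul_map (h : IsQuadGen c θ t n) {g : GL (Fin 2) (LocalAlg q L)}
    {v : ℚ_[q]ˣ} (hg : IsSimilitude q c (formJOne q L) g.1 v) :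
    ∃ (a : (LocalAlg q L)ˣ) (y : GL (Fin 2) ℚ_[q]),
      g.1 = (a : LocalAlg q L) • y.1.map (algebraMap ℚ_[q] (LocalAlg q L)) ∧
      Algebra.norm ℚ_[q] (a : LocalAlg q L) * y.1.det = v := by
  rw [isSimilitude_formJOne_iff] at hg
  obtain ⟨h00, h01, h10, h11⟩ := hg
  set D := Matrix.GeneralLinearGroup.det g with hD
  have hDv : (D : LocalAlg q L) = g.1 0 0 * g.1 1 1 - g.1 0 1 * g.1 1 0 := Matrix.det_fin_two g.1
  set V := algebraMap ℚ_[q] (LocalAlg q L) (v : ℚ_[q]) with hV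
  have hVc : localConj q c V = V := AlgEquiv.commutes _ _
  -- Multiplying the relation by the adjugate of g gives det(g) · conj(g) = v g.
  have e : ∀ i j, (D : LocalAlg q L) * localConj q c (g.1 i j) = V * g.1 i j := by
    rw [Fin.forall_fin_two, Fin.forall_fin_two, Fin.forall_fin_two, hDv]
    refine ⟨⟨?_, ?_⟩, ?_, ?_⟩
    · linear_combination g.1 0 0 * h01 - g.1 0 1 * h00
    · linear_combination g.1 0 0 * h11 - g.1 0 1 * h10
    · linear_combination g.1 1 0 * h01 - g.1 1 1 * h00
    · linear_combination g.1 1 0 * h11 - g.1 1 1 * h10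
  have hDinv : (D : LocalAlg q L) * ((D⁻¹ : (LocalAlg q L)ˣ) : LocalAlg q L) = 1 := D.mul_inv
  set Di := ((D⁻¹ : (LocalAlg q L)ˣ) : LocalAlg q L)
  have hDc : (D : LocalAlg q L) * localConj q c D = V ^ 2 := by
    have h1 : (D : LocalAlg q L) ^ 2 * localConj q c D = V ^ 2 * D := by
      have h2 : localConj q c (D : LocalAlg q L) = localConj q c (g.1 0 0) * localConj q c (g.1 1 1)
          - localConj q c (g.1 0 1) * localConj q c (g.1 1 0) := by
        rw [hDv, map_sub, map_mul, map_mul]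
      rw [h2]
      have := e 0 0
      have := e 1 1
      have := e 0 1
      have := e 1 0
      calc _ = (D * localConj q c (g.1 0 0)) * (D * localConj q c (g.1 1 1)) -
            (D * localConj q c (g.1 0 1)) * (D * localConj q c (g.1 1 0)) := by ring
        _ = _ := by rw [e, e, e, e, hDv]; ring
    linear_combination Di * h1 - (D * localConj q c D - V ^ 2) * hDinv
  have hε : (V * Di) * localConj q c (V * Di) = 1 := by
    have h1 : localConj q c (D : LocalAlg q L) * localConj q c Di = 1 := by
      rw [← map_mul, hDinv, map_one]
    rw [map_mul, hVc]
    calc _ = V ^ 2 * Di * localConj q c Di := by ring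
      _ = (D * Di) * (localConj q c D * localConj q c Di) := by rw [← hDc]; ring
      _ = 1 := by rw [h1, hDinv, one_mul]
  obtain ⟨a, ha⟩ := h.hilbert90 hε
  set ai := ((a⁻¹ : (LocalAlg q L)ˣ) : LocalAlg q L)
  have haai : (a : LocalAlg q L) * ai = 1 := a.mul_inv
  have hfix : ∀ i j, localConj q c (ai * g.1 i j) = ai * g.1 i j := by
    intro i j
    have hu : IsUnit (localConj q c (a : LocalAlg q L)) := a.isUnit.map _
    apply hu.mul_left_cancel
    rw [← map_mul, ← mul_assoc, haai, one_mul, ha]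
    have := e i j
    linear_combination Di * this - V * Di * g.1 i j * haai - localConj q c (g.1 i j) * hDinv
  choose y hy using fun i j => h.localConj_eq_self (hfix i j)
  have hgy : g.1 = (a : LocalAlg q L) • (Matrix.of y).map (algebraMap ℚ_[q] (LocalAlg q L)) := by
    ext i j
    rw [Matrix.smul_apply, Matrix.map_apply, Matrix.of_apply, ← hy, smul_eq_mul, ← mul_assoc, haai,
      one_mul]
  have hdet : (D : LocalAlg q L) = a ^ 2 * algebraMap ℚ_[q] _ (Matrix.of y).det := by
    rw [hDv, hgy, Matrix.det_fin_two]
    simp only [Matrix.smul_apply, Matrix.map_apply, smul_eq_mul, map_sub, map_mul]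
    ring
  have hy0 : (Matrix.of y).det ≠ 0 := by
    intro h0
    rw [h0, map_zero, mul_zero] at hdet
    have h1 := norm_ne_zero_of_unit D
    rw [hdet] at h1
    apply h1
    simp
  refine ⟨a, Matrix.GeneralLinearGroup.mkOfDetNeZero _ hy0, hgy, ?_⟩
  apply h.algebraMap_inj
  change algebraMap ℚ_[q] (LocalAlg q L) (_ * (Matrix.of y).det) = V
  rw [map_mul, ← h.mul_localConj, ha]
  linear_combination V * hDinv - V * Di * hdet

end Similitudes

/-! ### Openness of the maximal compact subgroup -/

section Topology

variable (q : ℕ) [Fact q.Prime] (L : Type*) [Field L] [NumberField L]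

instance isTopologicalRing_localAlg : IsTopologicalRing (LocalAlg q L) :=
  IsModuleTopology.isTopologicalRing ℚ_[q] (LocalAlg q L)

variable {q L} {c : L ≃ₐ[ℚ] L} {θ : 𝓞 L} {t n : ℤ}

theorem IsQuadGen.isOpen_localIntegers (h : IsQuadGen c θ t n) :
    IsOpen (localIntegers q L : Set (LocalAlg q L)) := by
  have h1 : (localIntegers q L : Set (LocalAlg q L)) =
      ((h.locBasis q).coord 0 ⁻¹' Metric.closedBall 0 1) ∩
        ((h.locBasis q).coord 1 ⁻¹' Metric.closedBall 0 1) := by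
    ext x
    obtain ⟨a, b, rfl⟩ := h.exists_locMk x
    simp only [SetLike.mem_coe, Set.mem_inter_iff, Set.mem_preimage, Module.Basis.coord_apply,
      (h.repr_locMk a b).1, (h.repr_locMk a b).2, mem_closedBall_zero_iff, h.locMk_mem]
  rw [h1]
  have hc : ∀ i, Continuous ((h.locBasis q).coord i) := fun i =>
    IsModuleTopology.continuous_of_linearMap _
  exact ((IsUltrametricDist.isOpen_closedBall _ one_ne_zero).preimage (hc 0)).inter
    ((IsUltrametricDist.isOpen_closedBall _ one_ne_zero).preimage (hc 1))

theorem mem_integralGL_iff {ι : Type*} [Fintype ι] [DecidableEq ι] {k : GL ι (LocalAlg q L)} :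
    k ∈ integralGL q L ι ↔ (∀ i j, k.1 i j ∈ localIntegers q L) ∧
      ∀ i j, (k⁻¹).1 i j ∈ localIntegers q L := by
  constructor
  · intro hk
    exact ⟨integralGL_apply_mem hk, integralGL_apply_mem (inv_mem hk)⟩
  · rintro ⟨h1, h2⟩
    have inj : Function.Injective (algebraMap (localIntegers q L) (LocalAlg q L)) :=
      Subtype.val_injective
    have e1 : ∀ A B : Matrix ι ι (localIntegers q L),
        A.map (algebraMap (localIntegers q L) (LocalAlg q L)) =
          B.map (algebraMap (localIntegers q L) (LocalAlg q L)) → A = B :=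
      fun A B hAB => Matrix.map_injective inj hAB
    let A : Matrix ι ι (localIntegers q L) := Matrix.of fun i j => ⟨k.1 i j, h1 i j⟩
    let B : Matrix ι ι (localIntegers q L) := Matrix.of fun i j => ⟨(k⁻¹).1 i j, h2 i j⟩
    have hA : A.map (algebraMap (localIntegers q L) (LocalAlg q L)) = k.1 := rfl
    have hB : B.map (algebraMap (localIntegers q L) (LocalAlg q L)) = (k⁻¹).1 := rfl
    refine ⟨⟨A, B, e1 _ _ ?_, e1 _ _ ?_⟩, Units.ext hA⟩
    · rw [Matrix.map_mul, hA, hB, ← Units.val_mul, mul_inv_cancel]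
      exact (Matrix.map_one _ (map_zero _) (map_one _)).symm
    · rw [Matrix.map_mul, hA, hB, ← Units.val_mul, inv_mul_cancel]
      exact (Matrix.map_one _ (map_zero _) (map_one _)).symm

theorem IsQuadGen.isOpen_compactUOne (h : IsQuadGen c θ t n) :
    IsOpen (compactUOne q c : Set (UOne q c)) := by
  have h1 : (compactUOne q c : Set (UOne q c)) =
      ⋂ i, ⋂ j, ({x : UOne q c | x.1.1.1 i j ∈ localIntegers q L} ∩
        {x : UOne q c | (x.1.1⁻¹).1 i j ∈ localIntegers q L}) := by
    ext x
    have : x ∈ compactUOne q c ↔ x.1.1 ∈ integralGL q L (Fin 2) := Iff.rfl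
    rw [SetLike.mem_coe, this, mem_integralGL_iff]
    simp only [Set.mem_iInter, Set.mem_inter_iff, Set.mem_ofPred_eq]
    constructor
    · rintro ⟨h1, h2⟩ i j
      exact ⟨h1 i j, h2 i j⟩
    · intro h1
      exact ⟨fun i j => (h1 i j).1, fun i j => (h1 i j).2⟩
  rw [h1]
  have hval : Continuous fun x : UOne q c => x.1.1 :=
    continuous_subtype_val.comp continuous_subtype_val
  refine isOpen_iInter_of_finite fun i => isOpen_iInter_of_finite fun j => IsOpen.inter ?_ ?_
  · exact h.isOpen_localIntegers.preimage
      ((Units.continuous_val.comp hval).matrix_elem i j)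
  · exact h.isOpen_localIntegers.preimage
      ((Units.continuous_val.comp (continuous_inv.comp hval)).matrix_elem i j)

end Topology

/-! ### Iwasawa decomposition and Hecke cosets for GL_2(ℚ_q) -/

section PadicGL

variable {q : ℕ} [Fact q.Prime]

theorem upperTri_val (a d : ℚ_[q]ˣ) (b : ℚ_[q]) :
    (upperTri a d b).1 = !![(a : ℚ_[q]), b; 0, (d : ℚ_[q])] := rfl

theorem upperTri_mul (a d a' d' : ℚ_[q]ˣ) (b b' : ℚ_[q]) :
    upperTri a d b * upperTri a' d' b' = upperTri (a * a') (d * d') (a * b' + b * d') := by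
  apply Units.ext
  rw [Units.val_mul, upperTri_val, upperTri_val, upperTri_val]
  ext i j
  fin_cases i <;> fin_cases j <;> simp [Matrix.mul_apply, Fin.sum_univ_two]

theorem upperTri_one : upperTri (1 : ℚ_[q]ˣ) 1 0 = 1 := by
  apply Units.ext
  rw [upperTri_val]
  ext i j
  fin_cases i <;> fin_cases j <;> simp

theorem norm_det_le_of_entries {x : Matrix (Fin 2) (Fin 2) ℚ_[q]} (hx : ∀ i j, ‖x i j‖ ≤ 1) :
    ‖x.det‖ ≤ 1 := by
  rw [Matrix.det_fin_two, sub_eq_add_neg]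
  refine (IsUltrametricDist.norm_add_le_max _ _).trans (max_le ?_ ?_) <;>
    simp only [norm_neg, norm_mul] <;> exact mul_le_one₀ (hx _ _) (norm_nonneg _) (hx _ _)

theorem mem_maxCompact_iff {k : GL (Fin 2) ℚ_[q]} :
    k ∈ maxCompact q ↔ (∀ i j, ‖k.1 i j‖ ≤ 1) ∧ ‖k.1.det‖ = 1 := by
  constructor
  · have key : ∀ k ∈ maxCompact q, ∀ i j, ‖k.1 i j‖ ≤ 1 := by
      rintro _ ⟨k₀, rfl⟩ i j
      exact (k₀.1 i j).2
    intro hk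
    have h1 := norm_det_le_of_entries (key k hk)
    have h2 := norm_det_le_of_entries (key _ (inv_mem hk))
    refine ⟨key k hk, le_antisymm h1 ?_⟩
    have h3 : k.1.det * (k⁻¹).1.det = 1 := by
      rw [← Matrix.det_mul, ← Units.val_mul, mul_inv_cancel, Units.val_one, Matrix.det_one]
    have h4 := congrArg norm h3
    rw [norm_mul, norm_one] at h4
    nlinarith [norm_nonneg k.1.det]
  · rintro ⟨h1, h2⟩
    let A : Matrix (Fin 2) (Fin 2) ℤ_[q] := Matrix.of fun i j => ⟨k.1 i j, h1 i j⟩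
    have hA : A.map (algebraMap ℤ_[q] ℚ_[q]) = k.1 := rfl
    have hdet : IsUnit A.det := by
      rw [PadicInt.isUnit_iff, ← h2, ← hA, ← RingHom.mapMatrix_apply, ← RingHom.map_det]
      rfl
    exact ⟨Matrix.GeneralLinearGroup.mk'' A hdet, Units.ext hA⟩

theorem upperTri_mem_maxCompact {a d : ℚ_[q]ˣ} {b : ℚ_[q]} (ha : ‖(a : ℚ_[q])‖ = 1)
    (hd : ‖(d : ℚ_[q])‖ = 1) (hb : ‖b‖ ≤ 1) : upperTri a d b ∈ maxCompact q := by
  rw [mem_maxCompact_iff, upperTri_val]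
  simp [Fin.forall_fin_two, Matrix.det_fin_two, ha, hd, hb]

/-- A column operation over ℤ_q clears the lower left entry: divide by the larger of the two entries
of the bottom row. -/
theorem exists_iwasawa (x : GL (Fin 2) ℚ_[q]) :
    ∃ (a d : ℚ_[q]ˣ) (b : ℚ_[q]), ∃ k ∈ maxCompact q, x = upperTri a d b * k := by
  have key : ∃ k ∈ maxCompact q, (x * k).1 1 0 = 0 := by
    have hdet : x.1.det ≠ 0 := (Matrix.GeneralLinearGroup.det x).ne_zero
    by_cases hcd : ‖x.1 1 0‖ ≤ ‖x.1 1 1‖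
    · have hd : x.1 1 1 ≠ 0 := by
        intro hd
        rw [hd, norm_zero] at hcd
        apply hdet
        rw [Matrix.det_fin_two, hd, norm_le_zero_iff.mp hcd]
        simp
      refine ⟨Matrix.GeneralLinearGroup.mkOfDetNeZero !![1, 0; -(x.1 1 0 / x.1 1 1), 1]
        (by simp [Matrix.det_fin_two]), ?_, ?_⟩
      · rw [mem_maxCompact_iff]
        simp only [Matrix.GeneralLinearGroup.mkOfDetNeZero]
        change (∀ i j, ‖(!![1, 0; -(x.1 1 0 / x.1 1 1), 1] : Matrix _ _ ℚ_[q]) i j‖ ≤ 1) ∧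
          ‖(!![1, 0; -(x.1 1 0 / x.1 1 1), 1] : Matrix _ _ ℚ_[q]).det‖ = 1
        have : ‖x.1 1 0‖ / ‖x.1 1 1‖ ≤ 1 := div_le_one_of_le₀ hcd (norm_nonneg _)
        simp [Fin.forall_fin_two, Matrix.det_fin_two, this]
      · change (x.1 * !![1, 0; -(x.1 1 0 / x.1 1 1), 1]) 1 0 = 0
        simp [Matrix.mul_apply, Fin.sum_univ_two]
        field_simp
        simp
    · push Not at hcd
      have hc : x.1 1 0 ≠ 0 := by
        intro hc
        rw [hc, norm_zero] at hcd
        exact absurd hcd (not_lt.mpr (norm_nonneg _))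
      refine ⟨Matrix.GeneralLinearGroup.mkOfDetNeZero !![-(x.1 1 1 / x.1 1 0), 1; 1, 0]
        (by simp [Matrix.det_fin_two]), ?_, ?_⟩
      · rw [mem_maxCompact_iff]
        change (∀ i j, ‖(!![-(x.1 1 1 / x.1 1 0), 1; 1, 0] : Matrix _ _ ℚ_[q]) i j‖ ≤ 1) ∧
          ‖(!![-(x.1 1 1 / x.1 1 0), 1; 1, 0] : Matrix _ _ ℚ_[q]).det‖ = 1
        have : ‖x.1 1 1‖ / ‖x.1 1 0‖ ≤ 1 := div_le_one_of_le₀ hcd.le (norm_nonneg _)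
        simp [Fin.forall_fin_two, Matrix.det_fin_two, this]
      · change (x.1 * !![-(x.1 1 1 / x.1 1 0), 1; 1, 0]) 1 0 = 0
        simp [Matrix.mul_apply, Fin.sum_univ_two]
        field_simp
        simp
  obtain ⟨k, hk, h0⟩ := key
  have hdet : (x * k).1.det ≠ 0 := (Matrix.GeneralLinearGroup.det (x * k)).ne_zero
  rw [Matrix.det_fin_two, h0, mul_zero, sub_zero] at hdet
  refine ⟨Units.mk0 _ (left_ne_zero_of_mul hdet), Units.mk0 _ (right_ne_zero_of_mul hdet),
    (x * k).1 0 1, k⁻¹, inv_mem hk, ?_⟩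
  rw [eq_mul_inv_iff_mul_eq]
  apply Units.ext
  rw [upperTri_val]
  ext i j
  fin_cases i <;> fin_cases j <;> simp [-Units.val_mul, h0]

theorem norm_primeUnit : ‖(primeUnit q : ℚ_[q])‖ = (q : ℝ)⁻¹ := by
  simp [primeUnit]

theorem norm_primeUnit_zpow (m : ℤ) : ‖((primeUnit q ^ m : ℚ_[q]ˣ) : ℚ_[q])‖ = (q : ℝ) ^ (-m) := by
  rw [Units.val_zpow_eq_zpow_val, norm_zpow, norm_primeUnit, inv_zpow, zpow_neg]

theorem norm_primeUnit_pow (m : ℕ) :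
    ‖((primeUnit q ^ m : ℚ_[q]ˣ) : ℚ_[q])‖ = (q : ℝ) ^ (-(m : ℤ)) := by
  rw [← norm_primeUnit_zpow, zpow_natCast]

theorem one_lt_q : (1 : ℝ) < q := by exact_mod_cast (Fact.out : q.Prime).one_lt

theorem q_zpow_inj {m n : ℤ} (h : (q : ℝ) ^ m = (q : ℝ) ^ n) : m = n :=
  zpow_right_injective₀ (by linarith [one_lt_q (q := q)]) (ne_of_gt one_lt_q) h

theorem exists_norm_eq_zpow (a : ℚ_[q]ˣ) : ∃ m : ℤ, ‖(a : ℚ_[q])‖ = (q : ℝ) ^ (-m) :=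
  (Padic.padicNormE.image a.ne_zero).imp fun m hm => by rw [hm]; norm_num

theorem exists_eq_primeUnit_zpow (a : ℚ_[q]ˣ) :
    ∃ (m : ℤ) (u : ℚ_[q]ˣ), ‖(u : ℚ_[q])‖ = 1 ∧ a = primeUnit q ^ m * u := by
  obtain ⟨m, hm⟩ := exists_norm_eq_zpow a
  refine ⟨m, (primeUnit q ^ m)⁻¹ * a, ?_, by simp⟩
  rw [Units.val_mul, norm_mul, ← zpow_neg, norm_primeUnit_zpow, hm, ← zpow_add₀]
  · simp
  · linarith [one_lt_q (q := q)]

variable (q) in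
/-- The indices `(i, b)`, `i ≤ d`, `b < q ^ i`, of the representatives `heckeRep` of the cosets
of `GL_2(ℤ_q)` in the set of integral matrices with determinant of absolute value `q ^ (-d)`. -/
def heckeIndex (d : ℕ) : Finset (Σ _ : ℕ, ℕ) :=
  (Finset.range (d + 1)).sigma fun i => Finset.range (q ^ i)

theorem mem_heckeIndex {d : ℕ} {p : Σ _ : ℕ, ℕ} :
    p ∈ heckeIndex q d ↔ p.1 ≤ d ∧ p.2 < q ^ p.1 := by
  simp [heckeIndex]

/-- The matrix `(q ^ i, b; 0, q ^ (d - i))`. -/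
noncomputable def heckeRep (d : ℕ) (p : Σ _ : ℕ, ℕ) : GL (Fin 2) ℚ_[q] :=
  upperTri (primeUnit q ^ p.1) (primeUnit q ^ (d - p.1)) (p.2 : ℚ_[q])

/-- In an Iwasawa decomposition of x the triangular factor is again integral. Its diagonal is
normalized to powers of q by units, and its upper right entry is reduced by an integral unipotent
matrix. -/
theorem exists_eq_heckeRep_mul {x : GL (Fin 2) ℚ_[q]} {d : ℕ} (hx : ∀ i j, ‖x.1 i j‖ ≤ 1)
    (hd : ‖x.1.det‖ = (q : ℝ) ^ (-(d : ℤ))) :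
    ∃ p ∈ heckeIndex q d, ∃ k ∈ maxCompact q, x = heckeRep d p * k := by
  obtain ⟨a, e, b, k, hk, rfl⟩ := exists_iwasawa x
  have hint : ∀ i j, ‖(upperTri a e b).1 i j‖ ≤ 1 := by
    have h1 : upperTri a e b = (upperTri a e b * k) * k⁻¹ := by group
    have hk' := (mem_maxCompact_iff.mp (inv_mem hk)).1
    intro i j
    rw [h1, Units.val_mul, Matrix.mul_apply]
    refine IsUltrametricDist.norm_sum_le_of_forall_le_of_nonneg zero_le_one fun l _ => ?_
    rw [norm_mul]
    exact mul_le_one₀ (hx i l) (norm_nonneg _) (hk' l j)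
  have ha : ‖(a : ℚ_[q])‖ ≤ 1 := hint 0 0
  have hb : ‖b‖ ≤ 1 := hint 0 1
  have he : ‖(e : ℚ_[q])‖ ≤ 1 := hint 1 1
  have hdet : ‖(a : ℚ_[q])‖ * ‖(e : ℚ_[q])‖ = (q : ℝ) ^ (-(d : ℤ)) := by
    rw [← hd, Units.val_mul, Matrix.det_mul, norm_mul, (mem_maxCompact_iff.mp hk).2, mul_one,
      upperTri_val, Matrix.det_fin_two]
    simp
  obtain ⟨m, u, hu, rfl⟩ := exists_eq_primeUnit_zpow a
  obtain ⟨l, v, hv, rfl⟩ := exists_eq_primeUnit_zpow e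
  simp only [Units.val_mul, norm_mul, hu, hv, mul_one, norm_primeUnit_zpow] at ha he hdet
  rw [← zpow_add₀ (by linarith [one_lt_q (q := q)])] at hdet
  have hml := q_zpow_inj hdet
  have hm : 0 ≤ m := by
    rw [zpow_le_one_iff_right₀ one_lt_q] at ha
    omega
  have hl : 0 ≤ l := by
    rw [zpow_le_one_iff_right₀ one_lt_q] at he
    omega
  lift m to ℕ using hm
  lift l to ℕ using hl
  have hlm : d - m = l := by omega
  -- The unit v of the lower right entry goes into the compact factor, so the residue modulo q^m is
  -- that of b/v.
  let β : ℤ_[q] := ⟨b * (v⁻¹ : ℚ_[q]ˣ), by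
    rw [norm_mul, Units.val_inv_eq_inv_val, norm_inv, hv, inv_one, mul_one]; exact hb⟩
  obtain ⟨r, hr⟩ := Ideal.mem_span_singleton.mp (PadicInt.appr_spec m β)
  have hr' : b * (v⁻¹ : ℚ_[q]ˣ) - (β.appr m : ℕ) = (q : ℚ_[q]) ^ m * r := by
    have := congrArg (fun z : ℤ_[q] => (z : ℚ_[q])) hr
    simp only [PadicInt.coe_sub, PadicInt.coe_mul, PadicInt.coe_pow, PadicInt.coe_natCast] at this
    exact this
  refine ⟨⟨m, β.appr m⟩, mem_heckeIndex.mpr ⟨by simp only; omega, PadicInt.appr_lt β m⟩,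
    upperTri u v (r * v) * k, mul_mem (upperTri_mem_maxCompact hu hv ?_) hk, ?_⟩
  · rw [norm_mul, hv, mul_one]
    exact r.2
  · rw [← mul_assoc, heckeRep, upperTri_mul]
    simp only [hlm, zpow_natCast]
    congr 2
    have hvv : (v : ℚ_[q]) * (v⁻¹ : ℚ_[q]ˣ) = 1 := v.mul_inv
    have hp : ((primeUnit q ^ m : ℚ_[q]ˣ) : ℚ_[q]) = (q : ℚ_[q]) ^ m := by simp [primeUnit]
    rw [hp]
    linear_combination (v : ℚ_[q]) * hr' - b * hvv

/-- The quotient k of two representatives is upper triangular with unit diagonal. As the diagonals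
of the representatives are powers of q, they agree, and k has lower right entry 1; the entries b, b'
are then congruent modulo q^i. -/
theorem heckeRep_inj {d d' : ℕ} {p p' : Σ _ : ℕ, ℕ} (hp : p ∈ heckeIndex q d)
    (hp' : p' ∈ heckeIndex q d') {k : GL (Fin 2) ℚ_[q]} (hk : k ∈ maxCompact q)
    (h : heckeRep d p * k = heckeRep d' p') : d = d' ∧ p = p' := by
  obtain ⟨hk1, hk2⟩ := mem_maxCompact_iff.mp hk
  obtain ⟨i, b⟩ := p
  obtain ⟨i', b'⟩ := p'
  rw [mem_heckeIndex] at hp hp'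
  simp only at hp hp'
  have hq0 : (q : ℚ_[q]) ≠ 0 := (primeUnit q).ne_zero
  have hval : ∀ m : ℕ, ((primeUnit q ^ m : ℚ_[q]ˣ) : ℚ_[q]) = (q : ℚ_[q]) ^ m := by
    intro m; simp [primeUnit]
  have hM := congrArg Units.val h
  simp only [heckeRep, Units.val_mul, upperTri_val, hval] at hM
  have h10 := congrFun (congrFun hM 1) 0
  have h00 := congrFun (congrFun hM 0) 0
  have h11 := congrFun (congrFun hM 1) 1
  have h01 := congrFun (congrFun hM 0) 1
  simp only [Matrix.mul_apply, Fin.sum_univ_two, Matrix.of_apply, Matrix.cons_val', Matrix.cons_val_zero,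
    Matrix.cons_val_one, Matrix.cons_val_fin_one, zero_mul, zero_add] at h10 h00 h11 h01
  have e10 : k.1 1 0 = 0 := by
    rcases mul_eq_zero.mp h10 with h | h
    · exact absurd h (pow_ne_zero _ hq0)
    · exact h
  rw [Matrix.det_fin_two, e10, mul_zero, sub_zero, norm_mul] at hk2
  have n00 : ‖k.1 0 0‖ = 1 := by nlinarith [hk1 0 0, hk1 1 1, norm_nonneg (k.1 0 0)]
  have n11 : ‖k.1 1 1‖ = 1 := by nlinarith [hk1 0 0, hk1 1 1, norm_nonneg (k.1 1 1)]
  rw [e10, mul_zero, add_zero] at h00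
  have f00 := congrArg norm h00
  have f11 := congrArg norm h11
  rw [norm_mul, n00, mul_one, ← hval, ← hval, norm_primeUnit_pow, norm_primeUnit_pow] at f00
  rw [norm_mul, n11, mul_one, ← hval, ← hval, norm_primeUnit_pow, norm_primeUnit_pow] at f11
  have hii : i = i' := by have := q_zpow_inj f00; omega
  subst hii
  have hdd : d = d' := by have := q_zpow_inj f11; omega
  subst hdd
  have hk11 : k.1 1 1 = 1 := by
    apply mul_left_cancel₀ (pow_ne_zero (d - i) hq0)
    rw [h11, mul_one]
  rw [hk11, mul_one] at h01
  refine ⟨rfl, ?_⟩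
  have h2 : (((b' : ℤ) - b : ℤ) : ℚ_[q]) = (q : ℚ_[q]) ^ i * k.1 0 1 := by
    push_cast
    linear_combination -h01
  have h3 : ‖(((b' : ℤ) - b : ℤ) : ℚ_[q])‖ ≤ (q : ℝ) ^ (-(i : ℤ)) := by
    rw [h2, norm_mul, ← hval, norm_primeUnit_pow]
    exact mul_le_of_le_one_right (by positivity) (hk1 0 1)
  rw [Padic.norm_int_le_pow_iff_dvd] at h3
  have h4 : (b : ℤ) ≡ b' [ZMOD (q ^ i : ℕ)] := by
    rw [Int.modEq_iff_dvd]; exact_mod_cast h3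
  have h5 : b ≡ b' [MOD q ^ i] := (Int.natCast_modEq_iff).mp h4
  rw [Nat.ModEq, Nat.mod_eq_of_lt hp.2, Nat.mod_eq_of_lt hp'.2] at h5
  rw [h5]

theorem heckeRep_integral {d : ℕ} {p : Σ _ : ℕ, ℕ} (i j : Fin 2) :
    ‖(heckeRep (q := q) d p).1 i j‖ ≤ 1 := by
  have hval : ∀ m : ℕ, ‖((primeUnit q ^ m : ℚ_[q]ˣ) : ℚ_[q])‖ ≤ 1 := by
    intro m
    rw [norm_primeUnit_pow, zpow_le_one_iff_right₀ one_lt_q]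
    omega
  have hb : ‖(p.2 : ℚ_[q])‖ ≤ 1 := by exact_mod_cast Padic.norm_int_le_one (p := q) p.2
  rw [heckeRep, upperTri_val]
  revert i j
  rw [Fin.forall_fin_two, Fin.forall_fin_two, Fin.forall_fin_two]
  exact ⟨⟨hval _, hb⟩, by simp, hval _⟩

theorem norm_det_heckeRep {d : ℕ} {p : Σ _ : ℕ, ℕ} (hp : p ∈ heckeIndex q d) :
    ‖(heckeRep (q := q) d p).1.det‖ = (q : ℝ) ^ (-(d : ℤ)) := by
  have h1 := (mem_heckeIndex.mp hp).1
  rw [heckeRep, upperTri_val, Matrix.det_fin_two_of, mul_zero, sub_zero, norm_mul,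
    norm_primeUnit_pow, norm_primeUnit_pow, ← zpow_add₀ (by linarith [one_lt_q (q := q)])]
  congr 1
  omega

/-- Left multiplication by k preserves the integral matrices with |det| = q^(-d), hence permutes
their cosets by GL_2(ℤ_q). -/
theorem sum_heckeRep_mul {M : Type*} [AddCommMonoid M] {Ψ : GL (Fin 2) ℚ_[q] → M}
    (hΨ : ∀ g, ∀ k ∈ maxCompact q, Ψ (g * k) = Ψ g) (d : ℕ) (x : GL (Fin 2) ℚ_[q])
    {k : GL (Fin 2) ℚ_[q]} (hk : k ∈ maxCompact q) :
    ∑ p ∈ heckeIndex q d, Ψ (x * k * heckeRep d p) =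
      ∑ p ∈ heckeIndex q d, Ψ (x * heckeRep d p) := by
  have hex : ∀ p ∈ heckeIndex q d, ∃ p' ∈ heckeIndex q d, ∃ k' ∈ maxCompact q,
      k * heckeRep d p = heckeRep d p' * k' := by
    intro p hp
    obtain ⟨hk1, hk2⟩ := mem_maxCompact_iff.mp hk
    refine exists_eq_heckeRep_mul (fun i j => ?_) ?_
    · rw [Units.val_mul, Matrix.mul_apply]
      refine IsUltrametricDist.norm_sum_le_of_forall_le_of_nonneg zero_le_one fun l _ => ?_
      rw [norm_mul]
      exact mul_le_one₀ (hk1 i l) (norm_nonneg _) (heckeRep_integral l j)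
    · rw [Units.val_mul, Matrix.det_mul, norm_mul, hk2, one_mul, norm_det_heckeRep hp]
  choose! σ hσ κ hκ heq using hex
  have hinj : Set.InjOn σ (heckeIndex q d) := by
    intro p hp p' hp' h
    have h1 := heq p hp
    have h2 := heq p' hp'
    rw [h] at h1
    refine (heckeRep_inj hp hp' (mul_mem (inv_mem (hκ p hp)) (hκ p' hp')) ?_).2
    apply mul_left_cancel (a := k)
    rw [h2, ← mul_assoc, h1]
    group
  refine Finset.sum_nbij σ hσ hinj ?_ fun p hp => ?_
  · exact Finset.surjOn_of_injOn_of_card_le σ hσ hinj le_rfl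
  · rw [mul_assoc, heq p hp, ← mul_assoc, hΨ _ _ (hκ p hp)]

variable (q) in
/-- The indices of the representatives `heckeRep d p` that are primitive matrices. -/
def sphereIndex (d : ℕ) : Finset (Σ _ : ℕ, ℕ) :=
  (heckeIndex q d).filter fun p => p.1 = 0 ∨ p.1 = d ∨ ¬ q ∣ p.2

theorem sphereIndex_subset (d : ℕ) : sphereIndex q d ⊆ heckeIndex q d := Finset.filter_subset _ _

theorem sphereIndex_of_lt_two {d : ℕ} (hd : d < 2) : sphereIndex q d = heckeIndex q d := by
  refine Finset.filter_true_of_mem fun p hp => ?_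
  have := (mem_heckeIndex.mp hp).1
  omega

theorem heckeRep_add_two {d i b : ℕ} (hi : i ≤ d) :
    heckeRep (q := q) (d + 2) ⟨i + 1, q * b⟩ =
      heckeRep d ⟨i, b⟩ * upperTri (primeUnit q) (primeUnit q) 0 := by
  rw [heckeRep, heckeRep, upperTri_mul]
  simp only
  rw [← pow_succ, ← pow_succ, show d + 2 - (i + 1) = d - i + 1 by omega]
  congr 1
  simp [primeUnit, mul_comm]

/-- A representative of degree d + 2 that is not primitive is q times a representative of degree d,
and the scalar q acts trivially on Ψ. -/
theorem sum_heckeIndex_add_two {M : Type*} [AddCommMonoid M] {Ψ : GL (Fin 2) ℚ_[q] → M}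
    (hΨ : ∀ g, Ψ (g * upperTri (primeUnit q) (primeUnit q) 0) = Ψ g) (d : ℕ)
    (x : GL (Fin 2) ℚ_[q]) :
    ∑ p ∈ heckeIndex q (d + 2), Ψ (x * heckeRep (d + 2) p) =
      ∑ p ∈ sphereIndex q (d + 2), Ψ (x * heckeRep (d + 2) p) +
        ∑ p ∈ heckeIndex q d, Ψ (x * heckeRep d p) := by
  have hq : 0 < q := (Fact.out : q.Prime).pos
  rw [sphereIndex, ← Finset.sum_filter_add_sum_filter_not (heckeIndex q (d + 2))
    (fun p => p.1 = 0 ∨ p.1 = d + 2 ∨ ¬ q ∣ p.2)]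
  congr 1
  symm
  refine Finset.sum_nbij (fun p => ⟨p.1 + 1, q * p.2⟩) ?_ ?_ ?_ ?_
  · rintro ⟨i, b⟩ hp
    rw [mem_heckeIndex] at hp
    rw [Finset.mem_filter, mem_heckeIndex]
    simp only at hp ⊢
    refine ⟨⟨by omega, ?_⟩, ?_⟩
    · rw [pow_succ, mul_comm]
      exact Nat.mul_lt_mul_of_pos_right hp.2 hq
    · simp
      omega
  · rintro ⟨i, b⟩ - ⟨i', b'⟩ - h
    simp only [Sigma.mk.injEq, heq_eq_eq, add_left_inj] at h
    obtain ⟨rfl, h⟩ := h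
    rw [Nat.eq_of_mul_eq_mul_left hq h]
  · rintro ⟨i, b⟩ hp
    rw [Finset.mem_coe, Finset.mem_filter, mem_heckeIndex] at hp
    simp only [not_or, not_not] at hp
    obtain ⟨⟨h1, h2⟩, h3, h4, b', rfl⟩ := hp
    obtain ⟨i', rfl⟩ := Nat.exists_eq_succ_of_ne_zero h3
    refine ⟨⟨i', b'⟩, ?_, rfl⟩
    rw [Finset.mem_coe, mem_heckeIndex]
    refine ⟨by simp only; omega, ?_⟩
    rw [Nat.succ_eq_add_one, pow_succ, mul_comm] at h2
    exact Nat.lt_of_mul_lt_mul_right h2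
  · rintro ⟨i, b⟩ hp
    rw [mem_heckeIndex] at hp
    rw [heckeRep_add_two hp.1, ← mul_assoc, hΨ]

/-- By Iwasawa and the permutation of cosets, it suffices to evaluate at a triangular x; there each
of the q^i representatives with diagonal (q^i, q^(d−i)) contributes the same amount. -/
theorem sum_heckeRep_of_upperTri {f : GL (Fin 2) ℚ_[q] → ℂ} {χ : ℚ_[q]ˣ → ℚ_[q]ˣ → ℂ}
    (hf : ∀ a d b g, f (upperTri a d b * g) = χ a d * f g)
    (hk : ∀ g, ∀ k ∈ maxCompact q, f (g * k) = f g) (d : ℕ) (x : GL (Fin 2) ℚ_[q]) :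
    ∑ p ∈ heckeIndex q d, f (x * heckeRep d p) =
      (∑ i ∈ Finset.range (d + 1), (q : ℂ) ^ i * χ (primeUnit q ^ i) (primeUnit q ^ (d - i))) *
        f x := by
  obtain ⟨a, e, b, k, hk', rfl⟩ := exists_iwasawa x
  rw [sum_heckeRep_mul hk d _ hk', hk _ _ hk', ← mul_one (upperTri a e b)]
  simp only [mul_assoc, hf]
  rw [← Finset.mul_sum, heckeIndex, Finset.sum_sigma, mul_left_comm]
  congr 1
  simp only [one_mul]
  rw [Finset.sum_mul]
  refine Finset.sum_congr rfl fun i _ => ?_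
  have : ∀ b ∈ Finset.range (q ^ i), f (heckeRep d ⟨i, b⟩) =
      χ (primeUnit q ^ i) (primeUnit q ^ (d - i)) * f 1 := by
    intro b _
    rw [← hf _ _ (b : ℚ_[q]), mul_one]
    rfl
  rw [Finset.sum_congr rfl this, Finset.sum_const, Finset.card_range, nsmul_eq_mul]
  push_cast
  ring

end PadicGL

/-- The complete homogeneous polynomial of degree `d` in two variables. -/
def completeHom (A B : ℂ) (d : ℕ) : ℂ := ∑ i ∈ Finset.range (d + 1), A ^ i * B ^ (d - i)

theorem completeHom_zero (A B : ℂ) : completeHom A B 0 = 1 := by simp [completeHom]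

theorem completeHom_succ (A B : ℂ) (d : ℕ) :
    completeHom A B (d + 1) = A * completeHom A B d + B ^ (d + 1) := by
  rw [completeHom, Finset.sum_range_succ', completeHom, Finset.mul_sum]
  congr 1
  · refine Finset.sum_congr rfl fun i _ => ?_
    rw [show d + 1 - (i + 1) = d - i by omega]
    ring
  · simp

theorem completeHom_succ' (A B : ℂ) (d : ℕ) :
    completeHom A B (d + 1) = B * completeHom A B d + A ^ (d + 1) := by
  rw [completeHom, Finset.sum_range_succ, completeHom, Finset.mul_sum]
  congr 1
  · refine Finset.sum_congr rfl fun i hi => ?_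
    have := Finset.mem_range.mp hi
    rw [show d + 1 - i = d - i + 1 by omega]
    ring
  · simp

/-- This recurrence matches the one that the Hecke operator of degree 1 imposes on Whittaker values.
-/
theorem completeHom_add_two (A B : ℂ) (d : ℕ) :
    completeHom A B (d + 2) = (A + B) * completeHom A B (d + 1) - A * B * completeHom A B d := by
  rw [completeHom_succ A B (d + 1), completeHom_succ A B d]
  ring

theorem norm_completeHom_le {A B : ℂ} {R : ℝ} (hA : ‖A‖ ≤ R) (hB : ‖B‖ ≤ R) (d : ℕ) :
    ‖completeHom A B d‖ ≤ (d + 1) * R ^ d := by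
  have hR : 0 ≤ R := (norm_nonneg A).trans hA
  calc ‖completeHom A B d‖ ≤ ∑ i ∈ Finset.range (d + 1), R ^ d := by
        refine norm_sum_le_of_le _ fun i hi => ?_
        have := Finset.mem_range.mp hi
        rw [norm_mul, norm_pow, norm_pow, ← Nat.add_sub_of_le (show i ≤ d by omega), pow_add]
        simp only [Nat.add_sub_cancel_left]
        gcongr
    _ = _ := by simp

/-! ### Spherical Whittaker functions: Hecke eigenvalues, explicit values, growth -/

section Whittaker

variable {q : ℕ} [Fact q.Prime]

/-- `w` is a spherical `ψ`-Whittaker function with trivial central character whose eigenvalues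
under the Hecke operators are the complete homogeneous polynomials in `A`, `B`. -/
structure IsUnramWhittaker (ψ : AddChar ℚ_[q] Circle) (A B : ℂ) (w : GL (Fin 2) ℚ_[q] → ℂ) :
    Prop where
  left : ∀ x g, w (upperTri 1 1 x * g) = (ψ x : ℂ) * w g
  right : ∀ g, ∀ k ∈ maxCompact q, w (g * k) = w g
  central : ∀ g z, w (g * upperTri z z 0) = w g
  hecke : ∀ d x, ∑ p ∈ heckeIndex q d, w (x * heckeRep d p) = completeHom A B d * w x

theorem upperTri_center (z : ℚ_[q]ˣ) (g : GL (Fin 2) ℚ_[q]) :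
    g * upperTri z z 0 = upperTri z z 0 * g := by
  apply Units.ext
  rw [Units.val_mul, Units.val_mul, upperTri_val]
  ext i j
  fin_cases i <;> fin_cases j <;> simp [Matrix.mul_apply, Fin.sum_univ_two, mul_comm]

/-- The spherical vector of the principal series is a Hecke eigenvector by Iwasawa, and the
equivariant map T transports the eigenvalue; uniqueness of Whittaker models is not needed. -/
theorem IsWhittakerMap.isUnramWhittaker {ψ : AddChar ℚ_[q] Circle} {α β : ℚ_[q]ˣ →* ℂˣ}
    (hαβ : ∀ x, α x * β x = 1)
    {T : principalSeries α β →ₗ[ℂ] (GL (Fin 2) ℚ_[q] → ℂ)} (hT : IsWhittakerMap ψ α β T)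
    {f : principalSeries α β} (hf : ∀ g, ∀ k ∈ maxCompact q, f.1 (g * k) = f.1 g) :
    IsUnramWhittaker ψ ((√(q : ℝ) : ℝ) * α (primeUnit q)) ((√(q : ℝ) : ℝ) * β (primeUnit q))
      (T f) where
  left x g := hT.1 f x g
  right g k hk := by
    rw [← hT.2]
    have : rightTranslate α β k f = f := Subtype.ext (funext fun x => hf x k hk)
    rw [this]
  central g z := by
    rw [← hT.2]
    suffices rightTranslate α β (upperTri z z 0) f = f by rw [this]
    refine Subtype.ext (funext fun x => ?_)
    change f.1 (x * upperTri z z 0) = f.1 x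
    have h1 : (α z : ℂ) * (β z : ℂ) = 1 := by
      rw [← Units.val_mul, hαβ, Units.val_one]
    have h2 : ‖(z : ℚ_[q])‖ ≠ 0 := norm_ne_zero_iff.mpr z.ne_zero
    rw [upperTri_center, f.2.2, h1, div_self h2]
    simp
  hecke d x := by
    have h1 : ∑ p ∈ heckeIndex q d, rightTranslate α β (heckeRep d p) f =
        completeHom ((√(q : ℝ) : ℝ) * α (primeUnit q)) ((√(q : ℝ) : ℝ) * β (primeUnit q)) d
          • f := by
      refine Subtype.ext (funext fun x => ?_)
      have h2 : (∑ p ∈ heckeIndex q d, rightTranslate α β (heckeRep d p) f).1 x =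
          ∑ p ∈ heckeIndex q d, f.1 (x * heckeRep d p) := by
        rw [AddSubmonoidClass.coe_finsetSum, Finset.sum_apply]
        rfl
      rw [h2, sum_heckeRep_of_upperTri f.2.2 hf]
      change _ = completeHom _ _ d * f.1 x
      congr 1
      refine Finset.sum_congr rfl fun i hi => ?_
      have hi' := Finset.mem_range.mp hi
      have hq : (0 : ℝ) < q := by linarith [one_lt_q (q := q)]
      -- The number q^i of cosets times the modulus factor q^((d−2i)/2) is q^(d/2) for every i,
      -- which is absorbed in the factor √q of both parameters.
      have h3 : (q : ℝ) ^ i * √(‖((primeUnit q ^ i : ℚ_[q]ˣ) : ℚ_[q])‖ /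
          ‖((primeUnit q ^ (d - i) : ℚ_[q]ˣ) : ℚ_[q])‖) = √(q : ℝ) ^ i * √(q : ℝ) ^ (d - i) := by
        rw [norm_primeUnit_pow, norm_primeUnit_pow, Real.sqrt_div (by positivity), zpow_neg,
          zpow_neg, Real.sqrt_inv, Real.sqrt_inv, zpow_natCast, zpow_natCast, Real.sqrt_eq_rpow,
          Real.sqrt_eq_rpow, Real.sqrt_eq_rpow, ← Real.rpow_natCast_mul hq.le,
          ← Real.rpow_natCast_mul hq.le, ← Real.rpow_mul_natCast hq.le,
          ← Real.rpow_mul_natCast hq.le, div_inv_eq_mul, ← Real.rpow_neg hq.le,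
          ← Real.rpow_natCast, ← Real.rpow_add hq, ← Real.rpow_add hq, ← Real.rpow_add hq]
        congr 1
        ring
      have h4 := congrArg (fun r : ℝ => (r : ℂ)) h3
      push_cast at h4
      rw [map_pow, map_pow, Units.val_pow_eq_pow_val, Units.val_pow_eq_pow_val, mul_pow, mul_pow]
      push_cast
      linear_combination ((α (primeUnit q) : ℂ) ^ i * (β (primeUnit q) : ℂ) ^ (d - i)) * h4
    have h5 := congrFun (congrArg T h1) x
    rw [map_sum, map_smul, Finset.sum_apply] at h5
    simpa [hT.2] using h5

variable {ψ : AddChar ℚ_[q] Circle} {A B : ℂ} {w : GL (Fin 2) ℚ_[q] → ℂ}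

theorem IsUnramWhittaker.upperTri_eq (hw : IsUnramWhittaker ψ A B w) (a d : ℚ_[q]ˣ) (b : ℚ_[q]) :
    w (upperTri a d b) = (ψ (b / d) : ℂ) * w (upperTri a d 0) := by
  rw [← hw.left, upperTri_mul]
  congr 2
  · simp
  · simp
  · simp

theorem IsUnramWhittaker.diag_eq (hw : IsUnramWhittaker ψ A B w) {a d : ℚ_[q]ˣ} {m : ℤ}
    (h : ‖(a : ℚ_[q])‖ = ‖(d : ℚ_[q])‖ * (q : ℝ) ^ (-m)) :
    w (upperTri a d 0) = w (upperTri (primeUnit q ^ m) 1 0) := by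
  have h1 : upperTri a d 0 = upperTri (primeUnit q ^ m) 1 0 * upperTri d d 0 *
      upperTri (a * d⁻¹ * (primeUnit q ^ m)⁻¹) 1 0 := by
    rw [upperTri_mul, upperTri_mul]
    congr 1
    · rw [mul_comm (primeUnit q ^ m) d, mul_assoc, mul_comm (primeUnit q ^ m)]
      simp [mul_comm d]
    · simp
    · simp
  rw [h1, hw.right _ _ (upperTri_mem_maxCompact ?_ (by simp) (by simp)), hw.central]
  have hd : ‖(d : ℚ_[q])‖ ≠ 0 := norm_ne_zero_iff.mpr d.ne_zero
  rw [Units.val_mul, Units.val_mul, norm_mul, norm_mul, Units.val_inv_eq_inv_val, norm_inv,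
    Units.val_inv_eq_inv_val, norm_inv, norm_primeUnit_zpow, h]
  have : (q : ℝ) ^ (-m) ≠ 0 := zpow_ne_zero _ (by linarith [one_lt_q (q := q)])
  field_simp

/-- An integral unipotent matrix moved to the left across diag(q^m, 1) becomes the one with entry x,
where ψ(x) ≠ 1; its action on the right is trivial, so the value is zero. -/
theorem IsUnramWhittaker.diag_of_neg (hw : IsUnramWhittaker ψ A B w)
    (hψ : HasConductorIntegers ψ) {m : ℤ} (hm : m < 0) : w (upperTri (primeUnit q ^ m) 1 0) = 0 := by
  obtain ⟨x, hx, hψx⟩ := hψ.2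
  have hk : upperTri 1 1 ((((primeUnit q ^ m)⁻¹ : ℚ_[q]ˣ) : ℚ_[q]) * x) ∈ maxCompact q := by
    refine upperTri_mem_maxCompact (by simp) (by simp) ?_
    rw [norm_mul, ← zpow_neg, norm_primeUnit_zpow, neg_neg]
    have hq := one_lt_q (q := q)
    calc (q : ℝ) ^ m * ‖x‖ ≤ (q : ℝ) ^ (-1 : ℤ) * q := by
          gcongr
          · exact hq.le
          · omega
      _ = 1 := by rw [zpow_neg_one]; exact inv_mul_cancel₀ (by linarith)
  have h1 := hw.right (upperTri (primeUnit q ^ m) 1 0) _ hk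
  have h2 : upperTri (primeUnit q ^ m) 1 0 * upperTri 1 1 ((((primeUnit q ^ m)⁻¹ : ℚ_[q]ˣ) : ℚ_[q]) * x) =
      upperTri 1 1 x * upperTri (primeUnit q ^ m) 1 0 := by
    rw [upperTri_mul, upperTri_mul]
    congr 1
    · simp
    · rw [← mul_assoc, ← Units.val_mul, mul_inv_cancel]
      simp
  rw [h2, hw.left] at h1
  by_contra h0
  apply hψx
  have h3 : (ψ x : ℂ) = 1 := by
    apply mul_right_cancel₀ h0
    rw [h1, one_mul]
  exact Circle.ext h3

/-- The Hecke relation of degree 1 reads (A + B) w_m = q w_{m+1} + w_{m−1} with w_{−1} = 0.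
Multiplied by q^m and with AB = q, this is the recurrence of the complete homogeneous polynomials.
-/
theorem IsUnramWhittaker.diag_nat (hw : IsUnramWhittaker ψ A B w) (hψ : HasConductorIntegers ψ)
    (hAB : A * B = q) (m : ℕ) :
    (q : ℂ) ^ m * w (upperTri (primeUnit q ^ (m : ℤ)) 1 0) = completeHom A B m * w 1 := by
  have hrec : ∀ m : ℕ, (A + B) * w (upperTri (primeUnit q ^ (m : ℤ)) 1 0) =
      q * w (upperTri (primeUnit q ^ ((m : ℤ) + 1)) 1 0) +
        w (upperTri (primeUnit q ^ ((m : ℤ) - 1)) 1 0) := by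
    intro m
    have h1 := hw.hecke 1 (upperTri (primeUnit q ^ (m : ℤ)) 1 0)
    have h2 : completeHom A B 1 = A + B := by
      simp [completeHom, Finset.sum_range_succ, add_comm]
    rw [h2] at h1
    rw [← h1, heckeIndex, Finset.sum_sigma, Finset.sum_range_succ, Finset.sum_range_succ,
      Finset.range_zero, Finset.sum_empty, zero_add, add_comm]
    congr 1
    · have h3 : ∀ b ∈ Finset.range (q ^ 1), w (upperTri (primeUnit q ^ (m : ℤ)) 1 0 *
          heckeRep 1 ⟨1, b⟩) = w (upperTri (primeUnit q ^ ((m : ℤ) + 1)) 1 0) := by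
        intro b _
        rw [heckeRep, upperTri_mul, hw.upperTri_eq]
        simp only [pow_one, Nat.sub_self, pow_zero, mul_one, add_zero, Units.val_one,
          div_one]
        have hb : ‖(b : ℚ_[q])‖ ≤ 1 := by exact_mod_cast Padic.norm_int_le_one (p := q) b
        rw [hψ.1, Circle.coe_one, one_mul, zpow_add_one]
        rw [norm_mul, norm_primeUnit_zpow]
        refine mul_le_one₀ ?_ (norm_nonneg _) hb
        rw [zpow_le_one_iff_right₀ one_lt_q]
        omega
      rw [Finset.sum_congr rfl h3, Finset.sum_const, Finset.card_range, nsmul_eq_mul, pow_one]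
    · simp only [pow_zero, Finset.range_one, Finset.sum_singleton]
      rw [heckeRep, upperTri_mul]
      simp only [pow_zero, mul_one, tsub_zero, pow_one, one_mul, Nat.cast_zero, mul_zero, zero_mul,
        add_zero]
      apply hw.diag_eq
      rw [norm_primeUnit_zpow, norm_primeUnit, ← zpow_neg_one, ← zpow_add₀]
      · congr 1; ring
      · linarith [one_lt_q (q := q)]
  have key : ∀ m : ℕ, ((q : ℂ) ^ m * w (upperTri (primeUnit q ^ (m : ℤ)) 1 0) =
        completeHom A B m * w 1) ∧
      ((q : ℂ) ^ (m + 1) * w (upperTri (primeUnit q ^ ((m : ℤ) + 1)) 1 0) =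
        completeHom A B (m + 1) * w 1) := by
    intro m
    induction m with
    | zero =>
      have h0 : w (upperTri (primeUnit q ^ (0 : ℤ)) 1 0) = w 1 := by rw [zpow_zero, upperTri_one]
      refine ⟨by simp [completeHom_zero, upperTri_one], ?_⟩
      have h1 := hrec 0
      simp only [Nat.cast_zero] at h1
      rw [h0, hw.diag_of_neg hψ (m := 0 - 1) (by norm_num)] at h1
      have h2 : completeHom A B (0 + 1) = A + B := by
        simp [completeHom, Finset.sum_range_succ, add_comm]
      rw [h2]
      simp only [Nat.cast_zero]
      linear_combination -h1
    | succ m ih =>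
      have h1 := hrec (m + 1)
      have e1 : (((m + 1 : ℕ) : ℤ) - 1) = m := by push_cast; ring
      have e2 : ((m + 1 : ℕ) : ℤ) = (m : ℤ) + 1 := by push_cast; ring
      rw [e1, e2] at h1
      rw [e2]
      refine ⟨ih.2, ?_⟩
      rw [completeHom_add_two, hAB]
      linear_combination (-(q : ℂ) ^ (m + 1)) * h1 + (A + B) * ih.2 - q * ih.1
  exact (key m).1

/-- The unipotent parts only contribute phases, so each term is a diagonal value with exponent m₀ +
2i − d, which is known explicitly. -/
theorem IsUnramWhittaker.exists_sum_norm_le (hw : IsUnramWhittaker ψ A B w)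
    (hψ : HasConductorIntegers ψ) (hAB : A * B = q) {R : ℝ} (hA : ‖A‖ ≤ R) (hB : ‖B‖ ≤ R)
    (x : GL (Fin 2) ℚ_[q]) :
    ∃ C : ℝ, 0 ≤ C ∧ ∀ d : ℕ,
      ∑ p ∈ heckeIndex q d, ‖w (x * heckeRep d p)‖ ≤ C * ((d + 1) ^ 2 * R ^ d) := by
  have hq := one_lt_q (q := q)
  have hq0 : (0 : ℝ) < q := by linarith
  -- The inequality q = |AB| ≤ R² makes the terms with i = d the dominant ones below.
  have hqR : (q : ℝ) ≤ R ^ 2 := by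
    have h1 := congrArg norm hAB
    rw [norm_mul, Complex.norm_natCast] at h1
    rw [← h1, sq]
    exact mul_le_mul hA hB (norm_nonneg _) ((norm_nonneg _).trans hA)
  have hR : 0 < R := by
    have : 0 ≤ R := (norm_nonneg _).trans hA
    rcases this.eq_or_lt with h | h
    · rw [← h, zero_pow two_ne_zero] at hqR; linarith
    · exact h
  obtain ⟨a, e, b, k, hk, rfl⟩ := exists_iwasawa x
  obtain ⟨ma, hma⟩ := exists_norm_eq_zpow a
  obtain ⟨me, hme⟩ := exists_norm_eq_zpow e
  set m₀ := ma - me with hm₀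
  have hV : ∀ m : ℤ, ‖w (upperTri (primeUnit q ^ m) 1 0)‖ ≤
      ‖w 1‖ * ((|m| + 1) * ((R / q) ^ m)) := by
    intro m
    rcases lt_or_ge m 0 with hm | hm
    · rw [hw.diag_of_neg hψ hm, norm_zero]
      positivity
    · lift m to ℕ using hm
      have h1 := congrArg norm (hw.diag_nat hψ hAB m)
      rw [norm_mul, norm_mul, norm_pow, Complex.norm_natCast] at h1
      have h2 : ‖w (upperTri (primeUnit q ^ (m : ℤ)) 1 0)‖ =
          ‖completeHom A B m‖ * ‖w 1‖ / (q : ℝ) ^ m := by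
        rw [← h1]; field_simp
      rw [h2, zpow_natCast, div_pow]
      calc _ ≤ ((m + 1) * R ^ m) * ‖w 1‖ / (q : ℝ) ^ m := by
            gcongr; exact norm_completeHom_le hA hB m
        _ = _ := by simp; ring
  have hterm : ∀ d : ℕ, ∀ i ∈ Finset.range (d + 1), ∀ b' : ℕ,
      (q : ℝ) ^ i * ‖w (upperTri a e b * heckeRep d ⟨i, b'⟩)‖ ≤
        ‖w 1‖ * (R / q) ^ m₀ * ((|m₀| + 1) * ((d + 1) * R ^ d)) := by
    intro d i hi b'
    have hi' := Finset.mem_range.mp hi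
    rw [heckeRep, upperTri_mul, hw.upperTri_eq, norm_mul, Circle.norm_coe, one_mul]
    rw [hw.diag_eq (m := m₀ + 2 * i - d) ?_]
    · have h1 := hV (m₀ + 2 * i - d)
      have h2 : ((|m₀ + 2 * i - d| : ℤ) : ℝ) + 1 ≤ (|m₀| + 1) * (d + 1) := by
        have h3 : |m₀ + 2 * i - d| ≤ |m₀| + d := by
          have : |m₀ + 2 * i - d| ≤ |m₀| + |(2 * i - d : ℤ)| := by
            rw [add_sub_assoc]; exact abs_add_le _ _
          have : |(2 * i - d : ℤ)| ≤ d := abs_le.mpr ⟨by omega, by omega⟩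
          omega
        have h4 : |m₀ + 2 * i - d| + 1 ≤ (|m₀| + 1) * (d + 1) := by
          nlinarith [mul_nonneg (abs_nonneg m₀) (Int.natCast_nonneg d)]
        exact_mod_cast h4
      -- There are q^i terms for each i, and q^i (R/q)^(2i−d) = R^d (q/R²)^(d−i) ≤ R^d.
      have h5 : (q : ℝ) ^ i * (R / q) ^ (m₀ + 2 * i - d) ≤ (R / q) ^ m₀ * R ^ d := by
        have h6 : (q : ℝ) ^ i * (R / q) ^ (m₀ + 2 * i - d) =
            (R / q) ^ m₀ * R ^ d * ((q : ℝ) / R ^ 2) ^ (d - i) := by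
          obtain ⟨l, rfl⟩ := Nat.exists_eq_add_of_le (show i ≤ d by omega)
          rw [Nat.add_sub_cancel_left, show m₀ + 2 * (i : ℤ) - (i + l : ℕ) = m₀ + i - l by
            push_cast; ring, zpow_sub₀ (by positivity), zpow_add₀ (by positivity), zpow_natCast,
            zpow_natCast, pow_add, div_pow, div_pow, div_pow, ← pow_mul]
          field_simp
          ring
        rw [h6]
        refine mul_le_of_le_one_right (by positivity) ?_
        exact pow_le_one₀ (by positivity) (div_le_one_of_le₀ hqR (by positivity))
      calc _ ≤ (q : ℝ) ^ i * (‖w 1‖ * (((|m₀ + 2 * i - d| : ℤ) + 1) *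
              (R / q) ^ (m₀ + 2 * i - d))) := by gcongr
        _ = ‖w 1‖ * (((|m₀ + 2 * i - d| : ℤ) + 1) *
              ((q : ℝ) ^ i * (R / q) ^ (m₀ + 2 * i - d))) := by ring
        _ ≤ ‖w 1‖ * (((|m₀| + 1) * (d + 1)) * ((R / q) ^ m₀ * R ^ d)) := by gcongr
        _ = _ := by ring
    · rw [Units.val_mul, Units.val_mul, norm_mul, norm_mul, hma, hme, norm_primeUnit_pow,
        norm_primeUnit_pow, ← zpow_add₀ hq0.ne', ← zpow_add₀ hq0.ne', ← zpow_add₀ hq0.ne']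
      congr 1
      simp only
      omega
  refine ⟨‖w 1‖ * (R / q) ^ m₀ * (|m₀| + 1), by positivity, fun d => ?_⟩
  rw [sum_heckeRep_mul (Ψ := fun g => ‖w g‖) (fun g k hk => by rw [hw.right g k hk]) d _ hk,
    heckeIndex, Finset.sum_sigma]
  calc _ ≤ ∑ i ∈ Finset.range (d + 1),
        ‖w 1‖ * (R / q) ^ m₀ * ((|m₀| + 1) * ((d + 1) * R ^ d)) := by
        refine Finset.sum_le_sum fun i hi => ?_
        calc _ ≤ ∑ b' ∈ Finset.range (q ^ i), ((q : ℝ) ^ i)⁻¹ *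
              (‖w 1‖ * (R / q) ^ m₀ * ((|m₀| + 1) * ((d + 1) * R ^ d))) := by
              refine Finset.sum_le_sum fun b' _ => ?_
              rw [le_inv_mul_iff₀ (by positivity)]
              exact hterm d i hi b'
          _ = _ := by
            rw [Finset.sum_const, Finset.card_range, nsmul_eq_mul]
            push_cast
            field_simp
    _ = _ := by
      rw [Finset.sum_const, Finset.card_range, nsmul_eq_mul]
      push_cast
      ring

/-- The eigenvalue of the sum over the sphere of radius `d`. -/
def sphereEigenvalue (A B : ℂ) : ℕ → ℂ
  | 0 => completeHom A B 0
  | 1 => completeHom A B 1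
  | d + 2 => completeHom A B (d + 2) - completeHom A B d

theorem IsUnramWhittaker.sum_sphere (hw : IsUnramWhittaker ψ A B w) (d : ℕ)
    (x : GL (Fin 2) ℚ_[q]) :
    ∑ p ∈ sphereIndex q d, w (x * heckeRep d p) = sphereEigenvalue A B d * w x := by
  match d with
  | 0 => rw [sphereIndex_of_lt_two (by norm_num), hw.hecke]; rfl
  | 1 => rw [sphereIndex_of_lt_two (by norm_num), hw.hecke]; rfl
  | d + 2 =>
    have h1 := sum_heckeIndex_add_two (fun g => hw.central g _) d x
    rw [hw.hecke, hw.hecke] at h1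
    rw [sphereEigenvalue, sub_mul, h1]
    ring

end Whittaker

/-! ### Cartan decomposition of primitive matrices -/

section Cartan

variable {q : ℕ} [Fact q.Prime]

/-- `M` is an integral matrix whose entries generate the unit ideal. -/
def IsPrimitiveMat (M : Matrix (Fin 2) (Fin 2) ℚ_[q]) : Prop :=
  (∀ i j, ‖M i j‖ ≤ 1) ∧ ∃ i j, ‖M i j‖ = 1

variable (q) in
/-- `SL_2(ℤ_q)`. -/
def specialCompact : Subgroup (GL (Fin 2) ℚ_[q]) where
  carrier := {k | k ∈ maxCompact q ∧ k.1.det = 1}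
  one_mem' := ⟨one_mem _, by simp⟩
  mul_mem' := by
    rintro a b ⟨h1, h2⟩ ⟨h3, h4⟩
    exact ⟨mul_mem h1 h3, by rw [Units.val_mul, Matrix.det_mul, h2, h4, mul_one]⟩
  inv_mem' := by
    rintro a ⟨h1, h2⟩
    refine ⟨inv_mem h1, ?_⟩
    have h3 : a.1.det * (a⁻¹).1.det = 1 := by
      rw [← Matrix.det_mul, ← Units.val_mul, mul_inv_cancel, Units.val_one, Matrix.det_one]
    rwa [h2, one_mul] at h3

theorem exists_specialCompact {M : Matrix (Fin 2) (Fin 2) ℚ_[q]} (h1 : ∀ i j, ‖M i j‖ ≤ 1)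
    (h2 : M.det = 1) : ∃ k ∈ specialCompact q, k.1 = M :=
  ⟨Matrix.GeneralLinearGroup.mkOfDetNeZero M (by rw [h2]; exact one_ne_zero),
    ⟨mem_maxCompact_iff.mpr ⟨h1, by change ‖M.det‖ = 1; rw [h2, norm_one]⟩, h2⟩, rfl⟩

/-- A unit in the lower right corner clears its row and column by elementary matrices; a unit
elsewhere is moved there by the Weyl element. The factors stay in SL_2(ℤ_q), since the left
invariance of the section is proved for that group. -/
theorem IsPrimitiveMat.exists_cartan {M : Matrix (Fin 2) (Fin 2) ℚ_[q]} (hM : IsPrimitiveMat M) :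
    ∃ k₁ ∈ specialCompact q, ∃ k₂ ∈ specialCompact q, ∃ e : ℚ_[q], ‖e‖ = 1 ∧
      M = k₁.1 * !![M.det / e, 0; 0, e] * k₂.1 := by
  have key : ∀ M : Matrix (Fin 2) (Fin 2) ℚ_[q], (∀ i j, ‖M i j‖ ≤ 1) → ‖M 1 1‖ = 1 →
      ∃ k₁ ∈ specialCompact q, ∃ k₂ ∈ specialCompact q, ∃ e : ℚ_[q], ‖e‖ = 1 ∧
      M = k₁.1 * !![M.det / e, 0; 0, e] * k₂.1 := by
    intro M hM he
    have he0 : M 1 1 ≠ 0 := by rw [← norm_ne_zero_iff, he]; exact one_ne_zero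
    obtain ⟨k₁, hk₁, e₁⟩ := exists_specialCompact (M := !![1, M 0 1 / M 1 1; 0, 1])
      (by simp [Fin.forall_fin_two, he, hM 0 1]) (by simp [Matrix.det_fin_two])
    obtain ⟨k₂, hk₂, e₂⟩ := exists_specialCompact (M := !![1, 0; M 1 0 / M 1 1, 1])
      (by simp [Fin.forall_fin_two, he, hM 1 0]) (by simp [Matrix.det_fin_two])
    refine ⟨k₁, hk₁, k₂, hk₂, M 1 1, he, ?_⟩
    rw [e₁, e₂, Matrix.det_fin_two]
    ext i j
    fin_cases i <;> fin_cases j <;> simp [Matrix.mul_apply, Fin.sum_univ_two] <;> field_simp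
    ring
  obtain ⟨w, hw, ew⟩ := exists_specialCompact (q := q) (M := !![0, 1; -1, 0])
    (by simp [Fin.forall_fin_two]) (by simp [Matrix.det_fin_two])
  have hww : ∀ N : Matrix (Fin 2) (Fin 2) ℚ_[q], (w⁻¹).1 * (w.1 * N) = N := by
    intro N
    rw [← Matrix.mul_assoc, ← Units.val_mul, inv_mul_cancel, Units.val_one, Matrix.one_mul]
  have hww' : ∀ N : Matrix (Fin 2) (Fin 2) ℚ_[q], N * w.1 * (w⁻¹).1 = N := by
    intro N
    rw [Matrix.mul_assoc, ← Units.val_mul, mul_inv_cancel, Units.val_one, Matrix.mul_one]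
  have left : ∀ M : Matrix (Fin 2) (Fin 2) ℚ_[q],
      (∃ k₁ ∈ specialCompact q, ∃ k₂ ∈ specialCompact q, ∃ e : ℚ_[q], ‖e‖ = 1 ∧
        w.1 * M = k₁.1 * !![(w.1 * M).det / e, 0; 0, e] * k₂.1) →
      ∃ k₁ ∈ specialCompact q, ∃ k₂ ∈ specialCompact q, ∃ e : ℚ_[q], ‖e‖ = 1 ∧
        M = k₁.1 * !![M.det / e, 0; 0, e] * k₂.1 := by
    rintro M ⟨k₁, hk₁, k₂, hk₂, e, he, h⟩
    refine ⟨w⁻¹ * k₁, mul_mem (inv_mem hw) hk₁, k₂, hk₂, e, he, ?_⟩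
    rw [Matrix.det_mul, hw.2, one_mul] at h
    rw [Units.val_mul, Matrix.mul_assoc, Matrix.mul_assoc, ← Matrix.mul_assoc k₁.1, ← h, hww]
  have right : ∀ M : Matrix (Fin 2) (Fin 2) ℚ_[q],
      (∃ k₁ ∈ specialCompact q, ∃ k₂ ∈ specialCompact q, ∃ e : ℚ_[q], ‖e‖ = 1 ∧
        M * w.1 = k₁.1 * !![(M * w.1).det / e, 0; 0, e] * k₂.1) →
      ∃ k₁ ∈ specialCompact q, ∃ k₂ ∈ specialCompact q, ∃ e : ℚ_[q], ‖e‖ = 1 ∧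
        M = k₁.1 * !![M.det / e, 0; 0, e] * k₂.1 := by
    rintro M ⟨k₁, hk₁, k₂, hk₂, e, he, h⟩
    refine ⟨k₁, hk₁, k₂ * w⁻¹, mul_mem hk₂ (inv_mem hw), e, he, ?_⟩
    rw [Matrix.det_mul, hw.2, mul_one] at h
    rw [Units.val_mul, ← Matrix.mul_assoc, ← h, hww']
  obtain ⟨hint, i, j, hij⟩ := hM
  have e00 : ∀ N : Matrix (Fin 2) (Fin 2) ℚ_[q], w.1 * N = !![N 1 0, N 1 1; -N 0 0, -N 0 1] := by
    intro N
    rw [ew]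
    ext i j
    fin_cases i <;> fin_cases j <;> simp [Matrix.mul_apply, Fin.sum_univ_two]
  have e01 : ∀ N : Matrix (Fin 2) (Fin 2) ℚ_[q], N * w.1 = !![-N 0 1, N 0 0; -N 1 1, N 1 0] := by
    intro N
    rw [ew]
    ext i j
    fin_cases i <;> fin_cases j <;> simp [Matrix.mul_apply, Fin.sum_univ_two]
  have right' : ‖M 1 0‖ = 1 → _ := fun h => right M (key _
    (by rw [e01]; simp [Fin.forall_fin_two, hint]) (by rw [e01]; simpa using h))
  have left' : ‖M 0 1‖ = 1 → _ := fun h => left M (key _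
    (by rw [e00]; simp [Fin.forall_fin_two, hint]) (by rw [e00]; simpa using h))
  fin_cases i <;> fin_cases j
  · exact left M (right _ (key _ (by rw [e01, e00]; simp [Fin.forall_fin_two, hint])
      (by rw [e01, e00]; simpa using hij)))
  · exact left' hij
  · exact right' hij
  · exact key M hint hij

end Cartan

/-! ### Integral Siegel decompositions and the stabilizer property of Q -/

section SectionValue

variable {q : ℕ} [Fact q.Prime] {L : Type*} [Field L] [NumberField L]
variable {c : L ≃ₐ[ℚ] L} {θ : 𝓞 L} {t n : ℤ}

theorem conjT_fromBlocks {l : Type*} (A B C D : Matrix l l (LocalAlg q L)) :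
    conjT q c (Matrix.fromBlocks A B C D) =
      Matrix.fromBlocks (conjT q c A) (conjT q c C) (conjT q c B) (conjT q c D) := by
  unfold conjT
  rw [Matrix.fromBlocks_map, Matrix.fromBlocks_transpose]

theorem isSimilitude_siegelN {b : Matrix (Fin 3) (Fin 3) (LocalAlg q L)}
    (hb : conjT q c b = b) : IsSimilitude q c (formJ q L 3) (siegelN q b) 1 := by
  have h1 : conjT q c (1 : Matrix (Fin 3) (Fin 3) (LocalAlg q L)) = 1 := by
    simp [conjT, Matrix.map_one]
  have h0 : conjT q c (0 : Matrix (Fin 3) (Fin 3) (LocalAlg q L)) = 0 := by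
    ext; simp [conjT]
  unfold IsSimilitude siegelN formJ
  rw [conjT_fromBlocks, hb, h0, h1, Matrix.fromBlocks_multiply, Matrix.fromBlocks_multiply]
  simp

theorem IsQuadGen.conjT_conjT (h : IsQuadGen c θ t n) {l m : Type*}
    (X : Matrix l m (LocalAlg q L)) : conjT q c (conjT q c X) = X := by
  ext i j
  simp [conjT, h.localConj_localConj]

theorem conjT_one {l : Type*} [DecidableEq l] :
    conjT q c (1 : Matrix l l (LocalAlg q L)) = 1 := by
  simp [conjT, Matrix.map_one]

theorem isSimilitude_siegelM (h : IsQuadGen c θ t n) (A : GL (Fin 3) (LocalAlg q L)) :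
    IsSimilitude q c (formJ q L 3) (siegelM q c A 1) 1 := by
  have h0 : conjT q c (0 : Matrix (Fin 3) (Fin 3) (LocalAlg q L)) = 0 := by
    ext; simp [conjT]
  have h2 : (A⁻¹).1 * A.1 = 1 := by rw [← Units.val_mul, inv_mul_cancel]; rfl
  have h3 : conjT q c A.1 * conjT q c (A⁻¹).1 = 1 := by rw [← conjT_mul, h2, conjT_one]
  unfold IsSimilitude siegelM formJ
  rw [conjT_fromBlocks, h0, Units.val_one, one_smul, one_smul, Matrix.fromBlocks_multiply,
    Matrix.fromBlocks_multiply, h.conjT_conjT]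
  simp only [Matrix.mul_zero, Matrix.zero_mul, Matrix.mul_one, Matrix.mul_neg, zero_add, add_zero,
    Matrix.neg_mul, neg_zero, h2, h3]

theorem formJ_mul_formJ (m : ℕ) : formJ q L m * formJ q L m = -1 := by
  unfold formJ
  rw [Matrix.fromBlocks_multiply, ← Matrix.fromBlocks_one, Matrix.fromBlocks_neg]
  simp

theorem formJ_mem {m : ℕ} (i j : Fin m ⊕ Fin m) : formJ q L m i j ∈ localIntegers q L := by
  unfold formJ
  rcases i with i | i <;> rcases j with j | j <;> simp [Matrix.one_apply, zero_mem] <;>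
    split_ifs <;> simp [one_mem, zero_mem]

theorem matrix_mul_mem {l m k : Type*} [Fintype m] {A : Matrix l m (LocalAlg q L)}
    {B : Matrix m k (LocalAlg q L)} (hA : ∀ i j, A i j ∈ localIntegers q L)
    (hB : ∀ i j, B i j ∈ localIntegers q L) (i : l) (j : k) : (A * B) i j ∈ localIntegers q L := by
  rw [Matrix.mul_apply]
  exact sum_mem fun l _ => mul_mem (hA i l) (hB l j)

/-- For an isometry M of the form J, the inverse is −J M* J, with M* the conjugate transpose, so it
is integral as soon as M is. -/
theorem exists_compactGUThree {M : Matrix (Fin 3 ⊕ Fin 3) (Fin 3 ⊕ Fin 3) (LocalAlg q L)}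
    (hM : IsSimilitude q c (formJ q L 3) M 1) (hint : ∀ i j, M i j ∈ localIntegers q L) :
    ∃ k ∈ compactGUThree q c, k.1.1 = M := by
  have h1 : -(formJ q L 3 * conjT q c M * formJ q L 3) * M = 1 := by
    unfold IsSimilitude at hM
    rw [Units.val_one, one_smul] at hM
    rw [Matrix.neg_mul, Matrix.mul_assoc, Matrix.mul_assoc, ← Matrix.mul_assoc (conjT q c M), hM,
      formJ_mul_formJ, neg_neg]
  let k : GL (Fin 3 ⊕ Fin 3) (LocalAlg q L) := ⟨M, _, mul_eq_one_comm.mp h1, h1⟩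
  refine ⟨⟨k, 1, hM⟩, ?_, rfl⟩
  change k ∈ integralGL q L (Fin 3 ⊕ Fin 3)
  rw [mem_integralGL_iff]
  refine ⟨hint, fun i j => ?_⟩
  change (-(formJ q L 3 * conjT q c M * formJ q L 3)) i j ∈ _
  rw [Matrix.neg_apply]
  exact neg_mem (matrix_mul_mem (matrix_mul_mem formJ_mem
    fun i j => localConj_mem q c (hint j i)) formJ_mem i j)

/-- Only integrality of M has to be checked: M is an isometry because it is a quotient of
isometries. -/
theorem hasSiegelPart_of_eq (h : IsQuadGen c θ t n) {g : GUThree q c}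
    (hg : IsSimilitude q c (formJ q L 3) g.1.1 1)
    {b : Matrix (Fin 3) (Fin 3) (LocalAlg q L)} (hb : conjT q c b = b)
    {A : GL (Fin 3) (LocalAlg q L)} {M : Matrix (Fin 3 ⊕ Fin 3) (Fin 3 ⊕ Fin 3) (LocalAlg q L)}
    (hM : ∀ i j, M i j ∈ localIntegers q L) (heq : g.1.1 = siegelN q b * siegelM q c A 1 * M) :
    HasSiegelPart c g A 1 := by
  have hb' : conjT q c (-b) = -b := by
    conv_rhs => rw [← hb]
    ext i j
    simp [conjT]
  have e0 : siegelN q (0 : Matrix (Fin 3) (Fin 3) (LocalAlg q L)) = 1 := Matrix.fromBlocks_one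
  have e1 : siegelM q c A⁻¹ 1 * siegelN q (-b) * g.1.1 = M := by
    rw [heq, Matrix.mul_assoc, Matrix.mul_assoc (siegelN q b), ← Matrix.mul_assoc (siegelN q (-b)),
      siegelN_mul, neg_add_cancel, e0, Matrix.one_mul, ← Matrix.mul_assoc, siegelM_mul,
      inv_mul_cancel, one_mul]
    simp [siegelM, conjT_one, Matrix.fromBlocks_one]
  have e2 : IsSimilitude q c (formJ q L 3) M 1 := by
    rw [← e1]
    have := ((isSimilitude_siegelM h A⁻¹).mul (isSimilitude_siegelN hb')).mul hg
    simpa using this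
  obtain ⟨k, hk, rfl⟩ := exists_compactGUThree e2 hM
  exact ⟨b, hb, k, hk, heq⟩

/-- The value of the unramified section at `Q ι(1, h)`. -/
noncomputable def sectionValue (c : L ≃ₐ[ℚ] L) (Λ : (LocalAlg q L)ˣ →* Circle) (s : ℂ)
    (h : UOne q c) : ℂ :=
  unramifiedSection c Λ s (elemQ q c * iota q c (isometryPair c 1 h))

theorem elemQ_mul_iota_val (h : UOne q c) : (elemQ q c * iota q c (isometryPair c 1 h)).1.1 =
    matQ (LocalAlg q L) * iotaMat 1 h.1.1.1 := rfl

theorem iotaMat_mem {g : Matrix (Fin 2 ⊕ Fin 2) (Fin 2 ⊕ Fin 2) (LocalAlg q L)}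
    {h : Matrix (Fin 2) (Fin 2) (LocalAlg q L)} (hg : ∀ i j, g i j ∈ localIntegers q L)
    (hh : ∀ i j, h i j ∈ localIntegers q L) (i j : Fin 3 ⊕ Fin 3) :
    iotaMat g h i j ∈ localIntegers q L := by
  unfold iotaMat
  rcases i with i | i <;> rcases j with j | j <;> fin_cases i <;> fin_cases j <;>
    simp [blockThree, zero_mem, Matrix.toBlocks₁₁, Matrix.toBlocks₁₂, Matrix.toBlocks₂₁,
      Matrix.toBlocks₂₂, hg, hh]

theorem one_entries_mem {l : Type*} [DecidableEq l] (i j : l) :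
    (1 : Matrix l l (LocalAlg q L)) i j ∈ localIntegers q L := by
  rw [Matrix.one_apply]
  split_ifs
  · exact one_mem _
  · exact zero_mem _

theorem sectionValue_mul_compact {Λ : (LocalAlg q L)ˣ →* Circle} (s : ℂ) (h k : UOne q c)
    (hk : k ∈ compactUOne q c) : sectionValue c Λ s (h * k) = sectionValue c Λ s h := by
  have h1 : elemQ q c * iota q c (isometryPair c 1 (h * k)) =
      elemQ q c * iota q c (isometryPair c 1 h) * iota q c (isometryPair c 1 k) := by
    rw [mul_assoc, ← map_mul]
    congr 2
    apply Subtype.ext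
    refine Prod.ext ?_ rfl
    exact (mul_one (1 : GUTwo q c)).symm
  unfold sectionValue
  rw [h1]
  apply unramifiedSection_mul_compact
  have hk' : k.1.1 ∈ integralGL q L (Fin 2) := hk
  rw [mem_integralGL_iff] at hk'
  change (iota q c (isometryPair c 1 k)).1 ∈ integralGL q L (Fin 3 ⊕ Fin 3)
  rw [mem_integralGL_iff]
  refine ⟨fun i j => iotaMat_mem one_entries_mem hk'.1 i j, fun i j => ?_⟩
  refine iotaMat_mem (fun i j => ?_) hk'.2 i j
  have : ((1 : UTwo q c)⁻¹).1.1.1 = 1 := by simp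
  change ((1 : UTwo q c)⁻¹).1.1.1 i j ∈ _
  rw [this]
  exact one_entries_mem i j

/-- A `2 × 2` matrix acting on the second and fourth coordinates. -/
def embedTwo {R : Type*} [Ring R] (k : Matrix (Fin 2) (Fin 2) R) :
    Matrix (Fin 2 ⊕ Fin 2) (Fin 2 ⊕ Fin 2) R :=
  Matrix.fromBlocks !![1, 0; 0, k 0 0] !![0, 0; 0, k 0 1] !![0, 0; 0, k 1 0] !![1, 0; 0, k 1 1]

theorem embedTwo_mul {R : Type*} [Ring R] (k l : Matrix (Fin 2) (Fin 2) R) :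
    embedTwo k * embedTwo l = embedTwo (k * l) := by
  unfold embedTwo
  rw [Matrix.fromBlocks_multiply]
  congr 1 <;> ext i j <;> fin_cases i <;> fin_cases j <;>
    simp [Matrix.mul_apply, Fin.sum_univ_two]

theorem embedTwo_one {R : Type*} [Ring R] : embedTwo (1 : Matrix (Fin 2) (Fin 2) R) = 1 := by
  unfold embedTwo
  rw [← Matrix.fromBlocks_one (l := Fin 2)]
  congr 1 <;> ext i j <;> fin_cases i <;> fin_cases j <;> simp

/-- This is the property for which Q is chosen: conjugation by Q takes the diagonally embedded 2 × 2
matrices (k, k) into block upper triangular matrices. No condition on the determinant is needed. -/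
theorem matQ_mul_iotaMat_embedTwo {R : Type*} [CommRing R] (k : Matrix (Fin 2) (Fin 2) R) :
    matQ R * iotaMat (embedTwo k) k =
      Matrix.fromBlocks !![k 0 0, 0, -k 0 1; 0, 1, 0; -k 1 0, 0, k 1 1]
        !![k 0 1, 0, 0; 0, 0, 0; 0, 0, k 1 0] 0
        !![k 1 1, 0, k 1 0; 0, 1, 0; k 0 1, 0, k 0 0] * matQ R := by
  unfold matQ iotaMat embedTwo
  simp only [Matrix.toBlocks_fromBlocks₁₁, Matrix.toBlocks_fromBlocks₁₂,
    Matrix.toBlocks_fromBlocks₂₁, Matrix.toBlocks_fromBlocks₂₂]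
  rw [Matrix.fromBlocks_multiply, Matrix.fromBlocks_multiply]
  congr 1 <;> ext i j <;> fin_cases i <;> fin_cases j <;>
    simp [blockThree]

end SectionValue

/-! ### Block matrix identities over a commutative ring -/

section MatrixIdentities

variable {R : Type*} [CommRing R]

theorem embedTwo_transpose (k : Matrix (Fin 2) (Fin 2) R) : (embedTwo k)ᵀ = embedTwo kᵀ := by
  unfold embedTwo
  rw [Matrix.fromBlocks_transpose]
  congr 1 <;> ext i j <;> fin_cases i <;> fin_cases j <;> rfl

theorem embedTwo_symplectic {k : Matrix (Fin 2) (Fin 2) R}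
    (hk : k 0 0 * k 1 1 - k 0 1 * k 1 0 = 1) :
    (embedTwo k)ᵀ * Matrix.fromBlocks 0 1 (-1) 0 * embedTwo k = Matrix.fromBlocks 0 1 (-1) 0 := by
  rw [embedTwo_transpose]
  unfold embedTwo
  rw [Matrix.fromBlocks_multiply, Matrix.fromBlocks_multiply]
  simp only [Matrix.mul_zero, Matrix.mul_one, Matrix.mul_neg, zero_add, add_zero]
  congr 1 <;> ext i j <;> fin_cases i <;> fin_cases j <;>
    simp <;>
    first
      | ring1
      | linear_combination hk
      | linear_combination -hk

/-- The `3 × 3` matrix `(a, 0, b; 0, 1, 0; c, 0, d)`. -/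
def cornerMat (a b c d : R) : Matrix (Fin 3) (Fin 3) R := !![a, 0, b; 0, 1, 0; c, 0, d]

theorem cornerMat_mul (a b c d a' b' c' d' : R) :
    cornerMat a b c d * cornerMat a' b' c' d' =
      cornerMat (a * a' + b * c') (a * b' + b * d') (c * a' + d * c') (c * b' + d * d') := by
  unfold cornerMat
  ext i j
  fin_cases i <;> fin_cases j <;> simp [Matrix.mul_apply, Fin.sum_univ_three]

theorem cornerMat_one : cornerMat (1 : R) 0 0 1 = 1 := by
  unfold cornerMat
  ext i j
  fin_cases i <;> fin_cases j <;> simp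

theorem cornerMat_det (a b c d : R) : (cornerMat a b c d).det = a * d - b * c := by
  rw [cornerMat, Matrix.det_fin_three]
  simp

theorem cornerMat_map {S : Type*} [CommRing S] {F : Type*} [FunLike F R S] [RingHomClass F R S]
    (f : F) (a b c d : R) :
    (cornerMat a b c d).map f = cornerMat (f a) (f b) (f c) (f d) := by
  unfold cornerMat
  ext i j
  fin_cases i <;> fin_cases j <;> simp

theorem cornerMat_transpose (a b c d : R) : (cornerMat a b c d)ᵀ = cornerMat a c b d := by
  unfold cornerMat
  ext i j
  fin_cases i <;> fin_cases j <;> rfl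

/-- The `3 × 3` matrix `(a, 0, b; 0, 0, 0; c, 0, d)`. -/
def cornerMatZero (a b c d : R) : Matrix (Fin 3) (Fin 3) R := !![a, 0, b; 0, 0, 0; c, 0, d]

theorem cornerMatZero_mul (a b c d a' b' c' d' : R) :
    cornerMatZero a b c d * cornerMat a' b' c' d' =
      cornerMatZero (a * a' + b * c') (a * b' + b * d') (c * a' + d * c') (c * b' + d * d') := by
  unfold cornerMat cornerMatZero
  ext i j
  fin_cases i <;> fin_cases j <;> simp [Matrix.mul_apply, Fin.sum_univ_three]

theorem cornerMatZero_map {S : Type*} [CommRing S] {F : Type*} [FunLike F R S]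
    [RingHomClass F R S] (f : F) (a b c d : R) :
    (cornerMatZero a b c d).map f = cornerMatZero (f a) (f b) (f c) (f d) := by
  unfold cornerMatZero
  ext i j
  fin_cases i <;> fin_cases j <;> simp

theorem cornerMatZero_transpose (a b c d : R) :
    (cornerMatZero a b c d)ᵀ = cornerMatZero a c b d := by
  unfold cornerMatZero
  ext i j
  fin_cases i <;> fin_cases j <;> rfl

/-- An Iwasawa decomposition in universal form: primed letters stand for conjugates, and the suffix
i for inverses. The Bezout relation completes the row with entries Y, X to an isometry whose entries
are, up to sign, 0, 1, S, T, X, Y and their conjugates. -/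
theorem matQ_mul_iotaMat_diagonal (a e S T S' T' X Y X' Y' Xi' Yi : R)
    (h1 : S * X + T * Y = 1) (h2 : X' * Xi' = 1) (h3 : Y * Yi = 1) (ha : a = X * Yi)
    (he : e = Y' * Xi') (h4 : S' * X' + T' * Y' = 1) :
    matQ R * iotaMat 1 !![a, 0; 0, e] =
      Matrix.fromBlocks (cornerMat X 0 0 Y')
        (cornerMatZero 0 (T * Y * Yi) (T' * Y' * Xi') 0) 0 (cornerMat Xi' 0 0 Yi) *
      Matrix.fromBlocks
        !![0, S, -T; 1, 0, 0; 0, 0, 0] !![0, 0, 0; 0, 0, 0; 0, -T', -S']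
        !![0, 0, 0; 0, 0, 0; 0, Y, X] !![0, X', -Y'; 1, 0, 0; 0, 0, 0] := by
  unfold matQ iotaMat cornerMat cornerMatZero
  subst ha he
  rw [← Matrix.fromBlocks_one]
  simp only [Matrix.toBlocks_fromBlocks₁₁, Matrix.toBlocks_fromBlocks₁₂,
    Matrix.toBlocks_fromBlocks₂₁, Matrix.toBlocks_fromBlocks₂₂]
  rw [Matrix.fromBlocks_multiply, Matrix.fromBlocks_multiply]
  congr 1 <;> ext i j <;> fin_cases i <;> fin_cases j <;>
    simp [blockThree, Matrix.vecHead, Matrix.vecTail, mul_assoc]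
  · linear_combination -h1 - T * Y * h3
  · linear_combination -X * T * h3
  · linear_combination -Y' * T' * h2
  · linear_combination Y' * Xi' * h4 - Y' * S' * h2
  · linear_combination -h3
  · ring
  · linear_combination -h2
  · ring

end MatrixIdentities

/-! ### Left invariance of the section and its value on diagonal elements -/

section SectionValue

variable {q : ℕ} [Fact q.Prime] {L : Type*} [Field L] [NumberField L]
variable {c : L ≃ₐ[ℚ] L} {θ : 𝓞 L} {t n : ℤ}

theorem isSimilitude_embedTwo {k : Matrix (Fin 2) (Fin 2) ℚ_[q]} (hk : k.det = 1) :
    IsSimilitude q c (formJ q L 2) (embedTwo (k.map (algebraMap ℚ_[q] (LocalAlg q L)))) 1 := by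
  have hdet : algebraMap ℚ_[q] (LocalAlg q L) (k 0 0) * algebraMap ℚ_[q] (LocalAlg q L) (k 1 1) -
      algebraMap ℚ_[q] (LocalAlg q L) (k 0 1) * algebraMap ℚ_[q] (LocalAlg q L) (k 1 0) = 1 := by
    rw [← map_mul, ← map_mul, ← map_sub, ← Matrix.det_fin_two, hk, map_one]
  have e : conjT q c (embedTwo (k.map (algebraMap ℚ_[q] (LocalAlg q L)))) =
      (embedTwo (k.map (algebraMap ℚ_[q] (LocalAlg q L))))ᵀ := by
    unfold embedTwo conjT
    rw [Matrix.fromBlocks_map]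
    congr 2 <;> ext i j <;> fin_cases i <;> fin_cases j <;>
      simp only [Matrix.map_apply, Matrix.of_apply,
        Matrix.cons_val', Matrix.cons_val_zero, Matrix.cons_val_one, Matrix.cons_val_fin_one,
        Fin.zero_eta, Fin.mk_one, map_zero, map_one, AlgEquiv.commutes]
  unfold IsSimilitude
  rw [e, Units.val_one, one_smul]
  exact embedTwo_symplectic hdet

/-- One writes ι(1, κx) = ι(κ, κ) ι(1, x) ι(κ⁻¹, 1), with κ embedded in the second and fourth
coordinates of GU(2,2). The first factor passes through Q to a parabolic element with determinant 1
on the Levi, and the last one is in the maximal compact subgroup. -/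
theorem sectionValue_mul_left (h : IsQuadGen c θ t n) {Λ : (LocalAlg q L)ˣ →* Circle}
    (hΛ : ∀ u : (LocalAlg q L)ˣ, (u : LocalAlg q L) ∈ localIntegers q L →
      ((u⁻¹ : (LocalAlg q L)ˣ) : LocalAlg q L) ∈ localIntegers q L → Λ u = 1) (s : ℂ)
    {k : GL (Fin 2) ℚ_[q]} (hk : k ∈ specialCompact q) {x x' : UOne q c}
    (hx : x'.1.1.1 = k.1.map (algebraMap ℚ_[q] (LocalAlg q L)) * x.1.1.1) :
    sectionValue c Λ s x' = sectionValue c Λ s x := by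
  set κ := k.1.map (algebraMap ℚ_[q] (LocalAlg q L)) with hκ
  set κ' := (k⁻¹).1.map (algebraMap ℚ_[q] (LocalAlg q L)) with hκ'
  have hκκ : κ * κ' = 1 := by
    rw [hκ, hκ', ← Matrix.map_mul, ← Units.val_mul, mul_inv_cancel, Units.val_one]
    exact Matrix.map_one _ (map_zero _) (map_one _)
  have hκc : ∀ i j, localConj q c (κ i j) = κ i j := fun i j => AlgEquiv.commutes _ _
  have hint : ∀ i j, κ' i j ∈ localIntegers q L := fun i j =>
    h.algebraMap_mem.mpr ((mem_maxCompact_iff.mp (inv_mem hk).1).1 i j)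
  have hdet : κ 0 0 * κ 1 1 - κ 0 1 * κ 1 0 = 1 := by
    have h1 : κ.det = 1 := by
      have := (RingHom.map_det (algebraMap ℚ_[q] (LocalAlg q L)) k.1).symm
      rw [hk.2, map_one] at this
      exact this
    rwa [Matrix.det_fin_two] at h1
  obtain ⟨K, hK, hKval⟩ := exists_compactGUThree
    (M := iotaMat (embedTwo κ') (1 : Matrix (Fin 2) (Fin 2) (LocalAlg q L)))
    ((isSimilitude_embedTwo (inv_mem hk).2).iotaMat (IsSimilitude.one (c := c) _))
    (iotaMat_mem (fun i j => by
      unfold embedTwo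
      rcases i with i | i <;> rcases j with j | j <;> fin_cases i <;> fin_cases j <;>
        simp [zero_mem, one_mem, hint]) one_entries_mem)
  let A : GL (Fin 3) (LocalAlg q L) :=
    ⟨cornerMat (κ 0 0) (-κ 0 1) (-κ 1 0) (κ 1 1), cornerMat (κ 1 1) (κ 0 1) (κ 1 0) (κ 0 0),
      by
        rw [cornerMat_mul, ← cornerMat_one]
        congr 1 <;> first | ring1 | linear_combination hdet,
      by
        rw [cornerMat_mul, ← cornerMat_one]
        congr 1 <;> first | ring1 | linear_combination hdet⟩
  -- The upper right block of the parabolic element times the inverse of its lower right block.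
  let b : Matrix (Fin 3) (Fin 3) (LocalAlg q L) :=
    cornerMatZero (κ 0 0 * κ 0 1) (-(κ 0 1 * κ 1 0)) (-(κ 0 1 * κ 1 0)) (κ 1 0 * κ 1 1)
  have hb : conjT q c b = b := by
    simp only [b, conjT, cornerMatZero_map, cornerMatZero_transpose, map_mul, map_neg, hκc]
  have hAi : conjT q c (A⁻¹).1 = cornerMat (κ 1 1) (κ 1 0) (κ 0 1) (κ 0 0) := by
    change conjT q c (cornerMat (κ 1 1) (κ 0 1) (κ 1 0) (κ 0 0)) = _
    simp only [conjT, cornerMat_map, cornerMat_transpose, hκc]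
  have hNM : siegelN q b * siegelM q c A 1 =
      Matrix.fromBlocks (cornerMat (κ 0 0) (-κ 0 1) (-κ 1 0) (κ 1 1))
        (cornerMatZero (κ 0 1) 0 0 (κ 1 0)) 0 (cornerMat (κ 1 1) (κ 1 0) (κ 0 1) (κ 0 0)) := by
    unfold siegelN siegelM
    rw [hAi, Units.val_one, one_smul, Matrix.fromBlocks_multiply]
    simp only [Matrix.one_mul, Matrix.mul_zero, add_zero, Matrix.zero_mul, zero_add]
    congr 1
    rw [cornerMatZero_mul]
    congr 1
    · linear_combination κ 0 1 * hdet
    · ring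
    · ring
    · linear_combination κ 1 0 * hdet
  have hQ : matQ (LocalAlg q L) * iotaMat (embedTwo κ) κ =
      Matrix.fromBlocks (cornerMat (κ 0 0) (-κ 0 1) (-κ 1 0) (κ 1 1))
        (cornerMatZero (κ 0 1) 0 0 (κ 1 0)) 0 (cornerMat (κ 1 1) (κ 1 0) (κ 0 1) (κ 0 0)) *
          matQ (LocalAlg q L) := matQ_mul_iotaMat_embedTwo κ
  have hmat : (elemQ q c * iota q c (isometryPair c 1 x')).1.1 = siegelN q b * siegelM q c A 1 *
      (elemQ q c * iota q c (isometryPair c 1 x) * K).1.1 := by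
    change _ = _ * ((elemQ q c * iota q c (isometryPair c 1 x)).1.1 * K.1.1)
    rw [elemQ_mul_iota_val, elemQ_mul_iota_val, hKval, Matrix.mul_assoc (matQ _), ← iotaMat_mul,
      Matrix.one_mul, Matrix.mul_one, hNM, ← Matrix.mul_assoc, ← hQ,
      Matrix.mul_assoc, ← iotaMat_mul, embedTwo_mul, hκκ, embedTwo_one, hx]
  have hdetA : A.1.det = 1 := by
    change (cornerMat (κ 0 0) (-κ 0 1) (-κ 1 0) (κ 1 1)).det = 1
    rw [cornerMat_det]
    linear_combination hdet
  have hchar : siegelChar Λ s A 1 = 1 := by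
    have hd : Matrix.GeneralLinearGroup.det A = 1 := Units.ext hdetA
    unfold siegelChar
    rw [hd, hdetA]
    simp
  unfold sectionValue
  rw [unramifiedSection_mul h.conj_conj hΛ s hb hmat, hchar, one_mul,
    unramifiedSection_mul_compact _ _ _ hK]

/-- The value of the section at the diagonal matrix with entries `x / y` and
`conj (y / x)`, where `x` and `y` are coprime. -/
theorem sectionValue_diagonal (h : IsQuadGen c θ t n) {Λ : (LocalAlg q L)ˣ →* Circle}
    (hΛ : ∀ u : (LocalAlg q L)ˣ, (u : LocalAlg q L) ∈ localIntegers q L →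
      ((u⁻¹ : (LocalAlg q L)ˣ) : LocalAlg q L) ∈ localIntegers q L → Λ u = 1) (s : ℂ)
    {x y : (LocalAlg q L)ˣ} {S T : LocalAlg q L} (hx : (x : LocalAlg q L) ∈ localIntegers q L)
    (hy : (y : LocalAlg q L) ∈ localIntegers q L) (hS : S ∈ localIntegers q L)
    (hT : T ∈ localIntegers q L) (hST : S * x + T * y = 1) {δ : UOne q c}
    (hδ : δ.1.1.1 = !![((x * y⁻¹ : (LocalAlg q L)ˣ) : LocalAlg q L), 0;
      0, localConj q c ((y * x⁻¹ : (LocalAlg q L)ˣ) : LocalAlg q L)]) :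
    sectionValue c Λ s δ =
      (‖Algebra.norm ℚ_[q] ((x * y : (LocalAlg q L)ˣ) : LocalAlg q L)‖ : ℂ) ^ (3 * (s + 1 / 2)) *
        (Λ (x * Units.map (localConj q c : LocalAlg q L →* LocalAlg q L) y) : ℂ) := by
  set X := (x : LocalAlg q L) with hX
  set Y := (y : LocalAlg q L) with hY
  set Xi := ((x⁻¹ : (LocalAlg q L)ˣ) : LocalAlg q L) with hXi
  set Yi := ((y⁻¹ : (LocalAlg q L)ˣ) : LocalAlg q L) with hYi
  have hXX : X * Xi = 1 := x.mul_inv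
  have hYY : Y * Yi = 1 := y.mul_inv
  have cXX : localConj q c X * localConj q c Xi = 1 := by rw [← map_mul, hXX, map_one]
  have cYY : localConj q c Y * localConj q c Yi = 1 := by rw [← map_mul, hYY, map_one]
  have cST : localConj q c S * localConj q c X + localConj q c T * localConj q c Y = 1 := by
    rw [← map_mul, ← map_mul, ← map_add, hST, map_one]
  -- The Levi part has determinant x conj(y), which accounts for the value.
  let A : GL (Fin 3) (LocalAlg q L) :=
    ⟨cornerMat X 0 0 (localConj q c Y), cornerMat Xi 0 0 (localConj q c Yi),
      by
        rw [cornerMat_mul, ← cornerMat_one, hXX, cYY]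
        simp,
      by
        rw [cornerMat_mul, ← cornerMat_one, mul_comm Xi X,
          mul_comm (localConj q c Yi) (localConj q c Y), hXX, cYY]
        simp⟩
  let b : Matrix (Fin 3) (Fin 3) (LocalAlg q L) :=
    cornerMatZero 0 (T * Y) (localConj q c (T * Y)) 0
  have hb : conjT q c b = b := by
    simp only [b, conjT, cornerMatZero_map, cornerMatZero_transpose, h.localConj_localConj,
      map_zero]
  have hAi : conjT q c (A⁻¹).1 = cornerMat (localConj q c Xi) 0 0 Yi := by
    change conjT q c (cornerMat Xi 0 0 (localConj q c Yi)) = _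
    simp only [conjT, cornerMat_map, cornerMat_transpose, h.localConj_localConj, map_zero]
  let M : Matrix (Fin 3 ⊕ Fin 3) (Fin 3 ⊕ Fin 3) (LocalAlg q L) := Matrix.fromBlocks
    !![0, S, -T; 1, 0, 0; 0, 0, 0] !![0, 0, 0; 0, 0, 0; 0, -localConj q c T, -localConj q c S]
    !![0, 0, 0; 0, 0, 0; 0, Y, X] !![0, localConj q c X, -localConj q c Y; 1, 0, 0; 0, 0, 0]
  have hM : ∀ i j, M i j ∈ localIntegers q L := by
    have hx' := localConj_mem q c hx
    have hy' := localConj_mem q c hy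
    have hS' := localConj_mem q c hS
    have hT' := localConj_mem q c hT
    intro i j
    rcases i with i | i <;> rcases j with j | j <;> fin_cases i <;> fin_cases j <;>
      first
        | exact zero_mem _
        | exact one_mem _
        | exact hx
        | exact hy
        | exact hS
        | exact neg_mem hT
        | exact hx'
        | exact neg_mem hy'
        | exact neg_mem hS'
        | exact neg_mem hT'
  have hpart : HasSiegelPart c (elemQ q c * iota q c (isometryPair c 1 δ)) A 1 := by
    refine hasSiegelPart_of_eq h ?_ hb hM ?_
    · rw [elemQ_mul_iota_val]
      have := (matQ_similitude q c).mul ((IsSimilitude.one (c := c) (formJ q L 2)).iotaMat δ.2)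
      rwa [mul_one] at this
    · rw [elemQ_mul_iota_val, hδ]
      have hNM : siegelN q b * siegelM q c A 1 =
          Matrix.fromBlocks (cornerMat X 0 0 (localConj q c Y))
            (cornerMatZero 0 (T * Y * Yi)
              (localConj q c T * localConj q c Y * localConj q c Xi) 0) 0
            (cornerMat (localConj q c Xi) 0 0 Yi) := by
        unfold siegelN siegelM
        rw [hAi, Units.val_one, one_smul, Matrix.fromBlocks_multiply]
        simp only [Matrix.one_mul, Matrix.mul_zero, add_zero, Matrix.zero_mul, zero_add]
        congr 1
        rw [cornerMatZero_mul, map_mul]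
        simp
      rw [hNM]
      refine matQ_mul_iotaMat_diagonal _ _ S T _ _ X Y _ _ _ Yi hST cXX hYY ?_ ?_ cST
      · rw [Units.val_mul]
      · rw [Units.val_mul, map_mul]
  have hdet : Matrix.GeneralLinearGroup.det A =
      x * Units.map (localConj q c : LocalAlg q L →* LocalAlg q L) y := by
    apply Units.ext
    change (cornerMat X 0 0 (localConj q c Y)).det = X * localConj q c Y
    rw [cornerMat_det]
    ring
  have hdet' : Algebra.norm ℚ_[q] A.1.det = Algebra.norm ℚ_[q] (X * Y) := by
    have : A.1.det = X * localConj q c Y := congrArg Units.val hdet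
    rw [this, map_mul, h.norm_localConj, map_mul]
  unfold sectionValue
  rw [unramifiedSection_eq hΛ s hpart, siegelChar, hdet, hdet', Units.val_mul, ← hX, ← hY,
    Units.val_one, norm_one, Complex.ofReal_one, Complex.one_cpow, one_mul]

end SectionValue

/-! ### The section at an arbitrary element of U(1,1) -/

section GeneralValue

variable {q : ℕ} [Fact q.Prime] {L : Type*} [Field L] [NumberField L]
variable {c : L ≃ₐ[ℚ] L} {θ : 𝓞 L} {t n : ℤ}

variable (q L) in
/-- The inclusion of `ℚ_q^×` into `L_q^×`. -/
noncomputable abbrev baseUnit : ℚ_[q]ˣ →* (LocalAlg q L)ˣ :=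
  Units.map (algebraMap ℚ_[q] (LocalAlg q L)).toMonoidHom

theorem baseUnit_val (a : ℚ_[q]ˣ) :
    (baseUnit q L a : LocalAlg q L) = algebraMap ℚ_[q] (LocalAlg q L) a := rfl

theorem exists_uOne (h : IsQuadGen c θ t n) {a : LocalAlg q L} {M : GL (Fin 2) ℚ_[q]}
    {g : GL (Fin 2) (LocalAlg q L)} (hg : g.1 = a • M.1.map (algebraMap ℚ_[q] (LocalAlg q L)))
    (hM : Algebra.norm ℚ_[q] a * M.1.det = 1) : ∃ κ : UOne q c, κ.1.1 = g := by
  have hs : IsSimilitude q c (formJOne q L) g.1 1 := by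
    rw [hg]
    exact isSimilitude_smul_map h a M.1 1 (by simpa using hM)
  exact ⟨⟨⟨g, 1, hs⟩, hs⟩, rfl⟩

theorem mul_localConj_unit (h : IsQuadGen c θ t n) (x : (LocalAlg q L)ˣ) :
    ∃ r : ℚ_[q]ˣ, x * Units.map (localConj q c : LocalAlg q L →* LocalAlg q L) x =
      baseUnit q L r :=
  ⟨Units.mk0 _ (norm_ne_zero_of_unit x), Units.ext (h.mul_localConj (x : LocalAlg q L))⟩

/-- The value of `Υ(Q ι(1, h)) Λ⁻¹(det h)` at `h = l M` with `M` primitive, in terms of a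
coprime fraction representing `l det M` up to units. -/
theorem sectionValue_eq (h : IsQuadGen c θ t n) {Λ : (LocalAlg q L)ˣ →* Circle}
    (hΛ : ∀ x : ℚ_[q]ˣ, Λ (baseUnit q L x) = 1)
    (hΛ' : ∀ u : (LocalAlg q L)ˣ, (u : LocalAlg q L) ∈ localIntegers q L →
      ((u⁻¹ : (LocalAlg q L)ˣ) : LocalAlg q L) ∈ localIntegers q L → Λ u = 1) (s : ℂ)
    {g : UOne q c} {l : (LocalAlg q L)ˣ} {M : GL (Fin 2) ℚ_[q]} (hM : IsPrimitiveMat M.1)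
    (hg : g.1.1.1 = (l : LocalAlg q L) • M.1.map (algebraMap ℚ_[q] (LocalAlg q L)))
    {x y ε : (LocalAlg q L)ˣ} {S T : LocalAlg q L} (hx : (x : LocalAlg q L) ∈ localIntegers q L)
    (hy : (y : LocalAlg q L) ∈ localIntegers q L) (hS : S ∈ localIntegers q L)
    (hT : T ∈ localIntegers q L) (hST : S * x + T * y = 1) (hε : ε ∈ localUnits q L)
    (hlx : l * baseUnit q L (Matrix.GeneralLinearGroup.det M) * y = ε * x) :
    sectionValue c Λ s g * ((Λ (Matrix.GeneralLinearGroup.det g.1.1) : ℂ))⁻¹ =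
      (‖Algebra.norm ℚ_[q] ((x * y : (LocalAlg q L)ˣ) : LocalAlg q L)‖ : ℂ) ^ (3 * (s + 1 / 2)) *
        ((Λ l : ℂ))⁻¹ := by
  obtain ⟨k₁, hk₁, k₂, hk₂, e, he, hMe⟩ := hM.exists_cartan
  have he0 : e ≠ 0 := by rw [← norm_ne_zero_iff, he]; exact one_ne_zero
  set eu : ℚ_[q]ˣ := Units.mk0 e he0 with heu
  set D := Matrix.GeneralLinearGroup.det M with hD
  have hreal : ∀ k ∈ specialCompact q, ∃ κ : UOne q c,
      κ.1.1 = Matrix.GeneralLinearGroup.map (algebraMap ℚ_[q] (LocalAlg q L)) k := by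
    intro k hk
    refine exists_uOne h (a := 1) (M := k) ?_ (by rw [map_one, one_mul, hk.2])
    rw [one_smul]
    rfl
  obtain ⟨κ₁, hκ₁⟩ := hreal k₁ hk₁
  obtain ⟨κ₂, hκ₂⟩ := hreal k₂ hk₂
  have hκ₁' : κ₁.1.1.1 = k₁.1.map (algebraMap ℚ_[q] (LocalAlg q L)) := congrArg Units.val hκ₁
  have hκ₂' : κ₂.1.1.1 = k₂.1.map (algebraMap ℚ_[q] (LocalAlg q L)) := congrArg Units.val hκ₂
  have hκ₂K : κ₂ ∈ compactUOne q c := by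
    change κ₂.1.1 ∈ integralGL q L (Fin 2)
    rw [hκ₂, mem_integralGL_iff, ← map_inv]
    exact ⟨fun i j => h.algebraMap_mem.mpr ((mem_maxCompact_iff.mp hk₂.1).1 i j),
      fun i j => h.algebraMap_mem.mpr ((mem_maxCompact_iff.mp (inv_mem hk₂.1)).1 i j)⟩
  -- Both Cartan factors lift to U(1,1) because their determinant is 1; removing them leaves the
  -- diagonal element l · diag(det M / e, e).
  set δ : UOne q c := κ₁⁻¹ * g * κ₂⁻¹ with hδ
  have e1 : g = κ₁ * (δ * κ₂) := by rw [hδ]; group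
  have hsec : sectionValue c Λ s g = sectionValue c Λ s δ := by
    rw [← sectionValue_mul_compact s δ κ₂ hκ₂K]
    refine sectionValue_mul_left h hΛ' s hk₁ ?_
    rw [← hκ₁']
    exact congrArg (fun z : UOne q c => z.1.1.1) e1
  set N : Matrix (Fin 2) (Fin 2) (LocalAlg q L) :=
    (l : LocalAlg q L) • (!![(D : ℚ_[q]) / e, 0; 0, e]).map (algebraMap ℚ_[q] (LocalAlg q L))
    with hN
  have hNg : g.1.1.1 = κ₁.1.1.1 * N * κ₂.1.1.1 := by
    have : M.1.det = (D : ℚ_[q]) := rfl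
    rw [hg, hMe, this, Matrix.map_mul, Matrix.map_mul, ← hκ₁', ← hκ₂', hN, Matrix.mul_smul,
      Matrix.smul_mul]
  have hδN : δ.1.1.1 = N := by
    have h1 : δ.1.1 = κ₁.1.1⁻¹ * g.1.1 * κ₂.1.1⁻¹ := rfl
    rw [h1, Units.val_mul, Units.val_mul, hNg]
    have h2 : (κ₁.1.1⁻¹).1 * κ₁.1.1.1 = 1 := κ₁.1.1.inv_mul
    have h3 : κ₂.1.1.1 * (κ₂.1.1⁻¹).1 = 1 := κ₂.1.1.mul_inv
    simp only [Matrix.mul_assoc]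
    rw [h3, Matrix.mul_one, ← Matrix.mul_assoc, h2, Matrix.one_mul]
  -- The units ε and e are absorbed in the numerator, so that the first diagonal entry l det M / e
  -- is exactly x'/y.
  set x' := ε * (baseUnit q L eu)⁻¹ * x with hx'
  have hx'y : x' * y⁻¹ = l * baseUnit q L (D * eu⁻¹) := by
    rw [map_mul, map_inv, hx', mul_right_comm ε, ← hlx, mul_right_comm, mul_inv_cancel_right,
      mul_assoc]
  have hinv : ((baseUnit q L eu)⁻¹ : (LocalAlg q L)ˣ) ∈ localUnits q L :=
    inv_mem (h.map_mem_localUnits he)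
  have hx'mem : (x' : LocalAlg q L) ∈ localIntegers q L := by
    rw [hx', Units.val_mul, Units.val_mul]
    exact mul_mem (mul_mem hε.1 hinv.1) hx
  set η := ε * (baseUnit q L eu)⁻¹ with hη
  have hηm : η ∈ localUnits q L := mul_mem hε hinv
  have hST' : S * ((η⁻¹ : (LocalAlg q L)ˣ) : LocalAlg q L) * x' + T * y = 1 := by
    rw [← hST, hx', Units.val_mul, mul_assoc S, Units.inv_mul_cancel_left]
  have hd00 : N 0 0 = ((x' * y⁻¹ : (LocalAlg q L)ˣ) : LocalAlg q L) := by
    rw [hx'y, Units.val_mul, baseUnit_val, hN]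
    simp [div_eq_mul_inv, heu]
  have hN01 : N 0 1 = 0 := by simp [hN]
  have hN10 : N 1 0 = 0 := by simp [hN]
  -- Unitarity forces the second diagonal entry to be the conjugate of the inverse of the first.
  have hd11 : N 1 1 = localConj q c ((y * x'⁻¹ : (LocalAlg q L)ˣ) : LocalAlg q L) := by
    have h1 := (isSimilitude_formJOne_iff.mp δ.2).2.1
    change localConj q c (δ.1.1.1 0 0) * δ.1.1.1 1 1 - localConj q c (δ.1.1.1 1 0) * δ.1.1.1 0 1 =
      algebraMap ℚ_[q] (LocalAlg q L) ((1 : ℚ_[q]ˣ) : ℚ_[q]) at h1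
    rw [hδN, hN10, map_zero, zero_mul, sub_zero, hd00, Units.val_one, map_one] at h1
    have h2 : localConj q c ((x' * y⁻¹ : (LocalAlg q L)ˣ) : LocalAlg q L) *
        localConj q c ((y * x'⁻¹ : (LocalAlg q L)ˣ) : LocalAlg q L) = 1 := by
      rw [← map_mul, ← Units.val_mul]
      simp
    calc N 1 1 = N 1 1 * (localConj q c ((x' * y⁻¹ : (LocalAlg q L)ˣ) : LocalAlg q L) *
        localConj q c ((y * x'⁻¹ : (LocalAlg q L)ˣ) : LocalAlg q L)) := by rw [h2, mul_one]
      _ = (localConj q c ((x' * y⁻¹ : (LocalAlg q L)ˣ) : LocalAlg q L) * N 1 1) *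
        localConj q c ((y * x'⁻¹ : (LocalAlg q L)ˣ) : LocalAlg q L) := by ring
      _ = _ := by rw [h1, one_mul]
  have hval := sectionValue_diagonal h hΛ' s hx'mem hy (mul_mem hS hηm.2) hT hST' (δ := δ) (by
    rw [hδN]
    ext i j
    fin_cases i <;> fin_cases j
    exacts [hd00, hN01, hN10, hd11])
  have hnorm : ‖Algebra.norm ℚ_[q] ((x' * y : (LocalAlg q L)ˣ) : LocalAlg q L)‖ =
      ‖Algebra.norm ℚ_[q] ((x * y : (LocalAlg q L)ˣ) : LocalAlg q L)‖ := by
    rw [hx', mul_assoc η, Units.val_mul, map_mul, norm_mul, (h.mem_localUnits_iff.mp hηm).2,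
      one_mul]
  -- The product y conj(y) is rational, and Λ is trivial on ℚ_q^×.
  have hΛy : Λ (Units.map (localConj q c : LocalAlg q L →* LocalAlg q L) y) = (Λ y)⁻¹ := by
    obtain ⟨r, hr⟩ := mul_localConj_unit h y
    have h1 := congrArg Λ hr
    rw [map_mul, hΛ] at h1
    exact eq_inv_of_mul_eq_one_right h1
  have hΛx : Λ (x' * Units.map (localConj q c : LocalAlg q L →* LocalAlg q L) y) = Λ l := by
    have h1 := congrArg Λ hx'y
    rw [map_mul Λ x', map_mul Λ l, hΛ, mul_one, map_inv] at h1
    rw [map_mul Λ x', hΛy, h1]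
  -- The section contributes Λ(x' conj(y)) = Λ(x'/y) = Λ(l), while Λ(det g) = Λ(l)²; the quotient is
  -- Λ(l)⁻¹.
  have hdet : Matrix.GeneralLinearGroup.det g.1.1 = l ^ 2 * baseUnit q L D := by
    apply Units.ext
    change g.1.1.1.det = (l : LocalAlg q L) ^ 2 * algebraMap ℚ_[q] (LocalAlg q L) M.1.det
    rw [hg, Matrix.det_smul, Fintype.card_fin]
    congr 1
    exact (RingHom.map_det (algebraMap ℚ_[q] (LocalAlg q L)) M.1).symm
  rw [hsec, hval, hnorm, hΛx, hdet, map_mul, hΛ, mul_one, map_pow, mul_assoc]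
  congr 1
  have hl0 : (Λ l : ℂ) ≠ 0 := Circle.coe_ne_zero _
  rw [Circle.coe_pow]
  field_simp

end GeneralValue

/-! ### Integrals of functions invariant under an open subgroup -/

section CosetSum

open MeasureTheory

/-- Each coset is a translate of K and has measure 1, so the measure pushed forward to the index set
is the counting measure. -/
theorem integral_eq_tsum_of_cosets {G : Type*} [Group G] [TopologicalSpace G] [ContinuousMul G]
    [MeasurableSpace G] [BorelSpace G] (μ : Measure G) [μ.IsMulLeftInvariant] {K : Subgroup G}
    (hK : IsOpen (K : Set G)) (hμ : μ (K : Set G) = 1) {I : Type*} [Countable I] (τ : I → G)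
    (hτ : ∀ g, ∃! i, (τ i)⁻¹ * g ∈ K) {f : G → ℂ} (hf : ∀ g, ∀ k ∈ K, f (g * k) = f g) :
    (Summable (fun i => f (τ i)) → Integrable f μ) ∧
      (Integrable f μ → ∫ g, f g ∂μ = ∑' i, f (τ i)) := by
  choose π hπ hπ' using hτ
  let _ : MeasurableSpace I := ⊤
  have hpre : ∀ i, π ⁻¹' {i} = (fun g => (τ i)⁻¹ * g) ⁻¹' (K : Set G) := by
    intro i
    ext g
    constructor
    · rintro rfl
      exact hπ g
    · intro hg
      exact (hπ' g i hg).symm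
  have hmeas : Measurable π := by
    refine measurable_to_countable' fun i => ?_
    rw [hpre]
    exact (hK.preimage (continuous_const_mul _)).measurableSet
  have hmap : μ.map π = Measure.count := by
    refine Measure.ext_of_singleton fun i => ?_
    rw [Measure.map_apply hmeas (measurableSet_singleton i), hpre, measure_preimage_mul, hμ,
      Measure.count_singleton]
  have hfπ : f = (fun i => f (τ i)) ∘ π := by
    funext g
    have := hf (τ (π g)) _ (hπ g)
    rw [mul_inv_cancel_left] at this
    exact this
  have hsm : AEStronglyMeasurable (fun i => f (τ i)) (μ.map π) :=
    (measurable_from_top : Measurable fun i => f (τ i)).aestronglyMeasurable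
  have hiff : Integrable f μ ↔ Integrable (fun i => f (τ i)) Measure.count := by
    rw [← hmap, integrable_map_measure hsm hmeas.aemeasurable, ← hfπ]
  refine ⟨fun hs => hiff.mpr (integrable_count_iff.mpr hs.norm), fun hi => ?_⟩
  have h1 : ∫ g, f g ∂μ = ∫ i, f (τ i) ∂(μ.map π) := by
    rw [integral_map hmeas.aemeasurable hsm]
    exact congrArg (fun F => ∫ g, F g ∂μ) hfπ
  rw [h1, hmap, integral_countable (hiff.mp hi)]
  simp

end CosetSum

/-! ### Primitive matrices and the uniqueness of h = l·M -/

section Primitive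

variable {q : ℕ} [Fact q.Prime] {L : Type*} [Field L] [NumberField L]
variable {c : L ≃ₐ[ℚ] L} {θ : 𝓞 L} {t n : ℤ}

instance continuousMul_uOne : ContinuousMul (UOne q c) := by
  have : ContinuousMul (GL (Fin 2) (LocalAlg q L)) :=
    inferInstanceAs (ContinuousMul (Matrix (Fin 2) (Fin 2) (LocalAlg q L))ˣ)
  have : ContinuousMul (GUOne q c) := (GUOne q c).toSubmonoid.continuousMul
  exact (UOne q c).toSubmonoid.continuousMul

theorem norm_mul_entries_le_one {x y : Matrix (Fin 2) (Fin 2) ℚ_[q]} (hx : ∀ i j, ‖x i j‖ ≤ 1)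
    (hy : ∀ i j, ‖y i j‖ ≤ 1) (i j : Fin 2) : ‖(x * y) i j‖ ≤ 1 := by
  rw [Matrix.mul_apply, Fin.sum_univ_two]
  refine (IsUltrametricDist.norm_add_le_max _ _).trans (max_le ?_ ?_) <;> rw [norm_mul]
  exacts [mul_le_one₀ (hx _ _) (norm_nonneg _) (hy _ _),
    mul_le_one₀ (hx _ _) (norm_nonneg _) (hy _ _)]

theorem norm_mul_entries_lt_one {x y : Matrix (Fin 2) (Fin 2) ℚ_[q]} (hx : ∀ i j, ‖x i j‖ < 1)
    (hy : ∀ i j, ‖y i j‖ ≤ 1) (i j : Fin 2) : ‖(x * y) i j‖ < 1 := by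
  rw [Matrix.mul_apply, Fin.sum_univ_two]
  refine (IsUltrametricDist.norm_add_le_max _ _).trans_lt (max_lt ?_ ?_) <;> rw [norm_mul]
  exacts [(mul_le_of_le_one_right (norm_nonneg _) (hy _ _)).trans_lt (hx _ _),
    (mul_le_of_le_one_right (norm_nonneg _) (hy _ _)).trans_lt (hx _ _)]

theorem IsPrimitiveMat.mul_right {x k : GL (Fin 2) ℚ_[q]} (hx : IsPrimitiveMat x.1)
    (hk : k ∈ maxCompact q) : IsPrimitiveMat (x * k).1 := by
  refine ⟨norm_mul_entries_le_one hx.1 (mem_maxCompact_iff.mp hk).1, ?_⟩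
  by_contra! hne
  have h1 : ∀ i j, ‖(x * k).1 i j‖ < 1 := fun i j =>
    lt_of_le_of_ne (norm_mul_entries_le_one hx.1 (mem_maxCompact_iff.mp hk).1 i j) (hne i j)
  have h2 := norm_mul_entries_lt_one h1 (mem_maxCompact_iff.mp (inv_mem hk)).1
  rw [← Units.val_mul, mul_inv_cancel_right] at h2
  obtain ⟨i, j, hij⟩ := hx.2
  exact (h2 i j).ne hij

theorem IsPrimitiveMat.of_mul_right {x k : GL (Fin 2) ℚ_[q]} (hk : k ∈ maxCompact q)
    (hx : IsPrimitiveMat (x * k).1) : IsPrimitiveMat x.1 := by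
  have := hx.mul_right (inv_mem hk)
  rwa [mul_inv_cancel_right] at this

theorem isPrimitiveMat_heckeRep_iff {d : ℕ} {p : Σ _ : ℕ, ℕ} (hp : p ∈ heckeIndex q d) :
    IsPrimitiveMat (heckeRep (q := q) d p).1 ↔ p ∈ sphereIndex q d := by
  have hq := one_lt_q (q := q)
  obtain ⟨i, b⟩ := p
  have hi : i ≤ d := (mem_heckeIndex.mp hp).1
  have hpow : ∀ m : ℕ, ‖((primeUnit q ^ m : ℚ_[q]ˣ) : ℚ_[q])‖ = 1 ↔ m = 0 := by
    intro m
    rw [norm_primeUnit_pow]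
    constructor
    · intro h1
      have := q_zpow_inj (q := q) (m := -(m : ℤ)) (n := 0) (by simpa using h1)
      omega
    · rintro rfl
      simp
  have hb : ‖(b : ℚ_[q])‖ = 1 ↔ ¬ q ∣ b := by
    have h2 := Padic.norm_int_le_one (p := q) (b : ℤ)
    rw [Int.cast_natCast] at h2
    rw [← Padic.norm_natCast_lt_one_iff, not_lt]
    exact ⟨fun h => h.ge, fun h => le_antisymm h2 h⟩
  have h0 : (0 : ℝ) ≠ 1 := zero_ne_one
  rw [sphereIndex, Finset.mem_filter, IsPrimitiveMat, heckeRep, upperTri_val]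
  constructor
  · rintro ⟨-, h1⟩
    refine ⟨hp, ?_⟩
    simp only [Fin.exists_fin_two, Matrix.of_apply, Matrix.cons_val_zero, Matrix.cons_val_one,
      Matrix.cons_val', Matrix.cons_val_fin_one, hpow, hb, norm_zero, h0, false_or] at h1
    rcases h1 with (h1 | h1) | h1
    · exact Or.inl h1
    · exact Or.inr (Or.inr h1)
    · exact Or.inr (Or.inl (show i = d by omega))
  · rintro ⟨-, h1⟩
    refine ⟨fun i' j' => heckeRep_integral (d := d) (p := ⟨i, b⟩) i' j', ?_⟩
    rcases h1 with h1 | h1 | h1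
    · exact ⟨0, 0, (hpow i).mpr h1⟩
    · exact ⟨1, 1, (hpow (d - i)).mpr (by change i = d at h1; omega)⟩
    · exact ⟨0, 1, hb.mpr h1⟩

/-- Divide by an entry of maximal absolute value. -/
theorem exists_isPrimitiveMat_smul (y : GL (Fin 2) ℚ_[q]) :
    ∃ (r : ℚ_[q]ˣ) (z : GL (Fin 2) ℚ_[q]), IsPrimitiveMat z.1 ∧ y.1 = (r : ℚ_[q]) • z.1 := by
  obtain ⟨p, -, hp⟩ := Finset.exists_max_image (Finset.univ : Finset (Fin 2 × Fin 2))
    (fun p => ‖y.1 p.1 p.2‖) ⟨(0, 0), Finset.mem_univ _⟩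
  have h0 : y.1 p.1 p.2 ≠ 0 := by
    intro h0
    apply (Matrix.GeneralLinearGroup.det y).ne_zero
    change y.1.det = 0
    have : y.1 = 0 := by
      ext i j
      have := hp (i, j) (Finset.mem_univ _)
      rw [h0, norm_zero] at this
      exact norm_le_zero_iff.mp this
    rw [this, Matrix.det_zero]
  set r : ℚ_[q]ˣ := Units.mk0 _ h0 with hr
  refine ⟨r, upperTri r⁻¹ r⁻¹ 0 * y, ⟨fun i j => ?_, p.1, p.2, ?_⟩, ?_⟩
  all_goals
    have hz : (upperTri r⁻¹ r⁻¹ 0 * y).1 = (r : ℚ_[q])⁻¹ • y.1 := by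
      rw [Units.val_mul, upperTri_val]
      ext i j
      fin_cases i <;> simp [Matrix.mul_apply, Fin.sum_univ_two]
    rw [hz]
  · have h1 := hp (i, j) (Finset.mem_univ _)
    rw [Matrix.smul_apply, smul_eq_mul, norm_mul, norm_inv,
      inv_mul_le_iff₀ (norm_pos_iff.mpr r.ne_zero), mul_one]
    exact h1
  · rw [Matrix.smul_apply, smul_eq_mul, hr, Units.val_mk0, inv_mul_cancel₀ h0, norm_one]
  · rw [smul_smul, mul_inv_cancel₀ r.ne_zero, one_smul]

/-- Comparison at a unit entry of y shows that b/a is rational. It is integral because x is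
integral, and a unit because x also has a unit entry. -/
theorem eq_smul_of_smul_map_eq (h : IsQuadGen c θ t n) {a b : (LocalAlg q L)ˣ}
    {x y : Matrix (Fin 2) (Fin 2) ℚ_[q]} (hx : IsPrimitiveMat x) (hy : IsPrimitiveMat y)
    (hxy : (a : LocalAlg q L) • x.map (algebraMap ℚ_[q] (LocalAlg q L)) =
      (b : LocalAlg q L) • y.map (algebraMap ℚ_[q] (LocalAlg q L))) :
    ∃ r : ℚ_[q]ˣ, ‖(r : ℚ_[q])‖ = 1 ∧ b = a * baseUnit q L r ∧ x = (r : ℚ_[q]) • y := by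
  have hent : ∀ i j, (a : LocalAlg q L) * algebraMap ℚ_[q] (LocalAlg q L) (x i j) =
      b * algebraMap ℚ_[q] (LocalAlg q L) (y i j) := fun i j => congrFun (congrFun hxy i) j
  obtain ⟨i, j, hij⟩ := hy.2
  have hy0 : y i j ≠ 0 := by rw [← norm_ne_zero_iff, hij]; exact one_ne_zero
  have hx0 : x i j ≠ 0 := by
    intro h0
    have h1 := hent i j
    rw [h0, map_zero, mul_zero] at h1
    have h2 : algebraMap ℚ_[q] (LocalAlg q L) (y i j) = algebraMap ℚ_[q] (LocalAlg q L) 0 := by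
      rw [map_zero, ← Units.mul_right_eq_zero b, ← h1]
    exact hy0 (h.algebraMap_inj h2)
  set r : ℚ_[q]ˣ := Units.mk0 (x i j / y i j) (div_ne_zero hx0 hy0) with hr
  have hb : b = a * baseUnit q L r := by
    apply Units.ext
    have h1 : algebraMap ℚ_[q] (LocalAlg q L) (y i j) * algebraMap ℚ_[q] _ (y i j)⁻¹ = 1 := by
      rw [← map_mul, mul_inv_cancel₀ hy0, map_one]
    rw [Units.val_mul, baseUnit_val, hr, Units.val_mk0, div_eq_mul_inv, map_mul, ← mul_assoc,
      hent, mul_assoc, h1, mul_one]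
  have hxr : x = (r : ℚ_[q]) • y := by
    ext i' j'
    have h1 := hent i' j'
    rw [hb, Units.val_mul, baseUnit_val, mul_assoc, ← map_mul] at h1
    exact h.algebraMap_inj ((Units.mul_right_inj a).mp h1)
  refine ⟨r, le_antisymm ?_ ?_, hb, hxr⟩
  · rw [hr, Units.val_mk0, norm_div, hij, div_one]
    exact hx.1 i j
  · obtain ⟨i', j', h1⟩ := hx.2
    rw [hxr, Matrix.smul_apply, smul_eq_mul, norm_mul] at h1
    calc (1 : ℝ) = ‖(r : ℚ_[q])‖ * ‖y i' j'‖ := h1.symm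
      _ ≤ ‖(r : ℚ_[q])‖ := mul_le_of_le_one_right (norm_nonneg _) (hy.1 i' j')

theorem mem_compactUOne_of_eq (h : IsQuadGen c θ t n) {κ : UOne q c} {ε : (LocalAlg q L)ˣ}
    {k : GL (Fin 2) ℚ_[q]} (hε : ε ∈ localUnits q L) (hk : k ∈ maxCompact q)
    (hκ : κ.1.1.1 = (ε : LocalAlg q L) • k.1.map (algebraMap ℚ_[q] (LocalAlg q L))) :
    κ ∈ compactUOne q c := by
  change κ.1.1 ∈ integralGL q L (Fin 2)
  have hinv : (κ.1.1⁻¹).1 = ((ε⁻¹ : (LocalAlg q L)ˣ) : LocalAlg q L) •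
      (k⁻¹).1.map (algebraMap ℚ_[q] (LocalAlg q L)) := by
    rw [Units.inv_eq_of_mul_eq_one_right]
    rw [hκ, Matrix.smul_mul, Matrix.mul_smul, smul_smul, ← Matrix.map_mul, Units.mul_inv,
      Units.mul_inv, one_smul, Matrix.map_one _ (map_zero _) (map_one _)]
  rw [mem_integralGL_iff, hinv, hκ]
  exact ⟨fun i j => mul_mem hε.1 (h.algebraMap_mem.mpr ((mem_maxCompact_iff.mp hk).1 i j)),
    fun i j => mul_mem hε.2
      (h.algebraMap_mem.mpr ((mem_maxCompact_iff.mp (inv_mem hk)).1 i j))⟩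

/-- Write κ = εz with z primitive. A unit entry of z makes ε integral; since N(ε) det z = 1 with
both factors of absolute value at most 1, both are units. -/
theorem exists_of_mem_compactUOne (h : IsQuadGen c θ t n) {κ : UOne q c}
    (hκ : κ ∈ compactUOne q c) : ∃ ε ∈ localUnits q L, ∃ k ∈ maxCompact q,
      κ.1.1.1 = (ε : LocalAlg q L) • k.1.map (algebraMap ℚ_[q] (LocalAlg q L)) := by
  obtain ⟨a, y, hay, hdet⟩ := h.exists_smul_map κ.2
  obtain ⟨r, z, hz, hyz⟩ := exists_isPrimitiveMat_smul y
  have hint := integralGL_apply_mem (k := κ.1.1) hκ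
  have heq : κ.1.1.1 = ((a * baseUnit q L r : (LocalAlg q L)ˣ) : LocalAlg q L) •
      z.1.map (algebraMap ℚ_[q] (LocalAlg q L)) := by
    rw [hay, hyz, Units.val_mul, baseUnit_val]
    ext i j
    simp [mul_assoc]
  have hdet' : Algebra.norm ℚ_[q] ((a * baseUnit q L r : (LocalAlg q L)ˣ) : LocalAlg q L) *
      z.1.det = 1 := by
    rw [Units.val_mul, baseUnit_val, map_mul, h.norm_algebraMap]
    rw [hyz, Matrix.det_smul, Fintype.card_fin, Units.val_one] at hdet
    linear_combination hdet
  set ε := a * baseUnit q L r with hε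
  have hεO : (ε : LocalAlg q L) ∈ localIntegers q L := by
    obtain ⟨i, j, hij⟩ := hz.2
    have hz0 : z.1 i j ≠ 0 := by rw [← norm_ne_zero_iff, hij]; exact one_ne_zero
    have h1 : (ε : LocalAlg q L) = κ.1.1.1 i j * algebraMap ℚ_[q] (LocalAlg q L) (z.1 i j)⁻¹ := by
      rw [heq, Matrix.smul_apply, Matrix.map_apply, smul_eq_mul, mul_assoc, ← map_mul,
        mul_inv_cancel₀ hz0, map_one, mul_one]
    rw [h1]
    exact mul_mem (hint i j) (h.algebraMap_mem.mpr (by rw [norm_inv, hij, inv_one]))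
  have h1 := norm_le_one q hεO
  have h2 := norm_det_le_of_entries hz.1
  have h3 := congrArg norm hdet'
  rw [norm_mul, norm_one] at h3
  have h4 : ‖Algebra.norm ℚ_[q] (ε : LocalAlg q L)‖ = 1 := by
    nlinarith [norm_nonneg (Algebra.norm ℚ_[q] (ε : LocalAlg q L)), norm_nonneg z.1.det]
  rw [h4, one_mul] at h3
  exact ⟨ε, h.mem_localUnits_iff.mpr ⟨hεO, h4⟩, z, mem_maxCompact_iff.mpr ⟨hz.1, h3⟩, heq⟩

end Primitive

/-! ### Representatives of U(1,1)/K -/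

section Unfolding

variable {q : ℕ} [Fact q.Prime] {L : Type*} [Field L] [NumberField L]
variable {c : L ≃ₐ[ℚ] L} {θ : 𝓞 L} {t n : ℤ}

/-- The elements `rep d i`, for `i : I d`, represent the classes modulo units of the elements
of `L_q^×` whose norm has absolute value `q ^ d`; up to a unit, `q ^ d * rep d i` is a coprime
fraction `x / y` with `|N (x y)| = q ^ (-e d i)`. -/
structure IsUnitReps (q : ℕ) [Fact q.Prime] {L : Type*} [Field L] [NumberField L]
    {I : ℕ → Type} (rep : ∀ d, I d → (LocalAlg q L)ˣ) (e : ∀ d, I d → ℕ) : Prop where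
  norm_rep : ∀ d i, ‖Algebra.norm ℚ_[q] (rep d i : LocalAlg q L)‖ = (q : ℝ) ^ (d : ℤ)
  existsUnique : ∀ (d : ℕ) (x : (LocalAlg q L)ˣ),
    ‖Algebra.norm ℚ_[q] (x : LocalAlg q L)‖ = (q : ℝ) ^ (d : ℤ) →
      ∃! i, x * (rep d i)⁻¹ ∈ localUnits q L
  fraction : ∀ d i, ∃ x y ε : (LocalAlg q L)ˣ, ∃ S ∈ localIntegers q L, ∃ T ∈ localIntegers q L,
    (x : LocalAlg q L) ∈ localIntegers q L ∧ (y : LocalAlg q L) ∈ localIntegers q L ∧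
      S * x + T * y = 1 ∧ ε ∈ localUnits q L ∧
      rep d i * baseUnit q L (primeUnit q ^ d) * y = ε * x ∧
      ‖Algebra.norm ℚ_[q] ((x * y : (LocalAlg q L)ˣ) : LocalAlg q L)‖ = (q : ℝ) ^ (-(e d i : ℤ))

variable {I : ℕ → Type} {rep : ∀ d, I d → (LocalAlg q L)ˣ} {e : ∀ d, I d → ℕ}

/-- A representative l·M is determined up to units by d, the coset of M by GL_2(ℤ_q) and the class
of l; the relation N(l) det M = 1 links |N l| = q^d to |det M| = q^(-d). -/
theorem IsUnitReps.exists_coset (h : IsQuadGen c θ t n) (hr : IsUnitReps q rep e) :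
    ∃ τ : (Σ d, {p // p ∈ sphereIndex q d} × I d) → UOne q c,
      (∀ j, ∃ k ∈ maxCompact q, (τ j).1.1.1 = (rep j.1 j.2.2 : LocalAlg q L) •
        (heckeRep j.1 j.2.1.1 * k).1.map (algebraMap ℚ_[q] (LocalAlg q L))) ∧
      ∀ g, ∃! j, (τ j)⁻¹ * g ∈ compactUOne q c := by
  have hex : ∀ j : (Σ d, {p // p ∈ sphereIndex q d} × I d), ∃ κ : UOne q c,
      ∃ k ∈ maxCompact q, κ.1.1.1 = (rep j.1 j.2.2 : LocalAlg q L) •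
        (heckeRep j.1 j.2.1.1 * k).1.map (algebraMap ℚ_[q] (LocalAlg q L)) := by
    rintro ⟨d, ⟨p, hp⟩, i⟩
    -- The absolute values of N(l) and det M cancel, so a unit in the lower right corner of the
    -- compact factor makes the product exactly 1.
    set u : ℚ_[q]ˣ := (Units.mk0 _ (norm_ne_zero_of_unit (rep d i)) *
      Matrix.GeneralLinearGroup.det (heckeRep d p))⁻¹ with hu
    have hu' : (u : ℚ_[q]) = (Algebra.norm ℚ_[q] (rep d i : LocalAlg q L) *
      (heckeRep (q := q) d p).1.det)⁻¹ := by
      rw [hu, Units.val_inv_eq_inv_val]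
      rfl
    have hnu : ‖(u : ℚ_[q])‖ = 1 := by
      rw [hu', norm_inv, norm_mul, hr.norm_rep, norm_det_heckeRep (sphereIndex_subset d hp),
        ← zpow_add₀ (by linarith [one_lt_q (q := q)])]
      simp
    have hk : upperTri 1 u 0 ∈ maxCompact q :=
      upperTri_mem_maxCompact (by simp) hnu (by simp)
    have hdet : Algebra.norm ℚ_[q] (rep d i : LocalAlg q L) *
        (heckeRep d p * upperTri 1 u 0).1.det = 1 := by
      have h0 : Algebra.norm ℚ_[q] (rep d i : LocalAlg q L) * (heckeRep (q := q) d p).1.det ≠ 0 :=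
        (Units.mk0 _ (norm_ne_zero_of_unit (rep d i)) *
          Matrix.GeneralLinearGroup.det (heckeRep d p)).ne_zero
      have h1 : (upperTri 1 u 0).1.det = u := by
        rw [upperTri_val, Matrix.det_fin_two]
        simp
      rw [Units.val_mul, Matrix.det_mul, h1, ← mul_assoc, hu', mul_inv_cancel₀ h0]
    obtain ⟨κ, hκ⟩ := exists_uOne h (a := (rep d i : LocalAlg q L))
      (M := heckeRep d p * upperTri 1 u 0)
      (g := rep d i • Matrix.GeneralLinearGroup.map (algebraMap ℚ_[q] (LocalAlg q L))
        (heckeRep d p * upperTri 1 u 0)) rfl hdet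
    exact ⟨κ, _, hk, congrArg Units.val hκ⟩
  choose τ k hk hτ using hex
  refine ⟨τ, fun j => ⟨k j, hk j, hτ j⟩, fun g => ?_⟩
  have hprim : ∀ j : (Σ d, {p // p ∈ sphereIndex q d} × I d),
      IsPrimitiveMat (heckeRep j.1 j.2.1.1 * k j).1 := fun j =>
    ((isPrimitiveMat_heckeRep_iff (sphereIndex_subset _ j.2.1.2)).mpr j.2.1.2).mul_right (hk j)
  refine existsUnique_of_exists_of_unique ?_ ?_
  · obtain ⟨a, y, hay, hdet⟩ := h.exists_smul_map g.2
    obtain ⟨r, z, hz, hyz⟩ := exists_isPrimitiveMat_smul y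
    have heq : g.1.1.1 = ((a * baseUnit q L r : (LocalAlg q L)ˣ) : LocalAlg q L) •
        z.1.map (algebraMap ℚ_[q] (LocalAlg q L)) := by
      rw [hay, hyz, Units.val_mul, baseUnit_val]
      ext i j
      simp [mul_assoc]
    have hdet' : Algebra.norm ℚ_[q] ((a * baseUnit q L r : (LocalAlg q L)ˣ) : LocalAlg q L) *
        z.1.det = 1 := by
      rw [Units.val_mul, baseUnit_val, map_mul, h.norm_algebraMap]
      rw [hyz, Matrix.det_smul, Fintype.card_fin, Units.val_one] at hdet
      linear_combination hdet
    set b := a * baseUnit q L r with hb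
    obtain ⟨m, hm⟩ := exists_norm_eq_zpow (Matrix.GeneralLinearGroup.det z)
    change ‖z.1.det‖ = _ at hm
    have hm0 : 0 ≤ m := by
      have h1 := norm_det_le_of_entries hz.1
      rw [hm] at h1
      by_contra hlt
      have := one_lt_zpow₀ (one_lt_q (q := q)) (n := -m) (by omega)
      linarith
    lift m to ℕ using hm0 with d
    obtain ⟨p, hp, k', hk', hzp⟩ := exists_eq_heckeRep_mul hz.1 hm
    -- Right multiplication by GL_2(ℤ_q) preserves primitivity, so the representative of a primitive
    -- matrix lies on the sphere.
    have hpS : p ∈ sphereIndex q d := by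
      rw [← isPrimitiveMat_heckeRep_iff hp]
      rw [hzp] at hz
      exact hz.of_mul_right hk'
    have hbn : ‖Algebra.norm ℚ_[q] (b : LocalAlg q L)‖ = (q : ℝ) ^ (d : ℤ) := by
      have h1 := congrArg norm hdet'
      rw [norm_mul, norm_one, hm, zpow_neg] at h1
      rw [eq_comm]
      exact (eq_of_mul_inv_eq_one h1).symm
    obtain ⟨i, hi, -⟩ := hr.existsUnique d b hbn
    refine ⟨⟨d, ⟨p, hpS⟩, i⟩, ?_⟩
    refine mem_compactUOne_of_eq h hi (mul_mem (inv_mem (hk ⟨d, ⟨p, hpS⟩, i⟩)) hk') ?_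
    have h1 := hτ ⟨d, ⟨p, hpS⟩, i⟩
    set j : (Σ d, {p // p ∈ sphereIndex q d} × I d) := ⟨d, ⟨p, hpS⟩, i⟩ with hj
    have h2 : (τ j).1.1.1 * (((b * (rep d i)⁻¹ : (LocalAlg q L)ˣ) : LocalAlg q L) •
        ((k j)⁻¹ * k').1.map (algebraMap ℚ_[q] (LocalAlg q L))) = g.1.1.1 := by
      rw [h1, heq, Matrix.smul_mul, Matrix.mul_smul, smul_smul, ← Matrix.map_mul,
        ← Units.val_mul, ← Units.val_mul]
      congr 1
      · change ((rep d i * (b * (rep d i)⁻¹) : (LocalAlg q L)ˣ) : LocalAlg q L) = _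
        rw [mul_comm b, mul_inv_cancel_left]
      · congr 2
        change heckeRep d p * k j * ((k j)⁻¹ * k') = z
        rw [hzp]
        group
    change (((τ j).1.1)⁻¹).1 * g.1.1.1 = _
    rw [← h2, ← Matrix.mul_assoc, ← Units.val_mul, inv_mul_cancel, Units.val_one, Matrix.one_mul]
  · intro j j' hj hj'
    have hκ : (τ j)⁻¹ * τ j' ∈ compactUOne q c := by
      have := mul_mem hj (inv_mem hj')
      have h1 : (τ j)⁻¹ * g * ((τ j')⁻¹ * g)⁻¹ = (τ j)⁻¹ * τ j' := by group
      rwa [h1] at this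
    -- If two representatives differ by an element εk' of K, uniqueness of the decomposition l·M up
    -- to ℤ_q^× identifies the cosets of the matrices and the classes of the scalars.
    obtain ⟨ε, hε, k', hk', heq⟩ := exists_of_mem_compactUOne h hκ
    have h1 : (τ j').1.1.1 = (τ j).1.1.1 * ((τ j)⁻¹ * τ j').1.1.1 := by
      have : τ j' = τ j * ((τ j)⁻¹ * τ j') := by group
      exact congrArg (fun z : UOne q c => z.1.1.1) this
    rw [hτ j', heq, hτ j, Matrix.smul_mul, Matrix.mul_smul, smul_smul, ← Matrix.map_mul,
      ← Units.val_mul, ← Units.val_mul] at h1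
    obtain ⟨r, hr1, hr2, hr3⟩ := eq_smul_of_smul_map_eq h (hprim j') ((hprim j).mul_right hk') h1
    obtain ⟨d, ⟨p, hp⟩, i⟩ := j
    obtain ⟨d', ⟨p', hp'⟩, i'⟩ := j'
    have hru := h.map_mem_localUnits hr1
    obtain ⟨rfl, rfl⟩ : d = d' ∧ p = p' := by
      refine heckeRep_inj (sphereIndex_subset _ hp) (sphereIndex_subset _ hp')
        (k := k ⟨d, ⟨p, hp⟩, i⟩ * k' * upperTri r r 0 * (k ⟨d', ⟨p', hp'⟩, i'⟩)⁻¹)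
        (mul_mem (mul_mem (mul_mem (hk _) hk')
          (upperTri_mem_maxCompact hr1 hr1 (by simp))) (inv_mem (hk _))) ?_
      have h4 : heckeRep d' p' * k ⟨d', ⟨p', hp'⟩, i'⟩ =
          heckeRep d p * k ⟨d, ⟨p, hp⟩, i⟩ * k' * upperTri r r 0 := by
        rw [upperTri_center]
        apply Units.ext
        rw [hr3, Units.val_mul (upperTri r r 0), upperTri_val]
        ext a b
        fin_cases a <;> simp [Matrix.mul_apply, Fin.sum_univ_two]
      simp only [← mul_assoc]
      rw [← h4, mul_inv_cancel_right]
    have hii : i = i' := by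
      refine (hr.existsUnique d (rep d i') (hr.norm_rep d i')).unique ?_
        (by rw [mul_inv_cancel]; exact one_mem _)
      have h5 : rep d i' * (rep d i)⁻¹ = ε⁻¹⁻¹ * (baseUnit q L r)⁻¹ := by
        rw [inv_inv, eq_mul_inv_iff_mul_eq, mul_right_comm, ← hr2, mul_comm (rep d i),
          mul_inv_cancel_right]
      rw [h5, inv_inv]
      exact mul_mem hε (inv_mem hru)
    rw [hii]

end Unfolding

/-! ### The zeta integral as a sum over cosets -/

section ZetaSum

open MeasureTheory

variable {q : ℕ} [Fact q.Prime] {L : Type*} [Field L] [NumberField L]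
variable {c : L ≃ₐ[ℚ] L} {θ : 𝓞 L} {t n : ℤ}
variable {I : ℕ → Type} {rep : ∀ d, I d → (LocalAlg q L)ˣ} {e : ∀ d, I d → ℕ}

theorem zetaIntegrand_eq (Λ : (LocalAlg q L)ˣ →* Circle) (W : GUOne q c → ℂ) (g : GUOne q c)
    (s : ℂ) (h : UOne q c) : zetaIntegrand c Λ W g 1 s h =
      sectionValue c Λ s h * ((Λ (Matrix.GeneralLinearGroup.det h.1.1) : ℂ))⁻¹ * W (g * h.1) := by
  unfold zetaIntegrand sectionValue
  ring

theorem mul_smul_map_mul (a b : LocalAlg q L) (x y : Matrix (Fin 2) (Fin 2) ℚ_[q]) :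
    (a • x.map (algebraMap ℚ_[q] (LocalAlg q L))) * (b • y.map (algebraMap ℚ_[q] (LocalAlg q L))) =
      (a * b) • (x * y).map (algebraMap ℚ_[q] (LocalAlg q L)) := by
  rw [Matrix.smul_mul, Matrix.mul_smul, smul_smul, ← Matrix.map_mul]

theorem zetaIntegrand_mul_compact (h : IsQuadGen c θ t n) {Λ : (LocalAlg q L)ˣ →* Circle}
    (hΛ' : ∀ u : (LocalAlg q L)ˣ, (u : LocalAlg q L) ∈ localIntegers q L →
      ((u⁻¹ : (LocalAlg q L)ˣ) : LocalAlg q L) ∈ localIntegers q L → Λ u = 1)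
    {W : GUOne q c → ℂ} {w : GL (Fin 2) ℚ_[q] → ℂ} (hw : ∀ x, ∀ k ∈ maxCompact q, w (x * k) = w x)
    (hW : ∀ (a : (LocalAlg q L)ˣ) (x : GL (Fin 2) ℚ_[q]) (g : GUOne q c),
      g.1.1 = (a : LocalAlg q L) • x.1.map (algebraMap ℚ_[q] (LocalAlg q L)) → W g = w x)
    (g : GUOne q c) (s : ℂ) (y κ : UOne q c) (hκ : κ ∈ compactUOne q c) :
    zetaIntegrand c Λ W g 1 s (y * κ) = zetaIntegrand c Λ W g 1 s y := by
  obtain ⟨ε, hε, k, hk, hεk⟩ := exists_of_mem_compactUOne h hκ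
  obtain ⟨v, hv⟩ := (g * y.1).2
  obtain ⟨a, x, hax, -⟩ := h.exists_smul_map hv
  have hWeq : W (g * (y * κ).1) = W (g * y.1) := by
    rw [hW a x _ hax, hW (a * ε) (x * k) _ ?_, hw x k hk]
    have h1 : (g * (y * κ).1).1.1 = (g * y.1).1.1 * κ.1.1.1 := by
      change g.1.1 * (y.1.1.1 * κ.1.1.1) = g.1.1 * y.1.1.1 * κ.1.1.1
      rw [Matrix.mul_assoc]
    rw [h1, hax, hεk, mul_smul_map_mul, Units.val_mul, Units.val_mul]
  have hdet : Λ (Matrix.GeneralLinearGroup.det κ.1.1) = 1 := by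
    have hd : ∀ k ∈ integralGL q L (Fin 2),
        ((Matrix.GeneralLinearGroup.det k : (LocalAlg q L)ˣ) : LocalAlg q L) ∈
          localIntegers q L := fun k hk => det_mem (integralGL_apply_mem hk)
    refine hΛ' _ (hd κ.1.1 hκ) ?_
    rw [← map_inv]
    exact hd _ (inv_mem hκ)
  have hdet' : Matrix.GeneralLinearGroup.det (y * κ).1.1 =
      Matrix.GeneralLinearGroup.det y.1.1 * Matrix.GeneralLinearGroup.det κ.1.1 :=
    map_mul Matrix.GeneralLinearGroup.det y.1.1 κ.1.1
  rw [zetaIntegrand_eq, zetaIntegrand_eq, sectionValue_mul_compact s y κ hκ, hWeq, hdet', map_mul,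
    hdet, mul_one]

/-- The local zeta integral as a sum over representatives of `U(1,1) / K`. -/
theorem localZeta_eq_tsum (h : IsQuadGen c θ t n) (hr : IsUnitReps q rep e)
    [∀ d, Countable (I d)] {Λ : (LocalAlg q L)ˣ →* Circle}
    (hΛ : ∀ x : ℚ_[q]ˣ, Λ (baseUnit q L x) = 1)
    (hΛ' : ∀ u : (LocalAlg q L)ˣ, (u : LocalAlg q L) ∈ localIntegers q L →
      ((u⁻¹ : (LocalAlg q L)ˣ) : LocalAlg q L) ∈ localIntegers q L → Λ u = 1)
    {W : GUOne q c → ℂ} {w : GL (Fin 2) ℚ_[q] → ℂ} (hw : ∀ x, ∀ k ∈ maxCompact q, w (x * k) = w x)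
    (hW : ∀ (a : (LocalAlg q L)ˣ) (x : GL (Fin 2) ℚ_[q]) (g : GUOne q c),
      g.1.1 = (a : LocalAlg q L) • x.1.map (algebraMap ℚ_[q] (LocalAlg q L)) → W g = w x)
    [MeasurableSpace (UOne q c)] [BorelSpace (UOne q c)]
    (μ : Measure (UOne q c)) [μ.IsMulLeftInvariant]
    (hμ : μ (compactUOne q c : Set (UOne q c)) = 1) (s : ℂ)
    (g : GUOne q c) {a : (LocalAlg q L)ˣ} {x : GL (Fin 2) ℚ_[q]}
    (hg : g.1.1 = (a : LocalAlg q L) • x.1.map (algebraMap ℚ_[q] (LocalAlg q L)))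
    {F : (Σ d, {p // p ∈ sphereIndex q d} × I d) → ℂ}
    (hF : ∀ j, F j = (((q : ℂ) ^ (-(3 * (s + 1 / 2)))) ^ e j.1 j.2.2 * ((Λ (rep j.1 j.2.2) : ℂ))⁻¹)
      * w (x * heckeRep j.1 j.2.1.1)) :
    (Summable F → Integrable (zetaIntegrand c Λ W g 1 s) μ) ∧
      (Integrable (zetaIntegrand c Λ W g 1 s) μ → localZeta c μ Λ W g 1 s = ∑' j, F j) := by
  obtain ⟨τ, hτ, hτ'⟩ := hr.exists_coset h
  have hval : ∀ j, zetaIntegrand c Λ W g 1 s (τ j) = F j := by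
    intro j
    obtain ⟨k, hk, hτk⟩ := hτ j
    obtain ⟨d, ⟨p, hp⟩, i⟩ := j
    simp only at hτk
    have hprim : IsPrimitiveMat (heckeRep d p * k).1 :=
      ((isPrimitiveMat_heckeRep_iff (sphereIndex_subset _ hp)).mpr hp).mul_right hk
    obtain ⟨x', y', ε, S, hS, T, hT, hx', hy', hST, hε, hfr, hn⟩ := hr.fraction d i
    have hWv : W (g * (τ ⟨d, ⟨p, hp⟩, i⟩).1) = w (x * heckeRep d p) := by
      rw [hW (a * rep d i) (x * (heckeRep d p * k)), ← mul_assoc, hw _ k hk]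
      change g.1.1 * (τ ⟨d, ⟨p, hp⟩, i⟩).1.1.1 = _
      rw [hg, hτk, mul_smul_map_mul, Units.val_mul a, Units.val_mul x]
    -- The determinant of M is q^d only up to a unit r, which is moved into the unit ε of the
    -- fraction.
    obtain ⟨r, hr1, hdet⟩ : ∃ r : ℚ_[q]ˣ, ‖(r : ℚ_[q])‖ = 1 ∧
        Matrix.GeneralLinearGroup.det (heckeRep d p * k) = primeUnit q ^ d * r := by
      refine ⟨(primeUnit q ^ d)⁻¹ * Matrix.GeneralLinearGroup.det (heckeRep d p * k), ?_, ?_⟩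
      · have h1 : ‖(Matrix.GeneralLinearGroup.det (heckeRep d p * k) : ℚ_[q])‖ =
            (q : ℝ) ^ (-(d : ℤ)) := by
          change ‖(heckeRep d p * k).1.det‖ = _
          rw [Units.val_mul, Matrix.det_mul, norm_mul, (mem_maxCompact_iff.mp hk).2, mul_one,
            norm_det_heckeRep (sphereIndex_subset _ hp)]
        have hq := one_lt_q (q := q)
        rw [Units.val_mul, norm_mul, h1, Units.val_inv_eq_inv_val, norm_inv, norm_primeUnit_pow,
          inv_mul_cancel₀ (zpow_ne_zero _ (by linarith))]
      · rw [mul_inv_cancel_left]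
    have hru : baseUnit q L r ∈ localUnits q L := h.map_mem_localUnits hr1
    have hsec := sectionValue_eq h hΛ hΛ' s (g := τ ⟨d, ⟨p, hp⟩, i⟩) hprim hτk hx' hy' hS hT hST
      (ε := ε * baseUnit q L r) (mul_mem hε hru) (by
        rw [hdet, map_mul, ← mul_assoc, mul_right_comm _ (baseUnit q L r), hfr, mul_right_comm])
    rw [zetaIntegrand_eq, hsec, hWv, hF, hn]
    congr 2
    -- Both sides are q^(-3e(s + 1/2)). The inverse may be taken out of the complex power because
    -- the argument of a positive number is not π.
    rw [zpow_neg, zpow_natCast, Complex.ofReal_inv, Complex.ofReal_pow, Complex.ofReal_natCast,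
      Complex.cpow_neg, inv_pow, ← Complex.cpow_nat_mul, Complex.natCast_cpow_natCast_mul,
      ← Nat.cast_pow, Complex.inv_cpow]
    rw [Complex.natCast_arg]
    exact Real.pi_pos.ne
  have hint := integral_eq_tsum_of_cosets μ h.isOpen_compactUOne hμ τ hτ'
    (f := zetaIntegrand c Λ W g 1 s) (zetaIntegrand_mul_compact h hΛ' hw hW g s)
  simp only [hval] at hint
  exact hint

/-- For each d the fibre is a product of a summable family and a finite one, so its sum factors;
absolute summability over all d follows from the bound on these products. -/
theorem summable_and_tsum_sigma {I J : ℕ → Type} [∀ d, Fintype (J d)] {a : ∀ d, I d → ℂ}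
    {b : ∀ d, J d → ℂ} {bound : ℕ → ℝ} (ha : ∀ d, Summable fun i => ‖a d i‖)
    (hab : ∀ d, (∑' i, ‖a d i‖) * ∑ p, ‖b d p‖ ≤ bound d) (hbd : Summable bound) :
    Summable (fun j : Σ d, J d × I d => a j.1 j.2.2 * b j.1 j.2.1) ∧
      ∑' j : Σ d, J d × I d, a j.1 j.2.2 * b j.1 j.2.1 = ∑' d, (∑' i, a d i) * ∑ p, b d p := by
  have hb : ∀ d, Summable fun p => ‖b d p‖ := fun d => (hasSum_fintype _).summable
  have hfib : ∀ d, Summable fun z : J d × I d => ‖a d z.2 * b d z.1‖ := by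
    intro d
    have := Summable.mul_of_nonneg (hb d) (ha d) (fun _ => norm_nonneg _) fun _ => norm_nonneg _
    refine this.congr fun z => ?_
    rw [norm_mul, mul_comm]
  have hfibsum : ∀ d, ∑' z : J d × I d, ‖a d z.2 * b d z.1‖ =
      (∑' i, ‖a d i‖) * ∑ p, ‖b d p‖ := by
    intro d
    rw [← tsum_fintype (L := .unconditional _), mul_comm,
      tsum_mul_tsum_of_summable_norm (hb d).norm (ha d).norm]
    refine tsum_congr fun z => ?_
    rw [norm_mul, mul_comm]
  have hs : Summable fun j : Σ d, J d × I d => ‖a j.1 j.2.2 * b j.1 j.2.1‖ := by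
    refine (summable_sigma_of_nonneg fun _ => norm_nonneg _).mpr ⟨hfib, ?_⟩
    refine Summable.of_nonneg_of_le (fun d => tsum_nonneg fun _ => norm_nonneg _) (fun d => ?_) hbd
    exact (hfibsum d).trans_le (hab d)
  refine ⟨hs.of_norm, ?_⟩
  rw [hs.of_norm.tsum_sigma' fun d => (hfib d).of_norm]
  refine tsum_congr fun d => ?_
  rw [← tsum_fintype (L := .unconditional _), mul_comm,
    tsum_mul_tsum_of_summable_norm (hb d) (ha d)]
  exact tsum_congr fun z => mul_comm _ _

end ZetaSum

/-! ### Generating series and Cauchy's identity -/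

section Series

theorem summable_polynomial_mul_geometric {r : ℝ} (h0 : 0 ≤ r) (h1 : r < 1) :
    Summable fun d : ℕ => ((d : ℝ) + 1) ^ 3 * r ^ d := by
  have hr : ‖r‖ < 1 := by rwa [Real.norm_of_nonneg h0]
  have h := ((summable_pow_mul_geometric_of_norm_lt_one 3 hr).mul_left 8).add
    ((summable_pow_mul_geometric_of_norm_lt_one 0 hr).mul_left 8)
  refine h.of_nonneg_of_le (fun d => by positivity) fun d => ?_
  have hd : (0 : ℝ) ≤ d := Nat.cast_nonneg d
  have : ((d : ℝ) + 1) ^ 3 ≤ 8 * d ^ 3 + 8 := by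
    nlinarith [mul_nonneg (sq_nonneg ((d : ℝ) - 1)) (by linarith : (0 : ℝ) ≤ d + 1)]
  calc ((d : ℝ) + 1) ^ 3 * r ^ d ≤ (8 * d ^ 3 + 8) * r ^ d :=
        mul_le_mul_of_nonneg_right this (pow_nonneg h0 d)
    _ = _ := by ring

theorem summable_of_norm_le_mul_geometric {f : ℕ → ℂ} {C r : ℝ} (h0 : 0 ≤ r) (h1 : r < 1)
    (hf : ∀ d, ‖f d‖ ≤ C * (((d : ℝ) + 1) ^ 3 * r ^ d)) : Summable f :=
  ((summable_polynomial_mul_geometric h0 h1).mul_left C).of_norm_bounded hf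

section Cauchy

variable {X Y A B : ℂ} {U R : ℝ}

theorem one_sub_mul_ne_zero (hX : ‖X‖ ≤ U) (hA : ‖A‖ ≤ R) (hUR : U * R < 1) : 1 - X * A ≠ 0 := by
  intro h
  have h1 : X * A = 1 := (sub_eq_zero.mp h).symm
  have h2 := congrArg norm h1
  rw [norm_mul, norm_one] at h2
  have := mul_le_mul hX hA (norm_nonneg _) ((norm_nonneg _).trans hX)
  linarith

theorem summable_completeHom_mul (hX : ‖X‖ ≤ U) (hY : ‖Y‖ ≤ U) (hA : ‖A‖ ≤ R) (hB : ‖B‖ ≤ R)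
    (hUR : U * R < 1) : Summable fun d => completeHom X Y d * completeHom A B d := by
  have hU : 0 ≤ U := (norm_nonneg _).trans hX
  have hR : 0 ≤ R := (norm_nonneg _).trans hA
  refine summable_of_norm_le_mul_geometric (C := 1) (mul_nonneg hU hR) hUR fun d => ?_
  have hd : (0 : ℝ) ≤ d := Nat.cast_nonneg d
  rw [norm_mul]
  calc ‖completeHom X Y d‖ * ‖completeHom A B d‖ ≤ ((d + 1) * U ^ d) * ((d + 1) * R ^ d) :=
        mul_le_mul (norm_completeHom_le hX hY d) (norm_completeHom_le hA hB d) (norm_nonneg _)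
          (by positivity)
    _ = ((d : ℝ) + 1) ^ 2 * (U * R) ^ d := by rw [mul_pow]; ring
    _ ≤ ((d : ℝ) + 1) ^ 3 * (U * R) ^ d := by
        refine mul_le_mul_of_nonneg_right ?_ (by positivity)
        exact pow_le_pow_right₀ (by linarith) (by norm_num)
    _ = _ := (one_mul _).symm

/-- The recurrence h_{d+1} = X h_d + Y^(d+1) becomes a linear equation for the sum, which is
solvable because XA ≠ 1. -/
theorem hasSum_completeHom_mul_pow (hX : ‖X‖ ≤ U) (hY : ‖Y‖ ≤ U) (hA : ‖A‖ ≤ R)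
    (hUR : U * R < 1) : HasSum (fun d => completeHom X Y d * A ^ d)
      ((1 - X * A)⁻¹ * (1 - Y * A)⁻¹) := by
  have hR : 0 ≤ R := (norm_nonneg _).trans hA
  have hA0 : ∀ d, completeHom A 0 d = A ^ d := by
    intro d
    cases d with
    | zero => simp [completeHom]
    | succ d => rw [completeHom_succ' A 0 d]; ring
  have hs : Summable fun d => completeHom X Y d * A ^ d := by
    refine (summable_completeHom_mul hX hY hA (B := 0) (by simpa using hR) hUR).congr fun d => ?_
    rw [hA0]
  have hYA : ‖Y * A‖ < 1 := by
    rw [norm_mul]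
    exact (mul_le_mul hY hA (norm_nonneg _) ((norm_nonneg _).trans hX)).trans_lt hUR
  obtain ⟨S, hS⟩ := hs
  have h1 := (hasSum_nat_add_iff' 1).mpr hS
  have h2 := (hS.mul_left (X * A)).add ((hasSum_nat_add_iff' 1).mpr (hasSum_geometric_of_norm_lt_one hYA))
  have h3 := h1.unique (h2.congr_fun fun d => by rw [completeHom_succ]; ring)
  simp only [Finset.sum_range_one, completeHom_zero, pow_zero, mul_one] at h3
  have e1 := one_sub_mul_ne_zero hX hA hUR
  have e2 := one_sub_mul_ne_zero hY hA hUR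
  have : S = (1 - X * A)⁻¹ * (1 - Y * A)⁻¹ := by
    field_simp at h3 ⊢
    linear_combination h3
  exact this ▸ hS

/-- Cauchy's identity in two pairs of variables. -/
theorem hasSum_completeHom_mul (hX : ‖X‖ ≤ U) (hY : ‖Y‖ ≤ U) (hA : ‖A‖ ≤ R) (hB : ‖B‖ ≤ R)
    (hUR : U * R < 1) : HasSum (fun d => completeHom X Y d * completeHom A B d)
      ((1 - X * Y * A * B) * ((1 - X * A)⁻¹ * (1 - X * B)⁻¹ * (1 - Y * A)⁻¹ * (1 - Y * B)⁻¹)) := by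
  obtain ⟨S, hS⟩ := summable_completeHom_mul hX hY hA hB hUR
  have hRU : R * U < 1 := by rwa [mul_comm]
  have h1 := (hasSum_nat_add_iff' 1).mpr hS
  -- Expand h_{d+1}(X,Y) h_{d+1}(A,B) as XA h_d(X,Y) h_d(A,B) + h_{d+1}(X,Y) B^(d+1) + A Y^(d+1)
  -- h_d(A,B). The last two series are already known, so the sum again satisfies a linear equation.
  have h2 := (hS.mul_left (X * A)).add (((hasSum_nat_add_iff' 1).mpr
    (hasSum_completeHom_mul_pow hX hY hB hUR)).add
      ((hasSum_completeHom_mul_pow hA hB hY hRU).mul_left (A * Y)))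
  have h3 := h1.unique (h2.congr_fun fun d => by
    rw [completeHom_succ X Y, completeHom_succ A B]; ring)
  simp only [Finset.sum_range_one, completeHom_zero, pow_zero, mul_one] at h3
  have e1 := one_sub_mul_ne_zero hX hA hUR
  have e2 := one_sub_mul_ne_zero hY hA hUR
  have e3 := one_sub_mul_ne_zero hX hB hUR
  have e4 := one_sub_mul_ne_zero hY hB hUR
  have : S = (1 - X * Y * A * B) *
      ((1 - X * A)⁻¹ * (1 - X * B)⁻¹ * (1 - Y * A)⁻¹ * (1 - Y * B)⁻¹) := by
    have e5 : 1 - A * Y ≠ 0 := by rwa [mul_comm]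
    have e6 : 1 - B * Y ≠ 0 := by rwa [mul_comm]
    field_simp at h3 ⊢
    linear_combination h3
  exact this ▸ hS

/-- The generating series of the sphere eigenvalues against coefficients `c d` such that
`c d - c (d + 2)` is a multiple of a complete homogeneous polynomial. -/
theorem hasSum_mul_sphereEigenvalue {c : ℕ → ℂ} {k : ℂ} {C : ℝ} (hX : ‖X‖ ≤ U) (hY : ‖Y‖ ≤ U)
    (hA : ‖A‖ ≤ R) (hB : ‖B‖ ≤ R) (hUR : U * R < 1)
    (hc : ∀ d, ‖c d‖ ≤ C * ((d + 1) * U ^ d))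
    (hcd : ∀ d, c d - c (d + 2) = k * completeHom X Y d) :
    HasSum (fun d => c d * sphereEigenvalue A B d) (k * ((1 - X * Y * A * B) *
      ((1 - X * A)⁻¹ * (1 - X * B)⁻¹ * (1 - Y * A)⁻¹ * (1 - Y * B)⁻¹))) := by
  have hU : 0 ≤ U := (norm_nonneg _).trans hX
  have hR : 0 ≤ R := (norm_nonneg _).trans hA
  have hC : 0 ≤ C := by simpa using (norm_nonneg _).trans (hc 0)
  have hs1 : Summable fun d => c d * completeHom A B d := by
    refine summable_of_norm_le_mul_geometric (C := C) (mul_nonneg hU hR) hUR fun d => ?_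
    have hd : (0 : ℝ) ≤ d := Nat.cast_nonneg d
    rw [norm_mul]
    calc ‖c d‖ * ‖completeHom A B d‖ ≤ (C * ((d + 1) * U ^ d)) * ((d + 1) * R ^ d) :=
          mul_le_mul (hc d) (norm_completeHom_le hA hB d) (norm_nonneg _) (by positivity)
      _ = C * (((d : ℝ) + 1) ^ 2 * (U * R) ^ d) := by rw [mul_pow]; ring
      _ ≤ C * (((d : ℝ) + 1) ^ 3 * (U * R) ^ d) := by
          refine mul_le_mul_of_nonneg_left (mul_le_mul_of_nonneg_right ?_ (by positivity)) hC
          exact pow_le_pow_right₀ (by linarith) (by norm_num)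
  -- Summation by parts: Σ c_d (h_d − h_{d−2}) = Σ (c_d − c_{d+2}) h_d, to which Cauchy's identity
  -- applies. The growth bound on c_d makes the two halves converge separately.
  have hs2 : HasSum (fun d => (c d - c (d + 2)) * completeHom A B d) _ :=
    ((hasSum_completeHom_mul hX hY hA hB hUR).mul_left k).congr_fun fun d => by
      rw [hcd, mul_assoc]
  have hs3 := hs1.hasSum.sub hs2
  have hs4 : HasSum (fun d => c (d + 2) * completeHom A B d) _ := hs3.congr_fun fun d => by ring
  -- The shifted half of the series, with zeros at d = 0, 1 where there is no term h_{d−2}.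
  let h' : ℕ → ℂ := fun d => match d with
    | 0 => 0
    | 1 => 0
    | d + 2 => c (d + 2) * completeHom A B d
  have hs5 : HasSum h' _ := (hasSum_nat_add_iff (f := h') 2).mp hs4
  have hs6 := hs1.hasSum.sub hs5
  have h0 : ∑ i ∈ Finset.range 2, h' i = 0 := by simp [Finset.sum_range_succ, h']
  rw [h0, add_zero, sub_sub_cancel] at hs6
  refine hs6.congr_fun fun d => ?_
  match d with
  | 0 => simp [h', sphereEigenvalue]
  | 1 => simp [h', sphereEigenvalue]
  | d + 2 =>
    simp only [h', sphereEigenvalue]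
    ring

end Cauchy

/-- A sum over `ℤ` that consists of the monomials of degree `d` and two geometric tails. -/
theorem hasSum_int_completeHom {X Y : ℂ} (hX : ‖X‖ < 1) (hY : ‖Y‖ < 1) (d : ℕ) {f : ℤ → ℂ}
    (hf : ∀ m : ℕ, m ≤ d → f m = X ^ m * Y ^ (d - m))
    (hf1 : ∀ m : ℕ, f ((m + (d + 1) : ℕ) : ℤ) = X ^ (d + 2) * (X ^ 2) ^ m)
    (hf2 : ∀ m : ℕ, f (-((m : ℤ) + 1)) = Y ^ (d + 2) * (Y ^ 2) ^ m) :
    HasSum f (completeHom X Y d + X ^ (d + 2) * (1 - X ^ 2)⁻¹ + Y ^ (d + 2) * (1 - Y ^ 2)⁻¹) := by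
  have hX2 : ‖X ^ 2‖ < 1 := by
    rw [norm_pow]
    exact pow_lt_one₀ (norm_nonneg _) hX two_ne_zero
  have hY2 : ‖Y ^ 2‖ < 1 := by
    rw [norm_pow]
    exact pow_lt_one₀ (norm_nonneg _) hY two_ne_zero
  refine HasSum.of_nat_of_neg_add_one ?_ ?_
  · have h1 := (hasSum_geometric_of_norm_lt_one hX2).mul_left (X ^ (d + 2))
    have h2 := (hasSum_nat_add_iff (f := fun m : ℕ => f m) (d + 1)).mp
      (h1.congr_fun fun m => hf1 m)
    have h3 : ∑ m ∈ Finset.range (d + 1), f m = completeHom X Y d :=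
      Finset.sum_congr rfl fun m hm => hf m (Nat.lt_succ_iff.mp (Finset.mem_range.mp hm))
    rwa [h3, add_comm] at h2
  · exact ((hasSum_geometric_of_norm_lt_one hY2).mul_left (Y ^ (d + 2))).congr_fun hf2

end Series

/-! ### The zeta integral in terms of the series of section values -/

section Formula

open MeasureTheory

variable {q : ℕ} [Fact q.Prime]

/-- The parameter `q ^ (-(3 s + 3 / 2))`. -/
noncomputable def sectionParam (q : ℕ) (s : ℂ) : ℂ := (q : ℂ) ^ (-(3 * (s + 1 / 2)))

theorem norm_sectionParam_mul_sqrt (s : ℂ) :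
    ‖sectionParam q s‖ * √(q : ℝ) = (q : ℝ) ^ (-(3 * s.re + 1)) := by
  have hq : 0 < q := (Fact.out : q.Prime).pos
  rw [sectionParam, Complex.norm_natCast_cpow_of_pos hq, Real.sqrt_eq_rpow,
    ← Real.rpow_add (by exact_mod_cast hq)]
  congr 1
  simp
  ring

/-- This is the hypothesis on s, restated as |u| · |√q a| < 1 for the parameter u of the section. -/
theorem norm_sectionParam_mul_lt_one {s : ℂ} {a : ℂ} (ha : ‖a‖ < (q : ℝ) ^ (3 * s.re + 1)) :
    ‖sectionParam q s‖ * (√(q : ℝ) * ‖a‖) < 1 := by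
  have hq : (0 : ℝ) < q := by linarith [one_lt_q (q := q)]
  rw [← mul_assoc, norm_sectionParam_mul_sqrt, Real.rpow_neg hq.le,
    inv_mul_lt_iff₀ (Real.rpow_pos_of_pos hq _), mul_one]
  exact ha

/-- The product of the two inequalities is |u|² q < 1. The bound is needed in the split case, where
already the sum over l for fixed d is infinite. -/
theorem norm_sectionParam_lt_one {s : ℂ} {a b : ℂ} (hab : a * b = 1)
    (ha : ‖a‖ < (q : ℝ) ^ (3 * s.re + 1)) (hb : ‖b‖ < (q : ℝ) ^ (3 * s.re + 1)) :
    ‖sectionParam q s‖ < 1 := by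
  have hq := one_lt_q (q := q)
  have h1 := norm_sectionParam_mul_lt_one ha
  have h2 := norm_sectionParam_mul_lt_one hb
  have h3 : ‖a‖ * ‖b‖ = 1 := by rw [← norm_mul, hab, norm_one]
  have h4 : √(q : ℝ) * √(q : ℝ) = q := Real.mul_self_sqrt (by linarith)
  by_contra! hge
  have h5 : (‖sectionParam q s‖ * (√(q : ℝ) * ‖a‖)) * (‖sectionParam q s‖ * (√(q : ℝ) * ‖b‖)) < 1 :=
    mul_lt_one_of_nonneg_of_lt_one_left (by positivity) h1 h2.le
  have h6 : (‖sectionParam q s‖ * (√(q : ℝ) * ‖a‖)) * (‖sectionParam q s‖ * (√(q : ℝ) * ‖b‖)) =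
      ‖sectionParam q s‖ ^ 2 * q := by
    linear_combination ‖sectionParam q s‖ ^ 2 * (√(q : ℝ) * √(q : ℝ)) * h3 +
      ‖sectionParam q s‖ ^ 2 * h4
  rw [h6] at h5
  nlinarith

variable {L : Type*} [Field L] [NumberField L]
variable {c : L ≃ₐ[ℚ] L} {θ : 𝓞 L} {t n : ℤ}
variable {I : ℕ → Type} {rep : ∀ d, I d → (LocalAlg q L)ˣ} {e : ∀ d, I d → ℕ}

/-- The local zeta integral, given the generating series of the section values over the classes
of `L_q^×` modulo units. -/
theorem localZeta_eq_of_isUnitReps (h : IsQuadGen c θ t n) (hr : IsUnitReps q rep e)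
    [∀ d, Countable (I d)] {Λ : (LocalAlg q L)ˣ →* Circle}
    (hΛ : ∀ x : ℚ_[q]ˣ, Λ (baseUnit q L x) = 1)
    (hΛ' : ∀ u : (LocalAlg q L)ˣ, (u : LocalAlg q L) ∈ localIntegers q L →
      ((u⁻¹ : (LocalAlg q L)ˣ) : LocalAlg q L) ∈ localIntegers q L → Λ u = 1)
    {α β : ℚ_[q]ˣ →* ℂˣ} (hαβ : ∀ x, α x * β x = 1)
    {ψ : AddChar ℚ_[q] Circle} (hψ : HasConductorIntegers ψ)
    {W : GUOne q c → ℂ} (hW : IsSphericalWhittaker c ψ α β W)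
    [MeasurableSpace (UOne q c)] [BorelSpace (UOne q c)]
    (μ : Measure (UOne q c)) [μ.IsMulLeftInvariant]
    (hμ : μ (compactUOne q c : Set (UOne q c)) = 1) {s : ℂ}
    (hsα : ‖(α (primeUnit q) : ℂ)‖ < (q : ℝ) ^ (3 * s.re + 1))
    (hsβ : ‖(β (primeUnit q) : ℂ)‖ < (q : ℝ) ^ (3 * s.re + 1))
    (g : GUOne q c) {a : ∀ d, I d → ℂ}
    (ha : ∀ d i, a d i = sectionParam q s ^ e d i * ((Λ (rep d i) : ℂ))⁻¹)
    (has : ∀ d, Summable fun i => ‖a d i‖) {C : ℝ}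
    (hC : ∀ d : ℕ, ∑' i, ‖a d i‖ ≤ C * ((d + 1) * ‖sectionParam q s‖ ^ d))
    {X Y : ℂ} (hX : ‖X‖ ≤ ‖sectionParam q s‖) (hY : ‖Y‖ ≤ ‖sectionParam q s‖)
    (hXY : ∀ d, ∑' i, a d i - ∑' i, a (d + 2) i =
      (1 - sectionParam q s ^ 2) * completeHom X Y d)
    {A B : ℂ} (hA : A = (√(q : ℝ) : ℝ) * α (primeUnit q))
    (hB : B = (√(q : ℝ) : ℝ) * β (primeUnit q)) :
    Integrable (zetaIntegrand c Λ W g 1 s) μ ∧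
      localZeta c μ Λ W g 1 s = W g * ((1 - sectionParam q s ^ 2) * ((1 - X * Y * A * B) *
        ((1 - X * A)⁻¹ * (1 - X * B)⁻¹ * (1 - Y * A)⁻¹ * (1 - Y * B)⁻¹))) := by
  obtain ⟨T, f, hT, hf, hWT⟩ := hW
  have hw := hT.isUnramWhittaker hαβ hf
  rw [← hA, ← hB] at hw
  have hq := one_lt_q (q := q)
  have hAB : A * B = q := by
    have h1 : ((α (primeUnit q) : ℂˣ) : ℂ) * (β (primeUnit q) : ℂˣ) = 1 := by
      rw [← Units.val_mul, hαβ, Units.val_one]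
    have h2 : ((√(q : ℝ) : ℝ) : ℂ) * ((√(q : ℝ) : ℝ) : ℂ) = q := by
      rw [← Complex.ofReal_mul, Real.mul_self_sqrt (by linarith), Complex.ofReal_natCast]
    rw [hA, hB]
    linear_combination ((√(q : ℝ) : ℝ) : ℂ) * ((√(q : ℝ) : ℝ) : ℂ) * h1 + h2
  set R : ℝ := √(q : ℝ) * max ‖(α (primeUnit q) : ℂ)‖ ‖(β (primeUnit q) : ℂ)‖ with hR
  have hAR : ‖A‖ ≤ R := by
    rw [hA, norm_mul, Complex.norm_real, Real.norm_of_nonneg (Real.sqrt_nonneg _)]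
    exact mul_le_mul_of_nonneg_left (le_max_left _ _) (Real.sqrt_nonneg _)
  have hBR : ‖B‖ ≤ R := by
    rw [hB, norm_mul, Complex.norm_real, Real.norm_of_nonneg (Real.sqrt_nonneg _)]
    exact mul_le_mul_of_nonneg_left (le_max_right _ _) (Real.sqrt_nonneg _)
  have hUR : ‖sectionParam q s‖ * R < 1 := by
    rw [hR]
    rcases max_choice ‖(α (primeUnit q) : ℂ)‖ ‖(β (primeUnit q) : ℂ)‖ with hm | hm <;> rw [hm]
    · exact norm_sectionParam_mul_lt_one hsα
    · exact norm_sectionParam_mul_lt_one hsβ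
  have hR0 : 0 ≤ R := (norm_nonneg _).trans hAR
  obtain ⟨v, hv⟩ := g.2
  obtain ⟨b, x, hgx, -⟩ := h.exists_smul_map hv
  obtain ⟨C', hC'0, hC'⟩ := hw.exists_sum_norm_le hψ hAB hAR hBR x
  have hC0 : 0 ≤ C := by
    have := (tsum_nonneg fun i => norm_nonneg (a 0 i)).trans (hC 0)
    simpa using this
  have hsum := summable_and_tsum_sigma (J := fun d => {p // p ∈ sphereIndex q d}) (a := a)
    (b := fun d p => T f (x * heckeRep d p.1)) (bound := fun d =>
      C * C' * (((d : ℝ) + 1) ^ 3 * (‖sectionParam q s‖ * R) ^ d)) has (fun d => by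
      rw [Finset.sum_coe_sort (sphereIndex q d) fun p => ‖T f (x * heckeRep d p)‖]
      calc (∑' i, ‖a d i‖) * ∑ p ∈ sphereIndex q d, ‖T f (x * heckeRep d p)‖
          ≤ (C * ((d + 1) * ‖sectionParam q s‖ ^ d)) * (C' * ((d + 1) ^ 2 * R ^ d)) := by
            refine mul_le_mul (hC d) ((Finset.sum_le_sum_of_subset_of_nonneg
              (sphereIndex_subset d) fun _ _ _ => norm_nonneg _).trans (hC' d))
              (Finset.sum_nonneg fun _ _ => norm_nonneg _) (by positivity)
        _ = _ := by rw [mul_pow]; ring)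
    ((summable_polynomial_mul_geometric (by positivity) hUR).mul_left _)
  have hz := localZeta_eq_tsum h hr hΛ hΛ' hw.right hWT μ hμ s g hgx
    (F := fun j => a j.1 j.2.2 * T f (x * heckeRep j.1 j.2.1.1)) fun j => by rw [ha]; rfl
  refine ⟨hz.1 hsum.1, ?_⟩
  -- For fixed d the sum over the sphere is the eigenvalue times W(g), which leaves the generating
  -- series of the c_d against the sphere eigenvalues.
  rw [hz.2 (hz.1 hsum.1), hsum.2, hWT b x g hgx, mul_comm (T f x),
    ← ((hasSum_mul_sphereEigenvalue (c := fun d => ∑' i, a d i) hX hY hAR hBR hUR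
      (fun d => (norm_tsum_le_tsum_norm (has d)).trans (hC d)) hXY).mul_right (T f x)).tsum_eq]
  refine tsum_congr fun d => ?_
  rw [Finset.sum_coe_sort (sphereIndex q d) fun p => T f (x * heckeRep d p), hw.sum_sphere,
    mul_assoc]

end Formula

/-! ### Inert and ramified primes in terms of norms and traces -/

section Splitting

variable {q : ℕ} [Fact q.Prime] {L : Type*} [Field L] [NumberField L]
variable {c : L ≃ₐ[ℚ] L} {θ : 𝓞 L} {t n : ℤ}

theorem IsQuadGen.intCast_inj (h : IsQuadGen c θ t n) {a b a' b' : ℤ}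
    (heq : (a : 𝓞 L) + b * θ = a' + b' * θ) : a = a' ∧ b = b' := by
  have h1 : (a : L) + b * θ = a' + b' * θ := by
    have := congrArg (algebraMap (𝓞 L) L) heq
    simpa using this
  have h2 : (a : L) + b * (t - θ) = a' + b' * (t - θ) := by
    have := congrArg c h1
    simpa [h.conj] using this
  have h3 : ((b - b' : ℤ) : L) * (θ - (t - θ)) = 0 := by
    push_cast
    linear_combination h1 - h2
  have h4 : (θ : L) - (t - θ) ≠ 0 := by
    rw [← h.conj]
    exact sub_ne_zero.mpr h.ne.symm
  have h5 : b = b' := by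
    have := (mul_eq_zero.mp h3).resolve_right h4
    rw [Int.cast_eq_zero] at this
    omega
  subst h5
  exact ⟨by exact_mod_cast add_right_cancel h1, rfl⟩

theorem IsQuadGen.natCast_dvd_iff (h : IsQuadGen c θ t n) {a b : ℤ} :
    (q : 𝓞 L) ∣ (a : 𝓞 L) + b * θ ↔ (q : ℤ) ∣ a ∧ (q : ℤ) ∣ b := by
  constructor
  · rintro ⟨x, hx⟩
    obtain ⟨a', b', rfl⟩ := h.span x
    have h1 : (a : 𝓞 L) + b * θ = ((q * a' : ℤ) : 𝓞 L) + ((q * b' : ℤ) : 𝓞 L) * θ := by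
      rw [hx]
      push_cast
      ring
    obtain ⟨rfl, rfl⟩ := h.intCast_inj h1
    exact ⟨dvd_mul_right _ _, dvd_mul_right _ _⟩
  · rintro ⟨⟨a', rfl⟩, ⟨b', rfl⟩⟩
    exact ⟨a' + b' * θ, by push_cast; ring⟩

theorem IsQuadGen.mul_conj_eq (h : IsQuadGen c θ t n) (a b : ℤ) :
    ((a : 𝓞 L) + b * θ) * (((a + t * b : ℤ) : 𝓞 L) + ((-b : ℤ) : 𝓞 L) * θ) =
      ((a ^ 2 + t * a * b + n * b ^ 2 : ℤ) : 𝓞 L) := by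
  push_cast
  linear_combination (-(b : 𝓞 L) ^ 2) * h.sq

theorem IsQuadGen.sq_eq (h : IsQuadGen c θ t n) (a b : ℤ) :
    ((a : 𝓞 L) + b * θ) ^ 2 = ((2 * a + t * b : ℤ) : 𝓞 L) * (a + b * θ) -
      ((a ^ 2 + t * a * b + n * b ^ 2 : ℤ) : 𝓞 L) := by
  push_cast
  linear_combination ((b : 𝓞 L) ^ 2) * h.sq

/-- The prime ideal (q) contains the norm z conj(z), hence contains z or conj(z), and divisibility
by q is read off the coordinates. -/
theorem IsQuadGen.dvd_of_dvd_norm (h : IsQuadGen c θ t n) (hq : IsInert q L) {a b : ℤ}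
    (hd : (q : ℤ) ∣ a ^ 2 + t * a * b + n * b ^ 2) : (q : ℤ) ∣ a ∧ (q : ℤ) ∣ b := by
  have h1 : ((a : 𝓞 L) + b * θ) * (((a + t * b : ℤ) : 𝓞 L) + ((-b : ℤ) : 𝓞 L) * θ) ∈
      Ideal.span {(q : 𝓞 L)} := by
    rw [h.mul_conj_eq, Ideal.mem_span_singleton]
    obtain ⟨m, hm⟩ := hd
    exact ⟨m, by rw [hm]; push_cast; ring⟩
  rcases hq.mem_or_mem h1 with h2 | h2
  · exact h.natCast_dvd_iff.mp (Ideal.mem_span_singleton.mp h2)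
  · obtain ⟨h3, h4⟩ := h.natCast_dvd_iff.mp (Ideal.mem_span_singleton.mp h2)
    rw [dvd_neg] at h4
    exact ⟨(dvd_add_left (h4.mul_left t)).mp h3, h4⟩

theorem IsQuadGen.absNorm_natCast (h : IsQuadGen c θ t n) :
    Ideal.absNorm (Ideal.span {(q : 𝓞 L)}) = q ^ 2 := by
  rw [Ideal.absNorm_span_natCast, RingOfIntegers.rank, h.finrank]

/-- For z = a + bθ with N(z) = qm and Tr(z) = qT one has z² = q(Tz − m). So (q, z)² lies in (q), and
it contains q because m is invertible modulo q. -/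
theorem IsQuadGen.isRamified_of_dvd (h : IsQuadGen c θ t n) {a b m : ℤ}
    (hm : a ^ 2 + t * a * b + n * b ^ 2 = q * m) (hqm : ¬ (q : ℤ) ∣ m)
    (hT : (q : ℤ) ∣ 2 * a + t * b) : IsRamified q L := by
  have hp : Prime (q : ℤ) := Nat.prime_iff_prime_int.mp Fact.out
  obtain ⟨T, hT⟩ := hT
  set z : 𝓞 L := a + b * θ with hz
  have hsq : z ^ 2 = q * (T * z - m) := by
    rw [hz, h.sq_eq, hT, hm]
    push_cast
    ring
  obtain ⟨x, y, hxy⟩ : IsCoprime (q : ℤ) m := (hp.coprime_iff_not_dvd).mpr hqm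
  have hxy' : (x : 𝓞 L) * q + y * m = 1 := by exact_mod_cast congrArg (Int.cast : ℤ → 𝓞 L) hxy
  have heq : Ideal.span {(q : 𝓞 L)} = Ideal.span {(q : 𝓞 L), z} ^ 2 := by
    refine Eq.trans ?_ (pow_two _).symm
    rw [Ideal.span_pair_mul_span_pair]
    apply le_antisymm
    · rw [Ideal.span_singleton_le_iff_mem]
      have h1 : (q : 𝓞 L) = x * (q * q) + (y * T) * (q * z) - y * (z * z) := by
        have : z * z = q * (T * z - m) := by rw [← pow_two, hsq]
        rw [this]
        linear_combination (-(q : 𝓞 L)) * hxy'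
      have h2 : x * (q * q) + (y * T) * (q * z) - y * (z * z) ∈
          Ideal.span {(q : 𝓞 L) * q, q * z, z * q, z * z} :=
        sub_mem (add_mem (Ideal.mul_mem_left _ _ (Ideal.subset_span (Or.inl rfl)))
          (Ideal.mul_mem_left _ _ (Ideal.subset_span (Or.inr (Or.inl rfl)))))
          (Ideal.mul_mem_left _ _ (Ideal.subset_span (Or.inr (Or.inr (Or.inr rfl)))))
      rwa [← h1] at h2
    · rw [Ideal.span_le]
      intro w hw
      rw [SetLike.mem_coe, Ideal.mem_span_singleton]
      simp only [Set.mem_insert_iff, Set.mem_singleton_iff] at hw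
      rcases hw with rfl | rfl | rfl | rfl
      · exact dvd_mul_right _ _
      · exact dvd_mul_right _ _
      · exact dvd_mul_left _ _
      · rw [← pow_two, hsq]
        exact dvd_mul_right _ _
  refine ⟨_, ?_, heq⟩
  -- The square of the ideal has absolute norm q², so the ideal itself has prime norm q.
  refine Ideal.isPrime_of_irreducible_absNorm ?_
  have h1 := h.absNorm_natCast (q := q)
  rw [heq, map_pow] at h1
  rw [Nat.pow_left_injective two_ne_zero h1]
  exact (Fact.out : q.Prime)

/-- If z lies in P then z² lies in P² = (q), and so does Tr(z) z = z² + N(z). Hence q divides Tr(z),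
or divides both coordinates of z; the latter would give q² | N(z). If z is not in P, its conjugate
is. -/
theorem IsQuadGen.dvd_of_isRamified (h : IsQuadGen c θ t n) (hR : IsRamified q L) {a b m : ℤ}
    (hm : a ^ 2 + t * a * b + n * b ^ 2 = q * m) (hqm : ¬ (q : ℤ) ∣ m) :
    (q : ℤ) ∣ 2 * a + t * b := by
  have hp : Prime (q : ℤ) := Nat.prime_iff_prime_int.mp Fact.out
  obtain ⟨P, hP, heq⟩ := hR
  have key : ∀ a b : ℤ, a ^ 2 + t * a * b + n * b ^ 2 = q * m → (a : 𝓞 L) + b * θ ∈ P →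
      (q : ℤ) ∣ 2 * a + t * b := by
    intro a b hm hz
    have h1 : ((a : 𝓞 L) + b * θ) ^ 2 ∈ Ideal.span {(q : 𝓞 L)} := by
      rw [heq]
      exact Ideal.pow_mem_pow hz 2
    rw [h.sq_eq, Ideal.mem_span_singleton, hm] at h1
    have h2 : (q : 𝓞 L) ∣ (((2 * a + t * b) * a : ℤ) : 𝓞 L) + (((2 * a + t * b) * b : ℤ) : 𝓞 L) * θ := by
      have h3 := dvd_add h1 (Dvd.intro (m : 𝓞 L) rfl : (q : 𝓞 L) ∣ q * m)
      convert h3 using 1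
      push_cast
      ring
    obtain ⟨h3, h4⟩ := h.natCast_dvd_iff.mp h2
    rcases hp.dvd_or_dvd h3 with h5 | h5
    · exact h5
    rcases hp.dvd_or_dvd h4 with h6 | h6
    · exact h6
    exfalso
    obtain ⟨a', rfl⟩ := h5
    obtain ⟨b', rfl⟩ := h6
    apply hqm
    refine ⟨a' ^ 2 + t * a' * b' + n * b' ^ 2, ?_⟩
    have h7 : (q : ℤ) * m = q * (q * (a' ^ 2 + t * a' * b' + n * b' ^ 2)) := by
      rw [← hm]
      ring
    exact mul_left_cancel₀ hp.ne_zero h7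
  have h1 : ((a : 𝓞 L) + b * θ) * (((a + t * b : ℤ) : 𝓞 L) + ((-b : ℤ) : 𝓞 L) * θ) ∈ P := by
    rw [h.mul_conj_eq, hm]
    refine Ideal.pow_le_self two_ne_zero (heq ▸ Ideal.mem_span_singleton.mpr ⟨m, ?_⟩ : _ ∈ P ^ 2)
    push_cast
    ring
  rcases hP.mem_or_mem h1 with h2 | h2
  · exact key a b hm h2
  · have h3 := key _ _ (by rw [← hm]; ring) h2
    have h4 : 2 * (a + t * b) + t * -b = 2 * a + t * b := by ring
    rwa [h4] at h3

theorem exists_int_norm_sub_le {x : ℚ_[q]} (hx : ‖x‖ ≤ 1) (m : ℕ) :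
    ∃ k : ℤ, ‖x - k‖ ≤ (q : ℝ) ^ (-(m : ℤ)) := by
  let y : ℤ_[q] := ⟨x, hx⟩
  refine ⟨(y.appr m : ℕ), ?_⟩
  have h1 := (PadicInt.norm_le_pow_iff_mem_span_pow _ m).mpr (PadicInt.appr_spec m y)
  have h2 : ‖((y - (y.appr m : ℤ_[q]) : ℤ_[q]) : ℚ_[q])‖ ≤ (q : ℝ) ^ (-(m : ℤ)) := h1
  rw [Int.cast_natCast]
  push_cast at h2
  exact h2

theorem norm_add_le_of_le {x y : ℚ_[q]} {r : ℝ} (hx : ‖x‖ ≤ r) (hy : ‖y‖ ≤ r) : ‖x + y‖ ≤ r :=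
  (IsUltrametricDist.norm_add_le_max x y).trans (max_le hx hy)

theorem norm_mul_le_of_le {x y : ℚ_[q]} {r : ℝ} (hx : ‖x‖ ≤ r) (hy : ‖y‖ ≤ 1) : ‖x * y‖ ≤ r := by
  rw [norm_mul]
  exact (mul_le_of_le_one_right (norm_nonneg _) hy).trans hx

theorem norm_form_sub_le (t n : ℤ) {a b a' b' : ℚ_[q]} {r : ℝ} (ha : ‖a‖ ≤ 1) (hb : ‖b‖ ≤ 1)
    (ha' : ‖a'‖ ≤ 1) (hb' : ‖b'‖ ≤ 1) (h1 : ‖a - a'‖ ≤ r) (h2 : ‖b - b'‖ ≤ r) :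
    ‖(a ^ 2 + t * a * b + n * b ^ 2) - (a' ^ 2 + t * a' * b' + n * b' ^ 2)‖ ≤ r := by
  have e : (a ^ 2 + t * a * b + n * b ^ 2) - (a' ^ 2 + t * a' * b' + n * b' ^ 2) =
      (a - a') * ((a + a') + b * t) + (b - b') * (a' * t + (b + b') * n) := by ring
  rw [e]
  have ht := Padic.norm_int_le_one (p := q) t
  have hn := Padic.norm_int_le_one (p := q) n
  exact norm_add_le_of_le
    (norm_mul_le_of_le h1 (norm_add_le_of_le (norm_add_le_of_le ha ha') (norm_mul_le_of_le hb ht)))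
    (norm_mul_le_of_le h2 (norm_add_le_of_le (norm_mul_le_of_le ha' ht)
      (norm_mul_le_of_le (norm_add_le_of_le hb hb') hn)))

theorem norm_lt_one_iff_le {x : ℚ_[q]} : ‖x‖ < 1 ↔ ‖x‖ ≤ (q : ℝ) ^ (-1 : ℤ) := by
  rw [Padic.norm_le_pow_iff_norm_lt_pow_add_one]
  simp

/-- If `q` is inert, then primitive elements of `ℤ_{L,q}` are units. -/
theorem IsQuadGen.norm_eq_one_of_isInert (h : IsQuadGen c θ t n) (hq : IsInert q L) {a b : ℚ_[q]}
    (ha : ‖a‖ ≤ 1) (hb : ‖b‖ ≤ 1) (hab : ¬ (‖a‖ < 1 ∧ ‖b‖ < 1)) :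
    ‖a ^ 2 + t * a * b + n * b ^ 2‖ = 1 := by
  have ht := Padic.norm_int_le_one (p := q) t
  have hn := Padic.norm_int_le_one (p := q) n
  by_contra hne
  have hle : ‖a ^ 2 + t * a * b + n * b ^ 2‖ ≤ 1 := by
    refine norm_add_le_of_le (norm_add_le_of_le ?_ (norm_mul_le_of_le (norm_mul_le_of_le ht ha) hb))
      (norm_mul_le_of_le hn ?_)
    · rw [norm_pow]; exact pow_le_one₀ (norm_nonneg _) ha
    · rw [norm_pow]; exact pow_le_one₀ (norm_nonneg _) hb
  -- The statement depends only on a and b modulo q, so integer approximations reduce it to the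
  -- ideal (q) of the ring of integers.
  have hlt := norm_lt_one_iff_le.mp (lt_of_le_of_ne hle hne)
  obtain ⟨a', ha'⟩ := exists_int_norm_sub_le ha 1
  obtain ⟨b', hb'⟩ := exists_int_norm_sub_le hb 1
  have h1 := norm_form_sub_le t n ha hb (Padic.norm_int_le_one (p := q) a')
    (Padic.norm_int_le_one (p := q) b') ha' hb'
  have h2 : ‖((a' ^ 2 + t * a' * b' + n * b' ^ 2 : ℤ) : ℚ_[q])‖ ≤ (q : ℝ) ^ (-((1 : ℕ) : ℤ)) := by
    have h3 := norm_add_le_of_le hlt (by rw [norm_neg]; exact h1)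
    rw [← sub_eq_add_neg, sub_sub_cancel] at h3
    push_cast
    exact h3
  rw [Padic.norm_int_le_pow_iff_dvd, pow_one] at h2
  obtain ⟨h3, h4⟩ := h.dvd_of_dvd_norm hq h2
  have key : ∀ (x : ℚ_[q]) (k : ℤ), ‖x - k‖ ≤ (q : ℝ) ^ (-((1 : ℕ) : ℤ)) → (q : ℤ) ∣ k → ‖x‖ < 1 := by
    intro x k h5 h6
    rw [norm_lt_one_iff_le]
    have h7 := (Padic.norm_int_le_pow_iff_dvd (p := q) k 1).mpr (by rwa [pow_one])
    have := norm_add_le_of_le h5 h7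
    rwa [sub_add_cancel] at this
  exact hab ⟨key a a' ha' h3, key b b' hb' h4⟩

end Splitting

section CommGroup

variable {G : Type*} [CommGroup G]

theorem zpow_mul_zpow_mul_mul_left (a b e : G) (i j : ℤ) :
    a ^ i * b ^ j * e * a = a ^ (i + 1) * b ^ j * e := by
  rw [zpow_add_one]
  ac_rfl

theorem zpow_mul_zpow_mul_mul_right (a b e : G) (i j : ℤ) :
    a ^ i * b ^ j * e * b = a ^ i * b ^ (j + 1) * e := by
  rw [zpow_add_one]
  ac_rfl

theorem mul_pow_inv_mul_zpow (a b e f : G) (i j : ℤ) (k : ℕ) :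
    ((a * b * f) ^ k)⁻¹ * (a ^ i * b ^ j * e) = a ^ (i - k) * b ^ (j - k) * (e * (f ^ k)⁻¹) := by
  rw [zpow_sub, zpow_sub, zpow_natCast, zpow_natCast, mul_pow, mul_pow, mul_inv, mul_inv]
  simp only [mul_assoc, mul_comm, mul_left_comm]

end CommGroup

/-! ### Elements whose norm is a uniformizer -/

section NormGen

variable {q : ℕ} [Fact q.Prime] {L : Type*} [Field L] [NumberField L]
variable {c : L ≃ₐ[ℚ] L} {θ : 𝓞 L} {t n : ℤ}

/-- Conjugation on the units of `L_q`. -/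
noncomputable abbrev conjUnit (c : L ≃ₐ[ℚ] L) : (LocalAlg q L)ˣ →* (LocalAlg q L)ˣ :=
  Units.map (localConj q c : LocalAlg q L →* LocalAlg q L)

theorem conjUnit_val (x : (LocalAlg q L)ˣ) :
    (conjUnit c x : LocalAlg q L) = localConj q c x := rfl

/-- `π` generates `ℤ_{L,q}` over `ℤ_q`, has trace `t₁` and norm `n₁`, and `n₁` is a uniformizer. -/
structure IsNormGen (c : L ≃ₐ[ℚ] L) (π : (LocalAlg q L)ˣ) (t₁ n₁ : ℚ_[q]) : Prop where
  mem : (π : LocalAlg q L) ∈ localIntegers q L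
  trace_le : ‖t₁‖ ≤ 1
  norm_eq : ‖n₁‖ = (q : ℝ) ^ (-1 : ℤ)
  conj : localConj q c π = algebraMap ℚ_[q] (LocalAlg q L) t₁ - π
  norm_add : ∀ a b : ℚ_[q], Algebra.norm ℚ_[q] (algebraMap ℚ_[q] (LocalAlg q L) a +
    algebraMap ℚ_[q] (LocalAlg q L) b * π) = a ^ 2 + t₁ * a * b + n₁ * b ^ 2
  span : ∀ x ∈ localIntegers q L, ∃ a b : ℚ_[q], ‖a‖ ≤ 1 ∧ ‖b‖ ≤ 1 ∧
    x = algebraMap ℚ_[q] (LocalAlg q L) a + algebraMap ℚ_[q] (LocalAlg q L) b * π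

theorem norm_form_le (t n : ℤ) {a b : ℚ_[q]} {r : ℝ} (ha : ‖a‖ ≤ r) (hb : ‖b‖ ≤ r) :
    ‖a ^ 2 + t * a * b + n * b ^ 2‖ ≤ r * r := by
  have ht := Padic.norm_int_le_one (p := q) t
  have hn := Padic.norm_int_le_one (p := q) n
  have hr : 0 ≤ r := (norm_nonneg _).trans ha
  have e : a ^ 2 + t * a * b + n * b ^ 2 = a * a + (a * b) * t + (b * b) * n := by ring
  rw [e]
  refine norm_add_le_of_le (norm_add_le_of_le ?_ (norm_mul_le_of_le ?_ ht))
    (norm_mul_le_of_le ?_ hn) <;> rw [norm_mul]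
  exacts [mul_le_mul ha ha (norm_nonneg _) hr, mul_le_mul ha hb (norm_nonneg _) hr,
    mul_le_mul hb hb (norm_nonneg _) hr]

theorem norm_eq_of_sub_lt {x y : ℚ_[q]} (h : ‖x - y‖ < ‖x‖) : ‖y‖ = ‖x‖ := by
  have h1 := Padic.add_eq_max_of_ne (p := q) (q := x) (r := -(x - y)) (by rw [norm_neg]; exact h.ne')
  rw [norm_neg, max_eq_left h.le] at h1
  rw [← h1]
  congr 1
  ring

/-- An integral π = a + bθ whose norm has valuation one must have b a unit, so π generates ℤ_{L,q}
over ℤ_q. Ramification is then divisibility of its trace by q. -/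
theorem IsQuadGen.exists_isNormGen (h : IsQuadGen c θ t n) {π : (LocalAlg q L)ˣ}
    (hπ : IsNormUniformizer q L π) :
    ∃ t₁ n₁, IsNormGen c π t₁ n₁ ∧ (IsRamified q L ↔ ‖t₁‖ < 1) := by
  have hq := one_lt_q (q := q)
  have hq0 : (0 : ℝ) < q := by linarith
  obtain ⟨hmem, hnorm⟩ := hπ
  obtain ⟨a, b, hab⟩ := h.exists_locMk (π : LocalAlg q L)
  rw [hab] at hmem hnorm
  obtain ⟨ha, hb⟩ := h.locMk_mem.mp hmem
  rw [h.norm_locMk] at hnorm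
  have hq1 : ‖(q : ℚ_[q])‖ = (q : ℝ) ^ (-1 : ℤ) := by rw [zpow_neg_one]; exact norm_primeUnit
  have hq2 : (q : ℝ) ^ (-1 : ℤ) * (q : ℝ) ^ (-1 : ℤ) < (q : ℝ) ^ (-1 : ℤ) := by
    rw [← zpow_add₀ hq0.ne']
    exact zpow_lt_zpow_right₀ hq (by norm_num)
  have hq3 : (q : ℝ) ^ (-1 : ℤ) < 1 := by
    rw [zpow_neg_one]
    exact inv_lt_one_of_one_lt₀ hq
  rw [hq1] at hnorm
  have ht := Padic.norm_int_le_one (p := q) t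
  have hn := Padic.norm_int_le_one (p := q) n
  -- If q divided b it would divide a², hence a, and the norm would have valuation at least two.
  have hb1 : ‖b‖ = 1 := by
    by_contra hne
    have h1 := norm_lt_one_iff_le.mp (lt_of_le_of_ne hb hne)
    have h2 : ‖a ^ 2‖ ≤ (q : ℝ) ^ (-1 : ℤ) := by
      have e : a ^ 2 = (a ^ 2 + t * a * b + n * b ^ 2) + b * (-(t * a + n * b)) := by ring
      rw [e]
      refine norm_add_le_of_le hnorm.le (norm_mul_le_of_le h1 ?_)
      rw [norm_neg]
      exact norm_add_le_of_le (norm_mul_le_of_le ht ha) (norm_mul_le_of_le hn hb)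
    have h3 : ‖a‖ < 1 := by
      rw [norm_pow] at h2
      exact (pow_lt_one_iff_of_nonneg (norm_nonneg _) two_ne_zero).mp (h2.trans_lt hq3)
    have h4 := norm_form_le t n (norm_lt_one_iff_le.mp h3) h1
    rw [hnorm] at h4
    linarith
  have hb0 : b ≠ 0 := by rw [← norm_ne_zero_iff, hb1]; exact one_ne_zero
  have halg : ∀ x y : ℚ_[q], algebraMap ℚ_[q] (LocalAlg q L) x +
      algebraMap ℚ_[q] (LocalAlg q L) y * π = locMk q θ (x + y * a) (y * b) := by
    intro x y
    rw [hab]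
    simp only [locMk, map_add, map_mul]
    ring
  refine ⟨2 * a + t * b, a ^ 2 + t * a * b + n * b ^ 2, ⟨?_, ?_, hnorm, ?_, ?_, ?_⟩, ?_⟩
  · rw [hab]; exact hmem
  · refine norm_add_le_of_le (norm_mul_le_of_le ?_ ha) (norm_mul_le_of_le ht hb)
    exact Padic.norm_int_le_one (p := q) 2
  · rw [hab, h.localConj_locMk]
    simp only [locMk, map_add, map_mul, map_neg, map_ofNat]
    ring
  · intro x y
    rw [halg, h.norm_locMk]
    ring
  · intro x hx
    obtain ⟨x₀, x₁, rfl⟩ := h.exists_locMk x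
    obtain ⟨h0, h1⟩ := h.locMk_mem.mp hx
    have h2 : ‖x₁ / b‖ ≤ 1 := by rw [norm_div, hb1, div_one]; exact h1
    refine ⟨x₀ + x₁ / b * -a, x₁ / b, norm_add_le_of_le h0 (norm_mul_le_of_le h2 ?_), h2, ?_⟩
    · rw [norm_neg]; exact ha
    · rw [halg]
      congr 1
      · ring
      · field_simp
  -- The approximation is modulo q², not q, so that the norm of the integer approximation still has
  -- valuation exactly one.
  · obtain ⟨a', ha'⟩ := exists_int_norm_sub_le ha 2
    obtain ⟨b', hb'⟩ := exists_int_norm_sub_le hb 2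
    have hq4 : (q : ℝ) ^ (-((2 : ℕ) : ℤ)) < (q : ℝ) ^ (-1 : ℤ) :=
      zpow_lt_zpow_right₀ hq (by norm_num)
    have hN := norm_form_sub_le t n ha hb (Padic.norm_int_le_one (p := q) a')
      (Padic.norm_int_le_one (p := q) b') ha' hb'
    have hN' : ‖((a' ^ 2 + t * a' * b' + n * b' ^ 2 : ℤ) : ℚ_[q])‖ = (q : ℝ) ^ (-1 : ℤ) := by
      rw [← hnorm]
      push_cast
      refine norm_eq_of_sub_lt (hN.trans_lt ?_)
      rw [hnorm]
      exact hq4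
    obtain ⟨m, hm⟩ : (q : ℤ) ∣ a' ^ 2 + t * a' * b' + n * b' ^ 2 := by
      have := (Padic.norm_int_le_pow_iff_dvd (p := q) (a' ^ 2 + t * a' * b' + n * b' ^ 2) 1).mp
        hN'.le
      rwa [pow_one] at this
    have hqm : ¬ (q : ℤ) ∣ m := by
      rintro ⟨m', rfl⟩
      have h1 := (Padic.norm_int_le_pow_iff_dvd (p := q) (a' ^ 2 + t * a' * b' + n * b' ^ 2) 2).mpr
        ⟨m', by rw [hm]; ring⟩
      rw [hN'] at h1
      linarith
    have hT : ‖(2 * a + t * b) - ((2 * a' + t * b' : ℤ) : ℚ_[q])‖ ≤ (q : ℝ) ^ (-1 : ℤ) := by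
      have e : (2 * a + t * b) - ((2 * a' + t * b' : ℤ) : ℚ_[q]) =
          (a - a') * (2 : ℤ) + (b - b') * t := by push_cast; ring
      rw [e]
      exact norm_add_le_of_le (norm_mul_le_of_le (ha'.trans hq4.le) (Padic.norm_int_le_one 2))
        (norm_mul_le_of_le (hb'.trans hq4.le) ht)
    have hT' : ‖2 * a + t * b‖ < 1 ↔ (q : ℤ) ∣ 2 * a' + t * b' := by
      rw [norm_lt_one_iff_le]
      have h1 := Padic.norm_int_le_pow_iff_dvd (p := q) (2 * a' + t * b') 1
      rw [pow_one] at h1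
      rw [← h1]
      constructor
      · intro h2
        have := norm_add_le_of_le h2 (by rw [norm_neg]; exact hT)
        rwa [← sub_eq_add_neg, sub_sub_cancel] at this
      · intro h2
        have := norm_add_le_of_le hT h2
        rwa [sub_add_cancel] at this
    rw [hT']
    exact ⟨fun hR => h.dvd_of_isRamified hR hm hqm, h.isRamified_of_dvd hm hqm⟩

variable {π : (LocalAlg q L)ˣ} {t₁ n₁ : ℚ_[q]}

theorem IsNormGen.norm_pi (hπ : IsNormGen c π t₁ n₁) :
    Algebra.norm ℚ_[q] (π : LocalAlg q L) = n₁ := by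
  have := hπ.norm_add 0 1
  rw [map_zero, zero_add, map_one, one_mul] at this
  rw [this]
  ring

theorem IsNormGen.mul_conj (h : IsQuadGen c θ t n) (hπ : IsNormGen c π t₁ n₁) :
    (π : LocalAlg q L) * localConj q c π = algebraMap ℚ_[q] (LocalAlg q L) n₁ := by
  rw [h.mul_localConj, hπ.norm_pi]

theorem IsNormGen.n_ne_zero (hπ : IsNormGen c π t₁ n₁) : n₁ ≠ 0 := by
  rw [← hπ.norm_pi]
  exact norm_ne_zero_of_unit π

theorem IsNormGen.conjUnit_mem (hπ : IsNormGen c π t₁ n₁) :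
    (conjUnit c π : LocalAlg q L) ∈ localIntegers q L := localConj_mem q c hπ.mem

theorem IsNormGen.inv_eq (h : IsQuadGen c θ t n) (hπ : IsNormGen c π t₁ n₁) :
    ((π⁻¹ : (LocalAlg q L)ˣ) : LocalAlg q L) =
      localConj q c π * algebraMap ℚ_[q] (LocalAlg q L) n₁⁻¹ := by
  rw [h.inv_eq, hπ.norm_pi]

theorem IsNormGen.conjUnit_inv_eq (h : IsQuadGen c θ t n) (hπ : IsNormGen c π t₁ n₁) :
    (((conjUnit c π)⁻¹ : (LocalAlg q L)ˣ) : LocalAlg q L) =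
      π * algebraMap ℚ_[q] (LocalAlg q L) n₁⁻¹ := by
  rw [h.inv_eq, conjUnit_val, h.localConj_localConj, h.norm_localConj, hπ.norm_pi]

/-- For x = a + bπ one has N(x) ≡ a(a + t₁b) modulo n₁. If q divides a, then π divides x; if q
divides a + t₁b, then conj(π) divides x = (a + t₁b) − b conj(π). -/
theorem IsNormGen.mul_inv_mem (h : IsQuadGen c θ t n) (hπ : IsNormGen c π t₁ n₁)
    {x : LocalAlg q L} (hx : x ∈ localIntegers q L) (hlt : ‖Algebra.norm ℚ_[q] x‖ < 1) :
    x * ((π⁻¹ : (LocalAlg q L)ˣ) : LocalAlg q L) ∈ localIntegers q L ∨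
      x * (((conjUnit c π)⁻¹ : (LocalAlg q L)ˣ) : LocalAlg q L) ∈ localIntegers q L := by
  have hn0 := hπ.n_ne_zero
  have hninv : ∀ a : ℚ_[q], ‖a‖ < 1 → ‖a * n₁⁻¹‖ ≤ 1 := by
    intro a ha
    rw [norm_mul, norm_inv, ← div_eq_mul_inv, div_le_one (norm_pos_iff.mpr hn0), hπ.norm_eq]
    exact norm_lt_one_iff_le.mp ha
  have hnn : algebraMap ℚ_[q] (LocalAlg q L) n₁ * algebraMap ℚ_[q] (LocalAlg q L) n₁⁻¹ = 1 := by
    rw [← map_mul, mul_inv_cancel₀ hn0, map_one]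
  have hmul := hπ.mul_conj h
  obtain ⟨a, b, ha, hb, rfl⟩ := hπ.span x hx
  have h1 : ‖a * (a + t₁ * b)‖ < 1 := by
    rw [hπ.norm_add] at hlt
    have e : a * (a + t₁ * b) = (a ^ 2 + t₁ * a * b + n₁ * b ^ 2) + n₁ * -(b ^ 2) := by ring
    rw [e, norm_lt_one_iff_le]
    refine norm_add_le_of_le (norm_lt_one_iff_le.mp hlt) (norm_mul_le_of_le hπ.norm_eq.le ?_)
    rw [norm_neg, norm_pow]
    exact pow_le_one₀ (norm_nonneg _) hb
  rcases lt_or_ge ‖a‖ 1 with h2 | h2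
  · left
    have e : (algebraMap ℚ_[q] (LocalAlg q L) a + algebraMap ℚ_[q] (LocalAlg q L) b * π) *
        ((π⁻¹ : (LocalAlg q L)ˣ) : LocalAlg q L) =
        algebraMap ℚ_[q] (LocalAlg q L) (a * n₁⁻¹) * localConj q c π +
          algebraMap ℚ_[q] (LocalAlg q L) b := by
      rw [add_mul, mul_assoc _ (π : LocalAlg q L), Units.mul_inv, mul_one, hπ.inv_eq h, map_mul]
      ring
    rw [e]
    exact add_mem (mul_mem (h.algebraMap_mem.mpr (hninv a h2)) (localConj_mem q c hπ.mem))
      (h.algebraMap_mem.mpr hb)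
  · right
    have h3 : ‖a + t₁ * b‖ < 1 := by
      by_contra! hge
      rw [norm_mul] at h1
      nlinarith
    have e : (algebraMap ℚ_[q] (LocalAlg q L) a + algebraMap ℚ_[q] (LocalAlg q L) b * π) *
        (((conjUnit c π)⁻¹ : (LocalAlg q L)ˣ) : LocalAlg q L) =
        algebraMap ℚ_[q] (LocalAlg q L) ((a + t₁ * b) * n₁⁻¹) * π -
          algebraMap ℚ_[q] (LocalAlg q L) b := by
      rw [hπ.conj] at hmul
      rw [hπ.conjUnit_inv_eq h, map_mul, map_add, map_mul]
      linear_combination (algebraMap ℚ_[q] (LocalAlg q L) b) * hnn * (-1) -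
        (algebraMap ℚ_[q] (LocalAlg q L) b * algebraMap ℚ_[q] (LocalAlg q L) n₁⁻¹) * hmul
    rw [e]
    exact sub_mem (mul_mem (h.algebraMap_mem.mpr (hninv _ h3)) hπ.mem) (h.algebraMap_mem.mpr hb)

theorem IsNormGen.norm_conjUnit (h : IsQuadGen c θ t n) (hπ : IsNormGen c π t₁ n₁) :
    Algebra.norm ℚ_[q] (conjUnit c π : LocalAlg q L) = n₁ := by
  rw [conjUnit_val, h.norm_localConj, hπ.norm_pi]

theorem IsQuadGen.exists_pow_mul_mem (h : IsQuadGen c θ t n) (x : (LocalAlg q L)ˣ) :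
    ∃ k : ℕ, ((baseUnit q L (primeUnit q) ^ k * x : (LocalAlg q L)ˣ) : LocalAlg q L) ∈
      localIntegers q L := by
  have hq := one_lt_q (q := q)
  obtain ⟨a, b, hab⟩ := h.exists_locMk (x : LocalAlg q L)
  obtain ⟨k, hk⟩ := pow_unbounded_of_one_lt (max ‖a‖ ‖b‖) hq
  refine ⟨k, ?_⟩
  have e : ((baseUnit q L (primeUnit q) ^ k * x : (LocalAlg q L)ˣ) : LocalAlg q L) =
      locMk q θ ((primeUnit q ^ k : ℚ_[q]ˣ) * a) ((primeUnit q ^ k : ℚ_[q]ˣ) * b) := by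
    rw [← map_pow, Units.val_mul, baseUnit_val, hab]
    simp only [locMk, map_mul]
    ring
  have hle : ∀ y : ℚ_[q], ‖y‖ ≤ max ‖a‖ ‖b‖ → ‖((primeUnit q ^ k : ℚ_[q]ˣ) : ℚ_[q]) * y‖ ≤ 1 := by
    intro y hy
    rw [norm_mul, norm_primeUnit_pow, zpow_neg, zpow_natCast, inv_mul_le_iff₀ (by positivity),
      mul_one]
    exact hy.trans hk.le
  rw [e, h.locMk_mem]
  exact ⟨hle a (le_max_left _ _), hle b (le_max_right _ _)⟩

theorem exists_norm_eq_pow {x : (LocalAlg q L)ˣ} (hx : (x : LocalAlg q L) ∈ localIntegers q L) :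
    ∃ m : ℕ, ‖Algebra.norm ℚ_[q] (x : LocalAlg q L)‖ = (q : ℝ) ^ (-(m : ℤ)) := by
  have hq := one_lt_q (q := q)
  obtain ⟨m, hm⟩ := exists_norm_eq_zpow (Units.mk0 _ (norm_ne_zero_of_unit x))
  rw [Units.val_mk0] at hm
  have hm0 : 0 ≤ m := by
    have h1 := norm_le_one q hx
    rw [hm] at h1
    by_contra hlt
    have := one_lt_zpow₀ hq (n := -m) (by omega)
    linarith
  lift m to ℕ using hm0
  exact ⟨m, hm⟩

theorem IsNormGen.exists_baseUnit_eq (h : IsQuadGen c θ t n) (hπ : IsNormGen c π t₁ n₁) :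
    ∃ ε ∈ localUnits q L, baseUnit q L (primeUnit q) = π * conjUnit c π * ε := by
  set ν : ℚ_[q]ˣ := Units.mk0 n₁ hπ.n_ne_zero with hν
  refine ⟨baseUnit q L (primeUnit q * ν⁻¹), h.map_mem_localUnits ?_, ?_⟩
  · rw [Units.val_mul, Units.val_inv_eq_inv_val, hν, Units.val_mk0, norm_mul, norm_inv,
      norm_primeUnit, hπ.norm_eq, zpow_neg_one]
    exact mul_inv_cancel₀ (inv_ne_zero (by linarith [one_lt_q (q := q)]))
  · have h1 : π * conjUnit c π = baseUnit q L ν := Units.ext (hπ.mul_conj h)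
    rw [h1, ← map_mul, mul_comm, inv_mul_cancel_right]

/-- Every element of `L_q^×` is a unit times powers of `π` and of its conjugate. -/
theorem IsNormGen.exists_factor (h : IsQuadGen c θ t n) (hπ : IsNormGen c π t₁ n₁)
    (x : (LocalAlg q L)ˣ) : ∃ i j : ℤ, ∃ ε ∈ localUnits q L, x = π ^ i * conjUnit c π ^ j * ε := by
  have hq := one_lt_q (q := q)
  have hq0 : (0 : ℝ) < q := by linarith
  -- Induction on the valuation of the norm for integral x, each step removing π or conj(π); a
  -- general x is made integral by a power of q, itself π conj(π) up to a unit.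
  have key : ∀ m : ℕ, ∀ x : (LocalAlg q L)ˣ, (x : LocalAlg q L) ∈ localIntegers q L →
      ‖Algebra.norm ℚ_[q] (x : LocalAlg q L)‖ = (q : ℝ) ^ (-(m : ℤ)) →
      ∃ i j : ℤ, ∃ ε ∈ localUnits q L, x = π ^ i * conjUnit c π ^ j * ε := by
    intro m
    induction m with
    | zero =>
      intro x hx hxn
      exact ⟨0, 0, x, h.mem_localUnits_iff.mpr ⟨hx, by simpa using hxn⟩, by simp⟩
    | succ m ih =>
      intro x hx hxn
      have hstep : ∀ y : (LocalAlg q L)ˣ, Algebra.norm ℚ_[q] (y : LocalAlg q L) = n₁ →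
          ‖Algebra.norm ℚ_[q] ((x * y⁻¹ : (LocalAlg q L)ˣ) : LocalAlg q L)‖ =
            (q : ℝ) ^ (-(m : ℤ)) := by
        intro y hy
        have h1 : Algebra.norm ℚ_[q] ((x * y⁻¹ : (LocalAlg q L)ˣ) : LocalAlg q L) * n₁ =
            Algebra.norm ℚ_[q] (x : LocalAlg q L) := by
          rw [← hy, ← map_mul, ← Units.val_mul, inv_mul_cancel_right]
        have h2 := congrArg norm h1
        rw [norm_mul, hπ.norm_eq, hxn] at h2
        have h3 : (q : ℝ) ^ (-((m + 1 : ℕ) : ℤ)) = (q : ℝ) ^ (-(m : ℤ)) * (q : ℝ) ^ (-1 : ℤ) := by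
          rw [← zpow_add₀ hq0.ne']
          congr 1
          push_cast
          ring
        rw [h3] at h2
        exact mul_right_cancel₀ (zpow_ne_zero _ hq0.ne') h2
      have hlt : ‖Algebra.norm ℚ_[q] (x : LocalAlg q L)‖ < 1 := by
        rw [hxn]
        exact zpow_lt_one_of_neg₀ hq (by omega)
      rcases hπ.mul_inv_mem h hx hlt with h1 | h1
      · obtain ⟨i, j, ε, hε, he⟩ := ih (x * π⁻¹) h1 (hstep _ hπ.norm_pi)
        refine ⟨i + 1, j, ε, hε, ?_⟩
        exact (mul_inv_eq_iff_eq_mul.mp he).trans (zpow_mul_zpow_mul_mul_left _ _ _ _ _)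
      · obtain ⟨i, j, ε, hε, he⟩ := ih (x * (conjUnit c π)⁻¹) h1 (hstep _ (hπ.norm_conjUnit h))
        refine ⟨i, j + 1, ε, hε, ?_⟩
        exact (mul_inv_eq_iff_eq_mul.mp he).trans (zpow_mul_zpow_mul_mul_right _ _ _ _ _)
  obtain ⟨k, hk⟩ := h.exists_pow_mul_mem x
  obtain ⟨m, hm⟩ := exists_norm_eq_pow hk
  obtain ⟨i, j, ε, hε, he⟩ := key m _ hk hm
  obtain ⟨η, hη, hqη⟩ := hπ.exists_baseUnit_eq h
  refine ⟨i - k, j - k, ε * (η ^ k)⁻¹, mul_mem hε (inv_mem (pow_mem hη k)), ?_⟩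
  have h1 : x = (baseUnit q L (primeUnit q) ^ k)⁻¹ * (π ^ i * conjUnit c π ^ j * ε) := by
    rw [← he, inv_mul_cancel_left]
  rw [h1, hqη]
  exact mul_pow_inv_mul_zpow _ _ _ _ _ _ _

end NormGen

/-! ### Classes of L_q^× modulo units in the three cases -/

section Reps

theorem inv_zpow_mul_mul_pow {G : Type*} [CommGroup G] (a b f : G) (i : ℤ) (d : ℕ) :
    (a ^ i * b ^ ((d : ℤ) - i))⁻¹ * (a * b * f) ^ d = f ^ d * (a ^ ((d : ℤ) - i) * b ^ i) := by
  rw [inv_mul_eq_iff_eq_mul, mul_pow, mul_pow]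
  have h1 : a ^ i * b ^ ((d : ℤ) - i) * (f ^ d * (a ^ ((d : ℤ) - i) * b ^ i)) =
      (a ^ i * a ^ ((d : ℤ) - i)) * (b ^ ((d : ℤ) - i) * b ^ i) * f ^ d := by ac_rfl
  rw [h1, ← zpow_add, ← zpow_add, add_sub_cancel, sub_add_cancel, zpow_natCast, zpow_natCast]

theorem inv_zpow_mul_inv {G : Type*} [CommGroup G] (a b : G) (i i' j : ℤ) :
    (a ^ i * b ^ (j - i))⁻¹ * (a ^ i' * b ^ (j - i')) = (a * b⁻¹) ^ (i' - i) := by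
  rw [zpow_sub, zpow_sub, zpow_sub, mul_inv, mul_inv, inv_inv, mul_zpow, mul_zpow, inv_zpow,
    inv_zpow, mul_inv, inv_inv]
  have : a ^ i' * (b ^ j * (b ^ i')⁻¹) = b ^ j * (a ^ i' * (b ^ i')⁻¹) := mul_left_comm _ _ _
  rw [this, mul_assoc, mul_assoc (b ^ j)⁻¹, mul_left_comm (b ^ i), inv_mul_cancel_left]
  simp only [mul_assoc, mul_comm, mul_left_comm]

variable {q : ℕ} [Fact q.Prime] {L : Type*} [Field L] [NumberField L]
variable {c : L ≃ₐ[ℚ] L} {θ : 𝓞 L} {t n : ℤ}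

variable (q L) in
/-- The absolute value of the norm from `L_q` to `ℚ_q`. -/
noncomputable def absNormHom : (LocalAlg q L)ˣ →* ℝ where
  toFun x := ‖Algebra.norm ℚ_[q] (x : LocalAlg q L)‖
  map_one' := by rw [Units.val_one, map_one, norm_one]
  map_mul' x y := by rw [Units.val_mul, map_mul, norm_mul]

theorem absNormHom_apply (x : (LocalAlg q L)ˣ) :
    absNormHom q L x = ‖Algebra.norm ℚ_[q] (x : LocalAlg q L)‖ := rfl

theorem absNormHom_zpow (x : (LocalAlg q L)ˣ) (i : ℤ) :
    absNormHom q L (x ^ i) = absNormHom q L x ^ i := by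
  have h1 := congrArg Units.val (map_zpow (absNormHom q L).toHomUnits x i)
  rw [Units.val_zpow_eq_zpow_val] at h1
  exact h1

theorem absNormHom_inv (x : (LocalAlg q L)ˣ) : absNormHom q L x⁻¹ = (absNormHom q L x)⁻¹ := by
  have := absNormHom_zpow x (-1)
  rwa [zpow_neg_one, zpow_neg_one] at this

theorem IsQuadGen.absNormHom_baseUnit (h : IsQuadGen c θ t n) (a : ℚ_[q]ˣ) :
    absNormHom q L (baseUnit q L a) = ‖(a : ℚ_[q])‖ ^ 2 := by
  rw [absNormHom_apply, baseUnit_val, h.norm_algebraMap, norm_pow]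

theorem IsQuadGen.absNormHom_eq_one (h : IsQuadGen c θ t n) {ε : (LocalAlg q L)ˣ}
    (hε : ε ∈ localUnits q L) : absNormHom q L ε = 1 := (h.mem_localUnits_iff.mp hε).2

theorem IsQuadGen.absNormHom_baseUnit_primeUnit_zpow (h : IsQuadGen c θ t n) (k : ℤ) :
    absNormHom q L (baseUnit q L (primeUnit q) ^ k) = (q : ℝ) ^ (-2 * k) := by
  rw [absNormHom_zpow, h.absNormHom_baseUnit, norm_primeUnit, zpow_mul, inv_pow]
  rfl

section Inert

/-- An integral element is a unit unless both coordinates are divisible by q; dividing by q lowers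
the valuation of the norm by two. -/
theorem IsQuadGen.exists_eq_of_isInert (h : IsQuadGen c θ t n) (hq : IsInert q L)
    (x : (LocalAlg q L)ˣ) : ∃ j : ℤ, ∃ ε ∈ localUnits q L, x = baseUnit q L (primeUnit q) ^ j * ε := by
  have hq1 := one_lt_q (q := q)
  have key : ∀ m : ℕ, ∀ y : (LocalAlg q L)ˣ, (y : LocalAlg q L) ∈ localIntegers q L →
      absNormHom q L y = (q : ℝ) ^ (-(m : ℤ)) →
      ∃ j : ℤ, ∃ ε ∈ localUnits q L, y = baseUnit q L (primeUnit q) ^ j * ε := by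
    intro m
    induction m using Nat.strong_induction_on with
    | _ m ih =>
      intro y hy hym
      obtain ⟨a, b, hab⟩ := h.exists_locMk (y : LocalAlg q L)
      have hmem := hy
      rw [hab] at hmem
      obtain ⟨ha, hb⟩ := h.locMk_mem.mp hmem
      by_cases hlt : ‖a‖ < 1 ∧ ‖b‖ < 1
      · have hval : ((y * (baseUnit q L (primeUnit q))⁻¹ : (LocalAlg q L)ˣ) : LocalAlg q L) =
            locMk q θ (a * (primeUnit q : ℚ_[q])⁻¹) (b * (primeUnit q : ℚ_[q])⁻¹) := by
          rw [← map_inv, Units.val_mul, baseUnit_val, hab, Units.val_inv_eq_inv_val]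
          simp only [locMk, map_mul]
          ring
        have hle : ∀ z : ℚ_[q], ‖z‖ < 1 → ‖z * (primeUnit q : ℚ_[q])⁻¹‖ ≤ 1 := by
          intro z hz
          rw [norm_mul, norm_inv, norm_primeUnit, inv_inv]
          have := norm_lt_one_iff_le.mp hz
          rw [zpow_neg_one, ← one_div, le_div_iff₀ (by linarith)] at this
          exact this
        have hO : ((y * (baseUnit q L (primeUnit q))⁻¹ : (LocalAlg q L)ˣ) : LocalAlg q L) ∈
            localIntegers q L := by
          rw [hval]
          exact h.locMk_mem.mpr ⟨hle a hlt.1, hle b hlt.2⟩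
        obtain ⟨m', hm'⟩ := exists_norm_eq_pow hO
        have h1 : absNormHom q L (y * (baseUnit q L (primeUnit q))⁻¹) =
            (q : ℝ) ^ (-(m : ℤ) + 2) := by
          rw [map_mul, hym, ← zpow_neg_one (baseUnit q L (primeUnit q)),
            h.absNormHom_baseUnit_primeUnit_zpow, ← zpow_add₀ (by linarith)]
          norm_num
        have h2 : -(m' : ℤ) = -(m : ℤ) + 2 := q_zpow_inj (hm'.symm.trans h1)
        obtain ⟨j, ε, hε, he⟩ := ih m' (by omega) _ hO hm'
        refine ⟨j + 1, ε, hε, ?_⟩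
        rw [mul_inv_eq_iff_eq_mul.mp he, zpow_add_one, mul_right_comm]
      · refine ⟨0, y, h.mem_localUnits_iff.mpr ⟨hy, ?_⟩, by simp⟩
        rw [hab, h.norm_locMk]
        exact h.norm_eq_one_of_isInert hq ha hb hlt
  obtain ⟨k, hk⟩ := h.exists_pow_mul_mem x
  obtain ⟨m, hm⟩ := exists_norm_eq_pow hk
  obtain ⟨j, ε, hε, he⟩ := key m _ hk hm
  refine ⟨-k + j, ε, hε, ?_⟩
  rw [zpow_add, zpow_neg, zpow_natCast, mul_assoc, ← he, inv_mul_cancel_left]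

/-- Norms have even valuation, so there is one class for d = 2k and none for odd d. The
representative q^(-k) gives the fraction q^k / 1, of norm q^d. -/
theorem IsQuadGen.isUnitReps_of_isInert (h : IsQuadGen c θ t n) (hq : IsInert q L) :
    IsUnitReps q (L := L) (I := fun d => {k : ℕ // d = 2 * k})
      (fun _ k => (baseUnit q L (primeUnit q) ^ (k : ℕ))⁻¹) (fun d _ => d) where
  norm_rep := by
    rintro d ⟨k, rfl⟩
    have := h.absNormHom_baseUnit_primeUnit_zpow (q := q) (-k)
    rw [zpow_neg, zpow_natCast] at this
    refine this.trans ?_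
    congr 1
    push_cast
    ring
  existsUnique := by
    intro d x hx
    obtain ⟨j, ε, hε, rfl⟩ := h.exists_eq_of_isInert hq x
    change absNormHom q L _ = _ at hx
    rw [map_mul, h.absNormHom_eq_one hε, mul_one, h.absNormHom_baseUnit_primeUnit_zpow] at hx
    have h1 := q_zpow_inj hx
    obtain ⟨k, hk⟩ := Int.eq_ofNat_of_zero_le (a := -j) (by omega)
    refine ⟨⟨k, by omega⟩, ?_, fun k' _ => Subtype.ext (by have := k'.2; dsimp only; omega)⟩
    have h2 : j = -(k : ℤ) := by omega
    simp only [inv_inv]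
    rw [h2, zpow_neg, zpow_natCast, mul_right_comm, inv_mul_cancel, one_mul]
    exact hε
  fraction := by
    rintro d ⟨k, rfl⟩
    refine ⟨baseUnit q L (primeUnit q) ^ k, 1, 1, 0, zero_mem _, 1, one_mem _, ?_, one_mem _,
      by simp, one_mem _, ?_, ?_⟩
    · rw [← map_pow, baseUnit_val, h.algebraMap_mem, norm_primeUnit_pow]
      exact zpow_le_one_of_nonpos₀ one_lt_q.le (by omega)
    · change (baseUnit q L (primeUnit q) ^ k)⁻¹ * baseUnit q L (primeUnit q ^ (2 * k)) * 1 = _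
      rw [map_pow, two_mul, pow_add, inv_mul_cancel_left, mul_one, one_mul]
    · rw [mul_one]
      have := h.absNormHom_baseUnit_primeUnit_zpow (q := q) k
      rw [zpow_natCast] at this
      refine this.trans ?_
      push_cast
      rw [neg_mul]

end Inert

variable {π : (LocalAlg q L)ˣ} {t₁ n₁ : ℚ_[q]}

theorem IsNormGen.absNormHom_pi (hπ : IsNormGen c π t₁ n₁) :
    absNormHom q L π = (q : ℝ) ^ (-1 : ℤ) := by
  rw [absNormHom_apply, hπ.norm_pi, hπ.norm_eq]

theorem IsNormGen.absNormHom_conjUnit (h : IsQuadGen c θ t n) (hπ : IsNormGen c π t₁ n₁) :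
    absNormHom q L (conjUnit c π) = (q : ℝ) ^ (-1 : ℤ) := by
  rw [absNormHom_apply, hπ.norm_conjUnit h, hπ.norm_eq]

theorem IsNormGen.absNormHom_mul (h : IsQuadGen c θ t n) (hπ : IsNormGen c π t₁ n₁) (i j : ℤ) :
    absNormHom q L (π ^ i * conjUnit c π ^ j) = (q : ℝ) ^ (-(i + j)) := by
  rw [map_mul, absNormHom_zpow, absNormHom_zpow, hπ.absNormHom_pi, hπ.absNormHom_conjUnit h,
    ← zpow_mul, ← zpow_mul, ← zpow_add₀ (by linarith [one_lt_q (q := q)])]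
  congr 1
  ring

section Ramified

/-- One has conj(π)/π = t₁ conj(π)/n₁ − 1, which is integral because q divides t₁. -/
theorem IsNormGen.conjUnit_mul_inv_mem (h : IsQuadGen c θ t n) (hπ : IsNormGen c π t₁ n₁)
    (ht : ‖t₁‖ < 1) : conjUnit c π * π⁻¹ ∈ localUnits q L := by
  have hn0 := hπ.n_ne_zero
  refine h.mem_localUnits_iff.mpr ⟨?_, ?_⟩
  · have e : ((conjUnit c π * π⁻¹ : (LocalAlg q L)ˣ) : LocalAlg q L) =
        algebraMap ℚ_[q] (LocalAlg q L) (t₁ * n₁⁻¹) * localConj q c π - 1 := by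
      have h1 := hπ.mul_conj h
      have hnn : algebraMap ℚ_[q] (LocalAlg q L) n₁ * algebraMap ℚ_[q] (LocalAlg q L) n₁⁻¹ = 1 := by
        rw [← map_mul, mul_inv_cancel₀ hn0, map_one]
      rw [Units.val_mul, conjUnit_val, hπ.inv_eq h, map_mul]
      rw [hπ.conj] at h1 ⊢
      linear_combination (-algebraMap ℚ_[q] (LocalAlg q L) n₁⁻¹) * h1 - hnn
    rw [e]
    refine sub_mem (mul_mem (h.algebraMap_mem.mpr ?_) (localConj_mem q c hπ.mem)) (one_mem _)
    rw [norm_mul, norm_inv, ← div_eq_mul_inv, div_le_one (norm_pos_iff.mpr hn0), hπ.norm_eq]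
    exact norm_lt_one_iff_le.mp ht
  · change absNormHom q L _ = 1
    rw [map_mul, absNormHom_inv, hπ.absNormHom_pi, hπ.absNormHom_conjUnit h]
    exact mul_inv_cancel₀ (zpow_ne_zero _ (by linarith [one_lt_q (q := q)]))

theorem IsNormGen.exists_eq_of_ramified (h : IsQuadGen c θ t n) (hπ : IsNormGen c π t₁ n₁)
    (ht : ‖t₁‖ < 1) (x : (LocalAlg q L)ˣ) : ∃ j : ℤ, ∃ ε ∈ localUnits q L, x = π ^ j * ε := by
  obtain ⟨i, j, ε, hε, rfl⟩ := hπ.exists_factor h x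
  refine ⟨i + j, (conjUnit c π * π⁻¹) ^ j * ε,
    mul_mem (zpow_mem (hπ.conjUnit_mul_inv_mem h ht) j) hε, ?_⟩
  rw [mul_zpow, inv_zpow, zpow_add, mul_comm (conjUnit c π ^ j), mul_assoc, mul_assoc, mul_assoc,
    mul_inv_cancel_left]

/-- There is one class for each d, that of π^(-d). As q is π² up to a unit, q^d π^(-d) is π^d up to
a unit, already a fraction with denominator 1. -/
theorem IsNormGen.isUnitReps_of_ramified (h : IsQuadGen c θ t n) (hπ : IsNormGen c π t₁ n₁)
    (ht : ‖t₁‖ < 1) : IsUnitReps q (L := L) (I := fun _ => Unit) (fun d _ => (π ^ d)⁻¹)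
      (fun d _ => d) where
  norm_rep := by
    intro d _
    have := absNormHom_zpow π (-d)
    rw [zpow_neg, zpow_natCast, hπ.absNormHom_pi, ← zpow_mul] at this
    refine this.trans ?_
    congr 1
    ring
  existsUnique := by
    intro d x hx
    obtain ⟨j, ε, hε, rfl⟩ := hπ.exists_eq_of_ramified h ht x
    change absNormHom q L _ = _ at hx
    rw [map_mul, h.absNormHom_eq_one hε, mul_one, absNormHom_zpow, hπ.absNormHom_pi, ← zpow_mul] at hx
    have h1 := q_zpow_inj hx
    refine ⟨(), ?_, fun _ _ => rfl⟩
    have h2 : j = -(d : ℤ) := by omega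
    simp only [inv_inv]
    rw [h2, zpow_neg, zpow_natCast, mul_right_comm, inv_mul_cancel, one_mul]
    exact hε
  fraction := by
    intro d _
    obtain ⟨η, hη, hqη⟩ := hπ.exists_baseUnit_eq h
    refine ⟨π ^ d, 1, ((conjUnit c π * π⁻¹) * η) ^ d, 0, zero_mem _, 1, one_mem _, ?_, one_mem _,
      by simp, pow_mem (mul_mem (hπ.conjUnit_mul_inv_mem h ht) hη) d, ?_, ?_⟩
    · rw [Units.val_pow_eq_pow_val]
      exact pow_mem hπ.mem d
    · rw [map_pow, hqη, mul_one, ← inv_pow, ← mul_pow, ← mul_pow]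
      congr 1
      rw [mul_assoc, inv_mul_cancel_left, mul_right_comm, inv_mul_cancel_right]
    · rw [mul_one]
      have := absNormHom_zpow π d
      rw [zpow_natCast, hπ.absNormHom_pi, ← zpow_mul] at this
      refine this.trans ?_
      congr 1
      ring

end Ramified

section Split

/-- The trace π + conj(π) is a unit, so π and conj(π) generate the unit ideal, and so do their
powers. -/
theorem IsNormGen.exists_coprime (h : IsQuadGen c θ t n) (hπ : IsNormGen c π t₁ n₁)
    (ht : ¬ ‖t₁‖ < 1) (k l : ℕ) : ∃ S ∈ localIntegers q L, ∃ T ∈ localIntegers q L,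
      S * ((π ^ k : (LocalAlg q L)ˣ) : LocalAlg q L) +
        T * ((conjUnit c π ^ l : (LocalAlg q L)ˣ) : LocalAlg q L) = 1 := by
  have ht1 : ‖t₁‖ = 1 := le_antisymm hπ.trace_le (not_lt.mp ht)
  have ht0 : t₁ ≠ 0 := by rw [← norm_ne_zero_iff, ht1]; exact one_ne_zero
  have hmem : algebraMap ℚ_[q] (LocalAlg q L) t₁⁻¹ ∈ localIntegers q L :=
    h.algebraMap_mem.mpr (by rw [norm_inv, ht1, inv_one])
  have hcop : IsCoprime (⟨(π : LocalAlg q L), hπ.mem⟩ : localIntegers q L)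
      ⟨(conjUnit c π : LocalAlg q L), hπ.conjUnit_mem⟩ := by
    refine ⟨⟨_, hmem⟩, ⟨_, hmem⟩, Subtype.ext ?_⟩
    change algebraMap ℚ_[q] (LocalAlg q L) t₁⁻¹ * π +
      algebraMap ℚ_[q] (LocalAlg q L) t₁⁻¹ * localConj q c π = 1
    rw [hπ.conj, ← mul_add, add_sub_cancel, ← map_mul, inv_mul_cancel₀ ht0, map_one]
  obtain ⟨S, T, hST⟩ := hcop.pow (m := k) (n := l)
  refine ⟨S, S.2, T, T.2, ?_⟩
  rw [Units.val_pow_eq_pow_val, Units.val_pow_eq_pow_val]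
  exact congrArg Subtype.val hST

/-- If π^k were a unit times conj(π)^k, coprimality would make conj(π)^k invertible, against its
norm. -/
theorem IsNormGen.zpow_mem_iff (h : IsQuadGen c θ t n) (hπ : IsNormGen c π t₁ n₁)
    (ht : ¬ ‖t₁‖ < 1) {m : ℤ} (hm : (π * (conjUnit c π)⁻¹) ^ m ∈ localUnits q L) : m = 0 := by
  have key : ∀ k : ℕ, (π * (conjUnit c π)⁻¹) ^ k ∈ localUnits q L → k = 0 := by
    intro k hk
    obtain ⟨S, hS, T, hT, hST⟩ := hπ.exists_coprime h ht k k
    set ε := (π * (conjUnit c π)⁻¹) ^ k with hε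
    have h1 : π ^ k = ε * conjUnit c π ^ k := by
      rw [hε, mul_pow, inv_pow, inv_mul_cancel_right]
    have h2 : (S * ε + T) * ((conjUnit c π ^ k : (LocalAlg q L)ˣ) : LocalAlg q L) = 1 := by
      rw [← hST, h1, Units.val_mul]
      ring
    have h3 := congrArg (fun z => ‖Algebra.norm ℚ_[q] z‖) h2
    simp only [map_mul, norm_mul, map_one, norm_one] at h3
    have h4 := norm_le_one q (add_mem (mul_mem hS hk.1) hT)
    have h5 : ‖Algebra.norm ℚ_[q] ((conjUnit c π ^ k : (LocalAlg q L)ˣ) : LocalAlg q L)‖ =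
        (q : ℝ) ^ (-(k : ℤ)) := by
      change absNormHom q L (conjUnit c π ^ k) = _
      rw [← zpow_natCast, absNormHom_zpow, hπ.absNormHom_conjUnit h, ← zpow_mul]
      congr 1
      ring
    rw [h5] at h3
    by_contra hk0
    have h6 : (q : ℝ) ^ (-(k : ℤ)) < 1 := zpow_lt_one_of_neg₀ one_lt_q (by omega)
    have h7 : (0 : ℝ) < (q : ℝ) ^ (-(k : ℤ)) := zpow_pos (by linarith [one_lt_q (q := q)]) _
    nlinarith
  rcases le_total 0 m with h0 | h0
  · lift m to ℕ using h0
    rw [zpow_natCast] at hm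
    rw [key m hm, Nat.cast_zero]
  · obtain ⟨k, hk⟩ := Int.eq_ofNat_of_zero_le (a := -m) (by omega)
    have h1 := inv_mem hm
    rw [← zpow_neg, hk, zpow_natCast] at h1
    have := key k h1
    omega

/-- Up to a unit, q^d times the representative is π^(d−i) conj(π)^i. Factors with a negative
exponent form the denominator, which is coprime to the numerator, so the total exponent is |i| + |d
− i|. -/
theorem IsNormGen.isUnitReps_of_split (h : IsQuadGen c θ t n) (hπ : IsNormGen c π t₁ n₁)
    (ht : ¬ ‖t₁‖ < 1) : IsUnitReps q (L := L) (I := fun _ => ℤ)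
      (fun d i => (π ^ i * conjUnit c π ^ ((d : ℤ) - i))⁻¹)
      (fun d i => i.natAbs + ((d : ℤ) - i).natAbs) where
  norm_rep := by
    intro d i
    refine (absNormHom_inv _).trans ?_
    rw [hπ.absNormHom_mul h, ← zpow_neg]
    congr 1
    ring
  existsUnique := by
    intro d x hx
    refine existsUnique_of_exists_of_unique ?_ ?_
    · obtain ⟨i, j, ε, hε, rfl⟩ := hπ.exists_factor h x
      change absNormHom q L _ = _ at hx
      rw [map_mul, h.absNormHom_eq_one hε, mul_one, hπ.absNormHom_mul h] at hx
      have h1 := q_zpow_inj hx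
      refine ⟨-i, ?_⟩
      rw [inv_inv]
      have h2 : (d : ℤ) - -i = -j := by omega
      have h3 : π ^ (-i) * conjUnit c π ^ (-j) = (π ^ i * conjUnit c π ^ j)⁻¹ := by
        rw [mul_inv, zpow_neg, zpow_neg]
      rw [h2, h3, mul_right_comm, mul_inv_cancel, one_mul]
      exact hε
    · intro i i' hi hi'
      have h1 := mul_mem (inv_mem hi) hi'
      rw [inv_inv, inv_inv] at h1
      have h2 : (x * (π ^ i * conjUnit c π ^ ((d : ℤ) - i)))⁻¹ *
          (x * (π ^ i' * conjUnit c π ^ ((d : ℤ) - i'))) = (π * (conjUnit c π)⁻¹) ^ (i' - i) := by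
        rw [← inv_zpow_mul_inv π (conjUnit c π) i i' d, mul_inv, mul_mul_mul_comm, inv_mul_cancel,
          one_mul]
      rw [h2] at h1
      have := hπ.zpow_mem_iff h ht h1
      omega
  fraction := by
    intro d i
    obtain ⟨η, hη, hqη⟩ := hπ.exists_baseUnit_eq h
    have key : ∀ x y : (LocalAlg q L)ˣ, π ^ ((d : ℤ) - i) * conjUnit c π ^ i * y = x →
        (π ^ i * conjUnit c π ^ ((d : ℤ) - i))⁻¹ * baseUnit q L (primeUnit q ^ d) * y =
          η ^ d * x := by
      intro x y hxy
      rw [map_pow, hqη, inv_zpow_mul_mul_pow, mul_assoc, hxy]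
    have hpow : ∀ (y : (LocalAlg q L)ˣ), (y : LocalAlg q L) ∈ localIntegers q L → ∀ k : ℕ,
        ((y ^ k : (LocalAlg q L)ˣ) : LocalAlg q L) ∈ localIntegers q L := by
      intro y hy k
      rw [Units.val_pow_eq_pow_val]
      exact pow_mem hy k
    have hnorm : ∀ k l m : ℕ, k + l = m →
        ‖Algebra.norm ℚ_[q] ((π ^ k * conjUnit c π ^ l : (LocalAlg q L)ˣ) : LocalAlg q L)‖ =
          (q : ℝ) ^ (-(m : ℤ)) := by
      intro k l m hm
      have := hπ.absNormHom_mul h k l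
      rw [zpow_natCast, zpow_natCast] at this
      refine this.trans ?_
      congr 1
      omega
    -- For i < 0 the denominator is a power of conj(π), for 0 ≤ i ≤ d it is 1, and for i > d it is a
    -- power of π.
    rcases lt_or_ge i 0 with hi | hi
    · obtain ⟨k, rfl⟩ : ∃ k : ℕ, i = -(k : ℤ) := ⟨i.natAbs, by omega⟩
      obtain ⟨S, hS, T, hT, hST⟩ := hπ.exists_coprime h ht (d + k) k
      refine ⟨π ^ (d + k), conjUnit c π ^ k, η ^ d, S, hS, T, hT, hpow _ hπ.mem _,
        hpow _ hπ.conjUnit_mem _, hST, pow_mem hη d, key _ _ ?_, hnorm _ _ _ (by omega)⟩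
      have : (d : ℤ) - -(k : ℤ) = ((d + k : ℕ) : ℤ) := by push_cast; ring
      rw [this, zpow_natCast, zpow_neg, zpow_natCast, inv_mul_cancel_right]
    · lift i to ℕ using hi with k
      rcases le_or_gt k d with hk | hk
      · obtain ⟨l, rfl⟩ := Nat.exists_eq_add_of_le hk
        refine ⟨π ^ l * conjUnit c π ^ k, 1, η ^ (k + l), 0, zero_mem _, 1, one_mem _, ?_,
          one_mem _, by simp, pow_mem hη _, key _ _ ?_, ?_⟩
        · rw [Units.val_mul]
          exact mul_mem (hpow _ hπ.mem _) (hpow _ hπ.conjUnit_mem _)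
        · have : ((k + l : ℕ) : ℤ) - (k : ℤ) = (l : ℤ) := by push_cast; ring
          rw [this, zpow_natCast, zpow_natCast, mul_one]
        · rw [mul_one]
          exact hnorm _ _ _ (by omega)
      · obtain ⟨l, rfl⟩ := Nat.exists_eq_add_of_le hk.le
        obtain ⟨S, hS, T, hT, hST⟩ := hπ.exists_coprime h ht l (d + l)
        refine ⟨conjUnit c π ^ (d + l), π ^ l, η ^ d, T, hT, S, hS, hpow _ hπ.conjUnit_mem _,
          hpow _ hπ.mem _, by rw [add_comm, hST], pow_mem hη d, key _ _ ?_, ?_⟩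
        · have : (d : ℤ) - ((d + l : ℕ) : ℤ) = -(l : ℤ) := by push_cast; ring
          rw [this, zpow_natCast, zpow_neg, zpow_natCast, mul_right_comm, inv_mul_cancel, one_mul]
        · rw [mul_comm]
          exact hnorm _ _ _ (by omega)

end Split

end Reps

/-! ### The quadratic character and its local factor -/

section ResidueChar

variable {q : ℕ} [Fact q.Prime] {L : Type*} [Field L] [NumberField L]
variable {c : L ≃ₐ[ℚ] L} {θ : 𝓞 L} {t n : ℤ}
variable {π : (LocalAlg q L)ˣ} {t₁ n₁ : ℚ_[q]}

theorem exists_root_quadratic {A B C x : ℤ_[q]} (h : ‖A * x ^ 2 + B * x + C‖ < 1)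
    (h' : ‖2 * A * x + B‖ = 1) : ∃ z : ℤ_[q], A * z ^ 2 + B * z + C = 0 := by
  let F : Polynomial ℤ_[q] := Polynomial.C A * Polynomial.X ^ 2 + Polynomial.C B * Polynomial.X +
    Polynomial.C C
  have hF : ∀ z : ℤ_[q], F.aeval z = A * z ^ 2 + B * z + C := by
    intro z
    simp [F]
  have hF' : F.derivative.aeval x = 2 * A * x + B := by
    simp [F]
    ring
  obtain ⟨z, hz, -⟩ := hensels_lemma (p := q) (F := F) (a := x) (by
    rw [hF, hF', h', one_pow]
    exact h)
  exact ⟨z, by rw [← hF, hz]⟩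

/-- A solution modulo q at which one partial derivative is a unit lifts by Hensel's lemma in that
variable, the other variable being fixed. -/
theorem exists_form_eq {t n a b u : ℤ_[q]} (h : ‖a ^ 2 + t * a * b + n * b ^ 2 - u‖ < 1)
    (h' : ‖2 * a + t * b‖ = 1 ∨ ‖t * a + 2 * n * b‖ = 1) :
    ∃ a b : ℤ_[q], a ^ 2 + t * a * b + n * b ^ 2 = u := by
  rcases h' with h' | h'
  · obtain ⟨z, hz⟩ := exists_root_quadratic (A := 1) (B := t * b) (C := n * b ^ 2 - u) (x := a)
      (by convert h using 2; ring) (by convert h' using 2; ring)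
    exact ⟨z, b, by linear_combination hz⟩
  · obtain ⟨z, hz⟩ := exists_root_quadratic (A := n) (B := t * a) (C := a ^ 2 - u) (x := b)
      (by convert h using 2; ring) (by convert h' using 2; ring)
    exact ⟨a, z, by linear_combination hz⟩

theorem toZMod_eq_zero_iff {x : ℤ_[q]} : PadicInt.toZMod x = 0 ↔ ‖x‖ < 1 := by
  rw [← RingHom.mem_ker, PadicInt.ker_toZMod, PadicInt.maximalIdeal_eq_span_p,
    Ideal.mem_span_singleton, PadicInt.norm_lt_one_iff_dvd]

theorem exists_toZMod_eq (r : ZMod q) : ∃ x : ℤ_[q], PadicInt.toZMod x = r :=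
  ⟨(r.val : ℤ_[q]), by rw [map_natCast, ZMod.natCast_zmod_val]⟩

theorem norm_padicInt_eq_one_iff {x : ℤ_[q]} : ‖x‖ = 1 ↔ ¬ ‖x‖ < 1 :=
  ⟨fun h => h.not_lt, fun h => le_antisymm x.norm_le_one (not_lt.mp h)⟩

theorem normResidueChar_eq_one {x : ℚ_[q]ˣ} (h : ∃ y : (LocalAlg q L)ˣ,
    Algebra.norm ℚ_[q] (y : LocalAlg q L) = x) : normResidueChar q L x = 1 := if_pos h

theorem normResidueChar_eq_neg_one {x : ℚ_[q]ˣ} (h : ¬ ∃ y : (LocalAlg q L)ˣ,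
    Algebra.norm ℚ_[q] (y : LocalAlg q L) = x) : normResidueChar q L x = -1 := if_neg h

theorem charLFactor_one (s : ℂ) :
    charLFactor (fun _ : ℚ_[q]ˣ => (1 : ℂ)) s = (1 - (q : ℂ) ^ (-s))⁻¹ := by
  have h : IsUnram (fun _ : ℚ_[q]ˣ => (1 : ℂ)) := fun _ _ => rfl
  rw [charLFactor, if_pos h, one_mul]

section Ramified

/-- Modulo q the form is a², so a lift of a nonsquare is not represented. -/
theorem not_square_of_odd (hq : q ≠ 2) :
    ∃ u : ℤ_[q], ‖u‖ = 1 ∧ ∀ a b t n : ℤ_[q], ‖t‖ < 1 → ‖n‖ < 1 →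
      a ^ 2 + t * a * b + n * b ^ 2 ≠ u := by
  obtain ⟨r, hr⟩ := FiniteField.exists_nonsquare (F := ZMod q) (by rwa [ZMod.ringChar_zmod_n])
  obtain ⟨u, rfl⟩ := exists_toZMod_eq r
  refine ⟨u, norm_padicInt_eq_one_iff.mpr fun h => hr ?_, fun a b t n ht hn h => hr ?_⟩
  · rw [toZMod_eq_zero_iff.mpr h]
    exact IsSquare.zero
  · rw [← h]
    simp only [map_add, map_mul, map_pow, toZMod_eq_zero_iff.mpr ht, toZMod_eq_zero_iff.mpr hn]
    exact ⟨PadicInt.toZMod a, by ring⟩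

theorem zmod_eight_disc : ∀ T V W : ZMod 8, V * W = 1 →
    2 * V - T ^ 2 = 1 ∨ 2 * V - T ^ 2 = 5 ∨ 2 * V - T ^ 2 = 2 ∨ 2 * V - T ^ 2 = 6 := by
  decide

theorem zmod_eight_form_odd : ∀ a b : ZMod 8, a ^ 2 + 1 * b ^ 2 ≠ 3 ∧ a ^ 2 + 5 * b ^ 2 ≠ 3 := by
  decide

theorem zmod_eight_form_even : ∀ a b : ZMod 8, a ^ 2 + 2 * b ^ 2 ≠ 5 ∧ a ^ 2 + 6 * b ^ 2 ≠ 5 := by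
  decide

/-- With t = 2t' and n = 2v, completing the square gives (a + t'b)² + (2v − t'²)b². Modulo 8 the
coefficient is 1, 5, 2 or 6; the form misses 3 in the first two cases and 5 in the others. -/
theorem exists_not_form_two {t n : ℤ_[2]} (ht : ‖t‖ < 1) (hn : ‖n‖ = (2 : ℝ)⁻¹) :
    ∃ u : ℤ_[2], ‖u‖ = 1 ∧ ∀ a b : ℤ_[2], a ^ 2 + t * a * b + n * b ^ 2 ≠ u := by
  obtain ⟨t', rfl⟩ := (PadicInt.norm_lt_one_iff_dvd t).mp ht
  obtain ⟨n', rfl⟩ := (PadicInt.norm_lt_one_iff_dvd n).mp (by rw [hn]; norm_num)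
  have hn' : IsUnit n' := by
    rw [PadicInt.isUnit_iff]
    rw [norm_mul, PadicInt.norm_p] at hn
    have : ((2 : ℕ) : ℝ)⁻¹ ≠ 0 := by norm_num
    exact mul_left_cancel₀ this (by rw [hn, mul_one]; norm_num)
  obtain ⟨v, rfl⟩ := hn'
  let φ : ℤ_[2] →+* ZMod 8 := PadicInt.toZModPow 3
  have hV : φ v * φ (v⁻¹ : ℤ_[2]ˣ) = 1 := by rw [← map_mul, Units.mul_inv, map_one]
  have hform : ∀ a b u : ℤ_[2], a ^ 2 + ((2 : ℕ) : ℤ_[2]) * t' * a * b +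
      ((2 : ℕ) : ℤ_[2]) * v * b ^ 2 = u →
      (φ (a + t' * b)) ^ 2 + (2 * φ v - (φ t') ^ 2) * (φ b) ^ 2 = φ u := by
    intro a b u h
    rw [← h]
    simp only [map_add, map_mul, map_pow, map_natCast]
    push_cast
    ring
  have hodd : ∀ k : ℕ, ¬ 2 ∣ k → ‖((k : ℕ) : ℤ_[2])‖ = 1 := by
    intro k hk
    rw [norm_padicInt_eq_one_iff, PadicInt.norm_lt_one_iff_dvd]
    intro h
    apply hk
    have := (PadicInt.norm_int_lt_one_iff_dvd (p := 2) (k : ℤ)).mp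
      (by rw [Int.cast_natCast, PadicInt.norm_lt_one_iff_dvd]; exact h)
    exact_mod_cast this
  rcases zmod_eight_disc (φ t') (φ v) _ hV with h | h | h | h
  · refine ⟨((3 : ℕ) : ℤ_[2]), hodd 3 (by norm_num), fun a b hab => ?_⟩
    have := hform a b _ hab
    rw [h, map_natCast] at this
    exact (zmod_eight_form_odd _ _).1 this
  · refine ⟨((3 : ℕ) : ℤ_[2]), hodd 3 (by norm_num), fun a b hab => ?_⟩
    have := hform a b _ hab
    rw [h, map_natCast] at this
    exact (zmod_eight_form_odd _ _).2 this
  · refine ⟨((5 : ℕ) : ℤ_[2]), hodd 5 (by norm_num), fun a b hab => ?_⟩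
    have := hform a b _ hab
    rw [h, map_natCast] at this
    exact (zmod_eight_form_even _ _).1 this
  · refine ⟨((5 : ℕ) : ℤ_[2]), hodd 5 (by norm_num), fun a b hab => ?_⟩
    have := hform a b _ hab
    rw [h, map_natCast] at this
    exact (zmod_eight_form_even _ _).2 this

theorem exists_not_form {t n : ℤ_[q]} (ht : ‖t‖ < 1) (hn : ‖n‖ = (q : ℝ)⁻¹) :
    ∃ u : ℤ_[q], ‖u‖ = 1 ∧ ∀ a b : ℤ_[q], a ^ 2 + t * a * b + n * b ^ 2 ≠ u := by
  by_cases hq : q = 2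
  · subst hq
    exact exists_not_form_two ht (by simpa using hn)
  · obtain ⟨u, hu, h⟩ := not_square_of_odd hq
    refine ⟨u, hu, fun a b => h a b t n ht ?_⟩
    rw [hn]
    exact inv_lt_one_of_one_lt₀ one_lt_q

/-- Some unit of ℤ_q is not a value of the integral norm form. If it were the norm of π^j ε,
comparison of absolute values would give j = 0, and ε is integral; so the character is nontrivial on
units. -/
theorem IsNormGen.charLFactor_of_ramified (h : IsQuadGen c θ t n) (hπ : IsNormGen c π t₁ n₁)
    (ht : ‖t₁‖ < 1) (s : ℂ) : charLFactor (normResidueChar q L) s = 1 := by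
  rw [charLFactor, if_neg]
  intro hun
  have hn1 : ‖n₁‖ ≤ 1 := by
    rw [hπ.norm_eq]
    exact zpow_le_one_of_nonpos₀ one_lt_q.le (by norm_num)
  obtain ⟨u, hu, hne⟩ := exists_not_form (q := q) (t := ⟨t₁, ht.le⟩) (n := ⟨n₁, hn1⟩) ht
    (by rw [← zpow_neg_one]; exact hπ.norm_eq)
  have hu' : ‖(u : ℚ_[q])‖ = 1 := hu
  have hu0 : (u : ℚ_[q]) ≠ 0 := by rw [← norm_ne_zero_iff, hu']; exact one_ne_zero
  have h1 := hun (Units.mk0 (u : ℚ_[q]) hu0) hu'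
  by_cases hex : ∃ y : (LocalAlg q L)ˣ, Algebra.norm ℚ_[q] (y : LocalAlg q L) =
      (Units.mk0 (u : ℚ_[q]) hu0 : ℚ_[q]ˣ)
  · obtain ⟨y, hy⟩ := hex
    rw [Units.val_mk0] at hy
    obtain ⟨j, ε, hε, rfl⟩ := hπ.exists_eq_of_ramified h ht y
    have h2 : absNormHom q L (π ^ j * ε) = (q : ℝ) ^ (0 : ℤ) := by
      rw [absNormHom_apply, hy, hu', zpow_zero]
    rw [map_mul, h.absNormHom_eq_one hε, mul_one, absNormHom_zpow, hπ.absNormHom_pi, ← zpow_mul] at h2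
    have h3 : j = 0 := by
      have := q_zpow_inj h2
      omega
    rw [h3, zpow_zero, one_mul] at hy
    obtain ⟨a, b, ha, hb, hab⟩ := hπ.span _ hε.1
    rw [hab, hπ.norm_add] at hy
    exact hne ⟨a, ha⟩ ⟨b, hb⟩ (Subtype.ext hy)
  · rw [normResidueChar_eq_neg_one hex] at h1
    norm_num at h1

end Ramified

section Split

/-- A unit u is a norm by Hensel's lemma, and powers of π account for the valuation. -/
theorem IsNormGen.exists_norm_eq (h : IsQuadGen c θ t n) (hπ : IsNormGen c π t₁ n₁)
    (ht : ¬ ‖t₁‖ < 1) (x : ℚ_[q]ˣ) :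
    ∃ y : (LocalAlg q L)ˣ, Algebra.norm ℚ_[q] (y : LocalAlg q L) = x := by
  have hunit : ∀ u : ℚ_[q]ˣ, ‖(u : ℚ_[q])‖ = 1 → ∃ y : (LocalAlg q L)ˣ,
      Algebra.norm ℚ_[q] (y : LocalAlg q L) = u := by
    intro u hu
    have ht1 : ‖t₁‖ = 1 := le_antisymm hπ.trace_le (not_lt.mp ht)
    have ht0 : t₁ ≠ 0 := by rw [← norm_ne_zero_iff, ht1]; exact one_ne_zero
    have hn1 : ‖n₁‖ < 1 := norm_lt_one_iff_le.mpr hπ.norm_eq.le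
    have hb1 : ‖(u - 1 : ℚ_[q]) / t₁‖ ≤ 1 := by
      rw [norm_div, ht1, div_one, sub_eq_add_neg]
      exact norm_add_le_of_le hu.le (by rw [norm_neg, norm_one])
    let τ : ℤ_[q] := ⟨t₁, ht1.le⟩
    let ν : ℤ_[q] := ⟨n₁, hn1.le⟩
    -- Since q divides n₁, the norm of 1 + bπ is 1 + t₁b modulo q; this b makes it u, and the
    -- derivative in b is the unit t₁ modulo q.
    let b : ℤ_[q] := ⟨(u - 1 : ℚ_[q]) / t₁, hb1⟩
    let υ : ℤ_[q] := ⟨u, hu.le⟩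
    have hτb : τ * b = υ - 1 := Subtype.ext (mul_div_cancel₀ _ ht0)
    have hν : ‖ν‖ < 1 := hn1
    have hlt : ∀ z : ℤ_[q], ‖ν * z‖ < 1 := by
      intro z
      rw [norm_mul]
      exact (mul_le_of_le_one_right (norm_nonneg _) z.norm_le_one).trans_lt hν
    obtain ⟨a', b', hab⟩ := exists_form_eq (t := τ) (n := ν) (a := 1) (b := b) (u := υ) (by
        have e : (1 : ℤ_[q]) ^ 2 + τ * 1 * b + ν * b ^ 2 - υ = ν * b ^ 2 := by
          linear_combination hτb
        rw [e]
        exact hlt _) (Or.inr (by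
        rw [norm_padicInt_eq_one_iff, ← toZMod_eq_zero_iff]
        have h1 := toZMod_eq_zero_iff.mpr hν
        rw [map_add, map_mul, map_mul, map_mul, h1, mul_zero, zero_mul, add_zero, map_one, mul_one,
          toZMod_eq_zero_iff]
        exact ht))
    have h2 : (a' : ℚ_[q]) ^ 2 + t₁ * a' * b' + n₁ * b' ^ 2 = u := congrArg Subtype.val hab
    rw [← hπ.norm_add] at h2
    obtain ⟨y, hy⟩ := h.isUnit_of_norm_ne_zero (x := algebraMap ℚ_[q] (LocalAlg q L) a' +
      algebraMap ℚ_[q] (LocalAlg q L) b' * (π : LocalAlg q L)) (by rw [h2]; exact u.ne_zero)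
    exact ⟨y, by rw [hy, h2]⟩
  obtain ⟨m, hm⟩ := exists_norm_eq_zpow x
  have hmul : ∀ y : (LocalAlg q L)ˣ, ((Units.map (Algebra.norm ℚ_[q]) y : ℚ_[q]ˣ) : ℚ_[q]) =
    Algebra.norm ℚ_[q] (y : LocalAlg q L) := fun y => rfl
  obtain ⟨y, hy⟩ := hunit (x * (Units.map (Algebra.norm ℚ_[q]) (π ^ m))⁻¹) (by
    rw [Units.val_mul, norm_mul, hm, Units.val_inv_eq_inv_val, norm_inv, hmul]
    have := absNormHom_zpow π m
    rw [absNormHom_apply, hπ.absNormHom_pi, ← zpow_mul, neg_one_mul] at this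
    rw [this]
    exact mul_inv_cancel₀ (zpow_ne_zero _ (by linarith [one_lt_q (q := q)])))
  refine ⟨y * π ^ m, ?_⟩
  rw [Units.val_mul, map_mul, hy, ← hmul, ← Units.val_mul, inv_mul_cancel_right]

theorem IsNormGen.charLFactor_of_split (h : IsQuadGen c θ t n) (hπ : IsNormGen c π t₁ n₁)
    (ht : ¬ ‖t₁‖ < 1) (s : ℂ) :
    charLFactor (normResidueChar q L) s = (1 - (q : ℂ) ^ (-s))⁻¹ := by
  have h1 : normResidueChar q L = fun _ : ℚ_[q]ˣ => (1 : ℂ) :=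
    funext fun x => normResidueChar_eq_one (hπ.exists_norm_eq h ht x)
  rw [h1, charLFactor_one]

end Split

section Inert

theorem zmod_two_eq_one : ∀ r : ZMod 2, r ≠ 0 → r = 1 := by
  decide

theorem zmod_two_ne_zero_of_form : ∀ t n : ZMod 2, n ^ 2 + t * n + n ≠ 0 → t ≠ 0 := by
  decide

/-- The expression is the norm of the primitive element a + θ, which is a unit in the inert case. -/
theorem IsQuadGen.toZMod_form_ne_zero (h : IsQuadGen c θ t n) (hq : IsInert q L) (a : ℤ_[q]) :
    (PadicInt.toZMod a) ^ 2 + (t : ZMod q) * PadicInt.toZMod a + (n : ZMod q) ≠ 0 := by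
  intro h0
  have h1 := h.norm_eq_one_of_isInert hq (a := a) (b := 1) a.norm_le_one (by rw [norm_one])
    (fun h => by simp at h)
  have h2 : PadicInt.toZMod (a ^ 2 + (t : ℤ_[q]) * a + (n : ℤ_[q])) = 0 := by
    rw [map_add, map_add, map_mul, map_pow, map_intCast, map_intCast, h0]
  rw [toZMod_eq_zero_iff] at h2
  have h3 : ‖(a : ℚ_[q]) ^ 2 + t * a + n‖ < 1 := by
    have : ‖((a ^ 2 + (t : ℤ_[q]) * a + (n : ℤ_[q]) : ℤ_[q]) : ℚ_[q])‖ < 1 := h2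
    push_cast at this
    exact this
  rw [mul_one, one_pow, mul_one] at h1
  exact h3.ne h1

/-- Modulo q the norm form is nondegenerate, so it represents u at a nonsingular point, and Hensel's
lemma lifts the solution. -/
theorem IsQuadGen.exists_form_of_isInert (h : IsQuadGen c θ t n) (hq : IsInert q L) {u : ℤ_[q]}
    (hu : ‖u‖ = 1) : ∃ a b : ℤ_[q], a ^ 2 + (t : ℤ_[q]) * a * b + (n : ℤ_[q]) * b ^ 2 = u := by
  by_cases hq2 : q = 2
  · subst hq2
    refine exists_form_eq (a := 1) (b := 0) ?_ (Or.inr ?_)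
    · rw [← toZMod_eq_zero_iff]
      have h1 : PadicInt.toZMod u ≠ 0 := by
        rw [Ne, toZMod_eq_zero_iff]
        exact norm_padicInt_eq_one_iff.mp hu
      simp [zmod_two_eq_one _ h1]
    · rw [norm_padicInt_eq_one_iff, ← toZMod_eq_zero_iff]
      have h1 := h.toZMod_form_ne_zero hq (n : ℤ_[2])
      rw [map_intCast] at h1
      simpa using zmod_two_ne_zero_of_form _ _ h1
  · have h2 : (2 : ZMod q) ≠ 0 := by
      have : ((2 : ℕ) : ZMod q) ≠ 0 := by
        rw [Ne, ZMod.natCast_eq_zero_iff, Nat.prime_dvd_prime_iff_eq Fact.out Nat.prime_two]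
        exact hq2
      exact_mod_cast this
    have hD : (n : ZMod q) - ((t : ZMod q) / 2) ^ 2 ≠ 0 := by
      obtain ⟨a, ha⟩ := exists_toZMod_eq (q := q) (-((t : ZMod q) / 2))
      have h1 := h.toZMod_form_ne_zero hq a
      rw [ha] at h1
      intro h3
      apply h1
      field_simp at h3 ⊢
      linear_combination h3
    -- After completing the square, the form x² + (n − t²/4)y² has nonzero coefficients and
    -- represents every residue for odd q.
    obtain ⟨x, y, hxy⟩ := FiniteField.exists_root_sum_quadratic (R := ZMod q)
      (f := Polynomial.X ^ 2 - Polynomial.C (PadicInt.toZMod u))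
      (g := Polynomial.C ((n : ZMod q) - ((t : ZMod q) / 2) ^ 2) * Polynomial.X ^ 2)
      (Polynomial.degree_X_pow_sub_C (by norm_num) _) (Polynomial.degree_C_mul_X_pow 2 hD) (by
        rw [ZMod.card]
        exact (Fact.out : q.Prime).eq_two_or_odd.resolve_left hq2)
    simp only [Polynomial.eval_sub, Polynomial.eval_pow, Polynomial.eval_X, Polynomial.eval_C,
      Polynomial.eval_mul] at hxy
    obtain ⟨a, ha⟩ := exists_toZMod_eq (x - (t : ZMod q) / 2 * y)
    obtain ⟨b, rfl⟩ := exists_toZMod_eq y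
    have hab : PadicInt.toZMod (a ^ 2 + (t : ℤ_[q]) * a * b + (n : ℤ_[q]) * b ^ 2) = PadicInt.toZMod u := by
      simp only [map_add, map_mul, map_pow, map_intCast]
      rw [ha]
      field_simp at hxy ⊢
      linear_combination hxy
    refine exists_form_eq (a := a) (b := b) ?_ ?_
    · rw [← toZMod_eq_zero_iff, map_sub, hab, sub_self]
    · rw [norm_padicInt_eq_one_iff, norm_padicInt_eq_one_iff, ← not_and_or]
      rintro ⟨h3, h4⟩
      rw [← toZMod_eq_zero_iff] at h3 h4
      apply norm_padicInt_eq_one_iff.mp hu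
      rw [← toZMod_eq_zero_iff, ← hab]
      -- Euler's identity: twice the form is a combination of its partial derivatives, so these
      -- cannot both vanish where the value is a unit.
      have h5 : (2 : ZMod q) * PadicInt.toZMod (a ^ 2 + (t : ℤ_[q]) * a * b + (n : ℤ_[q]) * b ^ 2) =
          PadicInt.toZMod a * PadicInt.toZMod (2 * a + (t : ℤ_[q]) * b) +
            PadicInt.toZMod b * PadicInt.toZMod ((t : ℤ_[q]) * a + 2 * (n : ℤ_[q]) * b) := by
        simp only [map_add, map_mul, map_pow, map_intCast, map_ofNat]
        ring
      rw [h3, h4, mul_zero, mul_zero, add_zero] at h5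
      exact (mul_eq_zero.mp h5).resolve_left h2

/-- All units are norms, but q is not, because norms of q^j ε have even valuation. -/
theorem IsQuadGen.charLFactor_of_isInert (h : IsQuadGen c θ t n) (hq : IsInert q L) (s : ℂ) :
    charLFactor (normResidueChar q L) s = (1 + (q : ℂ) ^ (-s))⁻¹ := by
  have h1 : IsUnram (normResidueChar q L) := by
    intro u hu
    refine normResidueChar_eq_one ?_
    obtain ⟨a, b, hab⟩ := h.exists_form_of_isInert hq (u := ⟨u, hu.le⟩) hu
    have h2 : (a : ℚ_[q]) ^ 2 + t * a * b + n * b ^ 2 = u := by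
      have := congrArg Subtype.val hab
      push_cast at this
      exact this
    rw [← h.norm_locMk] at h2
    obtain ⟨y, hy⟩ := h.isUnit_of_norm_ne_zero (x := locMk q θ (a : ℚ_[q]) b)
      (by rw [h2]; exact u.ne_zero)
    exact ⟨y, by rw [hy, h2]⟩
  have h2 : normResidueChar q L (primeUnit q) = -1 := by
    refine normResidueChar_eq_neg_one ?_
    rintro ⟨y, hy⟩
    obtain ⟨j, ε, hε, rfl⟩ := h.exists_eq_of_isInert hq y
    have h3 : absNormHom q L (baseUnit q L (primeUnit q) ^ j * ε) = (q : ℝ) ^ (-1 : ℤ) := by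
      rw [absNormHom_apply, hy, norm_primeUnit, zpow_neg_one]
    rw [map_mul, h.absNormHom_eq_one hε, mul_one, h.absNormHom_baseUnit_primeUnit_zpow] at h3
    have := q_zpow_inj h3
    omega
  rw [charLFactor, if_pos h1, h2, neg_one_mul, sub_neg_eq_add]

end Inert

end ResidueChar

/-! ### Powers of q in terms of the section parameter -/

section Factors

variable {q : ℕ} [Fact q.Prime]

theorem sectionParam_mul_sqrt (s : ℂ) :
    sectionParam q s * ((√(q : ℝ) : ℝ) : ℂ) = (q : ℂ) ^ (-(3 * s + 1)) := by
  have hq : (q : ℂ) ≠ 0 := Nat.cast_ne_zero.mpr (Fact.out : q.Prime).ne_zero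
  rw [sectionParam, Real.sqrt_eq_rpow, Complex.ofReal_cpow (Nat.cast_nonneg q),
    Complex.ofReal_natCast, ← Complex.cpow_add _ _ hq]
  congr 1
  push_cast
  ring

theorem sectionParam_sq (s : ℂ) : sectionParam q s ^ 2 = (q : ℂ) ^ (-(6 * s + 3)) := by
  rw [sectionParam, ← Complex.cpow_nat_mul]
  congr 1
  push_cast
  ring

theorem cpow_two_mul (s : ℂ) : (q : ℂ) ^ (-2 * s) = ((q : ℂ) ^ (-s)) ^ 2 := by
  rw [← Complex.cpow_nat_mul]
  congr 1
  push_cast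
  ring

theorem cpow_neg_six_mul_add_two (s : ℂ) :
    (q : ℂ) ^ (-(6 * s + 2)) = ((q : ℂ) ^ (-(3 * s + 1))) ^ 2 := by
  rw [← Complex.cpow_nat_mul]
  congr 1
  push_cast
  ring

end Factors

/-! ### Coefficients in the inert case -/

section InertSeries

theorem natCard_eq_two_mul (d : ℕ) :
    Nat.card {k : ℕ // d = 2 * k} = if Even d then 1 else 0 := by
  split_ifs with hd
  · rw [Nat.card_eq_one_iff_unique]
    obtain ⟨k, hk⟩ := hd
    refine ⟨⟨fun a b => Subtype.ext ?_⟩, ⟨⟨k, by omega⟩⟩⟩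
    have := a.2
    have := b.2
    omega
  · rw [Nat.card_eq_zero]
    exact Or.inl ⟨fun a => hd ⟨a.1, by have := a.2; omega⟩⟩

instance finite_eq_two_mul (d : ℕ) : Finite {k : ℕ // d = 2 * k} :=
  Finite.of_injective (fun _ => ()) fun a b _ => Subtype.ext (by
    have := a.2
    have := b.2
    omega)

theorem completeHom_neg (u : ℂ) : ∀ d : ℕ,
    completeHom u (-u) d = if Even d then u ^ d else 0
  | 0 => by simp [completeHom_zero]
  | 1 => by simp [completeHom, Finset.sum_range_succ]
  | d + 2 => by
    rw [completeHom_add_two, completeHom_neg u d, add_neg_cancel]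
    by_cases hd : Even d
    · rw [if_pos hd, if_pos (hd.add even_two)]
      ring
    · rw [if_neg hd, if_neg fun h => hd ((Nat.even_add.mp h).mpr even_two)]
      ring

end InertSeries

/-! ### Coefficients in the split case -/

section SplitSeries

/-- The exponent |i| + |d − i| equals d for 0 ≤ i ≤ d, which gives the homogeneous polynomial, and
grows by 2 at each step outside this range, which gives two geometric tails. -/
theorem hasSum_int_absPow {u τ : ℂ} (hu : ‖u‖ < 1) (hτ : ‖τ‖ = 1) (d : ℕ) :
    HasSum (fun i : ℤ => u ^ (i.natAbs + ((d : ℤ) - i).natAbs) * (τ ^ i * (τ⁻¹) ^ ((d : ℤ) - i)))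
      (completeHom (τ * u) (τ⁻¹ * u) d + (τ * u) ^ (d + 2) * (1 - (τ * u) ^ 2)⁻¹ +
        (τ⁻¹ * u) ^ (d + 2) * (1 - (τ⁻¹ * u) ^ 2)⁻¹) := by
  have hτ0 : τ ≠ 0 := by rw [← norm_ne_zero_iff, hτ]; exact one_ne_zero
  refine hasSum_int_completeHom (by rwa [norm_mul, hτ, one_mul])
    (by rwa [norm_mul, norm_inv, hτ, inv_one, one_mul]) d ?_ ?_ ?_
  · intro m hm
    have e1 : (m : ℤ).natAbs + ((d : ℤ) - m).natAbs = m + (d - m) := by omega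
    have e2 : (d : ℤ) - m = ((d - m : ℕ) : ℤ) := by omega
    rw [e1, e2, zpow_natCast, zpow_natCast]
    ring
  · intro m
    have e1 : ((m + (d + 1) : ℕ) : ℤ).natAbs + ((d : ℤ) - ((m + (d + 1) : ℕ) : ℤ)).natAbs =
        (d + 2) + 2 * m := by omega
    have e2 : (d : ℤ) - ((m + (d + 1) : ℕ) : ℤ) = -((m + 1 : ℕ) : ℤ) := by push_cast; ring
    rw [e1, e2, zpow_natCast, inv_zpow', neg_neg, zpow_natCast]
    ring
  · intro m
    have e1 : (-((m : ℤ) + 1)).natAbs + ((d : ℤ) - (-((m : ℤ) + 1))).natAbs =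
        (d + 2) + 2 * m := by omega
    have e2 : (d : ℤ) - (-((m : ℤ) + 1)) = ((d + m + 1 : ℕ) : ℤ) := by push_cast; ring
    have e3 : -((m : ℤ) + 1) = -((m + 1 : ℕ) : ℤ) := by push_cast; ring
    rw [e1, e2, e3, zpow_natCast, ← inv_zpow', zpow_natCast]
    ring

theorem summable_int_norm_absPow {u : ℂ} (hu : ‖u‖ < 1) (d : ℕ) :
    Summable fun i : ℤ => ‖u‖ ^ (i.natAbs + ((d : ℤ) - i).natAbs) := by
  have h := (hasSum_int_absPow (u := (‖u‖ : ℂ)) (τ := 1) (by simpa using hu) norm_one d).summable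
  rw [← Complex.summable_ofReal]
  simpa using h

/-- The exact formula with τ = 1 and |u| in place of u, each tail being estimated by |u|^d. -/
theorem tsum_int_norm_absPow_le {u : ℂ} (hu : ‖u‖ < 1) (d : ℕ) :
    ∑' i : ℤ, ‖u‖ ^ (i.natAbs + ((d : ℤ) - i).natAbs) ≤
      (1 + 2 * ‖(1 - (‖u‖ : ℂ) ^ 2)⁻¹‖) * ((d + 1) * ‖u‖ ^ d) := by
  have h := (hasSum_int_absPow (u := (‖u‖ : ℂ)) (τ := 1) (by simpa using hu) norm_one d).tsum_eq
  simp only [one_zpow, inv_one, mul_one, one_mul] at h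
  have h1 : ((∑' i : ℤ, ‖u‖ ^ (i.natAbs + ((d : ℤ) - i).natAbs) : ℝ) : ℂ) =
      ∑' i : ℤ, (‖u‖ : ℂ) ^ (i.natAbs + ((d : ℤ) - i).natAbs) := by
    rw [Complex.ofReal_tsum]
    push_cast
    rfl
  have hu0 := norm_nonneg u
  have hn : ‖(‖u‖ : ℂ)‖ = ‖u‖ := by simp
  rw [← Real.norm_of_nonneg (tsum_nonneg fun i : ℤ => pow_nonneg hu0 _), ← Complex.norm_real, h1, h]
  set K := ‖(1 - (‖u‖ : ℂ) ^ 2)⁻¹‖ with hK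
  have hpow : ‖u‖ ^ (d + 2) ≤ (d + 1) * ‖u‖ ^ d := by
    have h1 : ‖u‖ ^ (d + 2) ≤ ‖u‖ ^ d := pow_le_pow_of_le_one hu0 hu.le (by omega)
    have h2 : (0 : ℝ) ≤ d * ‖u‖ ^ d := by positivity
    linarith
  have hterm : ‖(‖u‖ : ℂ) ^ (d + 2) * (1 - (‖u‖ : ℂ) ^ 2)⁻¹‖ ≤ (d + 1) * ‖u‖ ^ d * K := by
    rw [norm_mul, norm_pow, hn]
    exact mul_le_mul_of_nonneg_right hpow (norm_nonneg _)
  have := norm_completeHom_le hn.le hn.le d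
  calc _ ≤ _ := norm_add₃_le
    _ ≤ (d + 1) * ‖u‖ ^ d + (d + 1) * ‖u‖ ^ d * K + (d + 1) * ‖u‖ ^ d * K := by gcongr
    _ = _ := by ring

end SplitSeries

/-! ### The zeta integral in the three cases -/

section Cases

open MeasureTheory

variable {q : ℕ} [Fact q.Prime] {L : Type*} [Field L] [NumberField L]
variable {c : L ≃ₐ[ℚ] L} {θ : 𝓞 L} {t n : ℤ} {π : (LocalAlg q L)ˣ} {t₁ n₁ : ℚ_[q]}
variable {Λ : (LocalAlg q L)ˣ →* Circle} {α β : ℚ_[q]ˣ →* ℂˣ}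

/-- Up to a unit π conj(π) is q, on which Λ is trivial. -/
theorem IsNormGen.character_conjUnit (h : IsQuadGen c θ t n) (hπ : IsNormGen c π t₁ n₁)
    (hΛ : ∀ x : ℚ_[q]ˣ, Λ (baseUnit q L x) = 1) (hΛ' : ∀ u ∈ localUnits q L, Λ u = 1) :
    Λ (conjUnit c π) = (Λ π)⁻¹ := by
  obtain ⟨ε, hε, he⟩ := hπ.exists_baseUnit_eq h
  have h1 := hΛ (primeUnit q)
  rw [he, map_mul, map_mul, hΛ' ε hε, mul_one] at h1
  exact eq_inv_of_mul_eq_one_right h1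

theorem IsNormGen.character_sq (h : IsQuadGen c θ t n) (hπ : IsNormGen c π t₁ n₁)
    (ht : ‖t₁‖ < 1) (hΛ : ∀ x : ℚ_[q]ˣ, Λ (baseUnit q L x) = 1)
    (hΛ' : ∀ u ∈ localUnits q L, Λ u = 1) : (Λ π : ℂ) ^ 2 = 1 := by
  have h1 := hΛ' _ (hπ.conjUnit_mul_inv_mem h ht)
  rw [map_mul, map_inv, hπ.character_conjUnit h hΛ hΛ', ← mul_inv, inv_eq_one] at h1
  rw [pow_two, ← Circle.coe_mul, h1, Circle.coe_one]

theorem completeHom_zero_right (X : ℂ) (d : ℕ) : completeHom X 0 d = X ^ d := by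
  induction d with
  | zero => simp [completeHom_zero]
  | succ d ih => rw [completeHom_succ, ih, zero_pow (by omega), add_zero, pow_succ']

/-- The coefficient c_d is u^d for even d and 0 for odd d, which is h_d(u, −u); hence X = u and Y =
−u. -/
theorem localZeta_of_isInert (h : IsQuadGen c θ t n) (hin : IsInert q L)
    (hΛ : ∀ x : ℚ_[q]ˣ, Λ (baseUnit q L x) = 1) (hΛ' : ∀ u ∈ localUnits q L, Λ u = 1)
    (hαβ : ∀ x, α x * β x = 1)
    {ψ : AddChar ℚ_[q] Circle} (hψ : HasConductorIntegers ψ)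
    {W : GUOne q c → ℂ} (hW : IsSphericalWhittaker c ψ α β W)
    [MeasurableSpace (UOne q c)] [BorelSpace (UOne q c)]
    (μ : Measure (UOne q c)) [μ.IsMulLeftInvariant]
    (hμ : μ (compactUOne q c : Set (UOne q c)) = 1) {s : ℂ}
    (hsα : ‖(α (primeUnit q) : ℂ)‖ < (q : ℝ) ^ (3 * s.re + 1))
    (hsβ : ‖(β (primeUnit q) : ℂ)‖ < (q : ℝ) ^ (3 * s.re + 1)) (g : GUOne q c)
    {A B : ℂ} (hA : A = (√(q : ℝ) : ℝ) * α (primeUnit q))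
    (hB : B = (√(q : ℝ) : ℝ) * β (primeUnit q)) :
    Integrable (zetaIntegrand c Λ W g 1 s) μ ∧
      localZeta c μ Λ W g 1 s = W g * ((1 - sectionParam q s ^ 2) *
        ((1 - sectionParam q s * -sectionParam q s * A * B) *
          ((1 - sectionParam q s * A)⁻¹ * (1 - sectionParam q s * B)⁻¹ *
            (1 - -sectionParam q s * A)⁻¹ * (1 - -sectionParam q s * B)⁻¹))) := by
  refine localZeta_eq_of_isUnitReps h (h.isUnitReps_of_isInert hin) hΛ
    (fun u h1 h2 => hΛ' u ⟨h1, h2⟩) hαβ hψ hW μ hμ hsα hsβ g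
    (a := fun d _ => sectionParam q s ^ d) (C := 1) ?_ ?_ ?_ le_rfl (norm_neg _).le ?_ hA hB
  · intro d i
    have h1 : Λ ((baseUnit q L (primeUnit q) ^ (i : ℕ))⁻¹) = 1 := by
      rw [map_inv, map_pow, hΛ, one_pow, inv_one]
    rw [h1, Circle.coe_one, inv_one, mul_one]
  · exact fun d => Summable.of_finite
  · intro d
    rw [tsum_const, natCard_eq_two_mul, norm_pow, one_mul, nsmul_eq_mul]
    refine mul_le_mul_of_nonneg_right ?_ (by positivity)
    split_ifs
    · simp
    · push_cast
      positivity
  · intro d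
    have h2 : Even (d + 2) ↔ Even d := by simp [Nat.even_add]
    rw [tsum_const, tsum_const, natCard_eq_two_mul, natCard_eq_two_mul, completeHom_neg]
    simp only [h2]
    split_ifs
    · simp only [one_smul]
      ring
    · simp

/-- There is a single class for each d and c_d = (Λ(π)u)^d. Since Λ(π)² = 1, passing from d to d + 2
multiplies by u²; hence X = Λ(π)u and Y = 0. -/
theorem localZeta_of_ramified (h : IsQuadGen c θ t n) (hπ : IsNormGen c π t₁ n₁)
    (ht : ‖t₁‖ < 1)
    (hΛ : ∀ x : ℚ_[q]ˣ, Λ (baseUnit q L x) = 1) (hΛ' : ∀ u ∈ localUnits q L, Λ u = 1)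
    (hαβ : ∀ x, α x * β x = 1)
    {ψ : AddChar ℚ_[q] Circle} (hψ : HasConductorIntegers ψ)
    {W : GUOne q c → ℂ} (hW : IsSphericalWhittaker c ψ α β W)
    [MeasurableSpace (UOne q c)] [BorelSpace (UOne q c)]
    (μ : Measure (UOne q c)) [μ.IsMulLeftInvariant]
    (hμ : μ (compactUOne q c : Set (UOne q c)) = 1) {s : ℂ}
    (hsα : ‖(α (primeUnit q) : ℂ)‖ < (q : ℝ) ^ (3 * s.re + 1))
    (hsβ : ‖(β (primeUnit q) : ℂ)‖ < (q : ℝ) ^ (3 * s.re + 1)) (g : GUOne q c)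
    {A B : ℂ} (hA : A = (√(q : ℝ) : ℝ) * α (primeUnit q))
    (hB : B = (√(q : ℝ) : ℝ) * β (primeUnit q)) :
    Integrable (zetaIntegrand c Λ W g 1 s) μ ∧
      localZeta c μ Λ W g 1 s = W g * ((1 - sectionParam q s ^ 2) *
        ((1 - (Λ π * sectionParam q s) * 0 * A * B) *
          ((1 - (Λ π * sectionParam q s) * A)⁻¹ * (1 - (Λ π * sectionParam q s) * B)⁻¹ *
            (1 - 0 * A)⁻¹ * (1 - 0 * B)⁻¹))) := by
  refine localZeta_eq_of_isUnitReps h (hπ.isUnitReps_of_ramified h ht) hΛ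
    (fun u h1 h2 => hΛ' u ⟨h1, h2⟩) hαβ hψ hW μ hμ hsα hsβ g
    (a := fun d _ => ((Λ π : ℂ) * sectionParam q s) ^ d) (C := 1) ?_ ?_ ?_ ?_ ?_ ?_ hA hB
  · intro d _
    rw [map_inv, map_pow, Circle.coe_inv, inv_inv, Circle.coe_pow]
    ring
  · exact fun d => Summable.of_finite
  · intro d
    rw [tsum_const, Nat.card_unique, one_smul, norm_pow, norm_mul, Circle.norm_coe, one_mul, one_mul]
    have h2 : (0 : ℝ) ≤ d * ‖sectionParam q s‖ ^ d := by positivity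
    linarith
  · rw [norm_mul, Circle.norm_coe, one_mul]
  · rw [norm_zero]
    exact norm_nonneg _
  · intro d
    rw [tsum_const, tsum_const, Nat.card_unique, one_smul, one_smul, completeHom_zero_right]
    linear_combination -((Λ π : ℂ) * sectionParam q s) ^ d * sectionParam q s ^ 2 *
      hπ.character_sq h ht hΛ hΛ'

/-- Here c_d is a sum over ℤ, and X = Λ(π)u, Y = Λ(π)⁻¹u have product u². -/
theorem localZeta_of_split (h : IsQuadGen c θ t n) (hπ : IsNormGen c π t₁ n₁)
    (ht : ¬ ‖t₁‖ < 1)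
    (hΛ : ∀ x : ℚ_[q]ˣ, Λ (baseUnit q L x) = 1) (hΛ' : ∀ u ∈ localUnits q L, Λ u = 1)
    (hαβ : ∀ x, α x * β x = 1)
    {ψ : AddChar ℚ_[q] Circle} (hψ : HasConductorIntegers ψ)
    {W : GUOne q c → ℂ} (hW : IsSphericalWhittaker c ψ α β W)
    [MeasurableSpace (UOne q c)] [BorelSpace (UOne q c)]
    (μ : Measure (UOne q c)) [μ.IsMulLeftInvariant]
    (hμ : μ (compactUOne q c : Set (UOne q c)) = 1) {s : ℂ}
    (hsα : ‖(α (primeUnit q) : ℂ)‖ < (q : ℝ) ^ (3 * s.re + 1))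
    (hsβ : ‖(β (primeUnit q) : ℂ)‖ < (q : ℝ) ^ (3 * s.re + 1)) (g : GUOne q c)
    {A B : ℂ} (hA : A = (√(q : ℝ) : ℝ) * α (primeUnit q))
    (hB : B = (√(q : ℝ) : ℝ) * β (primeUnit q)) :
    Integrable (zetaIntegrand c Λ W g 1 s) μ ∧
      localZeta c μ Λ W g 1 s = W g * ((1 - sectionParam q s ^ 2) *
        ((1 - (Λ π * sectionParam q s) * ((Λ π : ℂ)⁻¹ * sectionParam q s) * A * B) *
          ((1 - (Λ π * sectionParam q s) * A)⁻¹ * (1 - (Λ π * sectionParam q s) * B)⁻¹ *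
            (1 - ((Λ π : ℂ)⁻¹ * sectionParam q s) * A)⁻¹ *
            (1 - ((Λ π : ℂ)⁻¹ * sectionParam q s) * B)⁻¹))) := by
  have hab : ((α (primeUnit q) : ℂˣ) : ℂ) * (β (primeUnit q) : ℂˣ) = 1 := by
    rw [← Units.val_mul, hαβ, Units.val_one]
  have hu := norm_sectionParam_lt_one hab hsα hsβ
  have hτ : ‖(Λ π : ℂ)‖ = 1 := Circle.norm_coe _
  have hτ0 : (Λ π : ℂ) ≠ 0 := Circle.coe_ne_zero _
  have hsum := hasSum_int_absPow hu hτ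
  have hnorm : ∀ d (i : ℤ), ‖sectionParam q s ^ (i.natAbs + ((d : ℤ) - i).natAbs) *
      ((Λ π : ℂ) ^ i * ((Λ π : ℂ)⁻¹) ^ ((d : ℤ) - i))‖ =
      ‖sectionParam q s‖ ^ (i.natAbs + ((d : ℤ) - i).natAbs) := by
    intro d i
    rw [norm_mul, norm_mul, norm_zpow, norm_zpow, norm_inv, hτ, inv_one, one_zpow, one_zpow,
      mul_one, mul_one, norm_pow]
  refine localZeta_eq_of_isUnitReps h (hπ.isUnitReps_of_split h ht) hΛ
    (fun u h1 h2 => hΛ' u ⟨h1, h2⟩) hαβ hψ hW μ hμ hsα hsβ g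
    (a := fun d i => sectionParam q s ^ (i.natAbs + ((d : ℤ) - i).natAbs) *
      ((Λ π : ℂ) ^ i * ((Λ π : ℂ)⁻¹) ^ ((d : ℤ) - i)))
    (C := 1 + 2 * ‖(1 - (‖sectionParam q s‖ : ℂ) ^ 2)⁻¹‖) ?_ ?_ ?_ ?_ ?_ ?_ hA hB
  · intro d i
    rw [map_inv, map_mul, map_zpow, map_zpow, hπ.character_conjUnit h hΛ hΛ', Circle.coe_inv,
      inv_inv, Circle.coe_mul, Circle.coe_zpow, Circle.coe_zpow, Circle.coe_inv]
  · intro d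
    simp only [hnorm]
    exact summable_int_norm_absPow hu d
  · intro d
    simp only [hnorm]
    exact tsum_int_norm_absPow_le hu d
  · rw [norm_mul, hτ, one_mul]
  · rw [norm_mul, norm_inv, hτ, inv_one, one_mul]
  · intro d
    rw [(hsum d).tsum_eq, (hsum (d + 2)).tsum_eq]
    have hX : ‖((Λ π : ℂ) * sectionParam q s) ^ 2‖ < 1 := by
      rw [norm_pow, norm_mul, hτ, one_mul]
      exact pow_lt_one₀ (norm_nonneg _) hu two_ne_zero
    have hY : ‖((Λ π : ℂ)⁻¹ * sectionParam q s) ^ 2‖ < 1 := by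
      rw [norm_pow, norm_mul, norm_inv, hτ, inv_one, one_mul]
      exact pow_lt_one₀ (norm_nonneg _) hu two_ne_zero
    have hXY : ((Λ π : ℂ) * sectionParam q s) * ((Λ π : ℂ)⁻¹ * sectionParam q s) =
        sectionParam q s ^ 2 := by
      field_simp
    rw [← hXY]
    generalize (Λ π : ℂ) * sectionParam q s = X at *
    generalize (Λ π : ℂ)⁻¹ * sectionParam q s = Y at *
    have hX0 : 1 - X ^ 2 ≠ 0 := fun h0 => by
      rw [← sub_eq_zero.mp h0, norm_one] at hX
      exact hX.false
    have hY0 : 1 - Y ^ 2 ≠ 0 := fun h0 => by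
      rw [← sub_eq_zero.mp h0, norm_one] at hY
      exact hY.false
    -- The difference of the tails of c_d and c_{d+2} is X^(d+2) + Y^(d+2), exactly what remains of
    -- h_{d+2} after XY h_d is removed.
    have hrec : completeHom X Y (d + 2) = X ^ (d + 2) + Y ^ (d + 2) + X * Y * completeHom X Y d := by
      rw [completeHom_succ, completeHom_succ']
      ring
    rw [hrec]
    linear_combination X ^ (d + 2) * mul_inv_cancel₀ hX0 + Y ^ (d + 2) * mul_inv_cancel₀ hY0

end Cases

end PullbackFormula

/-! ### The local pullback formula -/

open PullbackFormula
theorem propositionp (q : ℕ) [Fact q.Prime]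
    (L : Type*) [Field L] [NumberField L] [NumberField.IsTotallyComplex L]
    (hL : Module.finrank ℚ L = 2) (c : L ≃ₐ[ℚ] L) (hc : c ≠ 1)
    (Λ : (LocalAlg q L)ˣ →* Circle)
    (hΛ : ∀ x : ℚ_[q]ˣ, Λ (Units.map (algebraMap ℚ_[q] (LocalAlg q L)).toMonoidHom x) = 1)
    (hΛ' : ∀ u : (LocalAlg q L)ˣ, (u : LocalAlg q L) ∈ localIntegers q L →
      ((u⁻¹ : (LocalAlg q L)ˣ) : LocalAlg q L) ∈ localIntegers q L → Λ u = 1)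
    (α β : ℚ_[q]ˣ →* ℂˣ) (hα : IsUnram α) (hβ : IsUnram β) (hαβ : ∀ x, α x * β x = 1)
    (ψ : AddChar ℚ_[q] Circle) (hψ : HasConductorIntegers ψ)
    (W : GUOne q c → ℂ) (hW : IsSphericalWhittaker c ψ α β W)
    [MeasurableSpace (UOne q c)] [BorelSpace (UOne q c)]
    (μ : MeasureTheory.Measure (UOne q c)) [μ.IsHaarMeasure]
    (hμ : μ (compactUOne q c : Set (UOne q c)) = 1)
    (q₁ : (LocalAlg q L)ˣ) (hq₁ : ¬ IsInert q L → IsNormUniformizer q L q₁)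
    (s : ℂ) (hsα : ‖(α (primeUnit q) : ℂ)‖ < (q : ℝ) ^ (3 * s.re + 1))
    (hsβ : ‖(β (primeUnit q) : ℂ)‖ < (q : ℝ) ^ (3 * s.re + 1))
    (g : GUOne q c) :
    MeasureTheory.Integrable (zetaIntegrand c Λ W g 1 s) μ ∧
      localZeta c μ Λ W g 1 s =
        W g * (rankinLFactor α β Λ q₁ (3 * s + 1) /
          (charLFactor (normResidueChar q L) (6 * s + 2) *
            charLFactor (fun _ : ℚ_[q]ˣ => (1 : ℂ)) (6 * s + 3))) := by
  obtain ⟨θ, t, n, h⟩ := exists_isQuadGen hL c hc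
  have hΛu : ∀ u ∈ localUnits q L, Λ u = 1 := fun u hu => hΛ' u hu.1 hu.2
  have hab : ((α (primeUnit q) : ℂˣ) : ℂ) * (β (primeUnit q) : ℂˣ) = 1 := by
    rw [← Units.val_mul, hαβ, Units.val_one]
  have hus := sectionParam_mul_sqrt (q := q) s
  have huu := sectionParam_sq (q := q) s
  have e3 : charLFactor (fun _ : ℚ_[q]ˣ => (1 : ℂ)) (6 * s + 3) =
      (1 - sectionParam q s ^ 2)⁻¹ := by rw [charLFactor_one, huu]
  have e2 := cpow_neg_six_mul_add_two (q := q) s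
  have e1 := cpow_two_mul (q := q) (3 * s + 1)
  rw [e3]
  by_cases hin : IsInert q L
  · obtain ⟨hint, hz⟩ := localZeta_of_isInert h hin hΛ hΛu hαβ hψ hW μ hμ hsα hsβ g rfl rfl
    refine ⟨hint, ?_⟩
    rw [hz, h.charLFactor_of_isInert hin, rankinLFactor, if_pos hin, e1, e2, div_eq_mul_inv,
      mul_inv, inv_inv, inv_inv, ← hus]
    generalize sectionParam q s = u at *
    generalize ((√(q : ℝ) : ℝ) : ℂ) = r at *
    generalize ((α (primeUnit q) : ℂˣ) : ℂ) = a at *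
    generalize ((β (primeUnit q) : ℂˣ) : ℂ) = b at *
    -- Since αβ = 1 and (ur)² = q^(-(6s+2)), the numerator of Cauchy's identity is 1 + q^(-(6s+2)),
    -- the inverse of L(6s+2, χ) with χ(q) = −1.
    have h1 : 1 - u * -u * (r * a) * (r * b) = 1 + (u * r) ^ 2 := by
      linear_combination u ^ 2 * r ^ 2 * hab
    have h2 : 1 - a ^ 2 * (u * r) ^ 2 = (1 - u * (r * a)) * (1 - -u * (r * a)) := by ring
    have h3 : 1 - b ^ 2 * (u * r) ^ 2 = (1 - u * (r * b)) * (1 - -u * (r * b)) := by ring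
    rw [h1, h2, h3, mul_inv, mul_inv]
    ring
  obtain ⟨t₁, n₁, hπ, ht⟩ := h.exists_isNormGen (hq₁ hin)
  by_cases hr : IsRamified q L
  · obtain ⟨hint, hz⟩ := localZeta_of_ramified h hπ (ht.mp hr) hΛ hΛu hαβ hψ hW μ hμ hsα hsβ g
      rfl rfl
    refine ⟨hint, ?_⟩
    rw [hz, hπ.charLFactor_of_ramified h (ht.mp hr), rankinLFactor, if_neg hin, if_pos hr,
      div_eq_mul_inv, one_mul, inv_inv, ← hus]
    generalize sectionParam q s = u at *
    generalize ((√(q : ℝ) : ℝ) : ℂ) = r at *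
    have h1 : ∀ a : ℂ, 1 - a * (Λ q₁ : ℂ) * (u * r) = 1 - (Λ q₁ : ℂ) * u * (r * a) := by
      intro a
      ring
    rw [h1, h1]
    -- With Y = 0 the numerator of Cauchy's identity and two of its four factors are 1, in
    -- accordance with the trivial factor of a ramified χ.
    simp only [mul_zero, zero_mul, sub_zero, inv_one, mul_one, one_mul]
    ring
  · have ht' : ¬ ‖t₁‖ < 1 := fun h0 => hr (ht.mpr h0)
    obtain ⟨hint, hz⟩ := localZeta_of_split h hπ ht' hΛ hΛu hαβ hψ hW μ hμ hsα hsβ g rfl rfl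
    refine ⟨hint, ?_⟩
    rw [hz, hπ.charLFactor_of_split h ht', rankinLFactor, if_neg hin, if_neg hr, e2,
      div_eq_mul_inv, mul_inv, inv_inv, inv_inv, ← hus]
    have hτ0 : (Λ q₁ : ℂ) ≠ 0 := Circle.coe_ne_zero _
    generalize sectionParam q s = u at *
    generalize ((√(q : ℝ) : ℝ) : ℂ) = r at *
    have h1 : ∀ a τ : ℂ, 1 - a * τ * (u * r) = 1 - τ * u * (r * a) := by
      intro a τ
      ring
    rw [h1, h1, h1, h1]
    -- The values Λ(q₁) and Λ(q₁)⁻¹ cancel, so the numerator is 1 − q^(-(6s+2)), the inverse of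
    -- L(6s+2, χ) for trivial χ.
    have h2 : 1 - (Λ q₁ : ℂ) * u * ((Λ q₁ : ℂ)⁻¹ * u) * (r * (α (primeUnit q) : ℂˣ)) *
        (r * (β (primeUnit q) : ℂˣ)) = 1 - (u * r) ^ 2 := by
      linear_combination -(u * r) ^ 2 * mul_inv_cancel₀ hτ0 -
        (u * r) ^ 2 * (Λ q₁ : ℂ) * (Λ q₁ : ℂ)⁻¹ * hab
    rw [h2]
    ring
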